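/- **Setting.** Let $n\ge 5$, $N\in\mathbb N$; on $\mathbb R^{1+n}$ let $x^0=t$, $m=\mathrm{diag}(-1,1,\dots,1)$, $\Box=m^{\mu\nu}\partial_\mu\partial_\nu$, indices being raised with $m$. Let $C^a_{bc}$ ($1\le a,b,c\le N$) be real constants with $C^a_{bc}=-C^a_{cb}$ and $\Gamma^a_{bc}=\tfrac12(C^a_{bc}+C^b_{ac}+C^c_{ab})$. Let $\eta\ge 0$ be a smooth even function on $\mathbb R^n$ with $\eta=1$ on $|\xi|\le 1$ and $\eta=0$ for $|\xi|>2$; $P_{\le k}$ is the Fourier multiplier in $x$ with symbol $\eta(2^{-k}\xi)$ and $P_k=P_{\le k}-P_{\le k-1}$, $k\in\mathbb Z$. For $T>0$ all norms are over $[0,T]\times\mathbb R^n$, the norm of an array is the sum of the norms of its components, and $$\|u\|_{S_k}=\sup_{(q,r)}2^{k(\frac1q+\frac nr-1)}\big(\|u\|_{L^q_tL^r_x}+2^{-k}\|\partial_tu\|_{L^q_tL^r_x}\big),$$ the supremum being over $2\le q,r\le\infty$ with $\frac1q+\frac{n-1}{2r}\le\frac{n-1}4$. Fix $0<\sigma<\min(\frac12,\frac{n-4}4)$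 and $A\in\mathbb R$. An envelope is a sequence $c_k\ge0$ in $\ell^2(\mathbb Z)$ with $c_k\le A\,2^{\sigma|k-k'|}c_{k'}$ for all $k,k'\in\mathbb Z$. **Claim.** There are constants $K>0$ and $C_0\ge1$, depending only on $n,N,C^a_{bc},\eta,\sigma,A$, such that for every $C\ge C_0$ there is $\varepsilon_0>0$ with the following property. Let $0<\varepsilon\le\varepsilon_0$, $0<T<\infty$, let $c$ be an envelope with $\|c\|_{\ell^2}\le\varepsilon$, and let $\Phi=(\phi^a_\alpha)$, $1\le a\le N$, $0\le\alpha\le n$, be real, smooth on $(0,T)\times\mathbb R^n$, with $\sup_{t\in(0,T)}\|\Phi(t)\|_{L^2}<\infty$, and satisfy there $$\partial_\beta\phi^a_\alpha-\partial_\alpha\phi^a_\beta=C^a_{bc}\phi^b_\alpha\phi^c_\beta,\qquad \partial^\alpha\phi^a_\alpha=-\Gamma^a_{bc}\phi^b_\beta\phi^c_\gamma m^{\beta\gamma},$$ together with $\|P_k\Phi\|_{S_k}\le 2Cc_k$ for all $k\in\mathbb Z$. Put $\Psi=(\psi^a_\alpha)=P_0\Phi$ and $\tilde R^a_{b\mu}=P_{\le-10}(\Gamma^a_{cb}\phi^c_\mu)$.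 Then there is a real $N\times N$ matrix function $\tilde\Delta$ on $(0,T)\times\mathbb R^n$, of class $C^3$ with bounded derivatives of all orders $\le3$, such that $$\Box\psi^a_\alpha=-2\,\partial_\mu\tilde\Delta^a_b\,\partial^\mu\psi^b_\alpha+F^a_\alpha,\qquad \|F\|_{L^1_tL^2_x}\le C^3\varepsilon c_0,$$ and, with $\tilde\Delta_k=P_k\tilde\Delta$ and $\bar R_\mu=\tilde R_\mu-\partial_\mu\tilde\Delta$: (i) $\tilde\Delta^t=-\tilde\Delta$, and for each $t$ the space Fourier transform of $\tilde\Delta(t)$ is supported in $|\xi|\le2^{-9}$; (ii) for all $k\in\mathbb Z$: $\|\tilde\Delta_k\|_{S_k}\le K2^{-k}Cc_k$, $\ \|\partial\tilde\Delta_k\|_{S_k}\le K\,Cc_k$, $\ \|\Box\tilde\Delta_k\|_{S_k}\le K2^kCc_k$, where $\partial$ is the full space-time gradient; (iii) for all $k\in\mathbb Z$: $\|P_k\bar R\|_{L^1_tL^\infty_x}\le K\,C^2c_k^2$ and $\|P_k\bar R\|_{L^\infty_tL^\infty_x}\le K2^kC^2c_k^2$. -/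

import Mathlib

open MeasureTheory Set
open scoped ENNReal ContDiff FourierTransform SchwartzMap

noncomputable section

namespace WaveMap

/-- Euclidean space of dimension `n`, the spatial domain. -/
abbrev Space (n : ℕ) : Type := EuclideanSpace ℝ (Fin n)

/-- Real-valued functions `u t x` of time and space. -/
abbrev STField (n : ℕ) : Type := ℝ → Space n → ℝ

/-- The open space-time slab of height `T`. -/
def slab (n : ℕ) (T : ℝ) : Set (ℝ × Space n) := Ioo 0 T ×ˢ univ

/-- The partial derivative in the direction `μ`; `μ = 0` is time, `μ = i + 1` is the `i`-th
space coordinate. -/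
def pd {n : ℕ} (μ : Fin (n + 1)) (u : STField n) : STField n :=
  Fin.cases (motive := fun _ => STField n)
    (fun t x => deriv (fun s => u s x) t)
    (fun i t x => lineDeriv ℝ (u t) x (EuclideanSpace.single i 1)) μ

/-- The diagonal entries of the Minkowski metric `diag (-1, 1, …, 1)`. -/
def mink {n : ℕ} (μ : Fin (n + 1)) : ℝ := if μ = 0 then -1 else 1

/-- The wave operator, the sum over `μ` of `m^{μμ} ∂_μ ∂_μ`. -/
def box {n : ℕ} (u : STField n) : STField n :=
  fun t x => ∑ μ : Fin (n + 1), mink μ * pd μ (pd μ u) t x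

/-- The bump functions from which the Littlewood-Paley projections are built. Evenness makes
the projections of real functions real. -/
structure IsCutoff {n : ℕ} (η : Space n → ℝ) : Prop where
  smooth : ContDiff ℝ ∞ η
  nonneg : ∀ ξ, 0 ≤ η ξ
  even : ∀ ξ, η (-ξ) = η ξ
  eq_one : ∀ ξ, ‖ξ‖ ≤ 1 → η ξ = 1
  eq_zero : ∀ ξ, 2 < ‖ξ‖ → η ξ = 0

/-- The convolution kernel of the Fourier multiplier `η (2 ^ (-k) ξ)`, that is
`(2π)^(-n) ∫ e^{i x·ξ} η (2 ^ (-k) ξ) dξ`; here `ξ = 2π v`, with `v` the variable of the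
transform `𝓕⁻`. The integral is real since `η` is even. -/
def lowKernel {n : ℕ} (η : Space n → ℝ) (k : ℤ) (x : Space n) : ℝ :=
  ((𝓕⁻ (fun v : Space n => ((η ((2 : ℝ) ^ (-k) • ((2 * Real.pi) • v)) : ℝ) : ℂ))) x).re

/-- The projection `P_{≤ k}` in the space variable, with multiplier `η (2 ^ (-k) ξ)`. -/
def lowProj {n : ℕ} (η : Space n → ℝ) (k : ℤ) (u : STField n) : STField n :=
  fun t x => ∫ y, lowKernel η k (x - y) * u t y

/-- The projection `P_k = P_{≤ k} - P_{≤ k - 1}`, with multiplier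
`η (2 ^ (-k) ξ) - η (2 ^ (1 - k) ξ)`. -/
def proj {n : ℕ} (η : Space n → ℝ) (k : ℤ) (u : STField n) : STField n :=
  fun t x => lowProj η k u t x - lowProj η (k - 1) u t x

/-- The space Fourier transform of `f`, as a tempered distribution in the frequency `ξ = 2π v`
(so that the characters are `e^{i x·ξ}`), is supported in the ball `‖ξ‖ ≤ r`. Used for bounded
continuous `f`. -/
def FourierSupportedIn {n : ℕ} (r : ℝ) (f : Space n → ℝ) : Prop :=
  ∀ h : 𝓢(Space n, ℂ), Disjoint (tsupport h) {v | ‖(2 * Real.pi) • v‖ ≤ r} →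
    ∫ x, (f x : ℂ) * (𝓕 h) x = 0

/-- The mixed norm `L^q_t L^r_x` on the slab of height `T`. -/
def mixedNorm {n : ℕ} (T : ℝ) (q r : ℝ≥0∞) (u : STField n) : ℝ≥0∞ :=
  eLpNorm (fun t => eLpNorm (u t) r volume) q (volume.restrict (Ioo 0 T))

/-- The admissible Strichartz exponents. -/
def Admissible (n : ℕ) (q r : ℝ≥0∞) : Prop :=
  2 ≤ q ∧ 2 ≤ r ∧ (q⁻¹).toReal + ((n : ℝ) - 1) / 2 * (r⁻¹).toReal ≤ ((n : ℝ) - 1) / 4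

/-- The norm `S_k` on the slab of height `T`. -/
def sNorm {n : ℕ} (T : ℝ) (k : ℤ) (u : STField n) : ℝ≥0∞ :=
  ⨆ (q : ℝ≥0∞) (r : ℝ≥0∞) (_ : Admissible n q r),
    ENNReal.ofReal ((2 : ℝ) ^ ((k : ℝ) * ((q⁻¹).toReal + n * (r⁻¹).toReal - 1))) *
      (mixedNorm T q r u + ENNReal.ofReal ((2 : ℝ) ^ (-k)) * mixedNorm T q r (pd 0 u))

/-- Frequency envelopes with exponent `σ` and constant `A`. -/
structure IsEnvelope (σ A : ℝ) (c : ℤ → ℝ) : Prop where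
  nonneg : ∀ k, 0 ≤ c k
  summable_sq : Summable fun k => c k ^ 2
  growth : ∀ k k' : ℤ, c k ≤ A * (2 : ℝ) ^ (σ * |((k - k' : ℤ) : ℝ)|) * c k'

/-- The connection coefficients `Γ^a_{bc}` of an orthonormal frame with constant structure
coefficients `C^a_{bc} = S a b c`. -/
def conn {N : ℕ} (S : Fin N → Fin N → Fin N → ℝ) (a b c : Fin N) : ℝ :=
  (S a b c + S b a c + S c a b) / 2

/-- The divergence-curl system of wave maps, on the slab of height `T`, for `φ^a_α = Φ a α`. -/
def IsSolution {n N : ℕ} (S : Fin N → Fin N → Fin N → ℝ) (T : ℝ)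
    (Φ : Fin N → Fin (n + 1) → STField n) : Prop :=
  ∀ t ∈ Ioo 0 T, ∀ (x : Space n) (a : Fin N),
    (∀ α β : Fin (n + 1), pd β (Φ a α) t x - pd α (Φ a β) t x
      = ∑ b, ∑ c, S a b c * Φ b α t x * Φ c β t x) ∧
    (∑ α, mink α * pd α (Φ a α) t x
      = -∑ b, ∑ c, ∑ β, conn S a b c * mink β * Φ b β t x * Φ c β t x)

/-- The matrices `R^a_{bμ} = Γ^a_{cb} φ^c_μ`. -/
def connForm {n N : ℕ} (S : Fin N → Fin N → Fin N → ℝ) (Φ : Fin N → Fin (n + 1) → STField n)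
    (a b : Fin N) (μ : Fin (n + 1)) : STField n :=
  fun t x => ∑ c, conn S a c b * Φ c μ t x

end WaveMap

end

noncomputable section

namespace WaveMap

open Filter Topology
open ENNReal (ofReal ofReal_ne_top ofReal_mul mul_ne_top ofReal_le_ofReal sum_ne_top add_ne_top
  mul_rpow_of_nonneg ofReal_toReal toReal_mono)
open Finset (sum_congr sum_le_sum mul_sum sum_mul single_le_sum sum_add_distrib sum_comm)
variable {n : ℕ} {T : ℝ}

/-! ### Convolution inequalities at a fixed time -/

/-- Convolution of real functions on space. -/
def cnv (κ f : Space n → ℝ) (x : Space n) : ℝ := ∫ y, κ (x - y) * f y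

/-- The convolution of absolute values. -/
def acnv (κ f : Space n → ℝ) (x : Space n) : ℝ≥0∞ := ∫⁻ y, ‖κ (x - y)‖ₑ * ‖f y‖ₑ

/-- A continuous kernel with `L¹` norm at most `A` and supremum at most `B`. -/
structure KBound (κ : Space n → ℝ) (A B : ℝ≥0∞) : Prop where
  cont : Continuous κ
  l1 : ∫⁻ y, ‖κ y‖ₑ ≤ A
  sup : ∀ y, ‖κ y‖ₑ ≤ B

lemma enorm_cnv_le (κ f : Space n → ℝ) (x : Space n) : ‖cnv κ f x‖ₑ ≤ acnv κ f x := by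
  refine (enorm_integral_le_lintegral_enorm _).trans_eq ?_
  simp [acnv, enorm_mul]

lemma KBound.l1_sub {κ : Space n → ℝ} {A B : ℝ≥0∞} (h : KBound κ A B) (x : Space n) :
    ∫⁻ y, ‖κ (x - y)‖ₑ ≤ A :=
  (lintegral_sub_left_eq_self (fun y => ‖κ y‖ₑ) x).trans_le h.l1

lemma acnv_le_rpow {κ f : Space n → ℝ} {A B : ℝ≥0∞} (h : KBound κ A B)
    (hf : AEStronglyMeasurable f volume) {p : ℝ} (hp : 1 ≤ p) (x : Space n) :
    acnv κ f x ≤ A ^ (1 - 1 / p) * (∫⁻ y, ‖κ (x - y)‖ₑ * ‖f y‖ₑ ^ p) ^ (1 / p) := by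
  have hp0 : 0 < p := by linarith
  have h1 : 0 ≤ 1 - 1 / p := by
    have : 1 / p ≤ 1 := by rw [div_le_one hp0]; exact hp
    linarith
  have hκ : AEMeasurable (fun y => ‖κ (x - y)‖ₑ) (volume : Measure (Space n)) :=
    (h.cont.comp (continuous_const.sub continuous_id)).enorm.measurable.aemeasurable
  have key := ENNReal.lintegral_mul_norm_pow_le (μ := (volume : Measure (Space n)))
    (f := fun y => ‖κ (x - y)‖ₑ) (g := fun y => ‖κ (x - y)‖ₑ * ‖f y‖ₑ ^ p)
    hκ (hκ.mul (hf.enorm.pow_const p))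
    h1 (by positivity : 0 ≤ 1 / p) (by ring)
  refine le_trans (le_of_eq ?_) (key.trans ?_)
  · refine lintegral_congr fun y => ?_
    rw [mul_rpow_of_nonneg _ _ (by positivity), ← mul_assoc,
      ← ENNReal.rpow_add_of_nonneg _ _ h1 (by positivity), ← ENNReal.rpow_mul]
    simp [hp0.ne']
  · gcongr
    exact h.l1_sub x

lemma acnv_le_eLpNorm {κ f : Space n → ℝ} {A B : ℝ≥0∞} (h : KBound κ A B)
    (hf : AEStronglyMeasurable f volume) {p : ℝ≥0∞} (hp : 1 ≤ p) (x : Space n) :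
    acnv κ f x ≤ A ^ (1 - (p⁻¹).toReal) * B ^ (p⁻¹).toReal * eLpNorm f p volume := by
  by_cases hpt : p = ⊤
  · subst hpt
    simp only [ENNReal.inv_top, ENNReal.toReal_zero, sub_zero, ENNReal.rpow_one, ENNReal.rpow_zero,
      mul_one]
    calc acnv κ f x ≤ ∫⁻ y, ‖κ (x - y)‖ₑ * eLpNorm f ⊤ volume := by
          refine lintegral_mono_ae ?_
          filter_upwards [enorm_ae_le_eLpNormEssSup f volume] with y hy
          gcongr
          simpa [eLpNorm_exponent_top] using hy
      _ = (∫⁻ y, ‖κ (x - y)‖ₑ) * eLpNorm f ⊤ volume := by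
          rw [lintegral_mul_const]
          exact (h.cont.comp (continuous_const.sub continuous_id)).enorm.measurable
      _ ≤ _ := by gcongr; exact h.l1_sub x
  · have hp1 : 1 ≤ p.toReal := by
      rw [← ENNReal.toReal_one]; exact (ENNReal.toReal_le_toReal (by simp) hpt).2 hp
    have hp0 : p ≠ 0 := (zero_lt_one.trans_le hp).ne'
    refine (acnv_le_rpow h hf hp1 x).trans ?_
    rw [ENNReal.toReal_inv, ← one_div, mul_assoc, eLpNorm_eq_lintegral_rpow_enorm_toReal hp0 hpt]
    gcongr
    rw [← mul_rpow_of_nonneg _ _ (by positivity),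
      ← lintegral_const_mul'' _ (hf.enorm.pow_const _)]
    gcongr
    exact h.sup _

lemma aestronglyMeasurable_prod_kernel {κ f : Space n → ℝ} (h : Continuous κ)
    (hf : AEStronglyMeasurable f volume) :
    AEStronglyMeasurable (fun z : Space n × Space n => κ (z.1 - z.2) * f z.2)
      ((volume : Measure (Space n)).prod volume) := by
  have h1 : Continuous (fun z : Space n × Space n => κ (z.1 - z.2)) := by fun_prop
  exact h1.aestronglyMeasurable.mul hf.comp_snd

lemma aestronglyMeasurable_cnv {κ f : Space n → ℝ} (h : Continuous κ)
    (hf : AEStronglyMeasurable f volume) : AEStronglyMeasurable (cnv κ f) volume :=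
  (aestronglyMeasurable_prod_kernel h hf).integral_prod_right'

lemma lintegral_acnv_rpow_le {κ f : Space n → ℝ} {A B : ℝ≥0∞} (h : KBound κ A B)
    (hf : AEStronglyMeasurable f volume) {p : ℝ} (hp : 1 ≤ p) :
    ∫⁻ x, acnv κ f x ^ p ≤ A ^ p * ∫⁻ y, ‖f y‖ₑ ^ p := by
  have hp0 : 0 < p := by linarith
  have hfp : AEMeasurable (fun y => ‖f y‖ₑ ^ p) (volume : Measure (Space n)) :=
    hf.enorm.pow_const p
  have hprod : AEMeasurable (fun z : Space n × Space n => ‖κ (z.1 - z.2)‖ₑ * ‖f z.2‖ₑ ^ p)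
      ((volume : Measure (Space n)).prod volume) := by
    refine AEMeasurable.mul ?_ (hfp.comp_snd)
    exact (h.cont.comp (continuous_fst.sub continuous_snd)).enorm.measurable.aemeasurable
  calc ∫⁻ x, acnv κ f x ^ p
      ≤ ∫⁻ x, A ^ (p - 1) * ∫⁻ y, ‖κ (x - y)‖ₑ * ‖f y‖ₑ ^ p := by
        refine lintegral_mono fun x => ?_
        refine (ENNReal.rpow_le_rpow (acnv_le_rpow h hf hp x) hp0.le).trans_eq ?_
        rw [mul_rpow_of_nonneg _ _ hp0.le, ← ENNReal.rpow_mul, ← ENNReal.rpow_mul]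
        congr 2
        · field_simp
        · field_simp; simp
    _ = A ^ (p - 1) * ∫⁻ x, ∫⁻ y, ‖κ (x - y)‖ₑ * ‖f y‖ₑ ^ p :=
        lintegral_const_mul'' _ hprod.lintegral_prod_right'
    _ = A ^ (p - 1) * ∫⁻ y, ∫⁻ x, ‖κ (x - y)‖ₑ * ‖f y‖ₑ ^ p := by
        rw [lintegral_lintegral_swap hprod]
    _ = A ^ (p - 1) * ∫⁻ y, (∫⁻ x, ‖κ x‖ₑ) * ‖f y‖ₑ ^ p := by
        congr 1
        refine lintegral_congr fun y => ?_
        have hm : Measurable (fun x => ‖κ (x - y)‖ₑ) :=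
          (h.cont.comp (continuous_id.sub continuous_const)).enorm.measurable
        rw [lintegral_mul_const _ hm]
        congr 1
        exact lintegral_sub_right_eq_self (fun x => ‖κ x‖ₑ) y
    _ ≤ A ^ (p - 1) * (A * ∫⁻ y, ‖f y‖ₑ ^ p) := by
        rw [lintegral_const_mul'' _ hfp]
        gcongr
        exact h.l1
    _ = A ^ p * ∫⁻ y, ‖f y‖ₑ ^ p := by
        rw [← mul_assoc]
        congr 1
        nth_rewrite 2 [← ENNReal.rpow_one A]
        rw [← ENNReal.rpow_add_of_nonneg _ _ (by linarith) (by norm_num)]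
        ring_nf

/-- Young's inequality with an integrable kernel. -/
lemma eLpNorm_cnv_le {κ f : Space n → ℝ} {A B : ℝ≥0∞} (h : KBound κ A B)
    (hf : AEStronglyMeasurable f volume) {p : ℝ≥0∞} (hp : 1 ≤ p) :
    eLpNorm (cnv κ f) p volume ≤ A * eLpNorm f p volume := by
  by_cases hpt : p = ⊤
  · subst hpt
    rw [eLpNorm_exponent_top (f := cnv κ f)]
    refine essSup_le_of_ae_le _ (Eventually.of_forall fun x => ?_)
    refine (enorm_cnv_le κ f x).trans ((acnv_le_eLpNorm h hf le_top x).trans_eq ?_)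
    simp
  · have hp1 : 1 ≤ p.toReal := by
      rw [← ENNReal.toReal_one]; exact (ENNReal.toReal_le_toReal (by simp) hpt).2 hp
    have hp0 : p ≠ 0 := (zero_lt_one.trans_le hp).ne'
    have hpp : 0 < p.toReal := by linarith
    rw [eLpNorm_eq_lintegral_rpow_enorm_toReal hp0 hpt,
      eLpNorm_eq_lintegral_rpow_enorm_toReal hp0 hpt]
    calc (∫⁻ x, ‖cnv κ f x‖ₑ ^ p.toReal) ^ (1 / p.toReal)
        ≤ (A ^ p.toReal * ∫⁻ y, ‖f y‖ₑ ^ p.toReal) ^ (1 / p.toReal) := by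
          gcongr
          refine le_trans (lintegral_mono fun x => ?_) (lintegral_acnv_rpow_le h hf hp1)
          exact ENNReal.rpow_le_rpow (enorm_cnv_le κ f x) hpp.le
      _ = _ := by
          rw [mul_rpow_of_nonneg _ _ (by positivity), ← ENNReal.rpow_mul]
          simp [hpp.ne']

/-- Bernstein's inequality: Young's inequality from `L^p` to `L^r`. -/
lemma eLpNorm_cnv_le_bernstein {κ f : Space n → ℝ} {A B : ℝ≥0∞} (h : KBound κ A B)
    (hA : A ≠ ⊤) (hA0 : A ≠ 0) (hf : AEStronglyMeasurable f volume) {p r : ℝ≥0∞} (hp : 1 ≤ p)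
    (hpr : p ≤ r) :
    eLpNorm (cnv κ f) r volume ≤ A ^ (1 - ((p⁻¹).toReal - (r⁻¹).toReal))
      * B ^ ((p⁻¹).toReal - (r⁻¹).toReal) * eLpNorm f p volume := by
  by_cases hrt : r = ⊤
  · subst hrt
    rw [eLpNorm_exponent_top (f := cnv κ f)]
    refine essSup_le_of_ae_le _ (Eventually.of_forall fun x => ?_)
    refine (enorm_cnv_le κ f x).trans ((acnv_le_eLpNorm h hf hp x).trans_eq ?_)
    simp
  have hpt : p ≠ ⊤ := fun h' => hrt (top_le_iff.1 (h' ▸ hpr))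
  have hp1 : 1 ≤ p.toReal := by
    rw [← ENNReal.toReal_one]; exact (ENNReal.toReal_le_toReal (by simp) hpt).2 hp
  have hp0 : p ≠ 0 := (zero_lt_one.trans_le hp).ne'
  have hr0 : r ≠ 0 := (zero_lt_one.trans_le (hp.trans hpr)).ne'
  have hprR : p.toReal ≤ r.toReal := (ENNReal.toReal_le_toReal hpt hrt).2 hpr
  set P := p.toReal with hP
  set R := r.toReal with hR
  have hP0 : 0 < P := by linarith
  have hR0 : 0 < R := by linarith
  set N := eLpNorm f p volume with hN
  have hNP : ∫⁻ y, ‖f y‖ₑ ^ P = N ^ P := by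
    rw [hN, eLpNorm_eq_lintegral_rpow_enorm_toReal hp0 hpt, ← ENNReal.rpow_mul]
    simp [← hP, hP0.ne']
  have hsup : ∀ x, acnv κ f x ≤ A ^ (1 - 1 / P) * B ^ (1 / P) * N := by
    intro x
    have := acnv_le_eLpNorm h hf hp x
    rwa [ENNReal.toReal_inv, ← one_div] at this
  have hint : ∫⁻ x, ‖cnv κ f x‖ₑ ^ R ≤
      (A ^ (1 - 1 / P) * B ^ (1 / P) * N) ^ (R - P) * (A ^ P * N ^ P) := by
    calc ∫⁻ x, ‖cnv κ f x‖ₑ ^ R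
        ≤ ∫⁻ x, (A ^ (1 - 1 / P) * B ^ (1 / P) * N) ^ (R - P) * ‖cnv κ f x‖ₑ ^ P := by
          refine lintegral_mono fun x => ?_
          have : ‖cnv κ f x‖ₑ ^ R = ‖cnv κ f x‖ₑ ^ (R - P) * ‖cnv κ f x‖ₑ ^ P := by
            rw [← ENNReal.rpow_add_of_nonneg _ _ (by linarith) hP0.le]; ring_nf
          rw [this]
          gcongr
          exact (enorm_cnv_le κ f x).trans (hsup x)
      _ = (A ^ (1 - 1 / P) * B ^ (1 / P) * N) ^ (R - P) * ∫⁻ x, ‖cnv κ f x‖ₑ ^ P :=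
          lintegral_const_mul'' _ ((aestronglyMeasurable_cnv h.cont hf).enorm.pow_const _)
      _ ≤ _ := by
          gcongr
          rw [← hNP]
          refine le_trans (lintegral_mono fun x => ?_) (lintegral_acnv_rpow_le h hf hp1)
          exact ENNReal.rpow_le_rpow (enorm_cnv_le κ f x) hP0.le
  rw [eLpNorm_eq_lintegral_rpow_enorm_toReal hr0 hrt (f := cnv κ f)]
  refine (ENNReal.rpow_le_rpow hint (by positivity : 0 ≤ 1 / r.toReal)).trans_eq ?_
  have hRP : 0 ≤ R - P := by linarith
  have e1 : 0 ≤ 1 / P := by positivity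
  have e2 : 0 ≤ 1 / R := by positivity
  have hinvp : (p⁻¹).toReal = 1 / P := by rw [ENNReal.toReal_inv, ← one_div]
  have hinvr : (r⁻¹).toReal = 1 / R := by rw [ENNReal.toReal_inv, ← one_div]
  rw [← hR, hinvp, hinvr]
  simp only [mul_rpow_of_nonneg _ _ hRP, mul_rpow_of_nonneg _ _ e2,
    ← ENNReal.rpow_mul]
  have a1 : A ^ ((1 - 1 / P) * (R - P) * (1 / R)) * A ^ (P * (1 / R))
      = A ^ (1 - (1 / P - 1 / R)) := by
    rw [← ENNReal.rpow_add _ _ hA0 hA]; congr 1; field_simp; ring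
  have b1 : (1 / P * (R - P) * (1 / R)) = 1 / P - 1 / R := by field_simp
  have n1 : N ^ ((R - P) * (1 / R)) * N ^ (P * (1 / R)) = N := by
    rw [← ENNReal.rpow_add_of_nonneg _ _ (by positivity) (by positivity)]
    conv_rhs => rw [← ENNReal.rpow_one N]
    congr 1; field_simp; ring
  rw [← a1, ← b1]
  conv_rhs => rw [← n1]
  ring

lemma integrable_kernel_mul {κ f : Space n → ℝ} {A B : ℝ≥0∞} (h : KBound κ A B)
    (hA : A ≠ ⊤) (hB : B ≠ ⊤) {p : ℝ≥0∞} (hp : 1 ≤ p) (hf : MemLp f p volume) (x : Space n) :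
    Integrable (fun y => κ (x - y) * f y) volume := by
  refine ⟨(h.cont.comp (continuous_const.sub continuous_id)).aestronglyMeasurable.mul hf.1, ?_⟩
  have hle : (p⁻¹).toReal ≤ 1 := by
    rw [← ENNReal.toReal_one]
    exact toReal_mono (by simp) (ENNReal.inv_le_one.2 hp)
  have : acnv κ f x < ⊤ := by
    refine (acnv_le_eLpNorm h hf.1 hp x).trans_lt ?_
    refine ENNReal.mul_lt_top (ENNReal.mul_lt_top ?_ ?_) hf.2
    · exact ENNReal.rpow_lt_top_of_nonneg (by linarith) hA
    · exact ENNReal.rpow_lt_top_of_nonneg ENNReal.toReal_nonneg hB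
  simpa [HasFiniteIntegral, acnv, enorm_mul] using this

/-! ### Symbols and their kernels -/

/-- Smooth compactly supported symbols with the symmetry of Fourier transforms of real
functions. -/
structure IsSymb (m : Space n → ℂ) : Prop where
  smooth : ContDiff ℝ ∞ m
  cpt : HasCompactSupport m
  herm : ∀ v, m (-v) = starRingEnd ℂ (m v)

/-- The real convolution kernel of a symbol. -/
def kern (m : Space n → ℂ) (x : Space n) : ℝ := ((𝓕⁻ m) x).re

/-- The Fourier multiplier of a symbol. -/
def Op (m : Space n → ℂ) (f : Space n → ℝ) : Space n → ℝ := cnv (kern m) f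

/-- The symbol as a Schwartz function. -/
def IsSymb.sch {m : Space n → ℂ} (h : IsSymb m) : 𝓢(Space n, ℂ) := h.cpt.toSchwartzMap h.smooth

lemma IsSymb.sch_coe {m : Space n → ℂ} (h : IsSymb m) : (h.sch : Space n → ℂ) = m := rfl

lemma IsSymb.fourierInv_sch {m : Space n → ℂ} (h : IsSymb m) (x : Space n) :
    (𝓕⁻ h.sch) x = 𝓕⁻ m x := by
  rw [SchwartzMap.fourierInv_coe, h.sch_coe]

lemma IsSymb.integrable {m : Space n → ℂ} (h : IsSymb m) : Integrable m volume :=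
  h.smooth.continuous.integrable_of_hasCompactSupport h.cpt

lemma IsSymb.fourierInv_eq {m : Space n → ℂ} (h : IsSymb m) (x : Space n) :
    𝓕⁻ m x = (kern m x : ℂ) := by
  have : starRingEnd ℂ (𝓕⁻ m x) = 𝓕⁻ m x := by
    rw [Real.fourierInv_eq', ← integral_conj, ← integral_neg_eq_self]
    congr 1
    ext v
    rw [smul_eq_mul, smul_eq_mul, map_mul, h.herm, Complex.conj_conj]
    congr 1
    rw [← Complex.exp_conj]
    congr 1
    simp [Complex.conj_ofNat]
  exact (Complex.conj_eq_iff_re.1 this).symm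

lemma IsSymb.mul {a b : Space n → ℂ} (ha : IsSymb a) (hb : IsSymb b) : IsSymb (a * b) :=
  ⟨ha.smooth.mul hb.smooth, ha.cpt.mul_right, fun v => by simp [ha.herm, hb.herm]⟩

lemma IsSymb.mul_smooth {a b : Space n → ℂ} (ha : IsSymb a) (hb : ContDiff ℝ ∞ b)
    (hb' : ∀ v, b (-v) = starRingEnd ℂ (b v)) : IsSymb (a * b) :=
  ⟨ha.smooth.mul hb, ha.cpt.mul_right, fun v => by simp [ha.herm, hb']⟩

lemma IsSymb.add {a b : Space n → ℂ} (ha : IsSymb a) (hb : IsSymb b) : IsSymb (a + b) :=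
  ⟨ha.smooth.add hb.smooth, ha.cpt.add hb.cpt, fun v => by simp [ha.herm, hb.herm]⟩

lemma IsSymb.smul {a : Space n → ℂ} (ha : IsSymb a) (c : ℝ) : IsSymb (c • a) :=
  ⟨ha.smooth.const_smul c, ha.cpt.smul_left (f := fun _ => c), fun v => by simp [ha.herm]⟩

lemma IsSymb.sub {a b : Space n → ℂ} (ha : IsSymb a) (hb : IsSymb b) : IsSymb (a - b) := by
  have := ha.add (hb.smul (-1))
  rwa [neg_one_smul, ← sub_eq_add_neg] at this

/-- Dilation of symbols by powers of two. -/
def dil (k : ℤ) (m : Space n → ℂ) (v : Space n) : ℂ := m ((2 : ℝ) ^ (-k) • v)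

lemma dil_mul (k : ℤ) (a b : Space n → ℂ) : dil k (a * b) = dil k a * dil k b := rfl

lemma dil_dil (k l : ℤ) (m : Space n → ℂ) : dil k (dil l m) = dil (k + l) m := by
  ext v
  simp only [dil, smul_smul]
  rw [← zpow_add₀ (by norm_num : (2 : ℝ) ≠ 0)]
  ring_nf

lemma IsSymb.dil {m : Space n → ℂ} (h : IsSymb m) (k : ℤ) : IsSymb (dil k m) := by
  have h2 : (2 : ℝ) ^ (-k) ≠ 0 := by positivity
  refine ⟨h.smooth.comp (contDiff_const_smul _), h.cpt.comp_smul h2, fun v => ?_⟩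
  simp [WaveMap.dil, h.herm]

lemma kern_dil (k : ℤ) (m : Space n → ℂ) (x : Space n) :
    kern (dil k m) x = (2 : ℝ) ^ (n * k) * kern m ((2 : ℝ) ^ k • x) := by
  unfold kern
  rw [Real.fourierInv_eq', Real.fourierInv_eq']
  have h2 : (2 : ℝ) ^ k ≠ 0 := by positivity
  have := Measure.integral_comp_smul (volume : Measure (Space n))
    (fun v => Complex.exp (↑(2 * Real.pi * inner ℝ v ((2 : ℝ) ^ k • x)) * Complex.I) • m v)
    ((2 : ℝ) ^ (-k))
  have e : ∀ v : Space n, Complex.exp (↑(2 * Real.pi * inner ℝ v x) * Complex.I) • dil k m v =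
      Complex.exp (↑(2 * Real.pi * inner ℝ ((2 : ℝ) ^ (-k) • v) ((2 : ℝ) ^ k • x)) * Complex.I) •
        m ((2 : ℝ) ^ (-k) • v) := by
    intro v
    rw [inner_smul_left, inner_smul_right]
    simp only [dil, zpow_neg, conj_trivial]
    congr 5
    field_simp
  simp_rw [e]
  rw [this, Complex.smul_re, smul_eq_mul]
  congr 1
  rw [finrank_euclideanSpace_fin, abs_of_pos (by positivity), ← zpow_natCast, ← zpow_mul,
    ← zpow_neg]
  congr 1
  ring

/-- The symbol of `∂_i` times `m`. -/
def dsymb (i : Fin n) (m : Space n → ℂ) (v : Space n) : ℂ :=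
  2 * Real.pi * Complex.I * (v i : ℂ) * m v

lemma dsymb_eq_mul (i : Fin n) (m : Space n → ℂ) :
    dsymb i m = m * fun v : Space n => 2 * Real.pi * Complex.I * (v i : ℂ) := by
  ext v; simp [dsymb]; ring

lemma dsymb_mul (i : Fin n) (a b : Space n → ℂ) : dsymb i (a * b) = dsymb i a * b := by
  ext v; simp [dsymb]; ring

lemma dsymb_mul' (i : Fin n) (a b : Space n → ℂ) : dsymb i (a * b) = a * dsymb i b := by
  ext v; simp [dsymb]; ring

lemma IsSymb.dsymb {m : Space n → ℂ} (h : IsSymb m) (i : Fin n) : IsSymb (dsymb i m) := by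
  rw [dsymb_eq_mul]
  refine h.mul_smooth ?_ (fun v => by simp [Complex.conj_ofNat])
  refine contDiff_const.mul (Complex.ofRealCLM.contDiff.comp ?_)
  exact (EuclideanSpace.proj (𝕜 := ℝ) i).contDiff

lemma dsymb_dil (i : Fin n) (k : ℤ) (m : Space n → ℂ) :
    dsymb i (dil k m) = (2 : ℝ) ^ k • dil k (dsymb i m) := by
  ext v
  simp only [dsymb, dil, Pi.smul_apply, PiLp.smul_apply, smul_eq_mul, Complex.real_smul]
  push_cast
  have : ((2 : ℂ) ^ k) * (2 : ℂ) ^ (-k) = 1 := by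
    rw [← zpow_add₀ (by norm_num)]; simp
  linear_combination (-2 * (Real.pi : ℂ) * Complex.I * (v i : ℂ) * m ((2 : ℝ) ^ (-k) • v)) * this

/-! ### Bounds on kernels -/

lemma IsSymb.contDiff_kern {m : Space n → ℂ} (h : IsSymb m) : ContDiff ℝ ∞ (kern m) := by
  have : kern m = fun x => Complex.reCLM ((𝓕⁻ h.sch) x) := by
    ext x; simp [kern, h.fourierInv_sch]
  rw [this]
  exact Complex.reCLM.contDiff.comp ((𝓕⁻ h.sch).smooth _)

lemma IsSymb.continuous_kern {m : Space n → ℂ} (h : IsSymb m) : Continuous (kern m) :=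
  h.contDiff_kern.continuous

lemma IsSymb.hasLineDerivAt_kern {m : Space n → ℂ} (h : IsSymb m) (i : Fin n) (x : Space n) :
    HasLineDerivAt ℝ (kern m) (kern (WaveMap.dsymb i m) x) x (EuclideanSpace.single i 1) := by
  have e1 : kern m = fun x => Complex.reCLM ((𝓕⁻ h.sch) x) := by
    ext x; simp [kern, h.fourierInv_sch]
  have hd := ((𝓕⁻ h.sch).differentiable x).hasFDerivAt
  have h1 := (Complex.reCLM.hasFDerivAt.comp x hd).hasLineDerivAt (EuclideanSpace.single i 1)
  rw [e1]
  refine (congrArg (fun a => HasLineDerivAt ℝ _ a _ _) ?_).mp h1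
  have h2 := SchwartzMap.lineDerivOp_fourierInv_eq h.sch (EuclideanSpace.single i (1 : ℝ))
  have h3 := congrArg (fun g : 𝓢(Space n, ℂ) => g x) h2
  rw [SchwartzMap.lineDerivOp_apply_eq_fderiv] at h3
  simp only [ContinuousLinearMap.comp_apply, Complex.reCLM_apply]
  rw [h3, SchwartzMap.fourierInv_coe, kern]
  refine congrArg (fun g : Space n → ℂ => (𝓕⁻ g x).re) (funext fun v => ?_)
  have ht : (fun y : Space n => inner ℝ y (EuclideanSpace.single i (1 : ℝ))).HasTemperateGrowth := by
    fun_prop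
  simp only [smul_apply]
  rw [SchwartzMap.smulLeftCLM_apply_apply ht]
  have hi : inner ℝ v (EuclideanSpace.single i (1 : ℝ)) = v i := by
    rw [EuclideanSpace.inner_single_right]; simp
  rw [hi]
  simp [WaveMap.dsymb, h.sch_coe]
  ring

lemma schwartz_weight (g : 𝓢(Space n, ℂ)) :
    ∃ C : ℝ, 0 < C ∧ ∀ y, (1 + ‖y‖) ^ (n + 2) * ‖g y‖ ≤ C := by
  obtain ⟨C, hC⟩ : ∃ C, ∀ y, (1 + ‖y‖) ^ (n + 2) * ‖iteratedFDeriv ℝ 0 g y‖ ≤ C :=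
    ⟨_, fun y => SchwartzMap.one_add_le_sup_seminorm_apply (𝕜 := ℝ) (m := (n + 2, 0)) le_rfl
      le_rfl g y⟩
  refine ⟨max C 1, by positivity, fun y => ?_⟩
  have := hC y
  rw [norm_iteratedFDeriv_zero] at this
  exact this.trans (le_max_left _ _)

lemma IsSymb.weight {m : Space n → ℂ} (h : IsSymb m) :
    ∃ C : ℝ, 0 < C ∧ ∀ y, (1 + ‖y‖) ^ (n + 2) * |kern m y| ≤ C := by
  obtain ⟨C, hC, hb⟩ := schwartz_weight (𝓕⁻ h.sch)
  refine ⟨C, hC, fun y => le_trans ?_ (hb y)⟩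
  gcongr
  rw [kern, ← h.fourierInv_sch]
  exact Complex.abs_re_le_norm _

/-- The integral of the weight `(1 + ‖y‖) ^ (-(n + 1))`. -/
def wint (n : ℕ) : ℝ≥0∞ := ∫⁻ y : Space n, ofReal ((1 + ‖y‖) ^ (-((n : ℝ) + 1)))

lemma wint_lt_top (n : ℕ) : wint n < ⊤ := by
  refine finite_integral_one_add_norm ?_
  rw [finrank_euclideanSpace_fin]; linarith

lemma kbound_of_weight {κ : Space n → ℝ} (hκ : Continuous κ) {C : ℝ} (hC : 0 ≤ C)
    (h : ∀ y, (1 + ‖y‖) ^ (n + 1) * |κ y| ≤ C) :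
    KBound κ (ofReal C * (wint n + 1)) (ofReal C * (wint n + 1)) := by
  have hw : ∀ y : Space n, |κ y| ≤ C * (1 + ‖y‖) ^ (-((n : ℝ) + 1)) := by
    intro y
    have h1 : 0 < 1 + ‖y‖ := by positivity
    rw [Real.rpow_neg h1.le, ← div_eq_mul_inv, le_div_iff₀ (by positivity), mul_comm]
    have e : (1 + ‖y‖) ^ ((n : ℝ) + 1) = (1 + ‖y‖) ^ (n + 1) := by
      rw [← Real.rpow_natCast]; push_cast; rfl
    rw [e]; exact h y
  refine ⟨hκ, ?_, fun y => ?_⟩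
  · calc ∫⁻ y, ‖κ y‖ₑ ≤ ∫⁻ y : Space n, ofReal C *
            ofReal ((1 + ‖y‖) ^ (-((n : ℝ) + 1))) := by
          refine lintegral_mono fun y => ?_
          rw [← ofReal_mul hC, Real.enorm_eq_ofReal_abs]
          exact ofReal_le_ofReal (hw y)
      _ = ofReal C * wint n := by
          rw [lintegral_const_mul' _ _ ofReal_ne_top]; rfl
      _ ≤ _ := by gcongr; exact le_self_add
  · have h2 : |κ y| ≤ C := by
      refine le_trans ?_ (h y)
      have : 1 ≤ (1 + ‖y‖) ^ (n + 1) := one_le_pow₀ (by linarith [norm_nonneg y])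
      nlinarith [abs_nonneg (κ y)]
    rw [Real.enorm_eq_ofReal_abs]
    calc ofReal |κ y| ≤ ofReal C * 1 := by
          rw [mul_one]; exact ofReal_le_ofReal h2
      _ ≤ _ := by gcongr; exact le_add_self

lemma IsSymb.exists_kbound {m : Space n → ℂ} (h : IsSymb m) :
    ∃ A : ℝ, 1 ≤ A ∧ KBound (kern m) (ofReal A) (ofReal A) := by
  obtain ⟨C, hC, hb⟩ := h.weight
  have := kbound_of_weight h.continuous_kern hC.le (fun y => le_trans (by
    gcongr
    · linarith [norm_nonneg y]
    · omega) (hb y))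
  refine ⟨max (ofReal C * (wint n + 1)).toReal 1, le_max_right _ _, ?_⟩
  have hfin : ofReal C * (wint n + 1) ≠ ⊤ :=
    mul_ne_top ofReal_ne_top (by simp [(wint_lt_top n).ne])
  have hle : ofReal C * (wint n + 1) ≤
      ofReal (max (ofReal C * (wint n + 1)).toReal 1) := by
    refine (ofReal_toReal hfin).symm.trans_le (ofReal_le_ofReal (le_max_left _ _))
  exact ⟨this.cont, this.l1.trans hle, fun y => (this.sup y).trans hle⟩

/-- A bound for both the `L¹` and the `L^∞` norm of the kernel of a symbol. -/
def kb (m : Space n → ℂ) : ℝ := by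
  classical exact if h : IsSymb m then h.exists_kbound.choose else 1

lemma IsSymb.kb_spec {m : Space n → ℂ} (h : IsSymb m) :
    1 ≤ kb m ∧ KBound (kern m) (ofReal (kb m)) (ofReal (kb m)) := by
  have : kb m = h.exists_kbound.choose := by simp [kb, h]
  rw [this]
  exact h.exists_kbound.choose_spec

lemma one_le_kb (m : Space n → ℂ) : 1 ≤ kb m := by
  by_cases h : IsSymb m
  · exact h.kb_spec.1
  · simp [kb, h]

lemma IsSymb.kbound_dil {m : Space n → ℂ} (h : IsSymb m) (k : ℤ) :
    KBound (kern (WaveMap.dil k m)) (ofReal (kb m))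
      (ofReal ((2 : ℝ) ^ (n * k) * kb m)) := by
  obtain ⟨h1, hκ⟩ := h.kb_spec
  refine ⟨(h.dil k).continuous_kern, ?_, fun y => ?_⟩
  · refine le_trans (le_of_eq ?_) hκ.l1
    simp_rw [kern_dil, enorm_mul]
    rw [lintegral_const_mul' _ _ enorm_ne_top]
    have h2 : (2 : ℝ) ^ k ≠ 0 := by positivity
    have : ∫⁻ y, ‖kern m ((2 : ℝ) ^ k • y)‖ₑ = ofReal |(((2 : ℝ) ^ k) ^ Module.finrank ℝ (Space n))⁻¹| *
        ∫⁻ y, ‖kern m y‖ₑ := by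
      rw [← smul_eq_mul, ← lintegral_smul_measure, ← Measure.map_addHaar_smul _ h2,
        lintegral_map h.continuous_kern.enorm.measurable (measurable_const_smul _)]
    rw [this, ← mul_assoc, Real.enorm_eq_ofReal (by positivity),
      ← ofReal_mul (by positivity), finrank_euclideanSpace_fin, abs_of_pos (by positivity),
      ← zpow_natCast, ← zpow_mul, mul_comm (n : ℤ) k, mul_inv_cancel₀ (by positivity)]
    simp
  · rw [kern_dil, enorm_mul, ofReal_mul (by positivity),
      Real.enorm_eq_ofReal (by positivity)]
    gcongr
    exact hκ.sup _

/-! ### Composition and products of multipliers -/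

lemma integral_fourierInv_sub_mul {a : Space n → ℂ} (ha : Integrable a volume)
    (b : 𝓢(Space n, ℂ)) (x : Space n) :
    ∫ y, 𝓕⁻ a (x - y) * 𝓕⁻ (b : Space n → ℂ) y = 𝓕⁻ (fun v => a v * b v) x := by
  set g : Space n → ℂ := fun v => Complex.exp (↑(2 * Real.pi * inner ℝ v x) * Complex.I) * a v
    with hg
  have hgi : Integrable g volume := by
    refine ha.bdd_mul (c := 1) ?_ (Eventually.of_forall fun v => ?_)
    · exact Continuous.aestronglyMeasurable (by fun_prop)
    · rw [Complex.norm_exp_ofReal_mul_I]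
  have h1 : ∀ y, 𝓕⁻ a (x - y) = 𝓕 g y := by
    intro y
    rw [Real.fourierInv_eq', Real.fourier_eq']
    refine integral_congr_ae (Eventually.of_forall fun v => ?_)
    simp only [smul_eq_mul, hg]
    rw [← mul_assoc, ← Complex.exp_add]
    congr 2
    rw [inner_sub_right]
    push_cast
    ring
  have h2 := VectorFourier.integral_bilin_fourierIntegral_eq_flip (ContinuousLinearMap.mul ℂ ℂ)
    (L := innerₗ (Space n)) Real.continuous_fourierChar continuous_inner hgi
    (𝓕⁻ b).integrable (μ := volume) (ν := volume)
  have h3 : ∀ y, (𝓕⁻ b) y = 𝓕⁻ (b : Space n → ℂ) y := fun y => by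
    rw [SchwartzMap.fourierInv_coe]
  calc ∫ y, 𝓕⁻ a (x - y) * 𝓕⁻ (b : Space n → ℂ) y = ∫ y, 𝓕 g y * (𝓕⁻ b) y := by
        refine integral_congr_ae (Eventually.of_forall fun y => ?_)
        simp only [h1, h3]
    _ = ∫ v, g v * 𝓕 ((𝓕⁻ b : 𝓢(Space n, ℂ)) : Space n → ℂ) v := by
        rw [flip_innerₗ] at h2
        exact h2
    _ = ∫ v, g v * b v := by
        refine integral_congr_ae (Eventually.of_forall fun v => ?_)
        simp only
        rw [← SchwartzMap.fourier_coe, FourierTransform.fourier_fourierInv_eq]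
    _ = _ := by
        rw [Real.fourierInv_eq']
        refine integral_congr_ae (Eventually.of_forall fun v => ?_)
        simp only [hg, smul_eq_mul]
        ring

lemma kern_conv {a b : Space n → ℂ} (ha : IsSymb a) (hb : IsSymb b) (x z : Space n) :
    ∫ y, kern a (x - y) * kern b (y - z) = kern (a * b) (x - z) := by
  have h := integral_fourierInv_sub_mul ha.integrable hb.sch (x - z)
  rw [← Complex.ofReal_inj, ← (ha.mul hb).fourierInv_eq, ← integral_complex_ofReal]
  refine Eq.trans ?_ h
  rw [← integral_add_right_eq_self _ z]
  refine integral_congr_ae (Eventually.of_forall fun y => ?_)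
  have e : x - (y + z) = x - z - y := by abel
  simp only [hb.sch_coe, hb.fourierInv_eq, ha.fourierInv_eq, add_sub_cancel_right, e]
  push_cast
  rfl

lemma IsSymb.integrable_kern {a : Space n → ℂ} (ha : IsSymb a) : Integrable (kern a) volume :=
  ⟨ha.continuous_kern.aestronglyMeasurable, ha.kb_spec.2.l1.trans_lt ENNReal.ofReal_lt_top⟩

lemma IsSymb.abs_kern_le {a : Space n → ℂ} (ha : IsSymb a) (x : Space n) : |kern a x| ≤ kb a := by
  have := ha.kb_spec.2.sup x
  rwa [Real.enorm_eq_ofReal_abs, ENNReal.ofReal_le_ofReal_iff (by linarith [one_le_kb a])] at this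

lemma kern_triple_eq_zero {a b c : Space n → ℂ} (ha : IsSymb a) (hb : IsSymb b) (hc : IsSymb c)
    (h : ∀ v ξ, a v * b ξ * c (v - ξ) = 0) (x z w : Space n) :
    ∫ y, kern a (x - y) * kern c (y - w) * kern b (y - z) = 0 := by
  have hA : Continuous fun y => (kern a (x - y) * kern c (y - w) : ℝ) :=
    (ha.continuous_kern.comp (by fun_prop)).mul (hc.continuous_kern.comp (by fun_prop))
  have hAi : Integrable (fun y => (kern a (x - y) * kern c (y - w) : ℝ)) volume := by
    refine (hc.integrable_kern.comp_sub_right w).bdd_mul (c := kb a) ?_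
      (Eventually.of_forall fun y => ?_)
    · exact (ha.continuous_kern.comp (by fun_prop)).aestronglyMeasurable
    · exact ha.abs_kern_le _
  set e : Space n → Space n → ℂ := fun y ξ =>
    Complex.exp (↑(2 * Real.pi * inner ℝ ξ (y - z)) * Complex.I) with he
  have hec : Continuous (fun q : Space n × Space n => e q.1 q.2) := by
    simp only [he]; fun_prop
  have hint : Integrable (fun q : Space n × Space n =>
      ((kern a (x - q.1) * kern c (q.1 - w) : ℝ) : ℂ) * b q.2 * e q.1 q.2)
      (volume.prod volume) := by
    have h0 : Integrable (fun q : Space n × Space n =>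
      ((kern a (x - q.1) * kern c (q.1 - w) : ℝ) : ℂ) * b q.2) (volume.prod volume) :=
      hAi.ofReal.mul_prod hb.integrable
    refine h0.mul_bdd (c := 1) hec.aestronglyMeasurable (Eventually.of_forall fun q => ?_)
    simp only [he]
    rw [Complex.norm_exp_ofReal_mul_I]
  rw [← Complex.ofReal_inj, ← integral_complex_ofReal]
  calc ∫ y, ((kern a (x - y) * kern c (y - w) * kern b (y - z) : ℝ) : ℂ)
      = ∫ y, ∫ ξ, ((kern a (x - y) * kern c (y - w) : ℝ) : ℂ) * b ξ * e y ξ := by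
        refine integral_congr_ae (Eventually.of_forall fun y => ?_)
        simp only
        rw [Complex.ofReal_mul, ← hb.fourierInv_eq, Real.fourierInv_eq', ← integral_const_mul]
        refine integral_congr_ae (Eventually.of_forall fun ξ => ?_)
        simp only [he, smul_eq_mul]
        ring
    _ = ∫ ξ, ∫ y, ((kern a (x - y) * kern c (y - w) : ℝ) : ℂ) * b ξ * e y ξ :=
        integral_integral_swap hint
    _ = ∫ ξ : Space n, (0 : ℂ) := by
        refine integral_congr_ae (Eventually.of_forall fun ξ => ?_)
        simp only
        have hcs : HasCompactSupport (fun v => c (v - ξ)) := by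
          simpa [sub_eq_add_neg] using! hc.cpt.comp_homeomorph (Homeomorph.addRight (-ξ))
        have hsm : ContDiff ℝ ∞ (fun v => c (v - ξ)) := hc.smooth.comp (by fun_prop)
        have key := integral_fourierInv_sub_mul ha.integrable (hcs.toSchwartzMap hsm) (x - w)
        have hτ : ∀ y, 𝓕⁻ (fun v => c (v - ξ)) y =
            Complex.exp (↑(2 * Real.pi * inner ℝ ξ y) * Complex.I) * 𝓕⁻ c y := by
          intro y
          rw [Real.fourierInv_eq', Real.fourierInv_eq', ← integral_add_right_eq_self _ ξ,
            ← integral_const_mul]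
          refine integral_congr_ae (Eventually.of_forall fun v => ?_)
          simp only [smul_eq_mul, add_sub_cancel_right]
          rw [← mul_assoc, ← Complex.exp_add]
          congr 2
          rw [inner_add_left]; push_cast; ring
        have e1 : ∫ y, ((kern a (x - y) * kern c (y - w) : ℝ) : ℂ) * b ξ * e y ξ =
            Complex.exp (↑(2 * Real.pi * inner ℝ ξ (w - z)) * Complex.I) * (b ξ *
              ∫ y, 𝓕⁻ a (x - w - y) * 𝓕⁻ (fun v => c (v - ξ)) y) := by
          rw [← integral_sub_right_eq_self
            (fun y => 𝓕⁻ a (x - w - y) * 𝓕⁻ (fun v => c (v - ξ)) y) w, ← integral_const_mul,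
            ← integral_const_mul]
          refine integral_congr_ae (Eventually.of_forall fun y => ?_)
          simp only [he, hτ]
          have e2 : Complex.exp (↑(2 * Real.pi * inner ℝ ξ (y - z)) * Complex.I) =
              Complex.exp (↑(2 * Real.pi * inner ℝ ξ (w - z)) * Complex.I) *
              Complex.exp (↑(2 * Real.pi * inner ℝ ξ (y - w)) * Complex.I) := by
            rw [← Complex.exp_add]
            congr 1
            simp only [inner_sub_right]; push_cast; ring
          have e3 : x - w - (y - w) = x - y := by abel
          rw [Complex.ofReal_mul (kern a (x - y)) (kern c (y - w)), ← ha.fourierInv_eq,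
            ← hc.fourierInv_eq, e2, e3]
          ring
        rw [e1]
        have e4 : b ξ * ∫ y, 𝓕⁻ a (x - w - y) * 𝓕⁻ (fun v => c (v - ξ)) y = 0 := by
          refine Eq.trans (congrArg (b ξ * ·) key) ?_
          rw [Real.fourierInv_eq', ← integral_const_mul]
          refine integral_eq_zero_of_ae (Eventually.of_forall fun v => ?_)
          have := h v ξ
          simp only [smul_eq_mul, HasCompactSupport.toSchwartzMap_toFun, Pi.zero_apply]
          change b ξ * (_ * (a v * c (v - ξ))) = 0
          linear_combination
            Complex.exp (↑(2 * Real.pi * inner ℝ v (x - w)) * Complex.I) * this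
        rw [e4, mul_zero]
    _ = _ := by simp

/-- Fubini's theorem for `∫ h (κ * f)`. -/
lemma integral_mul_cnv {𝕜 : Type*} [RCLike 𝕜] {κ f : Space n → ℝ} {A : ℝ}
    (hκ : KBound κ (ofReal A) (ofReal A)) {p : ℝ≥0∞} (hp : 1 ≤ p)
    (hf : MemLp f p volume) {h : Space n → 𝕜} (hh : Integrable h volume) :
    ∫ y, h y * (cnv κ f y : 𝕜) = ∫ z, (f z : 𝕜) * ∫ y, h y * (κ (y - z) : 𝕜) := by
  have hmeas : AEStronglyMeasurable (fun q : Space n × Space n =>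
      h q.1 * ((κ (q.1 - q.2) * f q.2 : ℝ) : 𝕜)) (volume.prod volume) :=
    hh.1.comp_fst.mul
      (RCLike.continuous_ofReal.comp_aestronglyMeasurable
        (aestronglyMeasurable_prod_kernel hκ.cont hf.1))
  have hle : (p⁻¹).toReal ≤ 1 := by
    rw [← ENNReal.toReal_one]
    exact toReal_mono (by simp) (ENNReal.inv_le_one.2 hp)
  have hint : Integrable (fun q : Space n × Space n =>
      h q.1 * ((κ (q.1 - q.2) * f q.2 : ℝ) : 𝕜)) (volume.prod volume) := by
    refine ⟨hmeas, ?_⟩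
    rw [HasFiniteIntegral, lintegral_prod _ hmeas.enorm]
    set C := ofReal A ^ (1 - (p⁻¹).toReal) * ofReal A ^ (p⁻¹).toReal *
      eLpNorm f p volume with hC
    have hCt : C < ⊤ := by
      refine ENNReal.mul_lt_top (ENNReal.mul_lt_top ?_ ?_) hf.2
      · exact ENNReal.rpow_lt_top_of_nonneg (by linarith) ofReal_ne_top
      · exact ENNReal.rpow_lt_top_of_nonneg ENNReal.toReal_nonneg ofReal_ne_top
    calc ∫⁻ y, ∫⁻ z, ‖h y * ((κ (y - z) * f z : ℝ) : 𝕜)‖ₑ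
        ≤ ∫⁻ y, ‖h y‖ₑ * C := by
          refine lintegral_mono fun y => ?_
          refine le_trans (le_of_eq ?_) (mul_le_mul_right (acnv_le_eLpNorm hκ hf.1 hp y) _)
          rw [acnv, ← lintegral_const_mul' _ _ enorm_ne_top]
          refine lintegral_congr fun z => ?_
          have e : ‖((κ (y - z) * f z : ℝ) : 𝕜)‖ₑ = ‖κ (y - z) * f z‖ₑ := by
            rw [← ofReal_norm, ← ofReal_norm, RCLike.norm_ofReal, Real.norm_eq_abs]
          rw [← enorm_mul, ← e, ← enorm_mul]
      _ = (∫⁻ y, ‖h y‖ₑ) * C := lintegral_mul_const' _ _ hCt.ne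
      _ < ⊤ := ENNReal.mul_lt_top hh.2 hCt
  calc ∫ y, h y * (cnv κ f y : 𝕜)
      = ∫ y, ∫ z, h y * ((κ (y - z) * f z : ℝ) : 𝕜) := by
        refine integral_congr_ae (Eventually.of_forall fun y => ?_)
        simp only [cnv]
        rw [← integral_ofReal, ← integral_const_mul]
    _ = ∫ z, ∫ y, h y * ((κ (y - z) * f z : ℝ) : 𝕜) := integral_integral_swap hint
    _ = _ := by
        refine integral_congr_ae (Eventually.of_forall fun z => ?_)
        simp only
        rw [← integral_const_mul]
        refine integral_congr_ae (Eventually.of_forall fun y => ?_)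
        simp only
        push_cast
        ring

lemma Op_comp {a b : Space n → ℂ} (ha : IsSymb a) (hb : IsSymb b) {p : ℝ≥0∞} (hp : 1 ≤ p)
    {f : Space n → ℝ} (hf : MemLp f p volume) : Op a (Op b f) = Op (a * b) f := by
  ext x
  have hh : Integrable (fun y => kern a (x - y)) volume :=
    ha.integrable_kern.comp_sub_left x
  have := integral_mul_cnv (𝕜 := ℝ) hb.kb_spec.2 hp hf hh
  simp only [RCLike.ofReal_real_eq_id, id_eq] at this
  rw [Op, cnv, Op, this, Op, cnv]
  refine integral_congr_ae (Eventually.of_forall fun z => ?_)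
  simp only
  rw [kern_conv ha hb, mul_comm]

lemma IsSymb.memLp_Op {a : Space n → ℂ} (ha : IsSymb a) {p : ℝ≥0∞} (hp : 1 ≤ p)
    {f : Space n → ℝ} (hf : MemLp f p volume) : MemLp (Op a f) p volume :=
  ⟨aestronglyMeasurable_cnv ha.continuous_kern hf.1,
    (eLpNorm_cnv_le ha.kb_spec.2 hf.1 hp).trans_lt (ENNReal.mul_lt_top ENNReal.ofReal_lt_top hf.2)⟩

lemma IsSymb.integrable_mul {a : Space n → ℂ} (ha : IsSymb a) {p : ℝ≥0∞} (hp : 1 ≤ p)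
    {f : Space n → ℝ} (hf : MemLp f p volume) (x : Space n) :
    Integrable (fun y => kern a (x - y) * f y) volume :=
  integrable_kernel_mul ha.kb_spec.2 ofReal_ne_top ofReal_ne_top hp hf x

/-- The product of two localized functions has no frequencies outside the sum of the
localizations. -/
lemma Op_mul_eq_zero {a b c : Space n → ℂ} (ha : IsSymb a) (hb : IsSymb b) (hc : IsSymb c)
    (h : ∀ v ξ, a v * b ξ * c (v - ξ) = 0) {p q : ℝ≥0∞} (hp : 1 ≤ p) (hq : 1 ≤ q)
    {f g : Space n → ℝ} (hf : MemLp f p volume) (hg : MemLp g q volume) :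
    Op a (fun y => Op b f y * Op c g y) = 0 := by
  ext x
  have h1 : Integrable (fun y => kern a (x - y) * Op c g y) volume := by
    obtain ⟨B, hB⟩ : ∃ B : ℝ, ∀ y, ‖Op c g y‖ ≤ B := by
      have hle : (q⁻¹).toReal ≤ 1 := by
        rw [← ENNReal.toReal_one]
        exact toReal_mono (by simp) (ENNReal.inv_le_one.2 hq)
      refine ⟨(ofReal (kb c) ^ (1 - (q⁻¹).toReal) * ofReal (kb c) ^ (q⁻¹).toReal *
        eLpNorm g q volume).toReal, fun y => ?_⟩
      rw [← toReal_enorm]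
      refine toReal_mono ?_
        ((enorm_cnv_le _ _ _).trans (acnv_le_eLpNorm hc.kb_spec.2 hg.1 hq y))
      refine (ENNReal.mul_lt_top (ENNReal.mul_lt_top ?_ ?_) hg.2).ne
      · exact ENNReal.rpow_lt_top_of_nonneg (by linarith) ofReal_ne_top
      · exact ENNReal.rpow_lt_top_of_nonneg ENNReal.toReal_nonneg ofReal_ne_top
    exact (ha.integrable_kern.comp_sub_left x).mul_bdd (c := B)
      (aestronglyMeasurable_cnv hc.continuous_kern hg.1) (Eventually.of_forall hB)
  have e1 := integral_mul_cnv (𝕜 := ℝ) hb.kb_spec.2 hp hf h1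
  have e2 : ∀ z, ∫ y, kern a (x - y) * kern b (y - z) * Op c g y = 0 := by
    intro z
    have h2 : Integrable (fun y => kern a (x - y) * kern b (y - z)) volume := by
      refine (hb.integrable_kern.comp_sub_right z).bdd_mul (c := kb a) ?_
        (Eventually.of_forall fun y => ha.abs_kern_le _)
      exact (ha.continuous_kern.comp (by fun_prop)).aestronglyMeasurable
    have e3 := integral_mul_cnv (𝕜 := ℝ) hc.kb_spec.2 hq hg h2
    simp only [RCLike.ofReal_real_eq_id, id_eq] at e3
    refine e3.trans (integral_eq_zero_of_ae (Eventually.of_forall fun w => ?_))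
    simp only [Pi.zero_apply]
    have e4 := kern_triple_eq_zero ha hb hc h x z w
    have e5 : ∫ y, kern a (x - y) * kern b (y - z) * kern c (y - w) = 0 := by
      rw [← e4]
      refine integral_congr_ae (Eventually.of_forall fun y => ?_)
      simp only; ring
    rw [e5, mul_zero]
  simp only [RCLike.ofReal_real_eq_id, id_eq] at e1
  have e6 : Op a (fun y => Op b f y * Op c g y) x
      = ∫ y, kern a (x - y) * Op c g y * cnv (kern b) f y := by
    rw [Op, cnv]
    refine integral_congr_ae (Eventually.of_forall fun y => ?_)
    simp only [Op]; ring
  rw [e6, e1]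
  refine integral_eq_zero_of_ae (Eventually.of_forall fun z => ?_)
  simp only [Pi.zero_apply]
  have e7 : ∫ y, kern a (x - y) * Op c g y * kern b (y - z) = 0 := by
    rw [← e2 z]
    refine integral_congr_ae (Eventually.of_forall fun y => ?_)
    simp only; ring
  rw [e7, mul_zero]

/-- Functions localized to the ball of radius `r` have Fourier transform supported there. -/
lemma fourierSupportedIn_Op {a : Space n → ℂ} (ha : IsSymb a) {r : ℝ}
    (har : ∀ v : Space n, r < ‖(2 * Real.pi) • v‖ → a v = 0) {p : ℝ≥0∞} (hp : 1 ≤ p)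
    {f : Space n → ℝ} (hf : MemLp f p volume) : FourierSupportedIn r (Op a f) := by
  intro h hd
  have hz : ∀ v, a v * h v = 0 := by
    intro v
    by_cases hv : r < ‖(2 * Real.pi) • v‖
    · rw [har v hv, zero_mul]
    · have : v ∉ tsupport h := fun hv' => Set.disjoint_left.1 hd hv' (not_lt.1 hv)
      rw [image_eq_zero_of_notMem_tsupport this, mul_zero]
  have e1 := integral_mul_cnv (𝕜 := ℂ) ha.kb_spec.2 hp hf ((𝓕 h).integrable (μ := volume))
  have e2 : ∫ x, (Op a f x : ℂ) * (𝓕 h) x = ∫ y, (𝓕 h) y * ((cnv (kern a) f y : ℝ) : ℂ) := by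
    refine integral_congr_ae (Eventually.of_forall fun y => ?_)
    simp only [Op]; ring
  rw [e2]
  refine e1.trans (integral_eq_zero_of_ae (Eventually.of_forall fun z => ?_))
  simp only [Pi.zero_apply]
  have e3 : ∫ y, (𝓕 h) y * ((kern a (y - z) : ℝ) : ℂ) = 0 := by
    have e4 := integral_fourierInv_sub_mul (a := fun v => a (-v))
      (ha.integrable.comp_neg) (𝓕 (𝓕 h)) z
    have e5 : ∀ y, 𝓕⁻ (fun v => a (-v)) (z - y) = ((kern a (y - z) : ℝ) : ℂ) := by
      intro y
      rw [← ha.fourierInv_eq, Real.fourierInv_eq', Real.fourierInv_eq', ← integral_neg_eq_self]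
      refine integral_congr_ae (Eventually.of_forall fun v => ?_)
      simp only [neg_neg]
      congr 4
      rw [← neg_sub, inner_neg_neg]
    have e6 : ∀ v, (𝓕 (𝓕 h)) v = h (-v) := by
      intro v
      have : (𝓕⁻ (𝓕 h)) (-v) = h (-v) := by rw [FourierTransform.fourierInv_fourier_eq]
      rw [← this, SchwartzMap.fourierInv_coe, SchwartzMap.fourier_coe (𝓕 h),
        Real.fourierInv_eq_fourier_neg, neg_neg]
    have e7 : 𝓕⁻ ((𝓕 (𝓕 h) : 𝓢(Space n, ℂ)) : Space n → ℂ) = (𝓕 h : 𝓢(Space n, ℂ)) := by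
      rw [← SchwartzMap.fourierInv_coe, FourierTransform.fourierInv_fourier_eq]
    rw [e7] at e4
    refine Eq.trans (integral_congr_ae (Eventually.of_forall fun y => ?_)) (e4.trans ?_)
    · simp only [e5]; ring
    · rw [Real.fourierInv_eq']
      refine integral_eq_zero_of_ae (Eventually.of_forall fun v => ?_)
      simp only [e6, hz, smul_zero, Pi.zero_apply]
  exact (congrArg ((f z : ℂ) * ·) e3).trans (mul_zero _)

/-! ### Space-time derivatives of fields -/

/-- The time component of the coordinate direction `μ`. -/
def dirT (μ : Fin (n + 1)) : ℝ := if μ = 0 then 1 else 0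

/-- The space component of the coordinate direction `μ`. -/
def dirX (μ : Fin (n + 1)) : Space n :=
  Fin.cases (motive := fun _ => Space n) 0 (fun i => EuclideanSpace.single i 1) μ

@[simp] lemma dirT_zero : dirT (0 : Fin (n + 1)) = 1 := by simp [dirT]
@[simp] lemma dirT_succ (i : Fin n) : dirT i.succ = 0 := by simp [dirT, Fin.succ_ne_zero]
@[simp] lemma dirX_zero : dirX (0 : Fin (n + 1)) = 0 := rfl
@[simp] lemma dirX_succ (i : Fin n) : dirX i.succ = EuclideanSpace.single i 1 := rfl

/-- `g` is the partial derivative of `f` in direction `μ` on the slab. -/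
def IsPd (T : ℝ) (μ : Fin (n + 1)) (f g : STField n) : Prop :=
  ∀ t ∈ Ioo 0 T, ∀ x, HasDerivAt (fun s : ℝ => f (t + s * dirT μ) (x + s • dirX μ)) (g t x) 0

lemma IsPd.hasDerivAt {μ : Fin (n + 1)} {f g : STField n} (h : IsPd T μ f g) {t s : ℝ}
    (hs : t + s * dirT μ ∈ Ioo 0 T) (x : Space n) :
    HasDerivAt (fun s : ℝ => f (t + s * dirT μ) (x + s • dirX μ))
      (g (t + s * dirT μ) (x + s • dirX μ)) s := by
  have h1 := h _ hs (x + s • dirX μ)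
  have h2 := HasDerivAt.comp_sub_const s s (by rwa [sub_self])
  refine h2.congr_of_eventuallyEq (Eventually.of_forall fun r => ?_)
  simp only
  congr 1
  · ring
  · rw [add_assoc, ← add_smul]; congr 2; ring

lemma IsPd.pd_eq {μ : Fin (n + 1)} {f g : STField n} (h : IsPd T μ f g) {t : ℝ}
    (ht : t ∈ Ioo 0 T) (x : Space n) : pd μ f t x = g t x := by
  have h1 := h t ht x
  induction μ using Fin.cases with
  | zero =>
    have h2 := HasDerivAt.comp_sub_const t t (by rwa [sub_self])
    simpa [pd] using h2.deriv
  | succ i =>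
    have : HasLineDerivAt ℝ (f t) (g t x) x (EuclideanSpace.single i 1) := by
      simpa [HasLineDerivAt] using! h1
    exact this.lineDeriv

lemma dir_mem (μ : Fin (n + 1)) {t : ℝ} (ht : t ∈ Ioo 0 T) :
    ∀ᶠ s in 𝓝 (0 : ℝ), t + s * dirT μ ∈ Ioo 0 T := by
  have : Tendsto (fun s : ℝ => t + s * dirT μ) (𝓝 0) (𝓝 (t + 0 * dirT μ)) := by
    apply Continuous.tendsto; fun_prop
  rw [zero_mul, add_zero] at this
  exact this.eventually (isOpen_Ioo.mem_nhds ht)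

lemma IsPd.congr {μ : Fin (n + 1)} {f g f' g' : STField n} (h : IsPd T μ f g)
    (hf : ∀ t ∈ Ioo 0 T, ∀ x, f' t x = f t x) (hg : ∀ t ∈ Ioo 0 T, ∀ x, g' t x = g t x) :
    IsPd T μ f' g' := by
  intro t ht x
  rw [hg t ht x]
  refine (h t ht x).congr_of_eventuallyEq ?_
  filter_upwards [dir_mem μ ht] with s hs
  exact hf _ hs _

lemma pd_congr {μ : Fin (n + 1)} {f f' : STField n} (hf : ∀ t ∈ Ioo 0 T, ∀ x, f' t x = f t x)
    {t : ℝ} (ht : t ∈ Ioo 0 T) (x : Space n) : pd μ f' t x = pd μ f t x := by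
  induction μ using Fin.cases with
  | zero =>
    simp only [pd, Fin.cases_zero]
    refine Filter.EventuallyEq.deriv_eq ?_
    filter_upwards [isOpen_Ioo.mem_nhds ht] with s hs using hf s hs x
  | succ i =>
    simp only [pd, Fin.cases_succ]
    rw [show f' t = f t from funext (hf t ht)]

lemma box_congr {f f' : STField n} (hf : ∀ t ∈ Ioo 0 T, ∀ x, f' t x = f t x)
    {t : ℝ} (ht : t ∈ Ioo 0 T) (x : Space n) : box f' t x = box f t x := by
  simp only [box]
  refine sum_congr rfl fun μ _ => ?_
  rw [pd_congr (fun s hs y => pd_congr hf hs y) ht]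

lemma IsPd.add {μ : Fin (n + 1)} {f g f' g' : STField n} (h : IsPd T μ f g)
    (h' : IsPd T μ f' g') :
    IsPd T μ (fun t x => f t x + f' t x) (fun t x => g t x + g' t x) :=
  fun t ht x => (h t ht x).add (h' t ht x)

lemma IsPd.const_mul {μ : Fin (n + 1)} {f g : STField n} (h : IsPd T μ f g) (c : ℝ) :
    IsPd T μ (fun t x => c * f t x) (fun t x => c * g t x) :=
  fun t ht x => (h t ht x).const_mul c

lemma IsPd.mul {μ : Fin (n + 1)} {f g f' g' : STField n} (h : IsPd T μ f g)
    (h' : IsPd T μ f' g') :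
    IsPd T μ (fun t x => f t x * f' t x) (fun t x => g t x * f' t x + f t x * g' t x) := by
  intro t ht x
  have := (h t ht x).mul (h' t ht x)
  simp only [zero_mul, add_zero, zero_smul] at this
  exact this

lemma IsPd.sum {ι : Type*} {μ : Fin (n + 1)} {f g : ι → STField n} (s : Finset ι)
    (h : ∀ i ∈ s, IsPd T μ (f i) (g i)) :
    IsPd T μ (fun t x => ∑ i ∈ s, f i t x) (fun t x => ∑ i ∈ s, g i t x) := by
  intro t ht x
  exact HasDerivAt.fun_sum fun i hi => h i hi t ht x

lemma isPd_zero (μ : Fin (n + 1)) : IsPd T μ (fun _ _ => 0) (fun _ _ => 0) :=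
  fun _ _ _ => hasDerivAt_const _ _

/-- Smooth fields on the slab. -/
def Smooth (T : ℝ) (u : STField n) : Prop :=
  ContDiffOn ℝ ∞ (fun p : ℝ × Space n => u p.1 p.2) (slab n T)

/-- Continuous fields on the slab. -/
def Cont (T : ℝ) (u : STField n) : Prop :=
  ContinuousOn (fun p : ℝ × Space n => u p.1 p.2) (slab n T)

lemma isOpen_slab : IsOpen (slab n T) := isOpen_Ioo.prod isOpen_univ

lemma mem_slab {t : ℝ} (ht : t ∈ Ioo 0 T) (x : Space n) : (t, x) ∈ slab n T := ⟨ht, mem_univ _⟩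

lemma Smooth.cont {u : STField n} (h : Smooth T u) : Cont T u := h.continuousOn

lemma isPd_of_differentiable {u : STField n}
    (h : DifferentiableOn ℝ (fun p : ℝ × Space n => u p.1 p.2) (slab n T)) (μ : Fin (n + 1)) :
    IsPd T μ u (fun t x => fderiv ℝ (fun p : ℝ × Space n => u p.1 p.2) (t, x)
      (dirT μ, dirX μ)) := by
  intro t ht x
  have hd := (h.differentiableAt (isOpen_slab.mem_nhds (mem_slab ht x))).hasFDerivAt
  have hl : HasDerivAt (fun s : ℝ => ((t + s * dirT μ, x + s • dirX μ) : ℝ × Space n))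
      (dirT μ, dirX μ) 0 := by
    refine HasDerivAt.prodMk ?_ ?_
    · simpa using ((hasDerivAt_id (0 : ℝ)).mul_const (dirT μ)).const_add t
    · simpa using ((hasDerivAt_id (0 : ℝ)).smul_const (dirX μ)).const_add x
  have e : ((t, x) : ℝ × Space n) = (t + 0 * dirT μ, x + (0 : ℝ) • dirX μ) := by simp
  rw [e] at hd
  have := hd.comp_hasDerivAt 0 hl
  rw [← e] at this
  exact this

lemma isPd_of_differentiable' {u : STField n}
    (h : DifferentiableOn ℝ (fun p : ℝ × Space n => u p.1 p.2) (slab n T)) (μ : Fin (n + 1)) :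
    IsPd T μ u (pd μ u) :=
  (isPd_of_differentiable h μ).congr (fun _ _ _ => rfl)
    fun _ ht x => (isPd_of_differentiable h μ).pd_eq ht x

lemma Smooth.isPd {u : STField n} (h : Smooth T u) (μ : Fin (n + 1)) : IsPd T μ u (pd μ u) :=
  isPd_of_differentiable' (h.differentiableOn (by simp)) μ

lemma Cont.congr {u v : STField n} (h : Cont T u) (hv : ∀ t ∈ Ioo 0 T, ∀ x, v t x = u t x) :
    Cont T v := ContinuousOn.congr h fun p hp => hv p.1 hp.1 p.2

lemma Smooth.pd {u : STField n} (h : Smooth T u) (μ : Fin (n + 1)) : Smooth T (pd μ u) := by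
  have h1 : ContDiffOn ℝ ∞ (fun p : ℝ × Space n =>
      fderiv ℝ (fun p : ℝ × Space n => u p.1 p.2) p (dirT μ, dirX μ)) (slab n T) :=
    (h.fderiv_of_isOpen isOpen_slab (by simp)).clm_apply contDiffOn_const
  exact h1.congr fun p hp =>
    (isPd_of_differentiable (h.differentiableOn (by simp)) μ).pd_eq hp.1 p.2

lemma Smooth.add {u v : STField n} (hu : Smooth T u) (hv : Smooth T v) :
    Smooth T (fun t x => u t x + v t x) := ContDiffOn.add hu hv

lemma Smooth.mul {u v : STField n} (hu : Smooth T u) (hv : Smooth T v) :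
    Smooth T (fun t x => u t x * v t x) := ContDiffOn.mul hu hv

lemma Smooth.const_mul {u : STField n} (hu : Smooth T u) (c : ℝ) :
    Smooth T (fun t x => c * u t x) := contDiffOn_const.mul hu

lemma smooth_zero : Smooth T (fun _ _ => 0 : STField n) := contDiffOn_const

lemma Smooth.sum {ι : Type*} {f : ι → STField n} (s : Finset ι) (h : ∀ i ∈ s, Smooth T (f i)) :
    Smooth T (fun t x => ∑ i ∈ s, f i t x) := ContDiffOn.sum h

lemma Cont.slice {u : STField n} (h : Cont T u) {t : ℝ} (ht : t ∈ Ioo 0 T) :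
    Continuous (u t) := by
  have : Continuous (fun x : Space n => ((t, x) : ℝ × Space n)) := by fun_prop
  exact h.comp_continuous this fun x => mem_slab ht x

lemma Cont.add {u v : STField n} (hu : Cont T u) (hv : Cont T v) :
    Cont T (fun t x => u t x + v t x) := ContinuousOn.add hu hv

lemma Cont.mul {u v : STField n} (hu : Cont T u) (hv : Cont T v) :
    Cont T (fun t x => u t x * v t x) := ContinuousOn.mul hu hv

lemma Cont.const_mul {u : STField n} (hu : Cont T u) (c : ℝ) :
    Cont T (fun t x => c * u t x) := continuousOn_const.mul hu

lemma Cont.sum {ι : Type*} {f : ι → STField n} (s : Finset ι) (h : ∀ i ∈ s, Cont T (f i)) :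
    Cont T (fun t x => ∑ i ∈ s, f i t x) := continuousOn_finsetSum s h

/-! ### Convolution with compactly supported kernels -/

lemma cnv_eq (κ f : Space n → ℝ) (x : Space n) : cnv κ f x = ∫ y, κ y * f (x - y) := by
  rw [cnv, ← integral_sub_left_eq_self _ volume x]
  simp

lemma integrable_cpt_mul {κ f : Space n → ℝ} (hκ : Continuous κ) (hc : HasCompactSupport κ)
    (hf : Continuous f) (x : Space n) : Integrable (fun y => κ y * f (x - y)) volume :=
  (hκ.mul (hf.comp (by fun_prop))).integrable_of_hasCompactSupport hc.mul_right

lemma continuousOn_cnv_cpt {κ : Space n → ℝ} (hκ : Continuous κ) (hc : HasCompactSupport κ)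
    {u : STField n} (hu : Cont T u) : Cont T (fun t => cnv κ (u t)) := by
  have : ContinuousOn (fun p : ℝ × Space n => ∫ y, κ y * u p.1 (p.2 - y)) (slab n T) := by
    refine continuousOn_integral_of_compact_support (k := tsupport κ) hc ?_ ?_
    · refine ContinuousOn.mul (hκ.comp continuous_snd).continuousOn ?_
      refine hu.comp (f := fun q : (ℝ × Space n) × Space n => ((q.1.1, q.1.2 - q.2) : ℝ × Space n))
        (by fun_prop) ?_
      intro q hq
      exact mem_slab hq.1.1 _
    · intro p y _ hy
      rw [image_eq_zero_of_notMem_tsupport hy, zero_mul]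
  exact this.congr fun p _ => cnv_eq _ _ _

lemma isPd_cnv_cpt {κ : Space n → ℝ} (hκ : Continuous κ) (hc : HasCompactSupport κ)
    {u g : STField n} {μ : Fin (n + 1)} (hu : Cont T u) (hg : Cont T g) (h : IsPd T μ u g) :
    IsPd T μ (fun t => cnv κ (u t)) (fun t => cnv κ (g t)) := by
  intro t ht x
  obtain ⟨δ, hδ, hδs⟩ := Metric.eventually_nhds_iff_ball.1 (dir_mem μ ht)
  set K : Set (ℝ × Space n) := (fun q : ℝ × Space n => ((t + q.1 * dirT μ,
    x + q.1 • dirX μ - q.2) : ℝ × Space n)) '' (Metric.closedBall 0 (δ / 2) ×ˢ tsupport κ) with hK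
  have hKc : IsCompact K := ((isCompact_closedBall _ _).prod hc).image (by fun_prop)
  have hKs : K ⊆ slab n T := by
    rintro _ ⟨q, hq, rfl⟩
    refine mem_slab (hδs _ ?_) _
    exact Metric.closedBall_subset_ball (by linarith) hq.1
  obtain ⟨M, hM⟩ := hKc.exists_bound_of_continuousOn (hg.mono hKs)
  have key := hasDerivAt_integral_of_dominated_loc_of_deriv_le (μ := (volume : Measure (Space n)))
    (F := fun s y => κ y * u (t + s * dirT μ) (x + s • dirX μ - y))
    (F' := fun s y => κ y * g (t + s * dirT μ) (x + s • dirX μ - y)) (x₀ := (0 : ℝ))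
    (s := Metric.ball 0 (δ / 2)) (bound := fun y => ‖κ y‖ * M)
    (Metric.ball_mem_nhds _ (by linarith)) ?_ ?_ ?_ ?_ ?_ ?_
  · have h2 := key.2
    simp only [zero_mul, add_zero, zero_smul, ← cnv_eq] at h2
    exact h2
  · filter_upwards [dir_mem μ ht] with s hs
    exact (integrable_cpt_mul hκ hc (hu.slice hs) _).1
  · simpa using integrable_cpt_mul hκ hc (hu.slice ht) _
  · simpa using (integrable_cpt_mul hκ hc (hg.slice ht) _).1
  · refine Eventually.of_forall fun y s hs => ?_
    by_cases hy : y ∈ tsupport κ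
    · rw [norm_mul]
      gcongr
      exact hM _ ⟨(s, y), ⟨Metric.ball_subset_closedBall hs, hy⟩, rfl⟩
    · simp [image_eq_zero_of_notMem_tsupport hy]
  · exact (hκ.norm.integrable_of_hasCompactSupport hc.norm).mul_const M
  · refine Eventually.of_forall fun y s hs => ?_
    have hs' := hδs s (Metric.ball_subset_ball (by linarith) hs)
    have := (h.hasDerivAt hs' (x - y)).const_mul (κ y)
    have e : ∀ r : ℝ, x + r • dirX μ - y = x - y + r • dirX μ := fun r => by abel
    simp only [e]
    exact this

lemma cnv_pd_cpt {κ κ' : Space n → ℝ} {i : Fin n} (hκ : ContDiff ℝ 1 κ)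
    (hκ' : ∀ x, HasLineDerivAt ℝ κ (κ' x) x (EuclideanSpace.single i 1))
    (hc : HasCompactSupport κ) {w : STField n} (hw : Smooth T w) {t : ℝ} (ht : t ∈ Ioo 0 T)
    (x : Space n) : cnv κ (pd i.succ w t) x = cnv κ' (w t) x := by
  have hws : ContDiff ℝ ∞ (w t) := by
    have : ContDiff ℝ ∞ (fun x : Space n => ((t, x) : ℝ × Space n)) := by fun_prop
    exact hw.comp_contDiff this fun x => mem_slab ht x
  have hwd : Differentiable ℝ (w t) := hws.differentiable (by simp)
  have h1 : ∀ y, pd i.succ w t y = fderiv ℝ (w t) y (EuclideanSpace.single i 1) := fun y =>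
    (hwd y).lineDeriv_eq_fderiv
  have hκd : Differentiable ℝ κ := hκ.differentiable (by simp)
  have h2 : ∀ y, κ' y = fderiv ℝ κ y (EuclideanSpace.single i 1) := fun y => by
    rw [← (hκd y).lineDeriv_eq_fderiv, (hκ' y).lineDeriv]
  have hsub : Differentiable ℝ (fun y : Space n => x - y) := by fun_prop
  have h3 : ∀ y, fderiv ℝ (fun y => κ (x - y)) y (EuclideanSpace.single i 1) = -κ' (x - y) := by
    intro y
    have : HasFDerivAt (fun y => κ (x - y)) ((fderiv ℝ κ (x - y)).comp
        (-ContinuousLinearMap.id ℝ (Space n))) y := by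
      refine (hκd (x - y)).hasFDerivAt.comp y ?_
      simpa using (hasFDerivAt_id y).const_sub x
    rw [this.fderiv, h2]
    simp
  have hcs : HasCompactSupport (fun y => κ (x - y)) := hc.comp_homeomorph (Homeomorph.subLeft x)
  have hκc : Continuous (fun y => κ (x - y)) := hκ.continuous.comp (by fun_prop)
  have hκ'c : Continuous κ' := by
    rw [show κ' = fun y => fderiv ℝ κ y (EuclideanSpace.single i 1) from funext h2]
    exact (hκ.continuous_fderiv (by simp)).clm_apply continuous_const
  have hκ'cs : HasCompactSupport κ' := by
    rw [show κ' = fun y => fderiv ℝ κ y (EuclideanSpace.single i 1) from funext h2]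
    exact hc.fderiv_apply ℝ _
  have hpc : Continuous (fun y => fderiv ℝ (w t) y (EuclideanSpace.single i 1)) :=
    (hws.continuous_fderiv (by simp)).clm_apply continuous_const
  have := integral_mul_fderiv_eq_neg_fderiv_mul_of_integrable (μ := (volume : Measure (Space n)))
    (f := fun y => κ (x - y)) (g := w t) (v := EuclideanSpace.single i 1) ?_ ?_ ?_
    (fun y _ => (hκd (x - y)).comp y (hsub y)) (fun y _ => hwd y)
  · simp only [cnv, h1]
    rw [this, ← integral_neg]
    simp only [h3]
    congr 1; ext y; ring
  · simp only [h3]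
    refine Continuous.integrable_of_hasCompactSupport ?_ ?_
    · exact ((hκ'c.comp (by fun_prop)).neg).mul hws.continuous
    · exact (HasCompactSupport.neg (hκ'cs.comp_homeomorph (Homeomorph.subLeft x))).mul_right
  · exact (hκc.mul hpc).integrable_of_hasCompactSupport hcs.mul_right
  · exact (hκc.mul hws.continuous).integrable_of_hasCompactSupport hcs.mul_right

/-! ### Multipliers and space-time derivatives -/

/-- Fields bounded in some `L^p`, uniformly in time. -/
def BddL (T : ℝ) (p : ℝ≥0∞) (u : STField n) : Prop :=
  ∃ B : ℝ≥0∞, B ≠ ⊤ ∧ ∀ t ∈ Ioo 0 T, eLpNorm (u t) p volume ≤ B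

lemma BddL.memLp {p : ℝ≥0∞} {u : STField n} (h : BddL T p u) (hu : Cont T u) {t : ℝ}
    (ht : t ∈ Ioo 0 T) : MemLp (u t) p volume := by
  obtain ⟨B, hB, hb⟩ := h
  exact ⟨(hu.slice ht).aestronglyMeasurable, (hb t ht).trans_lt (lt_top_iff_ne_top.2 hB)⟩

/-- Smooth truncations of the kernel of a symbol. -/
lemma IsSymb.exists_truncation {m : Space n → ℂ} (h : IsSymb m) :
    ∃ (C : ℝ) (κ : ℕ → Space n → ℝ) (κ' : Fin n → ℕ → Space n → ℝ), 0 ≤ C ∧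
      (∀ N, ContDiff ℝ 1 (κ N)) ∧ (∀ N, HasCompactSupport (κ N)) ∧
      (∀ i N, Continuous (κ' i N)) ∧
      (∀ i N x, HasLineDerivAt ℝ (κ N) (κ' i N x) x (EuclideanSpace.single i 1)) ∧
      (∀ N, KBound (fun y => kern m y - κ N y) (ofReal (C / (N + 1)))
        (ofReal (C / (N + 1)))) ∧
      (∀ i N, KBound (fun y => kern (WaveMap.dsymb i m) y - κ' i N y)
        (ofReal (C / (N + 1))) (ofReal (C / (N + 1)))) := by
  let χ : ContDiffBump (0 : Space n) := ⟨1, 2, by norm_num, by norm_num⟩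
  obtain ⟨L, hL⟩ : ∃ L, ∀ y, ‖fderiv ℝ χ y‖ ≤ L := by
    have h1 : Continuous (fderiv ℝ (χ : Space n → ℝ)) :=
      (χ.contDiff (n := 1)).continuous_fderiv (by simp)
    obtain ⟨L, hL⟩ := (χ.hasCompactSupport.fderiv ℝ).exists_bound_of_continuous h1
    exact ⟨L, hL⟩
  have hL0 : 0 ≤ L := (norm_nonneg _).trans (hL 0)
  obtain ⟨C₀, hC₀, hb₀⟩ := h.weight
  choose C₁ hC₁ hb₁ using fun i => (h.dsymb i).weight
  set C₂ : ℝ := C₀ + ∑ i, C₁ i + L * C₀ with hC₂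
  have hsum : 0 ≤ ∑ i, C₁ i := Finset.sum_nonneg fun i _ => (hC₁ i).le
  have hC₂0 : 0 ≤ C₂ := by positivity
  set r : ℕ → ℝ := fun N => ((N : ℝ) + 1)⁻¹ with hr
  have hr0 : ∀ N, 0 < r N := fun N => by positivity
  have hχsub : ∀ N (y : Space n), |1 - χ (r N • y)| ≤ r N * (1 + ‖y‖) := by
    intro N y
    by_cases hy : ‖y‖ ≤ N + 1
    · have : χ (r N • y) = 1 := by
        refine χ.one_of_mem_closedBall ?_
        simp only [Metric.mem_closedBall, dist_zero_right, norm_smul, Real.norm_eq_abs,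
          abs_of_pos (hr0 N)]
        change r N * ‖y‖ ≤ 1
        simp only [hr]
        rw [inv_mul_le_iff₀ (by positivity)]; linarith
      rw [this, sub_self, abs_zero]
      have := hr0 N; positivity
    · push Not at hy
      have h1 : |1 - χ (r N • y)| ≤ 1 := by
        rw [abs_le]
        constructor <;> linarith [χ.nonneg (x := r N • y), χ.le_one (x := r N • y)]
      refine h1.trans ?_
      simp only [hr]
      rw [← div_eq_inv_mul, le_div_iff₀ (by positivity)]; linarith
  set κ : ℕ → Space n → ℝ := fun N y => χ (r N • y) * kern m y with hκ
  set dχ : Fin n → ℕ → Space n → ℝ := fun i N y =>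
    r N * fderiv ℝ χ (r N • y) (EuclideanSpace.single i 1) with hdχ
  set κ' : Fin n → ℕ → Space n → ℝ := fun i N y =>
    dχ i N y * kern m y + χ (r N • y) * kern (WaveMap.dsymb i m) y with hκ'
  have hdχc : ∀ i N, Continuous (dχ i N) := by
    intro i N
    have h1 : Continuous (fderiv ℝ (χ : Space n → ℝ)) :=
      (χ.contDiff (n := 1)).continuous_fderiv (by simp)
    exact continuous_const.mul ((h1.comp (continuous_const_smul _)).clm_apply continuous_const)
  have hdχb : ∀ i N y, |dχ i N y| ≤ r N * L := by
    intro i N y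
    simp only [hdχ]
    rw [abs_mul, abs_of_pos (hr0 N)]
    have : |fderiv ℝ χ (r N • y) (EuclideanSpace.single i 1)| ≤ L := by
      refine ((fderiv ℝ χ (r N • y)).le_opNorm _).trans ?_
      rw [PiLp.norm_single, norm_one, mul_one]
      exact hL _
    have := hr0 N
    gcongr
  have hχc : ∀ N, Continuous fun y : Space n => χ (r N • y) := fun N =>
    χ.continuous.comp (continuous_const_smul _)
  have hκ'c : ∀ i N, Continuous (κ' i N) := fun i N =>
    ((hdχc i N).mul h.continuous_kern).add ((hχc N).mul (h.dsymb i).continuous_kern)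
  have hw : ∀ (N : ℕ) (κ₁ : Space n → ℝ) (C' : ℝ), (∀ y, (1 + ‖y‖) ^ (n + 2) * |κ₁ y| ≤ C') →
      ∀ y, (1 + ‖y‖) ^ (n + 1) * |(1 - χ (r N • y)) * κ₁ y| ≤ r N * C' := by
    intro N κ₁ C' hk y
    rw [abs_mul]
    have h1 := hχsub N y
    have h2 := hk y
    have h3 := hr0 N
    calc (1 + ‖y‖) ^ (n + 1) * (|1 - χ (r N • y)| * |κ₁ y|)
        ≤ (1 + ‖y‖) ^ (n + 1) * (r N * (1 + ‖y‖) * |κ₁ y|) := by gcongr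
      _ = r N * ((1 + ‖y‖) ^ (n + 2) * |κ₁ y|) := by ring
      _ ≤ _ := by gcongr
  have hkb : ∀ (κ₁ : Space n → ℝ) (N : ℕ), Continuous κ₁ →
      (∀ y, (1 + ‖y‖) ^ (n + 1) * |κ₁ y| ≤ r N * C₂) →
      KBound κ₁ (ofReal (C₂ * (wint n + 1).toReal / (N + 1)))
        (ofReal (C₂ * (wint n + 1).toReal / (N + 1))) := by
    intro κ₁ N hc hb
    have h1 := kbound_of_weight hc (by have := hr0 N; positivity) hb
    have h2 : ofReal (r N * C₂) * (wint n + 1) =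
        ofReal (C₂ * (wint n + 1).toReal / (N + 1)) := by
      have hfin : wint n + 1 ≠ ⊤ := by simp [(wint_lt_top n).ne]
      conv_lhs => rw [← ofReal_toReal hfin]
      rw [← ofReal_mul (by have := hr0 N; positivity)]
      congr 1
      simp only [hr]; field_simp
    rwa [h2] at h1
  refine ⟨C₂ * (wint n + 1).toReal, κ, κ', by positivity, fun N => ?_, fun N => ?_, hκ'c,
    fun i N x => ?_, fun N => ?_, fun i N => ?_⟩
  · exact ((χ.contDiff (n := 1)).comp (contDiff_const_smul _)).mul
      (h.contDiff_kern.of_le (by simp))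
  · exact (χ.hasCompactSupport.comp_smul (hr0 N).ne').mul_right
  · have h1 : HasFDerivAt (fun y : Space n => χ (r N • y))
        ((fderiv ℝ χ (r N • x)).comp (r N • ContinuousLinearMap.id ℝ (Space n))) x :=
      ((χ.contDiff (n := 1)).differentiable (by simp) (r N • x)).hasFDerivAt.comp x
        ((hasFDerivAt_id x).const_smul (r N))
    have h2 := h1.hasLineDerivAt (EuclideanSpace.single i 1)
    have h3 := HasDerivAt.mul h2 (h.hasLineDerivAt_kern i x)
    simp only [zero_smul, add_zero] at h3
    refine (congrArg (fun a => HasLineDerivAt ℝ (κ N) a x _) ?_).mp h3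
    simp [hκ', hdχ]
  · refine hkb _ N (h.continuous_kern.sub ((hχc N).mul h.continuous_kern)) fun y => ?_
    have e : kern m y - κ N y = (1 - χ (r N • y)) * kern m y := by simp only [hκ]; ring
    rw [e]
    refine (hw N (kern m) C₀ hb₀ y).trans ?_
    have := hr0 N
    gcongr
    nlinarith
  · refine hkb _ N ((h.dsymb i).continuous_kern.sub (hκ'c i N)) fun y => ?_
    have e : kern (WaveMap.dsymb i m) y - κ' i N y =
        (1 - χ (r N • y)) * kern (WaveMap.dsymb i m) y + -(dχ i N y * kern m y) := by
      simp only [hκ']; ring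
    rw [e]
    have h1 := hw N (kern (WaveMap.dsymb i m)) (C₁ i) (hb₁ i) y
    have h2 : (1 + ‖y‖) ^ (n + 1) * |dχ i N y * kern m y| ≤ r N * (L * C₀) := by
      rw [abs_mul]
      have h3 := hdχb i N y
      have h4 : (1 + ‖y‖) ^ (n + 1) * |kern m y| ≤ C₀ := le_trans (by
        gcongr
        · linarith [norm_nonneg y]
        · omega) (hb₀ y)
      have h5 := hr0 N
      calc (1 + ‖y‖) ^ (n + 1) * (|dχ i N y| * |kern m y|)
          ≤ (1 + ‖y‖) ^ (n + 1) * (r N * L * |kern m y|) := by gcongr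
        _ = r N * L * ((1 + ‖y‖) ^ (n + 1) * |kern m y|) := by ring
        _ ≤ r N * L * C₀ := by gcongr
        _ = _ := by ring
    calc _ ≤ (1 + ‖y‖) ^ (n + 1) * (|(1 - χ (r N • y)) * kern (WaveMap.dsymb i m) y| +
          |dχ i N y * kern m y|) := by
          gcongr
          refine (abs_add_le _ _).trans ?_
          rw [abs_neg]
      _ ≤ r N * C₁ i + r N * (L * C₀) := by rw [mul_add]; exact add_le_add h1 h2
      _ ≤ r N * C₂ := by
          have := hr0 N
          rw [← mul_add]
          gcongr
          have := single_le_sum (fun i _ => (hC₁ i).le) (Finset.mem_univ i)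
          simp only [hC₂]; linarith

lemma norm_cnv_le_of_bound {κ f : Space n → ℝ} {a : ℝ} (ha : 0 < a)
    (hκ : KBound κ (ofReal a) (ofReal a)) {p : ℝ≥0∞} (hp : 1 ≤ p)
    (hf : AEStronglyMeasurable f volume) {B : ℝ≥0∞} (hB : B ≠ ⊤)
    (hfB : eLpNorm f p volume ≤ B) (x : Space n) : ‖cnv κ f x‖ ≤ a * B.toReal := by
  have h1 := (enorm_cnv_le κ f x).trans (acnv_le_eLpNorm hκ hf hp x)
  have ha0 : ofReal a ≠ 0 := by simpa using ha
  rw [← ENNReal.rpow_add _ _ ha0 ofReal_ne_top, sub_add_cancel, ENNReal.rpow_one] at h1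
  have h2 : ‖cnv κ f x‖ₑ ≤ ofReal a * B := h1.trans (by gcongr)
  rw [← toReal_enorm, ← ENNReal.toReal_ofReal ha.le, ← ENNReal.toReal_mul]
  exact toReal_mono (mul_ne_top ofReal_ne_top hB) h2

/-- Uniform convergence of convolutions with truncated kernels. -/
lemma tendstoUniformlyOn_cnv {κ : ℕ → Space n → ℝ} {κ₀ : Space n → ℝ} {C A₀ : ℝ} (hC : 0 ≤ C)
    (hκ₀ : KBound κ₀ (ofReal A₀) (ofReal A₀))
    (hκ : ∀ N, KBound (fun y => κ₀ y - κ N y) (ofReal (C / (N + 1)))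
        (ofReal (C / (N + 1)))) {u : STField n} (hu : Cont T u)
    {p : ℝ≥0∞} (hp : 1 ≤ p) (hb : BddL T p u) :
    TendstoUniformlyOn (fun N (q : ℝ × Space n) => cnv (κ N) (u q.1) q.2)
      (fun q => cnv κ₀ (u q.1) q.2) atTop (slab n T) := by
  obtain ⟨B, hB, hB'⟩ := id hb
  have hlim : Tendsto (fun N : ℕ => (C + 1) / ((N : ℝ) + 1) * B.toReal) atTop (𝓝 0) := by
    have h1 : Tendsto (fun N : ℕ => (C + 1) / ((N : ℝ) + 1)) atTop (𝓝 0) :=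
      tendsto_const_nhds.div_atTop (tendsto_atTop_add_const_right _ _ tendsto_natCast_atTop_atTop)
    simpa using h1.mul_const B.toReal
  rw [Metric.tendstoUniformlyOn_iff]
  intro ε hε
  filter_upwards [hlim.eventually (gt_mem_nhds hε)] with N hN q hq
  have hm := hb.memLp hu hq.1
  have hκ' : KBound (fun y => κ₀ y - κ N y) (ofReal ((C + 1) / (N + 1)))
        (ofReal ((C + 1) / (N + 1))) := by
    have hle : ofReal (C / (N + 1)) ≤ ofReal ((C + 1) / (N + 1)) :=
      ofReal_le_ofReal (by gcongr; linarith)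
    exact ⟨(hκ N).cont, (hκ N).l1.trans hle, fun y => ((hκ N).sup y).trans hle⟩
  have h1 := integrable_kernel_mul hκ₀ ofReal_ne_top ofReal_ne_top hp hm q.2
  have h2 := integrable_kernel_mul (hκ N) ofReal_ne_top ofReal_ne_top hp hm q.2
  have e : cnv κ₀ (u q.1) q.2 - cnv (κ N) (u q.1) q.2 =
      cnv (fun y => κ₀ y - κ N y) (u q.1) q.2 := by
    have e2 : cnv (κ N) (u q.1) q.2 = ∫ y, (κ₀ (q.2 - y) * u q.1 y -
        (κ₀ (q.2 - y) - κ N (q.2 - y)) * u q.1 y) := by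
      rw [cnv]; congr 1; ext y; ring
    rw [e2, integral_sub h1 h2, cnv, cnv]; ring
  rw [dist_eq_norm, e]
  exact (norm_cnv_le_of_bound (by positivity) hκ' hp hm.1 hB (hB' _ hq.1) _).trans_lt hN

lemma IsSymb.cont_Op {m : Space n → ℂ} (h : IsSymb m) {u : STField n} (hu : Cont T u)
    {p : ℝ≥0∞} (hp : 1 ≤ p) (hb : BddL T p u) : Cont T (fun t => Op m (u t)) := by
  obtain ⟨C, κ, κ', hC, h1, h2, h3, h4, h5, h6⟩ := h.exists_truncation
  refine (tendstoUniformlyOn_cnv hC h.kb_spec.2 h5 hu hp hb).continuousOn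
    (Eventually.of_forall fun N => ?_).frequently
  exact continuousOn_cnv_cpt (h1 N).continuous (h2 N) hu

/-- If `∂_μ u = v + ∑ ∂_i w_i` then `∂_μ` of a multiplier of `u` is obtained by moving the
derivatives `∂_i` to the kernel. No decay of `∂_μ u` itself is needed. -/
lemma IsSymb.isPd_Op {m : Space n → ℂ} (h : IsSymb m) {μ : Fin (n + 1)} {u v : STField n}
    {w : Fin n → STField n} (hu : Smooth T u) (hv : Smooth T v) (hw : ∀ i, Smooth T (w i))
    {p q : ℝ≥0∞} {r : Fin n → ℝ≥0∞} (hp : 1 ≤ p) (hq : 1 ≤ q) (hr : ∀ i, 1 ≤ r i)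
    (hub : BddL T p u) (hvb : BddL T q v) (hwb : ∀ i, BddL T (r i) (w i))
    (heq : ∀ t ∈ Ioo 0 T, ∀ x, pd μ u t x = v t x + ∑ i, pd i.succ (w i) t x) :
    IsPd T μ (fun t => Op m (u t))
      (fun t x => Op m (v t) x + ∑ i, Op (WaveMap.dsymb i m) (w i t) x) := by
  obtain ⟨C, κ, κ', hC, h1, h2, h3, h4, h5, h6⟩ := h.exists_truncation
  have hF := tendstoUniformlyOn_cnv hC h.kb_spec.2 h5 hu.cont hp hub
  have hG := tendstoUniformlyOn_cnv hC h.kb_spec.2 h5 hv.cont hq hvb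
  have hH := fun i => tendstoUniformlyOn_cnv hC (h.dsymb i).kb_spec.2 (h6 i) (hw i).cont (hr i)
    (hwb i)
  have hderiv : ∀ N, IsPd T μ (fun t => cnv (κ N) (u t))
      (fun t x => cnv (κ N) (v t) x + ∑ i, cnv (κ' i N) (w i t) x) := by
    intro N
    refine (isPd_cnv_cpt (h1 N).continuous (h2 N) hu.cont (hu.pd μ).cont (hu.isPd μ)).congr
      (fun _ _ _ => rfl) fun t ht x => ?_
    have hint : ∀ f : STField n, Smooth T f → Integrable (fun y => κ N (x - y) * f t y) volume := by
      intro f hf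
      refine (((h1 N).continuous.comp (by fun_prop)).mul
        (hf.cont.slice ht)).integrable_of_hasCompactSupport ?_
      exact ((h2 N).comp_homeomorph (Homeomorph.subLeft x)).mul_right
    have e1 : cnv (κ N) (pd μ u t) x = cnv (κ N) (v t) x +
        ∑ i, cnv (κ N) (pd i.succ (w i) t) x := by
      simp only [cnv]
      rw [← integral_finsetSum _ fun i _ => hint _ ((hw i).pd _),
        ← integral_add (hint v hv) (integrable_finsetSum _ fun i _ => hint _ ((hw i).pd _))]
      congr 1; ext y
      rw [heq t ht y, mul_add, mul_sum]
    rw [e1]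
    congr 1
    exact sum_congr rfl fun i _ => (cnv_pd_cpt (h1 N) (h4 i N) (h2 N) (hw i) ht x).symm
  intro t ht x
  obtain ⟨δ, hδ, hδs⟩ := Metric.eventually_nhds_iff_ball.1 (dir_mem μ ht)
  set γ : ℝ → ℝ × Space n := fun s => (t + s * dirT μ, x + s • dirX μ) with hγ
  have hγs : ∀ s ∈ Metric.ball (0 : ℝ) δ, γ s ∈ slab n T := fun s hs => mem_slab (hδs s hs) _
  have hD : TendstoUniformlyOn (fun N (q : ℝ × Space n) =>
      cnv (κ N) (v q.1) q.2 + ∑ i, cnv (κ' i N) (w i q.1) q.2)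
      (fun q => Op m (v q.1) q.2 + ∑ i, Op (WaveMap.dsymb i m) (w i q.1) q.2) atTop
      (slab n T) := by
    refine hG.add ?_
    have : ∀ s : Finset (Fin n), TendstoUniformlyOn (fun N (q : ℝ × Space n) =>
        ∑ i ∈ s, cnv (κ' i N) (w i q.1) q.2)
        (fun q => ∑ i ∈ s, Op (WaveMap.dsymb i m) (w i q.1) q.2) atTop (slab n T) := by
      intro s
      induction s using Finset.induction_on with
      | empty =>
        simp only [Finset.sum_empty]
        exact fun U hU => Eventually.of_forall fun _ _ _ => refl_mem_uniformity hU
      | insert a s ha ih =>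
        simp only [Finset.sum_insert ha]
        exact (hH a).add ih
    exact this _
  have key := hasDerivAt_of_tendstoUniformlyOn (l := atTop) (s := Metric.ball (0 : ℝ) δ)
    (f := fun N s => cnv (κ N) (u (γ s).1) (γ s).2)
    (g := fun s => Op m (u (γ s).1) (γ s).2)
    (f' := fun N s => cnv (κ N) (v (γ s).1) (γ s).2 + ∑ i, cnv (κ' i N) (w i (γ s).1) (γ s).2)
    (g' := fun s => Op m (v (γ s).1) (γ s).2 +
      ∑ i, Op (WaveMap.dsymb i m) (w i (γ s).1) (γ s).2) Metric.isOpen_ball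
    ((hD.comp γ).mono hγs) (Eventually.of_forall fun N s hs => (hderiv N).hasDerivAt (hδs s hs) x)
    (fun s hs => hF.tendsto_at (hγs s hs)) (Metric.mem_ball_self hδ)
  simpa [hγ] using key

/-! ### Littlewood-Paley symbols -/

/-- The symbol of `P_{≤ 0}`. -/
def e0 (η : Space n → ℝ) (v : Space n) : ℂ := (η ((2 * Real.pi) • v) : ℂ)

/-- The symbol of `P_0`. -/
def p0 (η : Space n → ℝ) : Space n → ℂ := e0 η - dil (-1) (e0 η)

/-- The symbol of `P_{-1} + P_0 + P_1`. -/
def pt (η : Space n → ℝ) : Space n → ℂ := dil 1 (e0 η) - dil (-2) (e0 η)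

/-- The projections `P_{≤ k}` at a fixed time. -/
def LL (η : Space n → ℝ) (k : ℤ) (f : Space n → ℝ) : Space n → ℝ := Op (dil k (e0 η)) f

/-- The projections `P_k` at a fixed time. -/
def PP (η : Space n → ℝ) (k : ℤ) (f : Space n → ℝ) : Space n → ℝ := Op (dil k (p0 η)) f

section symbols
variable {η : Space n → ℝ} (hη : IsCutoff η)
include hη

lemma isSymb_e0 : IsSymb (e0 η) := by
  have h2 : ContDiff ℝ ∞ (fun v : Space n => η ((2 * Real.pi) • v)) :=
    hη.smooth.comp (contDiff_const_smul _)
  refine ⟨Complex.ofRealCLM.contDiff.comp h2, ?_, fun v => ?_⟩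
  · refine HasCompactSupport.of_support_subset_isCompact
      (isCompact_closedBall (0 : Space n) (2 / (2 * Real.pi))) fun v hv => ?_
    by_contra hb
    apply hv
    simp only [Metric.mem_closedBall, dist_zero_right, not_le] at hb
    rw [e0, hη.eq_zero _ _, Complex.ofReal_zero]
    rw [norm_smul, Real.norm_eq_abs, abs_of_pos Real.two_pi_pos]
    rwa [div_lt_iff₀' Real.two_pi_pos] at hb
  · simp [e0, hη.even]

lemma isSymb_p0 : IsSymb (p0 η) := (isSymb_e0 hη).sub ((isSymb_e0 hη).dil _)

lemma isSymb_pt : IsSymb (pt η) := ((isSymb_e0 hη).dil _).sub ((isSymb_e0 hη).dil _)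
end symbols

lemma norm_two_pi (v : Space n) : ‖(2 * Real.pi) • v‖ = 2 * Real.pi * ‖v‖ := by
  rw [norm_smul, Real.norm_eq_abs, abs_of_pos Real.two_pi_pos]

section supports
variable {η : Space n → ℝ} (hη : IsCutoff η) (k : ℤ) (v : Space n)
include hη

lemma dil_e0_eq_one (h : 2 * Real.pi * ‖v‖ ≤ 2 ^ k) : dil k (e0 η) v = 1 := by
  rw [dil, e0, hη.eq_one, Complex.ofReal_one]
  rw [norm_two_pi, norm_smul, Real.norm_eq_abs, abs_of_pos (by positivity), zpow_neg]
  rw [mul_left_comm, inv_mul_le_iff₀ (by positivity)]; linarith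

lemma dil_e0_eq_zero (h : 2 ^ (k + 1) < 2 * Real.pi * ‖v‖) : dil k (e0 η) v = 0 := by
  rw [dil, e0, hη.eq_zero, Complex.ofReal_zero]
  rw [norm_two_pi, norm_smul, Real.norm_eq_abs, abs_of_pos (by positivity), zpow_neg]
  rw [mul_left_comm, lt_inv_mul_iff₀ (by positivity)]
  rwa [zpow_add_one₀ (by norm_num)] at h

omit hη in
lemma dil_p0 : dil k (p0 η) v = dil k (e0 η) v - dil (k - 1) (e0 η) v := by
  have : dil (k - 1) (e0 η) v = dil k (dil (-1) (e0 η)) v := by rw [dil_dil]; rfl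
  rw [this]; rfl

lemma dil_p0_eq_zero_of_le (h : 2 * Real.pi * ‖v‖ ≤ 2 ^ (k - 1)) : dil k (p0 η) v = 0 := by
  rw [dil_p0, dil_e0_eq_one hη _ _ h, dil_e0_eq_one hη _ _ (h.trans _), sub_self]
  exact zpow_le_zpow_right₀ (by norm_num) (by omega)

lemma dil_p0_eq_zero_of_lt (h : 2 ^ (k + 1) < 2 * Real.pi * ‖v‖) : dil k (p0 η) v = 0 := by
  rw [dil_p0, dil_e0_eq_zero hη _ _ h, dil_e0_eq_zero hη _ _ (lt_of_le_of_lt _ h), sub_self]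
  exact zpow_le_zpow_right₀ (by norm_num) (by omega)

lemma p0_mul_pt : p0 η * pt η = p0 η := by
  ext v
  simp only [Pi.mul_apply]
  have e1 : p0 η v = dil 0 (p0 η) v := by simp [dil]
  by_cases h1 : 2 * Real.pi * ‖v‖ ≤ 2 ^ ((0 : ℤ) - 1)
  · rw [e1, dil_p0_eq_zero_of_le hη _ _ h1, zero_mul]
  by_cases h2 : 2 ^ ((0 : ℤ) + 1) < 2 * Real.pi * ‖v‖
  · rw [e1, dil_p0_eq_zero_of_lt hη _ _ h2, zero_mul]
  have : pt η v = 1 := by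
    rw [pt, Pi.sub_apply, dil_e0_eq_one hη, dil_e0_eq_zero hη, sub_zero]
    · push Not at h1; simpa using h1
    · push Not at h2; simpa using h2
  rw [this, mul_one]
end supports

lemma dil_p0_mul_dil_p0 {η : Space n → ℝ} (hη : IsCutoff η) {k l : ℤ} (h : l + 2 ≤ k) :
    dil k (p0 η) * dil l (p0 η) = 0 := by
  ext v
  simp only [Pi.mul_apply, Pi.zero_apply]
  by_cases h1 : 2 * Real.pi * ‖v‖ ≤ 2 ^ (k - 1)
  · rw [dil_p0_eq_zero_of_le hη _ _ h1, zero_mul]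
  · rw [dil_p0_eq_zero_of_lt hη l v, mul_zero]
    push Not at h1
    exact lt_of_le_of_lt (zpow_le_zpow_right₀ (by norm_num) (by omega)) h1

lemma two_pi_norm_sub (v ξ : Space n) :
    2 * Real.pi * ‖v‖ ≤ 2 * Real.pi * ‖ξ‖ + 2 * Real.pi * ‖v - ξ‖ := by
  rw [← mul_add]
  gcongr
  have := norm_add_le ξ (v - ξ)
  rwa [add_sub_cancel] at this

/-- Low frequencies do not interact to a high one. -/
lemma low_low {η : Space n → ℝ} (hη : IsCutoff η) {k l l' : ℤ} (hl : l ≤ k - 3) (hl' : l' ≤ k - 3)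
    (v ξ : Space n) : dil k (p0 η) v * dil l (e0 η) ξ * dil l' (e0 η) (v - ξ) = 0 := by
  by_cases h1 : 2 * Real.pi * ‖v‖ ≤ 2 ^ (k - 1)
  · rw [dil_p0_eq_zero_of_le hη _ _ h1, zero_mul, zero_mul]
  by_cases h2 : 2 ^ (l + 1) < 2 * Real.pi * ‖ξ‖
  · rw [dil_e0_eq_zero hη _ _ h2, mul_zero, zero_mul]
  by_cases h3 : 2 ^ (l' + 1) < 2 * Real.pi * ‖v - ξ‖
  · rw [dil_e0_eq_zero hη _ _ h3, mul_zero]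
  exfalso
  push Not at h1 h2 h3
  have h4 := two_pi_norm_sub v ξ
  have h5 : (2 : ℝ) ^ (l + 1) ≤ 2 ^ (k - 2) := zpow_le_zpow_right₀ (by norm_num) (by omega)
  have h6 : (2 : ℝ) ^ (l' + 1) ≤ 2 ^ (k - 2) := zpow_le_zpow_right₀ (by norm_num) (by omega)
  have h7 : (2 : ℝ) ^ (k - 1) = 2 ^ (k - 2) * 2 := by
    rw [← zpow_add_one₀ (by norm_num)]; congr 1; ring
  linarith

/-- A high and a low frequency do not interact to a low one. -/
lemma high_low {η : Space n → ℝ} (hη : IsCutoff η) {k J l : ℤ} (hk : k ≤ J - 6) (hl : l ≤ J - 4)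
    (v ξ : Space n) : dil k (p0 η) v * dil J (p0 η) ξ * dil l (e0 η) (v - ξ) = 0 := by
  by_cases h1 : 2 * Real.pi * ‖ξ‖ ≤ 2 ^ (J - 1)
  · rw [dil_p0_eq_zero_of_le hη _ _ h1, mul_zero, zero_mul]
  by_cases h2 : 2 ^ (k + 1) < 2 * Real.pi * ‖v‖
  · rw [dil_p0_eq_zero_of_lt hη _ _ h2, zero_mul, zero_mul]
  by_cases h3 : 2 ^ (l + 1) < 2 * Real.pi * ‖v - ξ‖
  · rw [dil_e0_eq_zero hη _ _ h3, mul_zero]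
  exfalso
  push Not at h1 h2 h3
  have h4 := two_pi_norm_sub ξ v
  rw [norm_sub_rev ξ v] at h4
  have h5 : (2 : ℝ) ^ (k + 1) ≤ 2 ^ (J - 2) := zpow_le_zpow_right₀ (by norm_num) (by omega)
  have h6 : (2 : ℝ) ^ (l + 1) ≤ 2 ^ (J - 2) := zpow_le_zpow_right₀ (by norm_num) (by omega)
  have h7 : (2 : ℝ) ^ (J - 1) = 2 ^ (J - 2) * 2 := by
    rw [← zpow_add_one₀ (by norm_num)]; congr 1; ring
  linarith

/-! ### Algebra of multipliers -/

section algebra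
variable {a b : Space n → ℂ} {p : ℝ≥0∞} {f g : Space n → ℝ}

lemma kern_sub (ha : IsSymb a) (hb : IsSymb b) (x : Space n) :
    kern (a - b) x = kern a x - kern b x := by
  rw [← Complex.ofReal_inj, Complex.ofReal_sub, ← ha.fourierInv_eq, ← hb.fourierInv_eq,
    ← (ha.sub hb).fourierInv_eq, ← (ha.sub hb).fourierInv_sch, ← ha.fourierInv_sch,
    ← hb.fourierInv_sch]
  have : (ha.sub hb).sch = ha.sch - hb.sch := rfl
  rw [this, sub_eq_add_neg, FourierTransform.fourierInv_add,
    show -hb.sch = (-1 : ℂ) • hb.sch from (neg_one_smul ℂ _).symm, FourierTransform.fourierInv_smul]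
  simp [sub_eq_add_neg]

lemma kern_smul (ha : IsSymb a) (c : ℝ) (x : Space n) : kern (c • a) x = c * kern a x := by
  rw [← Complex.ofReal_inj, Complex.ofReal_mul, ← ha.fourierInv_eq,
    ← (ha.smul c).fourierInv_eq, Real.fourierInv_eq', Real.fourierInv_eq', ← integral_const_mul]
  congr 1
  ext v
  simp only [Pi.smul_apply, Complex.real_smul, smul_eq_mul]
  ring

lemma Op_sub (ha : IsSymb a) (hb : IsSymb b) (hp : 1 ≤ p) (hf : MemLp f p volume) (x : Space n) :
    Op (a - b) f x = Op a f x - Op b f x := by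
  simp only [Op, cnv, kern_sub ha hb, sub_mul]
  exact integral_sub (ha.integrable_mul hp hf x) (hb.integrable_mul hp hf x)

lemma Op_smul (ha : IsSymb a) (c : ℝ) (x : Space n) : Op (c • a) f x = c * Op a f x := by
  simp only [Op, cnv, kern_smul ha, mul_assoc, integral_const_mul]

lemma Op_add_symb (ha : IsSymb a) (hb : IsSymb b) (hp : 1 ≤ p) (hf : MemLp f p volume)
    (x : Space n) : Op (a + b) f x = Op a f x + Op b f x := by
  have : a + b = a - (-1 : ℝ) • b := by simp
  rw [this, Op_sub ha (hb.smul _) hp hf, Op_smul hb]; ring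

lemma Op_zero_symb (x : Space n) : Op (0 : Space n → ℂ) f x = 0 := by
  have : ∀ y : Space n, kern 0 y = 0 := fun y => by
    rw [kern, Real.fourierInv_eq']; simp
  simp [Op, cnv, this]

lemma Op_add (ha : IsSymb a) {q : ℝ≥0∞} (hp : 1 ≤ p) (hq : 1 ≤ q) (hf : MemLp f p volume)
    (hg : MemLp g q volume) (x : Space n) :
    Op a (fun y => f y + g y) x = Op a f x + Op a g x := by
  simp only [Op, cnv, mul_add]
  exact integral_add (ha.integrable_mul hp hf x) (ha.integrable_mul hq hg x)

lemma Op_const_mul (c : ℝ) (x : Space n) : Op a (fun y => c * f y) x = c * Op a f x := by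
  simp only [Op, cnv]
  rw [← integral_const_mul]
  congr 1; ext y; ring

lemma Op_sub_fun (ha : IsSymb a) {q : ℝ≥0∞} (hp : 1 ≤ p) (hq : 1 ≤ q) (hf : MemLp f p volume)
    (hg : MemLp g q volume) (x : Space n) :
    Op a (fun y => f y - g y) x = Op a f x - Op a g x := by
  simp only [Op, cnv, mul_sub]
  exact integral_sub (ha.integrable_mul hp hf x) (ha.integrable_mul hq hg x)

lemma Op_sum (ha : IsSymb a) {ι : Type*} (s : Finset ι) {F : ι → Space n → ℝ} (hp : 1 ≤ p)
    (hF : ∀ i ∈ s, MemLp (F i) p volume) (x : Space n) :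
    Op a (fun y => ∑ i ∈ s, F i y) x = ∑ i ∈ s, Op a (F i) x := by
  simp only [Op, cnv, mul_sum]
  exact integral_finsetSum _ fun i hi => ha.integrable_mul hp (hF i hi) x

/-- Sup bound for a multiplier. -/
lemma enorm_Op_dil_le (ha : IsSymb a) (k : ℤ) (hp : 1 ≤ p) (hf : AEStronglyMeasurable f volume)
    (x : Space n) : ‖Op (dil k a) f x‖ₑ ≤
      ofReal (kb a * (2 : ℝ) ^ ((n : ℝ) * k * (p⁻¹).toReal)) * eLpNorm f p volume := by
  refine (enorm_cnv_le _ _ _).trans ((acnv_le_eLpNorm (ha.kbound_dil k) hf hp x).trans_eq ?_)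
  congr 1
  have h1 : 0 < kb a := by linarith [one_le_kb a]
  rw [ENNReal.ofReal_rpow_of_pos h1, ENNReal.ofReal_rpow_of_pos (by positivity),
    ← ofReal_mul (by positivity), Real.mul_rpow (by positivity) h1.le, mul_left_comm,
    ← Real.rpow_add h1, sub_add_cancel, Real.rpow_one, mul_comm]
  congr 2
  rw [Real.rpow_mul (by norm_num)]
  congr 1
  exact_mod_cast (Real.rpow_intCast 2 (n * k)).symm

/-- Bernstein's inequality for a dilated multiplier. -/
lemma eLpNorm_Op_dil_le_bernstein (ha : IsSymb a) (k : ℤ) {r : ℝ≥0∞} (hp : 1 ≤ p) (hpr : p ≤ r)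
    (hf : AEStronglyMeasurable f volume) : eLpNorm (Op (dil k a) f) r volume ≤
      ofReal (kb a * (2 : ℝ) ^ ((n : ℝ) * k * ((p⁻¹).toReal - (r⁻¹).toReal)))
        * eLpNorm f p volume := by
  have h1 : 0 < kb a := by linarith [one_le_kb a]
  refine (eLpNorm_cnv_le_bernstein (ha.kbound_dil k) ofReal_ne_top (by simpa using h1)
    hf hp hpr).trans_eq ?_
  congr 1
  rw [ENNReal.ofReal_rpow_of_pos h1, ENNReal.ofReal_rpow_of_pos (by positivity),
    ← ofReal_mul (by positivity), Real.mul_rpow (by positivity) h1.le, mul_left_comm,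
    ← Real.rpow_add h1, sub_add_cancel, Real.rpow_one, mul_comm]
  congr 2
  rw [Real.rpow_mul (by norm_num)]
  congr 1
  exact_mod_cast (Real.rpow_intCast 2 (n * k)).symm

lemma eLpNorm_Op_dil_le (ha : IsSymb a) (k : ℤ) (hp : 1 ≤ p)
    (hf : AEStronglyMeasurable f volume) :
    eLpNorm (Op (dil k a) f) p volume ≤ ofReal (kb a) * eLpNorm f p volume :=
  eLpNorm_cnv_le (ha.kbound_dil k) hf hp
end algebra

/-! ### Littlewood-Paley decompositions at a fixed time -/

lemma lowProj_eq (η : Space n → ℝ) (k : ℤ) (u : STField n) (t : ℝ) :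
    lowProj η k u t = LL η k (u t) := by
  have h : lowKernel η k = kern (dil k (e0 η)) := by
    funext x
    simp only [lowKernel, kern]
    simp_rw [smul_comm ((2 : ℝ) ^ (-k)) (2 * Real.pi)]
    rfl
  unfold lowProj LL Op cnv
  rw [h]

section lp
variable {η : Space n → ℝ} (hη : IsCutoff η) {p : ℝ≥0∞} {f : Space n → ℝ}
include hη

lemma PP_eq (hp : 1 ≤ p) (hf : MemLp f p volume) (k : ℤ) (x : Space n) :
    PP η k f x = LL η k f x - LL η (k - 1) f x := by
  have h : dil k (p0 η) = dil k (e0 η) - dil (k - 1) (e0 η) := funext fun v => dil_p0 k v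
  rw [PP, h, Op_sub ((isSymb_e0 hη).dil k) ((isSymb_e0 hη).dil _) hp hf]
  rfl

lemma proj_eq (hp : 1 ≤ p) {u : STField n} {t : ℝ} (hf : MemLp (u t) p volume) (k : ℤ)
    (x : Space n) : proj η k u t x = PP η k (u t) x := by
  rw [PP_eq hη hp hf, proj, lowProj_eq, lowProj_eq]

lemma tendsto_LL_atBot (hp : 1 ≤ p) (hpt : p ≠ ⊤) (hn : 1 ≤ n) (hf : MemLp f p volume) (J : ℤ)
    (x : Space n) : Tendsto (fun m : ℕ => LL η (J - m) f x) atTop (𝓝 0) := by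
  have ha : 0 < (p⁻¹).toReal := by
    rw [ENNReal.toReal_inv]
    have := ENNReal.toReal_pos (zero_lt_one.trans_le hp).ne' hpt
    positivity
  have hk := one_le_kb (e0 η)
  have hb : ∀ m : ℕ, ‖LL η (J - m) f x‖ ≤ kb (e0 η) * (2 : ℝ) ^ ((n : ℝ) * (J - m : ℤ) *
      (p⁻¹).toReal) * (eLpNorm f p volume).toReal := by
    intro m
    have h1 := enorm_Op_dil_le (isSymb_e0 hη) (J - m) hp hf.1 x
    rw [← toReal_enorm, ← ENNReal.toReal_ofReal (r := kb (e0 η) * _) (by positivity),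
      ← ENNReal.toReal_mul]
    exact toReal_mono (mul_ne_top ofReal_ne_top hf.2.ne) h1
  refine squeeze_zero_norm hb ?_
  have h2 : ∀ m : ℕ, (2 : ℝ) ^ ((n : ℝ) * (J - m : ℤ) * (p⁻¹).toReal) =
      (2 : ℝ) ^ ((n : ℝ) * J * (p⁻¹).toReal) * ((2 : ℝ) ^ (-((n : ℝ) * (p⁻¹).toReal))) ^ m := by
    intro m
    rw [← Real.rpow_natCast, ← Real.rpow_mul (by norm_num), ← Real.rpow_add (by norm_num)]
    congr 1; push_cast; ring
  simp_rw [h2]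
  have h3 : Tendsto (fun m : ℕ => ((2 : ℝ) ^ (-((n : ℝ) * (p⁻¹).toReal))) ^ m) atTop (𝓝 0) := by
    refine tendsto_pow_atTop_nhds_zero_of_lt_one (by positivity) ?_
    refine Real.rpow_lt_one_of_one_lt_of_neg (by norm_num) ?_
    have : (1 : ℝ) ≤ n := by exact_mod_cast hn
    have : 0 < (n : ℝ) * (p⁻¹).toReal := by positivity
    linarith
  simpa using ((h3.const_mul _).const_mul (kb (e0 η))).mul_const (eLpNorm f p volume).toReal

omit hη in
lemma integral_kern {m : Space n → ℂ} (h : IsSymb m) : ∫ y, kern m y = (m 0).re := by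
  have h1 : (𝓕 (𝓕⁻ h.sch)) 0 = m 0 := by
    rw [FourierTransform.fourier_fourierInv_eq]; rfl
  rw [SchwartzMap.fourier_coe, Real.fourier_eq'] at h1
  have h2 : ∫ y, ((kern m y : ℝ) : ℂ) = m 0 := by
    rw [← h1]
    refine integral_congr_ae (Eventually.of_forall fun y => ?_)
    simp [h.fourierInv_sch, h.fourierInv_eq]
  rw [integral_complex_ofReal] at h2
  rw [← h2, Complex.ofReal_re]

/-- The low frequency projections converge pointwise. -/
lemma tendsto_LL_atTop (hp : 1 ≤ p) (hf : MemLp f p volume) (hc : Continuous f) (J₀ : ℤ)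
    (x : Space n) : Tendsto (fun m : ℕ => LL η (J₀ + m) f x) atTop (𝓝 (f x)) := by
  set a := e0 η with ha
  have hs : IsSymb a := isSymb_e0 hη
  obtain ⟨C, hC, hw⟩ := hs.weight
  have hfin : ∀ J : ℤ, Integrable (fun y => kern (dil J a) (x - y)) volume := fun J =>
    (hs.dil J).integrable_kern.comp_sub_left x
  have hone : ∀ J : ℤ, ∫ y, kern (dil J a) (x - y) = 1 := by
    intro J
    rw [integral_sub_left_eq_self (fun y => kern (dil J a) y) volume x, integral_kern (hs.dil J),
      dil_e0_eq_one hη _ _ (by simp; positivity), Complex.one_re]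
  have hdiff : ∀ J : ℤ, LL η J f x - f x = ∫ y, kern (dil J a) (x - y) * (f y - f x) := by
    intro J
    simp only [mul_sub]
    rw [integral_sub ((hs.dil J).integrable_mul hp hf x) ((hfin J).mul_const _),
      integral_mul_const, hone J, one_mul]
    rfl
  rw [Metric.tendsto_atTop]
  intro ε hε
  have hkb := one_le_kb a
  obtain ⟨δ, hδ, hδf⟩ := Metric.continuous_iff.1 hc x (ε / (2 * kb a)) (by positivity)
  set cδ : ℝ := δ / (1 + δ) with hcδ
  have hcδ0 : 0 < cδ := by positivity
  -- far from the diagonal the kernel is dominated by a small weight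
  set Cδ : ℝ := C / cδ ^ (n + 1) with hCδ
  set ρ : Space n → ℝ := fun z => Cδ * ((1 + ‖z‖) ^ (n + 1))⁻¹ with hρ
  have hρc : Continuous ρ := by
    refine continuous_const.mul (Continuous.inv₀ (by fun_prop) fun z => by positivity)
  have hρ0 : ∀ z, 0 ≤ ρ z := fun z => by positivity
  have hρb := kbound_of_weight hρc (C := Cδ) (by positivity) (fun z => by
    rw [abs_of_nonneg (hρ0 z)]
    simp only [hρ]
    rw [mul_left_comm, mul_inv_cancel₀ (by positivity), mul_one])
  set W := ofReal Cδ * (wint n + 1) with hW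
  have hWt : W ≠ ⊤ := mul_ne_top ofReal_ne_top (by simp [(wint_lt_top n).ne])
  have hfar : ∀ J : ℤ, 0 ≤ J → ∀ z : Space n, δ ≤ ‖z‖ →
      |kern (dil J a) z| ≤ (2 : ℝ) ^ (-J) * ρ z := by
    intro J hJ z hz
    rw [kern_dil, abs_mul, abs_of_pos (by positivity : (0 : ℝ) < 2 ^ ((n : ℤ) * J))]
    have h1 := hw ((2 : ℝ) ^ J • z)
    rw [norm_smul, Real.norm_eq_abs, abs_of_pos (by positivity : (0 : ℝ) < 2 ^ J)] at h1
    have h2 : (2 : ℝ) ^ J * (cδ * (1 + ‖z‖)) ≤ 1 + 2 ^ J * ‖z‖ := by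
      have : cδ * (1 + ‖z‖) ≤ ‖z‖ := by
        rw [hcδ, div_mul_eq_mul_div, div_le_iff₀ (by positivity)]; nlinarith
      have h3 : (2 : ℝ) ^ J * (cδ * (1 + ‖z‖)) ≤ 2 ^ J * ‖z‖ := by gcongr
      linarith
    have h3 : ((2 : ℝ) ^ J * (cδ * (1 + ‖z‖))) ^ (n + 1) * |kern a ((2 : ℝ) ^ J • z)| ≤ C := by
      refine le_trans ?_ h1
      have h4 : 1 ≤ 1 + 2 ^ J * ‖z‖ := by
        have : 0 ≤ (2 : ℝ) ^ J * ‖z‖ := by positivity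
        linarith
      gcongr
      calc ((2 : ℝ) ^ J * (cδ * (1 + ‖z‖))) ^ (n + 1) ≤ (1 + 2 ^ J * ‖z‖) ^ (n + 1) := by gcongr
        _ ≤ _ := pow_le_pow_right₀ h4 (by omega)
    have h5 : ((2 : ℝ) ^ J) ^ (n + 1) = 2 ^ ((n : ℤ) * J) * 2 ^ J := by
      rw [← zpow_natCast, ← zpow_mul, ← zpow_add₀ (by norm_num)]; congr 1; push_cast; ring
    rw [mul_pow, mul_pow, h5] at h3
    simp only [hρ, hCδ]
    rw [zpow_neg]
    have e : ((2 : ℝ) ^ J)⁻¹ * (C / cδ ^ (n + 1) * ((1 + ‖z‖) ^ (n + 1))⁻¹) =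
        C / (2 ^ J * cδ ^ (n + 1) * (1 + ‖z‖) ^ (n + 1)) := by
      field_simp
    rw [e, le_div_iff₀ (by positivity)]
    nlinarith
  set M : ℝ≥0∞ := W * eLpNorm f p volume + W * ofReal |f x| with hM
  have hMt : M ≠ ⊤ := ENNReal.add_ne_top.2 ⟨mul_ne_top hWt hf.2.ne,
    mul_ne_top hWt ofReal_ne_top⟩
  have hacn : ∀ {q : ℝ≥0∞} {g : Space n → ℝ}, 1 ≤ q → AEStronglyMeasurable g volume →
      acnv ρ g x ≤ W * eLpNorm g q volume := by
    intro q g hq hg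
    refine (acnv_le_eLpNorm hρb hg hq x).trans ?_
    rcases eq_or_ne W 0 with h0 | h0
    · have hle : (q⁻¹).toReal ≤ 1 := by
        rw [← ENNReal.toReal_one]
        exact toReal_mono (by simp) (ENNReal.inv_le_one.2 hq)
      rw [h0]
      rcases eq_or_lt_of_le hle with h1 | h1
      · rw [h1]; simp
      · rw [ENNReal.zero_rpow_of_pos (by linarith)]; simp
    · rw [← ENNReal.rpow_add _ _ h0 hWt]; simp
  have hmain : ∀ J : ℤ, 0 ≤ J → ‖LL η J f x - f x‖ₑ ≤
      ofReal (ε / 2) + ofReal ((2 : ℝ) ^ (-J)) * M := by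
    intro J hJ
    rw [hdiff J]
    refine (enorm_integral_le_lintegral_enorm _).trans ?_
    have hpt : ∀ y, ‖kern (dil J a) (x - y) * (f y - f x)‖ₑ ≤
        ‖kern (dil J a) (x - y)‖ₑ * ofReal (ε / (2 * kb a)) +
        ofReal ((2 : ℝ) ^ (-J)) * (‖ρ (x - y)‖ₑ * ‖f y‖ₑ + ‖ρ (x - y)‖ₑ * ‖f x‖ₑ) := by
      intro y
      rw [enorm_mul]
      by_cases hy : ‖x - y‖ < δ
      · refine le_trans ?_ le_self_add
        gcongr
        rw [Real.enorm_eq_ofReal_abs]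
        refine ofReal_le_ofReal ?_
        have := hδf y (by rw [dist_eq_norm, norm_sub_rev]; exact hy)
        rw [Real.dist_eq] at this
        exact this.le
      · push Not at hy
        refine le_trans ?_ le_add_self
        rw [← mul_add, ← mul_assoc]
        gcongr
        · rw [Real.enorm_eq_ofReal_abs, Real.enorm_eq_ofReal_abs, abs_of_nonneg (hρ0 _),
            ← ofReal_mul (by positivity)]
          exact ofReal_le_ofReal (hfar J hJ _ hy)
        · exact enorm_sub_le
    refine (lintegral_mono hpt).trans ?_
    have hm1 : Measurable fun y => ‖kern (dil J a) (x - y)‖ₑ :=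
      ((hs.dil J).continuous_kern.comp (continuous_const.sub continuous_id)).enorm.measurable
    rw [lintegral_add_left (hm1.mul_const _), lintegral_mul_const _ hm1,
      lintegral_const_mul' _ _ ofReal_ne_top]
    have hm2 : Measurable fun y => ‖ρ (x - y)‖ₑ :=
      (hρc.comp (continuous_const.sub continuous_id)).enorm.measurable
    gcongr
    · calc (∫⁻ y, ‖kern (dil J a) (x - y)‖ₑ) * ofReal (ε / (2 * kb a))
          ≤ ofReal (kb a) * ofReal (ε / (2 * kb a)) := by
            gcongr; exact (hs.kbound_dil J).l1_sub x
        _ = ofReal (ε / 2) := by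
            rw [← ofReal_mul (by positivity)]; congr 1; field_simp
    · have hm3 : AEMeasurable (fun y => ‖ρ (x - y)‖ₑ * ‖f y‖ₑ) volume :=
        hm2.aemeasurable.mul hf.1.enorm
      rw [lintegral_add_left' hm3]
      refine add_le_add ?_ ?_
      · exact hacn hp hf.1
      · have := hacn (q := ⊤) (g := fun _ => f x) le_top aestronglyMeasurable_const
        refine this.trans ?_
        gcongr
        rw [eLpNorm_exponent_top]
        refine essSup_le_of_ae_le _ (Eventually.of_forall fun y => ?_)
        simp only
        rw [Real.enorm_eq_ofReal_abs]
  have hlim : Tendsto (fun m : ℕ => (2 : ℝ) ^ (-(J₀ + m)) * M.toReal) atTop (𝓝 0) := by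
    have h3 : Tendsto (fun m : ℕ => ((2 : ℝ)⁻¹) ^ m) atTop (𝓝 0) :=
      tendsto_pow_atTop_nhds_zero_of_lt_one (by norm_num) (by norm_num)
    have h4 : ∀ m : ℕ, (2 : ℝ) ^ (-(J₀ + m)) * M.toReal =
        2 ^ (-J₀) * M.toReal * ((2 : ℝ)⁻¹) ^ m := by
      intro m
      rw [neg_add, zpow_add₀ (by norm_num), zpow_neg _ (m : ℤ), zpow_natCast, inv_pow]; ring
    simp_rw [h4]
    simpa using h3.const_mul (2 ^ (-J₀) * M.toReal)
  obtain ⟨m₀, hm₀⟩ := eventually_atTop.1 (hlim.eventually (gt_mem_nhds (half_pos hε)))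
  refine ⟨max m₀ J₀.natAbs, fun m hm => ?_⟩
  have hJ : 0 ≤ J₀ + m := by omega
  have h1 := hmain (J₀ + m) hJ
  have h2 := hm₀ m (le_trans (le_max_left _ _) hm)
  rw [dist_eq_norm, ← toReal_enorm]
  calc ‖LL η (J₀ + m) f x - f x‖ₑ.toReal
      ≤ (ofReal (ε / 2) + ofReal ((2 : ℝ) ^ (-(J₀ + m))) * M).toReal :=
        toReal_mono (ENNReal.add_ne_top.2 ⟨ofReal_ne_top,
          mul_ne_top ofReal_ne_top hMt⟩) h1
    _ = ε / 2 + 2 ^ (-(J₀ + m)) * M.toReal := by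
        rw [ENNReal.toReal_add ofReal_ne_top
          (mul_ne_top ofReal_ne_top hMt), ENNReal.toReal_mul,
          ENNReal.toReal_ofReal (by positivity), ENNReal.toReal_ofReal (by positivity)]
    _ < ε := by linarith

lemma LL_add_eq (hp : 1 ≤ p) (hf : MemLp f p volume) (J : ℤ) (m : ℕ) (x : Space n) :
    LL η (J + m) f x = LL η J f x + ∑ i ∈ Finset.range m, PP η (J + 1 + i) f x := by
  induction m with
  | zero => simp
  | succ m ih =>
    rw [Finset.sum_range_succ, ← add_assoc, ← ih, PP_eq hη hp hf]
    have e1 : J + ((m + 1 : ℕ) : ℤ) = J + 1 + m := by push_cast; ring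
    have e2 : J + 1 + (m : ℤ) - 1 = J + m := by ring
    rw [e1, e2]; ring

/-- The sum of the pieces of low frequency. -/
lemma tendsto_sum_PP_low (hp : 1 ≤ p) (hpt : p ≠ ⊤) (hn : 1 ≤ n) (hf : MemLp f p volume) (J : ℤ)
    (x : Space n) :
    Tendsto (fun m : ℕ => ∑ i ∈ Finset.range m, PP η (J - i) f x) atTop (𝓝 (LL η J f x)) := by
  have h1 : ∀ m : ℕ, ∑ i ∈ Finset.range m, PP η (J - i) f x = LL η J f x - LL η (J - m) f x := by
    intro m
    induction m with
    | zero => simp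
    | succ m ih =>
      rw [Finset.sum_range_succ, ih, PP_eq hη hp hf]
      have : J - ((m + 1 : ℕ) : ℤ) = J - m - 1 := by push_cast; ring
      rw [this]; ring
  simp_rw [h1]
  simpa using (tendsto_LL_atBot hη hp hpt hn hf J x).const_sub (LL η J f x)

/-- The sum of the pieces of high frequency. -/
lemma tendsto_sum_PP_high (hp : 1 ≤ p) (hf : MemLp f p volume) (hc : Continuous f) (J : ℤ)
    (x : Space n) :
    Tendsto (fun m : ℕ => ∑ i ∈ Finset.range m, PP η (J + 1 + i) f x) atTop
      (𝓝 (f x - LL η J f x)) := by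
  have h1 : ∀ m : ℕ, ∑ i ∈ Finset.range m, PP η (J + 1 + i) f x =
      LL η (J + m) f x - LL η J f x := by
    intro m; rw [LL_add_eq hη hp hf]; ring
  simp_rw [h1]
  exact (tendsto_LL_atTop hη hp hf hc J x).sub_const _

end lp

/-- Countable subadditivity of the `L^r` norm for pointwise convergent series. -/
lemma eLpNorm_le_tsum {α : Type*} [MeasurableSpace α] {μ : Measure α} {F : ℕ → α → ℝ} {f : α → ℝ}
    (hF : ∀ i, AEStronglyMeasurable (F i) μ)
    (h : ∀ x, Tendsto (fun m : ℕ => ∑ i ∈ Finset.range m, F i x) atTop (𝓝 (f x)))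
    {r : ℝ≥0∞} (hr : 1 ≤ r) : eLpNorm f r μ ≤ ∑' i, eLpNorm (F i) r μ := by
  have hS : ∀ m : ℕ, AEStronglyMeasurable (fun x => ∑ i ∈ Finset.range m, F i x) μ := fun m =>
    Finset.aestronglyMeasurable_fun_sum _ fun _ _ => hF _
  refine Lp.eLpNorm_le_of_ae_tendsto (u := atTop)
    (f := fun (m : ℕ) x => ∑ i ∈ Finset.range m, F i x) (Eventually.of_forall fun m => ?_) hS
    (Eventually.of_forall h)
  have := eLpNorm_sum_le (s := Finset.range m) (f := F) (fun _ _ => hF _) hr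
  rw [show (∑ i ∈ Finset.range m, F i) = fun x => ∑ i ∈ Finset.range m, F i x from
    funext fun x => by simp] at this
  exact this.trans (ENNReal.sum_le_tsum _)

section sums
variable {η : Space n → ℝ} (hη : IsCutoff η) {p r : ℝ≥0∞} {f : Space n → ℝ}
include hη

lemma aestronglyMeasurable_PP (hf : AEStronglyMeasurable f volume) (k : ℤ) :
    AEStronglyMeasurable (PP η k f) volume :=
  aestronglyMeasurable_cnv ((isSymb_p0 hη).dil k).continuous_kern hf

lemma aestronglyMeasurable_LL (hf : AEStronglyMeasurable f volume) (k : ℤ) :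
    AEStronglyMeasurable (LL η k f) volume :=
  aestronglyMeasurable_cnv ((isSymb_e0 hη).dil k).continuous_kern hf

lemma eLpNorm_LL_le_tsum (hp : 1 ≤ p) (hpt : p ≠ ⊤) (hn : 1 ≤ n) (hf : MemLp f p volume) (J : ℤ)
    (hr : 1 ≤ r) : eLpNorm (LL η J f) r volume ≤ ∑' i : ℕ, eLpNorm (PP η (J - i) f) r volume :=
  eLpNorm_le_tsum (fun _ => aestronglyMeasurable_PP hη hf.1 _)
    (fun x => tendsto_sum_PP_low hη hp hpt hn hf J x) hr

lemma eLpNorm_sub_LL_le_tsum (hp : 1 ≤ p) (hf : MemLp f p volume) (hc : Continuous f) (J : ℤ)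
    (hr : 1 ≤ r) : eLpNorm (fun x => f x - LL η J f x) r volume ≤
      ∑' i : ℕ, eLpNorm (PP η (J + 1 + i) f) r volume :=
  eLpNorm_le_tsum (fun _ => aestronglyMeasurable_PP hη hf.1 _)
    (fun x => tendsto_sum_PP_high hη hp hf hc J x) hr
end sums

/-! ### Mixed norms -/

/-- The norm in time of a function with values in `[0, ∞]`. -/
def tnorm (T : ℝ) (q : ℝ≥0∞) (g : ℝ → ℝ≥0∞) : ℝ≥0∞ := eLpNorm g q (volume.restrict (Ioo 0 T))

lemma ae_of_Ioo {P : ℝ → Prop} (h : ∀ t ∈ Ioo 0 T, P t) : ∀ᵐ t ∂(volume.restrict (Ioo 0 T)), P t :=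
  (ae_restrict_iff' measurableSet_Ioo).2 (Eventually.of_forall h)

lemma tnorm_mono {q : ℝ≥0∞} {g h : ℝ → ℝ≥0∞} (hgh : ∀ t ∈ Ioo 0 T, g t ≤ h t) :
    tnorm T q g ≤ tnorm T q h :=
  eLpNorm_mono_enorm_ae (ae_of_Ioo fun t ht => by simpa using hgh t ht)

lemma tnorm_const_mul (c : ℝ) {q : ℝ≥0∞} (g : ℝ → ℝ≥0∞) :
    tnorm T q (fun t => ofReal c * g t) ≤ ofReal c * tnorm T q g :=
  eLpNorm_le_mul_eLpNorm_of_ae_le_mul' (c := c.toNNReal) (Eventually.of_forall fun t => by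
    simp [ofReal]) q

lemma tnorm_add_le {q : ℝ≥0∞} (hq : 1 ≤ q) {g h : ℝ → ℝ≥0∞}
    (hg : AEMeasurable g (volume.restrict (Ioo 0 T)))
    (hh : AEMeasurable h (volume.restrict (Ioo 0 T))) :
    tnorm T q (fun t => g t + h t) ≤ tnorm T q g + tnorm T q h :=
  eLpNorm_add_le hg.aestronglyMeasurable hh.aestronglyMeasurable hq

lemma tnorm_sum_le {ι : Type*} (s : Finset ι) {q : ℝ≥0∞} (hq : 1 ≤ q) {g : ι → ℝ → ℝ≥0∞}
    (hg : ∀ i ∈ s, AEMeasurable (g i) (volume.restrict (Ioo 0 T))) :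
    tnorm T q (fun t => ∑ i ∈ s, g i t) ≤ ∑ i ∈ s, tnorm T q (g i) := by
  have := eLpNorm_sum_le (s := s) (fun i hi => (hg i hi).aestronglyMeasurable) hq
  rwa [show (∑ i ∈ s, g i) = fun t => ∑ i ∈ s, g i t from funext fun t => by simp] at this

lemma tnorm_tsum_le {q : ℝ≥0∞} (hq : 1 ≤ q) {g : ℕ → ℝ → ℝ≥0∞}
    (hg : ∀ i, AEMeasurable (g i) (volume.restrict (Ioo 0 T))) :
    tnorm T q (fun t => ∑' i, g i t) ≤ ∑' i, tnorm T q (g i) := by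
  have hfin : ∀ m, tnorm T q (fun t => ∑ i ∈ Finset.range m, g i t) ≤ ∑' i, tnorm T q (g i) :=
    fun m => (tnorm_sum_le _ hq fun i _ => hg i).trans (ENNReal.sum_le_tsum _)
  have hmono : ∀ t, Monotone fun m => ∑ i ∈ Finset.range m, g i t := fun t m m' h =>
    Finset.sum_le_sum_of_subset (Finset.range_mono h)
  have hmeas : ∀ m, AEMeasurable (fun t => ∑ i ∈ Finset.range m, g i t)
      (volume.restrict (Ioo 0 T)) := fun m => Finset.aemeasurable_fun_sum _ fun i _ => hg i
  rcases eq_or_ne q ⊤ with rfl | hqt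
  · simp only [tnorm, eLpNorm_exponent_top] at hfin ⊢
    refine essSup_le_of_ae_le _ ?_
    have h1 : ∀ᵐ t ∂(volume.restrict (Ioo 0 T)), ∀ m, ∑ i ∈ Finset.range m, g i t ≤
        ∑' i, eLpNormEssSup (g i) (volume.restrict (Ioo 0 T)) := by
      rw [ae_all_iff]
      intro m
      filter_upwards [ae_le_eLpNormEssSup (f := fun t => ∑ i ∈ Finset.range m, g i t)
        (μ := volume.restrict (Ioo 0 T))] with t ht
      exact le_trans (by simpa using ht) (hfin m)
    filter_upwards [h1] with t ht
    rw [enorm_eq_self, ENNReal.tsum_eq_iSup_nat]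
    exact iSup_le ht
  · have hq0 : q ≠ 0 := (zero_lt_one.trans_le hq).ne'
    have hp : 0 < q.toReal := ENNReal.toReal_pos hq0 hqt
    simp only [tnorm, eLpNorm_eq_lintegral_rpow_enorm_toReal hq0 hqt, enorm_eq_self, one_div] at hfin ⊢
    rw [ENNReal.rpow_inv_le_iff hp]
    have h1 : ∀ t, (∑' i, g i t) ^ q.toReal =
        ⨆ m, (∑ i ∈ Finset.range m, g i t) ^ q.toReal := by
      intro t
      rw [ENNReal.tsum_eq_iSup_nat]
      exact (ENNReal.orderIsoRpow q.toReal hp).map_iSup _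
    simp_rw [h1]
    rw [lintegral_iSup' (fun m => (hmeas m).pow_const _)
      (Eventually.of_forall fun t m m' h => by
        simp only; exact ENNReal.rpow_le_rpow (hmono t h) hp.le)]
    refine iSup_le fun m => ?_
    exact (ENNReal.rpow_inv_le_iff hp).1 (hfin m)

/-- Triples of exponents for which Hölder's inequality in time is used. -/
def TimeHolder (q₁ q₂ q : ℝ≥0∞) : Prop :=
  ∀ (T : ℝ) (g h : ℝ → ℝ≥0∞), AEMeasurable g (volume.restrict (Ioo 0 T)) →
    AEMeasurable h (volume.restrict (Ioo 0 T)) →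
    tnorm T q (fun t => g t * h t) ≤ tnorm T q₁ g * tnorm T q₂ h

lemma timeHolder_top_right (q : ℝ≥0∞) (hq : 1 ≤ q) : TimeHolder q ⊤ q := by
  intro T g h hg hh
  set μ := (volume.restrict (Ioo 0 T))
  have hb : ∀ᵐ t ∂μ, h t ≤ eLpNorm h ⊤ μ := by
    rw [eLpNorm_exponent_top]
    filter_upwards [ae_le_eLpNormEssSup (f := h) (μ := μ)] with t ht
    simpa using ht
  have h1 : tnorm T q (fun t => g t * h t) ≤ tnorm T q (fun t => g t * eLpNorm h ⊤ μ) := by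
    refine eLpNorm_mono_enorm_ae ?_
    filter_upwards [hb] with t ht
    simp only [enorm_eq_self]
    gcongr
  refine h1.trans ?_
  set c := eLpNorm h ⊤ μ with hc
  rcases eq_or_ne c ⊤ with hct | hct
  · rcases eq_or_ne (tnorm T q g) 0 with h0 | h0
    · have : g =ᵐ[μ] 0 := (eLpNorm_eq_zero_iff hg.aestronglyMeasurable
        (zero_lt_one.trans_le hq).ne').1 h0
      have h2 : (fun t => g t * c) =ᵐ[μ] 0 := by
        filter_upwards [this] with t ht
        simp [ht]
      rw [tnorm, eLpNorm_congr_ae h2]; simp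
    · have : tnorm T ⊤ h = ⊤ := hct
      rw [this, ENNReal.mul_top h0]; exact le_top
  · have := tnorm_const_mul (T := T) c.toReal (q := q) g
    rw [ofReal_toReal hct] at this
    simp_rw [mul_comm _ c]
    exact this.trans_eq (mul_comm _ _)

lemma timeHolder_top_left (q : ℝ≥0∞) (hq : 1 ≤ q) : TimeHolder ⊤ q q := by
  intro T g h hg hh
  have := timeHolder_top_right q hq T h g hh hg
  simp_rw [mul_comm (g _)]
  rwa [mul_comm]

lemma timeHolder_two : TimeHolder 2 2 1 := by
  intro T g h hg hh
  have := ENNReal.lintegral_mul_le_Lp_mul_Lq (volume.restrict (Ioo 0 T))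
    (Real.HolderConjugate.two_two) hg hh
  simp only [tnorm, eLpNorm_one_eq_lintegral_enorm, enorm_eq_self]
  rw [eLpNorm_eq_lintegral_rpow_enorm_toReal (by norm_num) (by norm_num),
    eLpNorm_eq_lintegral_rpow_enorm_toReal (by norm_num) (by norm_num)]
  simpa using this

/-- Semicontinuity in time of the spatial norms of continuous fields. -/
lemma isOpen_lt_eLpNorm {u : STField n} (hu : Cont T u) (r : ℝ≥0∞) (B : ℝ≥0∞) :
    IsOpen {t | t ∈ Ioo 0 T ∧ B < eLpNorm (u t) r volume} := by
  rw [isOpen_iff_mem_nhds]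
  rintro t ⟨ht, hB⟩
  by_contra hcon
  set S : Set ℝ := {s | s ∈ Ioo 0 T ∧ eLpNorm (u s) r volume ≤ B} with hS
  have hfr : ∃ᶠ s in 𝓝 t, s ∈ S := by
    intro hno
    apply hcon
    filter_upwards [hno, isOpen_Ioo.mem_nhds ht] with s hs hsI
    refine ⟨hsI, ?_⟩
    by_contra h
    exact hs ⟨hsI, not_lt.1 h⟩
  have hne : (𝓝[S] t).NeBot := frequently_mem_iff_neBot.1 hfr |>.mono le_rfl
  -- restrict to the slab, where the slices are measurable
  set v : ℝ → Space n → ℝ := fun s => if s ∈ Ioo 0 T then u s else 0 with hv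
  have hvm : ∀ s, AEStronglyMeasurable (v s) volume := by
    intro s
    by_cases hs : s ∈ Ioo 0 T
    · simp only [hv, if_pos hs]; exact (hu.slice hs).aestronglyMeasurable
    · simp only [hv, if_neg hs]; exact aestronglyMeasurable_const
  have := Lp.eLpNorm_le_of_ae_tendsto (u := 𝓝[S] t) (f := v) (g := u t) (p := r) (μ := volume)
    (C := B) (by
      filter_upwards [self_mem_nhdsWithin] with s hs
      simp only [hv, if_pos hs.1]; exact hs.2) hvm (Eventually.of_forall fun x => by
      have h1 : Tendsto (fun s => u s x) (𝓝[S] t) (𝓝 (u t x)) := by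
        have h2 : ContinuousAt (fun p : ℝ × Space n => u p.1 p.2) (t, x) :=
          ContinuousOn.continuousAt hu (isOpen_slab.mem_nhds (mem_slab ht x))
        have h3 : Tendsto (fun s : ℝ => ((s, x) : ℝ × Space n)) (𝓝 t) (𝓝 (t, x)) := by
          apply Continuous.tendsto'; fun_prop; rfl
        exact (h2.tendsto.comp h3).mono_left nhdsWithin_le_nhds
      refine h1.congr' ?_
      filter_upwards [self_mem_nhdsWithin] with s hs
      simp only [hv, if_pos hs.1])
  exact absurd hB (not_lt.2 this)

lemma Cont.aemeasurable_eLpNorm {u : STField n} (hu : Cont T u) (r : ℝ≥0∞) :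
    AEMeasurable (fun t => eLpNorm (u t) r volume) (volume.restrict (Ioo 0 T)) := by
  refine ⟨(Ioo 0 T).indicator fun t => eLpNorm (u t) r volume, ?_, ?_⟩
  · refine measurable_of_Ioi fun B => ?_
    have : ((Ioo 0 T).indicator fun t => eLpNorm (u t) r volume) ⁻¹' Ioi B =
        {t | t ∈ Ioo 0 T ∧ B < eLpNorm (u t) r volume} := by
      ext t
      by_cases ht : t ∈ Ioo 0 T
      · simp only [mem_preimage, indicator_of_mem ht, mem_Ioi, mem_ofPred_eq, ht, true_and]
      · simp only [mem_preimage, indicator_of_notMem ht, mem_Ioi, mem_ofPred_eq, ht, false_and,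
          iff_false, not_lt, zero_le]
    rw [this]
    exact (isOpen_lt_eLpNorm hu r B).measurableSet
  · exact ae_of_Ioo fun t ht => by rw [indicator_of_mem ht]

/-- The essential supremum in time is a supremum. -/
lemma Cont.eLpNorm_le_mixedNorm {u : STField n} (hu : Cont T u) (r : ℝ≥0∞) {t : ℝ}
    (ht : t ∈ Ioo 0 T) : eLpNorm (u t) r volume ≤ mixedNorm T ⊤ r u := by
  by_contra hcon
  push Not at hcon
  set S := {t | t ∈ Ioo 0 T ∧ mixedNorm T ⊤ r u < eLpNorm (u t) r volume} with hS
  have h0 : volume S = 0 := by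
    have h1 : ∀ᵐ t ∂(volume.restrict (Ioo 0 T)), eLpNorm (u t) r volume ≤ mixedNorm T ⊤ r u := by
      simp only [mixedNorm, eLpNorm_exponent_top]
      filter_upwards [ae_le_eLpNormEssSup (f := fun t => eLpNorm (u t) r volume)
        (μ := volume.restrict (Ioo 0 T))] with t ht
      simpa [eLpNorm_exponent_top] using ht
    rw [ae_restrict_iff' measurableSet_Ioo] at h1
    refine measure_mono_null (fun s hs => ?_) h1
    simp only [mem_compl_iff, mem_ofPred_eq, Classical.not_imp, not_le]
    exact hs
  have := (isOpen_lt_eLpNorm hu r (mixedNorm T ⊤ r u)).measure_eq_zero_iff volume |>.1 h0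
  exact (Set.eq_empty_iff_forall_notMem.1 this t) ⟨ht, hcon⟩

lemma mixedNorm_congr {q r : ℝ≥0∞} {u v : STField n}
    (h : ∀ t ∈ Ioo 0 T, ∀ x, u t x = v t x) : mixedNorm T q r u = mixedNorm T q r v := by
  refine eLpNorm_congr_ae (ae_of_Ioo fun t ht => ?_)
  simp only
  rw [show u t = v t from funext (h t ht)]

lemma mixedNorm_le_mul {q r r' : ℝ≥0∞} {u v : STField n} (c : ℝ)
    (h : ∀ t ∈ Ioo 0 T, eLpNorm (u t) r volume ≤ ofReal c * eLpNorm (v t) r' volume) :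
    mixedNorm T q r u ≤ ofReal c * mixedNorm T q r' v :=
  (tnorm_mono h).trans (tnorm_const_mul _ _)

lemma mixedNorm_const_mul {q r : ℝ≥0∞} (c : ℝ) (u : STField n) :
    mixedNorm T q r (fun t x => c * u t x) ≤ ofReal |c| * mixedNorm T q r u :=
  mixedNorm_le_mul _ fun t _ => by
    have := eLpNorm_const_smul_le (c := c) (f := u t) (p := r) (μ := volume)
    rw [Real.enorm_eq_ofReal_abs] at this
    exact this

lemma mixedNorm_add_le {q r : ℝ≥0∞} (hq : 1 ≤ q) (hr : 1 ≤ r) {u v : STField n} (hu : Cont T u)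
    (hv : Cont T v) : mixedNorm T q r (fun t x => u t x + v t x) ≤
      mixedNorm T q r u + mixedNorm T q r v :=
  (tnorm_mono fun _ ht => eLpNorm_add_le (hu.slice ht).aestronglyMeasurable
    (hv.slice ht).aestronglyMeasurable hr).trans
    (tnorm_add_le hq (hu.aemeasurable_eLpNorm r) (hv.aemeasurable_eLpNorm r))

lemma mixedNorm_sum_le {ι : Type*} (s : Finset ι) {q r : ℝ≥0∞} (hq : 1 ≤ q) (hr : 1 ≤ r)
    {u : ι → STField n} (hu : ∀ i ∈ s, Cont T (u i)) :
    mixedNorm T q r (fun t x => ∑ i ∈ s, u i t x) ≤ ∑ i ∈ s, mixedNorm T q r (u i) := by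
  refine (tnorm_mono fun t ht => ?_).trans
    (tnorm_sum_le s hq fun i hi => (hu i hi).aemeasurable_eLpNorm r)
  have := eLpNorm_sum_le (s := s) (f := fun i => u i t) (μ := volume)
    (fun i hi => ((hu i hi).slice ht).aestronglyMeasurable) hr
  rwa [show (∑ i ∈ s, u i t) = fun x => ∑ i ∈ s, u i t x from funext fun x => by simp] at this

lemma mixedNorm_le_tsum {q r : ℝ≥0∞} (hq : 1 ≤ q) {u : STField n} {v : ℕ → STField n}
    (hv : ∀ i, Cont T (v i))
    (h : ∀ t ∈ Ioo 0 T, eLpNorm (u t) r volume ≤ ∑' i, eLpNorm (v i t) r volume) :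
    mixedNorm T q r u ≤ ∑' i, mixedNorm T q r (v i) :=
  (tnorm_mono h).trans (tnorm_tsum_le hq fun i => (hv i).aemeasurable_eLpNorm r)

lemma eLpNorm_mul_le {r₁ r₂ r : ℝ≥0∞} [ENNReal.HolderTriple r₁ r₂ r] {f g : Space n → ℝ}
    (hf : AEStronglyMeasurable f volume) (hg : AEStronglyMeasurable g volume) :
    eLpNorm (fun x => f x * g x) r volume ≤ eLpNorm f r₁ volume * eLpNorm g r₂ volume := by
  have := eLpNorm_le_eLpNorm_mul_eLpNorm_of_nnnorm (p := r₁) (q := r₂) (r := r) hf hg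
    (fun a b : ℝ => a * b) 1 (Eventually.of_forall fun x => by simp [nnnorm_mul])
  simpa using this

lemma mixedNorm_mul_le {q₁ q₂ q : ℝ≥0∞} (hq : TimeHolder q₁ q₂ q) {r₁ r₂ r : ℝ≥0∞}
    [ENNReal.HolderTriple r₁ r₂ r] {f g : STField n} (hf : Cont T f) (hg : Cont T g) :
    mixedNorm T q r (fun t x => f t x * g t x) ≤ mixedNorm T q₁ r₁ f * mixedNorm T q₂ r₂ g :=
  (tnorm_mono fun _ ht => eLpNorm_mul_le (hf.slice ht).aestronglyMeasurable
    (hg.slice ht).aestronglyMeasurable).trans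
    (hq T _ _ (hf.aemeasurable_eLpNorm r₁) (hg.aemeasurable_eLpNorm r₂))

/-! ### The frequency decomposition of a product -/

/-- Continuous square integrable functions with summable high frequencies. -/
structure TameAt (η : Space n → ℝ) (f : Space n → ℝ) : Prop where
  memLp : MemLp f 2 volume
  cont : Continuous f
  tail : ∀ J : ℤ, ∑' i : ℕ, eLpNorm (PP η (J + 1 + i) f) 2 volume ≠ ⊤

lemma memLp_mul_one {f g : Space n → ℝ} (hf : MemLp f 2 volume) (hg : MemLp g 2 volume) :
    MemLp (fun x => f x * g x) 1 volume := hg.mul (p := 2) (q := 2) (r := 1) hf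

lemma memLp_add_fun {p : ℝ≥0∞} {f g : Space n → ℝ} (hf : MemLp f p volume)
    (hg : MemLp g p volume) : MemLp (fun x => f x + g x) p volume := hf.add hg

section product
variable {η : Space n → ℝ} (hη : IsCutoff η) {f g : Space n → ℝ}
include hη

lemma memLp_PP {p : ℝ≥0∞} (hp : 1 ≤ p) (hf : MemLp f p volume) (k : ℤ) :
    MemLp (PP η k f) p volume := ((isSymb_p0 hη).dil k).memLp_Op hp hf

lemma memLp_LL {p : ℝ≥0∞} (hp : 1 ≤ p) (hf : MemLp f p volume) (k : ℤ) :
    MemLp (LL η k f) p volume := ((isSymb_e0 hη).dil k).memLp_Op hp hf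

lemma TameAt.tendsto_sub (hf : TameAt η f) (J : ℤ) :
    Tendsto (fun m : ℕ => eLpNorm (fun x => f x - LL η (J + m) f x) 2 volume) atTop (𝓝 0) := by
  have h1 := ENNReal.tendsto_sum_nat_add _ (hf.tail J)
  refine tendsto_of_tendsto_of_tendsto_of_le_of_le tendsto_const_nhds h1 (fun _ => zero_le)
    fun m => ?_
  refine (eLpNorm_sub_LL_le_tsum hη one_le_two hf.memLp hf.cont (J + m) one_le_two).trans_eq ?_
  refine tsum_congr fun i => ?_
  congr 2; push_cast; ring

/-- The products of the low frequency parts approximate the product. -/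
lemma TameAt.tendsto_PP_mul (hf : TameAt η f) (hg : TameAt η g) (k J : ℤ) (x : Space n) :
    Tendsto (fun m : ℕ => PP η k (fun y => LL η (J + m) f y * LL η (J + m) g y) x) atTop
      (𝓝 (PP η k (fun y => f y * g y) x)) := by
  rw [tendsto_iff_edist_tendsto_0]
  set C := ofReal (kb (p0 η) * (2 : ℝ) ^ ((n : ℝ) * k * ((1 : ℝ≥0∞)⁻¹).toReal)) with hC
  have hb : ∀ m : ℕ, edist (PP η k (fun y => LL η (J + m) f y * LL η (J + m) g y) x)
      (PP η k (fun y => f y * g y) x) ≤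
      C * (eLpNorm (fun x => f x - LL η (J + m) f x) 2 volume * eLpNorm g 2 volume +
        ofReal (kb (e0 η)) * eLpNorm f 2 volume *
          eLpNorm (fun x => g x - LL η (J + m) g x) 2 volume) := by
    intro m
    have hf' := memLp_LL hη one_le_two hf.memLp (J + m)
    have hg' := memLp_LL hη one_le_two hg.memLp (J + m)
    rw [edist_comm, edist_eq_enorm_sub, PP, PP, ← Op_sub_fun ((isSymb_p0 hη).dil k) le_rfl le_rfl
      (memLp_mul_one hf.memLp hg.memLp) (memLp_mul_one hf' hg')]
    refine (enorm_Op_dil_le (isSymb_p0 hη) k le_rfl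
      ((memLp_mul_one hf.memLp hg.memLp).sub (memLp_mul_one hf' hg')).1 x).trans ?_
    gcongr
    have e : (fun y => f y * g y - LL η (J + m) f y * LL η (J + m) g y) =
        (fun y => (f y - LL η (J + m) f y) * g y) + fun y => LL η (J + m) f y *
          (g y - LL η (J + m) g y) := by
      ext y; simp only [Pi.add_apply]; ring
    refine (le_of_eq (congrArg (fun F => eLpNorm F 1 volume) e)).trans ?_
    have hfs := hf.memLp.sub hf'
    have hgs := hg.memLp.sub hg'
    refine (eLpNorm_add_le (memLp_mul_one hfs hg.memLp).1 (memLp_mul_one hf' hgs).1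
      le_rfl).trans (add_le_add ?_ ?_)
    · exact eLpNorm_mul_le hfs.1 hg.memLp.1
    · refine (eLpNorm_mul_le (r₁ := 2) (r₂ := 2) hf'.1 hgs.1).trans ?_
      gcongr
      · exact eLpNorm_Op_dil_le (isSymb_e0 hη) _ one_le_two hf.memLp.1
      · exact le_rfl
  refine tendsto_of_tendsto_of_tendsto_of_le_of_le tendsto_const_nhds ?_ (fun _ => zero_le) hb
  have h1 := ENNReal.Tendsto.mul_const (hf.tendsto_sub hη J) (b := eLpNorm g 2 volume)
    (Or.inr hg.memLp.2.ne)
  have h2 := ENNReal.Tendsto.const_mul (a := ofReal (kb (e0 η)) * eLpNorm f 2 volume)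
    (hg.tendsto_sub hη J) (Or.inr (mul_ne_top ofReal_ne_top hf.memLp.2.ne))
  have h3 := ENNReal.Tendsto.const_mul (a := C) (h1.add h2) (Or.inr ofReal_ne_top)
  simpa using h3

/-- The part of `P_k (f g)` in which the higher of the two frequencies is `2 ^ J`. -/
def piece (η : Space n → ℝ) (k J : ℤ) (f g : Space n → ℝ) : Space n → ℝ :=
  PP η k fun y => PP η J f y * LL η J g y + LL η (J - 1) f y * PP η J g y

lemma eLpNorm_PP_mul_le (hf : TameAt η f) (hg : TameAt η g) (k : ℤ) {r : ℝ≥0∞} (hr : 1 ≤ r) :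
    eLpNorm (PP η k fun y => f y * g y) r volume ≤
      ∑' i : ℕ, eLpNorm (piece η k (k - 4 + i) f g) r volume := by
  have hF : ∀ J, MemLp (LL η J f) 2 volume := memLp_LL hη one_le_two hf.memLp
  have hG : ∀ J, MemLp (LL η J g) 2 volume := memLp_LL hη one_le_two hg.memLp
  have hF' : ∀ J, MemLp (PP η J f) 2 volume := memLp_PP hη one_le_two hf.memLp
  have hG' : ∀ J, MemLp (PP η J g) 2 volume := memLp_PP hη one_le_two hg.memLp
  refine eLpNorm_le_tsum (fun i => ?_) (fun x => ?_) hr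
  · exact aestronglyMeasurable_PP hη
      ((memLp_mul_one (hF' _) (hG _)).add (memLp_mul_one (hF _) (hG' _))).1 k
  · have h1 : ∀ m : ℕ, ∑ i ∈ Finset.range m, piece η k (k - 4 + i) f g x =
        PP η k (fun y => LL η (k - 5 + m) f y * LL η (k - 5 + m) g y) x := by
      intro m
      induction m with
      | zero =>
        have := Op_mul_eq_zero ((isSymb_p0 hη).dil k) ((isSymb_e0 hη).dil (k - 5))
          ((isSymb_e0 hη).dil (k - 5)) (low_low hη (by omega) (by omega)) one_le_two one_le_two
          hf.memLp hg.memLp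
        simpa [PP, LL] using (congrFun this x).symm
      | succ m ih =>
        rw [Finset.sum_range_succ, ih, piece]
        have := Op_add ((isSymb_p0 hη).dil k) le_rfl
          le_rfl (memLp_mul_one (hF (k - 5 + m)) (hG (k - 5 + m)))
          (memLp_add_fun (memLp_mul_one (hF' (k - 4 + m)) (hG (k - 4 + m)))
            (memLp_mul_one (hF (k - 4 + m - 1)) (hG' (k - 4 + m)))) x
        refine this.symm.trans ?_
        unfold PP
        congr 1
        ext y
        change _ + (PP η (k - 4 + m) f y * _ + _ * PP η (k - 4 + m) g y) = _
        have e1 : k - 5 + ((m + 1 : ℕ) : ℤ) = k - 4 + m := by push_cast; ring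
        have e2 : k - 4 + (m : ℤ) - 1 = k - 5 + m := by ring
        rw [e1, PP_eq hη one_le_two hf.memLp, PP_eq hη one_le_two hg.memLp, e2]; ring
    simp_rw [h1]
    exact hf.tendsto_PP_mul hη hg k (k - 5) x

lemma LL_eq_sum (hf : MemLp f 2 volume) (J : ℤ) (x : Space n) :
    LL η J f x = ∑ d ∈ Finset.range 4, PP η (J - d) f x + LL η (J - 4) f x := by
  simp only [Finset.sum_range_succ, Finset.range_zero, Finset.sum_empty,
    PP_eq hη one_le_two hf]
  push_cast
  rw [show J - 1 - 1 = J - 2 by ring, show J - 2 - 1 = J - 3 by ring,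
    show J - 3 - 1 = J - 4 by ring, show J - 0 - 1 = J - 1 by ring, sub_zero]
  ring

/-- If the output frequency is much lower, then the two input frequencies are comparable. -/
lemma piece_eq_of_le (hf : MemLp f 2 volume) (hg : MemLp g 2 volume) {k J : ℤ} (h : k ≤ J - 6) :
    piece η k J f g = PP η k fun y => ∑ d ∈ Finset.range 4,
      (PP η J f y * PP η (J - d) g y + PP η (J - 1 - d) f y * PP η J g y) := by
  have hp := (isSymb_p0 hη).dil k
  have hF : ∀ J, MemLp (LL η J f) 2 volume := memLp_LL hη one_le_two hf
  have hG : ∀ J, MemLp (LL η J g) 2 volume := memLp_LL hη one_le_two hg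
  have hF' : ∀ J, MemLp (PP η J f) 2 volume := memLp_PP hη one_le_two hf
  have hG' : ∀ J, MemLp (PP η J g) 2 volume := memLp_PP hη one_le_two hg
  ext x
  have e : (fun y => PP η J f y * LL η J g y + LL η (J - 1) f y * PP η J g y) = fun y =>
      (∑ d ∈ Finset.range 4,
        (PP η J f y * PP η (J - d) g y + PP η (J - 1 - d) f y * PP η J g y)) +
      (PP η J f y * LL η (J - 4) g y + PP η J g y * LL η (J - 1 - 4) f y) := by
    ext y
    rw [LL_eq_sum hη hg, LL_eq_sum hη hf (J - 1), sum_add_distrib, ← mul_sum,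
      ← sum_mul]
    ring
  have z1 := Op_mul_eq_zero hp ((isSymb_p0 hη).dil J) ((isSymb_e0 hη).dil (J - 4))
    (high_low hη h le_rfl) one_le_two one_le_two hf hg
  have z2 := Op_mul_eq_zero hp ((isSymb_p0 hη).dil J) ((isSymb_e0 hη).dil (J - 1 - 4))
    (high_low hη h (by omega)) one_le_two one_le_two hg hf
  have hs : MemLp (fun y => ∑ d ∈ Finset.range 4,
      (PP η J f y * PP η (J - d) g y + PP η (J - 1 - d) f y * PP η J g y)) 1 volume :=
    memLp_finsetSum _ fun d _ =>
      (memLp_mul_one (hF' _) (hG' _)).add (memLp_mul_one (hF' _) (hG' _))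
  rw [piece, e, PP, Op_add hp le_rfl le_rfl hs
    (memLp_add_fun (memLp_mul_one (hF' _) (hG _)) (memLp_mul_one (hG' _) (hF _))),
    Op_add hp le_rfl le_rfl (memLp_mul_one (hF' _) (hG _)) (memLp_mul_one (hG' _) (hF _))]
  have z1' := congrFun z1 x
  have z2' := congrFun z2 x
  simp only [Pi.zero_apply] at z1' z2'
  simp only [PP, LL] at z1' z2' ⊢
  rw [z1', z2', add_zero, add_zero]

end product

/-! ### Products in mixed norms -/

/-- The mixed norm of the piece of frequency `2 ^ k`. -/
def pnorm (η : Space n → ℝ) (T : ℝ) (q r : ℝ≥0∞) (k : ℤ) (f : STField n) : ℝ≥0∞ :=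
  mixedNorm T q r fun t => PP η k (f t)

/-- Continuous fields which are bounded in `L²` and tame at each time. -/
structure Tame (η : Space n → ℝ) (T : ℝ) (f : STField n) : Prop where
  cont : Cont T f
  bdd : BddL T 2 f
  tail : ∀ t ∈ Ioo 0 T, ∀ J : ℤ, ∑' i : ℕ, eLpNorm (PP η (J + 1 + i) (f t)) 2 volume ≠ ⊤

lemma Tame.at {η : Space n → ℝ} {f : STField n} (hf : Tame η T f) {t : ℝ} (ht : t ∈ Ioo 0 T) :
    TameAt η (f t) := ⟨hf.bdd.memLp hf.cont ht, hf.cont.slice ht, hf.tail t ht⟩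

lemma BddL.mul {r₁ r₂ r : ℝ≥0∞} [ENNReal.HolderTriple r₁ r₂ r] {f g : STField n} (hf : Cont T f)
    (hg : Cont T g) (hfb : BddL T r₁ f) (hgb : BddL T r₂ g) :
    BddL T r (fun t x => f t x * g t x) := by
  obtain ⟨B, hB, hb⟩ := hfb
  obtain ⟨B', hB', hb'⟩ := hgb
  refine ⟨B * B', mul_ne_top hB hB', fun t ht => ?_⟩
  refine (eLpNorm_mul_le (r₁ := r₁) (r₂ := r₂) (hf.slice ht).aestronglyMeasurable
    (hg.slice ht).aestronglyMeasurable).trans ?_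
  gcongr
  exacts [hb t ht, hb' t ht]

lemma BddL.add {r : ℝ≥0∞} (hr : 1 ≤ r) {f g : STField n} (hf : Cont T f)
    (hg : Cont T g) (hfb : BddL T r f) (hgb : BddL T r g) :
    BddL T r (fun t x => f t x + g t x) := by
  obtain ⟨B, hB, hb⟩ := hfb
  obtain ⟨B', hB', hb'⟩ := hgb
  refine ⟨B + B', ENNReal.add_ne_top.2 ⟨hB, hB'⟩, fun t ht => ?_⟩
  exact (eLpNorm_add_le (hf.slice ht).aestronglyMeasurable
    (hg.slice ht).aestronglyMeasurable hr).trans (add_le_add (hb t ht) (hb' t ht))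

lemma IsSymb.bddL_Op {m : Space n → ℂ} (h : IsSymb m) {f : STField n} {p : ℝ≥0∞} (hp : 1 ≤ p)
    (hf : Cont T f) (hb : BddL T p f) : BddL T p (fun t => Op m (f t)) := by
  obtain ⟨B, hB, hb⟩ := hb
  refine ⟨ofReal (kb m) * B, mul_ne_top ofReal_ne_top hB, fun t ht => ?_⟩
  refine (eLpNorm_cnv_le h.kb_spec.2 (hf.slice ht).aestronglyMeasurable hp).trans ?_
  gcongr
  exact hb t ht

/-- Dyadic weights. -/
def wt (x : ℝ) : ℝ≥0∞ := ofReal ((2 : ℝ) ^ x)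

section product
variable {η : Space n → ℝ} (hη : IsCutoff η) {f g : STField n}
include hη

lemma Tame.cont_PP (hf : Tame η T f) (J : ℤ) : Cont T (fun t => PP η J (f t)) :=
  ((isSymb_p0 hη).dil J).cont_Op hf.cont one_le_two hf.bdd

lemma Tame.cont_LL (hf : Tame η T f) (J : ℤ) : Cont T (fun t => LL η J (f t)) :=
  ((isSymb_e0 hη).dil J).cont_Op hf.cont one_le_two hf.bdd

lemma Tame.bdd_PP (hf : Tame η T f) (J : ℤ) : BddL T 2 (fun t => PP η J (f t)) :=
  ((isSymb_p0 hη).dil J).bddL_Op one_le_two hf.cont hf.bdd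

lemma Tame.bdd_LL (hf : Tame η T f) (J : ℤ) : BddL T 2 (fun t => LL η J (f t)) :=
  ((isSymb_e0 hη).dil J).bddL_Op one_le_two hf.cont hf.bdd

lemma Tame.mixedNorm_LL_le (hf : Tame η T f) (hn : 1 ≤ n) {q r : ℝ≥0∞} (hq : 1 ≤ q) (hr : 1 ≤ r)
    (J : ℤ) : mixedNorm T q r (fun t => LL η J (f t)) ≤ ∑' l : ℕ, pnorm η T q r (J - l) f :=
  mixedNorm_le_tsum hq (fun l => hf.cont_PP hη _) fun _ ht =>
    eLpNorm_LL_le_tsum hη one_le_two (by norm_num) hn (hf.at ht).memLp J hr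

/-- The contribution of the frequencies `2 ^ J` to the norm of a product, when one factor has
this frequency and the other one a lower frequency. -/
def lowHigh (η : Space n → ℝ) (T : ℝ) (q₁ r₁ q₂ r₂ q₃ r₃ q₄ r₄ : ℝ≥0∞) (f g : STField n) (J : ℤ) :
    ℝ≥0∞ :=
  pnorm η T q₁ r₁ J f * ∑' l : ℕ, pnorm η T q₂ r₂ (J - l) g +
    (∑' l : ℕ, pnorm η T q₃ r₃ (J - 1 - l) f) * pnorm η T q₄ r₄ J g

/-- The contribution of the frequencies `2 ^ J` to the norm of a product, when both factors have
about this frequency. -/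
def highHigh (η : Space n → ℝ) (T : ℝ) (q₁ r₁ q₂ r₂ : ℝ≥0∞) (f g : STField n) (J : ℤ) : ℝ≥0∞ :=
  ∑ d ∈ Finset.range 4, (pnorm η T q₁ r₁ J f * pnorm η T q₂ r₂ (J - d) g +
    pnorm η T q₁ r₁ (J - 1 - d) f * pnorm η T q₂ r₂ J g)

lemma mixedNorm_piece_le (hf : Tame η T f) (hg : Tame η T g) (hn : 1 ≤ n) (k J : ℤ)
    {q r q₁ r₁ q₂ r₂ q₃ r₃ q₄ r₄ : ℝ≥0∞} (hq : 1 ≤ q) (hr : 1 ≤ r)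
    [ENNReal.HolderTriple r₁ r₂ r] [ENNReal.HolderTriple r₃ r₄ r]
    (h12 : TimeHolder q₁ q₂ q) (h34 : TimeHolder q₃ q₄ q)
    (hq2 : 1 ≤ q₂) (hr2 : 1 ≤ r₂) (hq3 : 1 ≤ q₃) (hr3 : 1 ≤ r₃) :
    mixedNorm T q r (fun t => piece η k J (f t) (g t)) ≤
      ofReal (kb (p0 η)) * lowHigh η T q₁ r₁ q₂ r₂ q₃ r₃ q₄ r₄ f g J := by
  have c1 := (hf.cont_PP hη J).mul (hg.cont_LL hη J)
  have c2 := (hf.cont_LL hη (J - 1)).mul (hg.cont_PP hη J)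
  refine (mixedNorm_le_mul (r' := r) (v := fun t y => PP η J (f t) y * LL η J (g t) y +
    LL η (J - 1) (f t) y * PP η J (g t) y) (kb (p0 η)) fun t ht =>
      eLpNorm_Op_dil_le (isSymb_p0 hη) k hr ((c1.add c2).slice ht).aestronglyMeasurable).trans ?_
  refine mul_le_mul' le_rfl ((mixedNorm_add_le hq hr c1 c2).trans (add_le_add ?_ ?_))
  · refine (mixedNorm_mul_le h12 (r₁ := r₁) (r₂ := r₂) (hf.cont_PP hη J) (hg.cont_LL hη J)).trans ?_
    exact mul_le_mul' le_rfl (hg.mixedNorm_LL_le hη hn hq2 hr2 J)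
  · refine (mixedNorm_mul_le h34 (r₁ := r₃) (r₂ := r₄) (hf.cont_LL hη _) (hg.cont_PP hη J)).trans ?_
    exact mul_le_mul' (hf.mixedNorm_LL_le hη hn hq3 hr3 _) le_rfl

lemma mixedNorm_piece_le_of_le (hf : Tame η T f) (hg : Tame η T g) {k J : ℤ} (hk : k ≤ J - 6)
    {q r q₁ r₁ q₂ r₂ p : ℝ≥0∞} (hq : 1 ≤ q) (hp : 1 ≤ p) (hpr : p ≤ r)
    [ENNReal.HolderTriple r₁ r₂ p] (h12 : TimeHolder q₁ q₂ q) :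
    mixedNorm T q r (fun t => piece η k J (f t) (g t)) ≤
      ofReal (kb (p0 η)) * wt ((n : ℝ) * k * ((p⁻¹).toReal - (r⁻¹).toReal)) *
        highHigh η T q₁ r₁ q₂ r₂ f g J := by
  have c1 : ∀ J J' : ℤ, Cont T (fun t y => PP η J (f t) y * PP η J' (g t) y) := fun J J' =>
    (hf.cont_PP hη J).mul (hg.cont_PP hη J')
  have c2 : Cont T (fun t y => ∑ d ∈ Finset.range 4, (PP η J (f t) y * PP η (J - d) (g t) y +
    PP η (J - 1 - d) (f t) y * PP η J (g t) y)) := Cont.sum _ fun d _ => (c1 _ _).add (c1 _ _)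
  have h1 := mixedNorm_le_mul (q := q) (r := r) (r' := p)
    (u := fun t => piece η k J (f t) (g t)) (v := fun t y => ∑ d ∈ Finset.range 4,
      (PP η J (f t) y * PP η (J - d) (g t) y + PP η (J - 1 - d) (f t) y * PP η J (g t) y))
    (kb (p0 η) * (2 : ℝ) ^ ((n : ℝ) * k * ((p⁻¹).toReal - (r⁻¹).toReal))) fun t ht => by
      rw [piece_eq_of_le hη (hf.at ht).memLp (hg.at ht).memLp hk]
      exact eLpNorm_Op_dil_le_bernstein (isSymb_p0 hη) k hp hpr (c2.slice ht).aestronglyMeasurable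
  rw [ofReal_mul (by linarith [one_le_kb (p0 η)])] at h1
  refine h1.trans (mul_le_mul' le_rfl ?_)
  refine (mixedNorm_sum_le _ hq hp fun d _ => (c1 _ _).add (c1 _ _)).trans ?_
  refine sum_le_sum fun d _ => ?_
  refine (mixedNorm_add_le hq hp (c1 _ _) (c1 _ _)).trans (add_le_add ?_ ?_)
  · exact mixedNorm_mul_le h12 (hf.cont_PP hη _) (hg.cont_PP hη _)
  · exact mixedNorm_mul_le h12 (hf.cont_PP hη _) (hg.cont_PP hη _)

/-- The frequency pieces of a product, in terms of those of the factors. -/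
theorem pnorm_mul_le (hf : Tame η T f) (hg : Tame η T g) (hn : 1 ≤ n) (k : ℤ)
    {q r q₁ r₁ q₂ r₂ q₃ r₃ q₄ r₄ q₅ r₅ q₆ r₆ p : ℝ≥0∞} (hq : 1 ≤ q) (hr : 1 ≤ r)
    [ENNReal.HolderTriple r₁ r₂ r] [ENNReal.HolderTriple r₃ r₄ r] [ENNReal.HolderTriple r₅ r₆ p]
    (h12 : TimeHolder q₁ q₂ q) (h34 : TimeHolder q₃ q₄ q) (h56 : TimeHolder q₅ q₆ q)
    (hq2 : 1 ≤ q₂) (hr2 : 1 ≤ r₂) (hq3 : 1 ≤ q₃) (hr3 : 1 ≤ r₃) (hp : 1 ≤ p) (hpr : p ≤ r) :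
    pnorm η T q r k (fun t x => f t x * g t x) ≤ ofReal (kb (p0 η)) *
      (∑ i ∈ Finset.range 10, lowHigh η T q₁ r₁ q₂ r₂ q₃ r₃ q₄ r₄ f g (k - 4 + i) +
        wt ((n : ℝ) * k * ((p⁻¹).toReal - (r⁻¹).toReal)) *
          ∑' i : ℕ, highHigh η T q₅ r₅ q₆ r₆ f g (k + 6 + i)) := by
  have hc : ∀ J, Cont T (fun t => piece η k J (f t) (g t)) := by
    intro J
    have c1 := (hf.cont_PP hη J).mul (hg.cont_LL hη J)
    have c2 := (hf.cont_LL hη (J - 1)).mul (hg.cont_PP hη J)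
    refine ((isSymb_p0 hη).dil k).cont_Op (c1.add c2) le_rfl (BddL.add le_rfl c1 c2 ?_ ?_)
    · exact BddL.mul (r₁ := 2) (r₂ := 2) (hf.cont_PP hη J) (hg.cont_LL hη J) (hf.bdd_PP hη J)
        (hg.bdd_LL hη J)
    · exact BddL.mul (r₁ := 2) (r₂ := 2) (hf.cont_LL hη _) (hg.cont_PP hη J) (hf.bdd_LL hη _)
        (hg.bdd_PP hη J)
  refine (mixedNorm_le_tsum hq (v := fun i t => piece η k (k - 4 + i) (f t) (g t))
    (fun i => hc _) fun t ht => eLpNorm_PP_mul_le hη (hf.at ht) (hg.at ht) k hr).trans ?_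
  rw [← Summable.sum_add_tsum_nat_add' (k := 10) ENNReal.summable, mul_add, mul_sum]
  refine add_le_add (sum_le_sum fun i _ => ?_) ?_
  · exact mixedNorm_piece_le hη hf hg hn k _ hq hr h12 h34 hq2 hr2 hq3 hr3
  · rw [← mul_assoc, ← ENNReal.tsum_mul_left]
    refine ENNReal.tsum_le_tsum fun i => ?_
    have e : k - 4 + ((i + 10 : ℕ) : ℤ) = k + 6 + i := by push_cast; ring
    rw [e]
    exact mixedNorm_piece_le_of_le hη hf hg (by omega) hq hp hpr h56

end product

/-! ### Dyadic sums -/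

lemma wt_add (x y : ℝ) : wt (x + y) = wt x * wt y := by
  rw [wt, Real.rpow_add (by norm_num), ofReal_mul (by positivity)]; rfl

lemma wt_mono {x y : ℝ} (h : x ≤ y) : wt x ≤ wt y :=
  ofReal_le_ofReal (Real.rpow_le_rpow_of_exponent_le (by norm_num) h)

@[simp] lemma wt_zero : wt 0 = 1 := by simp [wt]

lemma wt_ne_top (x : ℝ) : wt x ≠ ⊤ := ofReal_ne_top

lemma one_le_wt {x : ℝ} (h : 0 ≤ x) : 1 ≤ wt x := wt_zero ▸ wt_mono h

lemma wt_neg_mul (x : ℝ) : wt (-x) * wt x = 1 := by rw [← wt_add]; simp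

/-- The geometric series of ratio `2 ^ (-δ)`. -/
def geo (δ : ℝ) : ℝ≥0∞ := ∑' i : ℕ, wt (-(δ * i))

lemma geo_ne_top {δ : ℝ} (h : 0 < δ) : geo δ ≠ ⊤ := by
  have h1 : ∀ i : ℕ, wt (-(δ * i)) = wt (-δ) ^ i := by
    intro i
    rw [wt, wt, ← ENNReal.ofReal_pow (by positivity), ← Real.rpow_natCast,
      ← Real.rpow_mul (by norm_num)]
    congr 2; ring
  simp only [geo, h1]
  rw [ENNReal.tsum_geometric]
  refine ENNReal.inv_ne_top.2 (tsub_pos_of_lt ?_).ne'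
  rw [wt, ← ENNReal.ofReal_one]
  exact (ENNReal.ofReal_lt_ofReal_iff one_pos).2
    (Real.rpow_lt_one_of_one_lt_of_neg (by norm_num) (by linarith))

/-- Sequences of exponential growth at most `σ`. -/
def Grow (σ : ℝ) (A : ℝ≥0∞) (e : ℤ → ℝ≥0∞) : Prop :=
  ∀ k l : ℤ, e k ≤ A * wt (σ * |((k - l : ℤ) : ℝ)|) * e l

lemma grow_const {A : ℝ≥0∞} (hA : 1 ≤ A) (c : ℝ≥0∞) : Grow 0 A fun _ => c := fun k l => by
  simpa using le_mul_of_one_le_left' hA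

lemma Grow.le {σ : ℝ} {A : ℝ≥0∞} {e : ℤ → ℝ≥0∞} (h : Grow σ A e) (hσ : 0 ≤ σ) {k l : ℤ} {x : ℝ}
    (hx : |((k - l : ℤ) : ℝ)| ≤ x) : e k ≤ A * wt (σ * x) * e l :=
  (h k l).trans (mul_le_mul' (mul_le_mul' le_rfl (wt_mono (by gcongr))) le_rfl)

lemma Grow.tsum_low_le {σ β δ : ℝ} {A M : ℝ≥0∞} {e : ℤ → ℝ≥0∞} (h : Grow σ A e) (hδ : δ ≤ β - σ)
    {J : ℤ} {b : ℤ → ℝ≥0∞} (hb : ∀ l ≤ J, b l ≤ M * wt (β * l) * e l) :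
    ∑' i : ℕ, b (J - i) ≤ M * (A * geo δ) * wt (β * J) * e J := by
  have h1 : ∀ i : ℕ, b (J - i) ≤ M * A * wt (β * J) * e J * wt (-(δ * i)) := by
    intro i
    have h2 := h (J - i) J
    have e1 : |((J - i - J : ℤ) : ℝ)| = i := by push_cast; simp
    rw [e1] at h2
    calc b (J - i) ≤ M * wt (β * (J - i : ℤ)) * (A * wt (σ * i) * e J) :=
          (hb _ (by omega)).trans (by gcongr)
      _ = M * A * e J * wt (β * J + (-(β - σ) * i)) := by
          rw [show β * J + (-(β - σ) * i) = β * (J - i : ℤ) + σ * i by push_cast; ring, wt_add]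
          ring
      _ ≤ M * A * e J * wt (β * J + (-(δ * i))) := by
          refine mul_le_mul' le_rfl (wt_mono ?_)
          have : δ * i ≤ (β - σ) * i := by gcongr
          linarith
      _ = _ := by rw [wt_add]; ring
  refine (ENNReal.tsum_le_tsum h1).trans_eq ?_
  rw [ENNReal.tsum_mul_left, geo]
  ring

lemma abs_mul_le_of {a x L X : ℝ} (ha : |a| ≤ L) (hx : |x| ≤ X) : a * x ≤ L * X := by
  refine (le_abs_self _).trans ?_
  rw [abs_mul]
  exact mul_le_mul ha hx (abs_nonneg _) ((abs_nonneg _).trans ha)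

/-- The constant in the product estimates. -/
def mulConst (η : Space n → ℝ) (A : ℝ≥0∞) (L δ : ℝ) : ℝ≥0∞ :=
  ofReal (kb (p0 η)) * (10 * (A * A * A * geo δ * wt (12 + 12 * L)))

lemma mulConst_ne_top (η : Space n → ℝ) {A : ℝ≥0∞} (hA : A ≠ ⊤) (L : ℝ) {δ : ℝ} (hδ : 0 < δ) :
    mulConst η A L δ ≠ ⊤ := by
  have h1 := geo_ne_top hδ
  have h2 := wt_ne_top (12 + 12 * L)
  unfold mulConst
  finiteness

section numeric
variable {η : Space n → ℝ} {σ σ' δ L : ℝ} {A : ℝ≥0∞} {e e' : ℤ → ℝ≥0∞} (he : Grow σ A e)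
  (he' : Grow σ' A e') (hσ : 0 ≤ σ) (hσ1 : σ ≤ 1) (hσ' : 0 ≤ σ') (hσ1' : σ' ≤ 1) {f g : STField n}
include he he' hσ hσ1 hσ' hσ1'

lemma lowHigh_le {q₁ r₁ q₂ r₂ q₃ r₃ q₄ r₄ : ℝ≥0∞} {M₁ M₂ M₃ M₄ : ℝ≥0∞} {α₁ β₂ β₃ α₄ : ℝ}
    (h1 : |α₁| ≤ L) (h2 : |β₂| ≤ L) (h3 : |β₃| ≤ L) (h4 : |α₄| ≤ L) (hβ₂ : δ ≤ β₂ - σ')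
    (hβ₃ : δ ≤ β₃ - σ) {k J : ℤ} (hJ : k - 4 ≤ J) (hJ' : J ≤ k + 5)
    (b1 : pnorm η T q₁ r₁ J f ≤ M₁ * wt (α₁ * J) * e J)
    (b2 : ∀ l ≤ k + 5, pnorm η T q₂ r₂ l g ≤ M₂ * wt (β₂ * l) * e' l)
    (b3 : ∀ l ≤ k + 5, pnorm η T q₃ r₃ l f ≤ M₃ * wt (β₃ * l) * e l)
    (b4 : pnorm η T q₄ r₄ J g ≤ M₄ * wt (α₄ * J) * e' J) :
    lowHigh η T q₁ r₁ q₂ r₂ q₃ r₃ q₄ r₄ f g J ≤ A * A * A * geo δ * wt (12 + 12 * L) *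
      ((M₁ * M₂ * wt ((α₁ + β₂) * k) + M₃ * M₄ * wt ((β₃ + α₄) * k)) * (e k * e' k)) := by
  have hJk : |((J - k : ℤ) : ℝ)| ≤ 6 := by
    rw [← Int.cast_abs]; exact_mod_cast abs_le.2 ⟨by omega, by omega⟩
  have hJk1 : |((J - 1 - k : ℤ) : ℝ)| ≤ 6 := by
    rw [← Int.cast_abs]; exact_mod_cast abs_le.2 ⟨by omega, by omega⟩
  have t2 := he'.tsum_low_le (δ := δ) hβ₂ (J := J) fun l hl => b2 l (by omega)
  have t3 := he.tsum_low_le (δ := δ) hβ₃ (J := J - 1) fun l hl => b3 l (by omega)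
  have mon : ∀ {s : ℝ}, s ≤ 1 → wt (s * 6) ≤ wt 6 := fun hs => wt_mono (by nlinarith)
  have eJ : e J ≤ A * wt 6 * e k := (he.le hσ hJk).trans
    (mul_le_mul' (mul_le_mul' le_rfl (mon hσ1)) le_rfl)
  have eJ1 : e (J - 1) ≤ A * wt 6 * e k := (he.le hσ hJk1).trans
    (mul_le_mul' (mul_le_mul' le_rfl (mon hσ1)) le_rfl)
  have eJ' : e' J ≤ A * wt 6 * e' k := (he'.le hσ' hJk).trans
    (mul_le_mul' (mul_le_mul' le_rfl (mon hσ1')) le_rfl)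
  have w12 : wt (12 + 12 * L) = wt 6 * wt 6 * wt (12 * L) := by
    rw [← wt_add, ← wt_add]; congr 1; ring
  have w1 : wt (α₁ * J) * wt (β₂ * J) ≤ wt (12 * L) * wt ((α₁ + β₂) * k) := by
    rw [← wt_add, ← wt_add]
    refine wt_mono ?_
    have a1 := abs_mul_le_of h1 hJk
    have a2 := abs_mul_le_of h2 hJk
    push_cast at a1 a2
    linarith
  have w2 : wt (β₃ * (J - 1 : ℤ)) * wt (α₄ * J) ≤ wt (12 * L) * wt ((β₃ + α₄) * k) := by
    rw [← wt_add, ← wt_add]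
    refine wt_mono ?_
    have a1 := abs_mul_le_of h3 hJk1
    have a2 := abs_mul_le_of h4 hJk
    push_cast at a1 a2 ⊢
    linarith
  rw [lowHigh, add_mul (M₁ * M₂ * _), mul_add]
  refine add_le_add ?_ ?_
  · calc pnorm η T q₁ r₁ J f * ∑' l : ℕ, pnorm η T q₂ r₂ (J - l) g
        ≤ (M₁ * wt (α₁ * J) * e J) * (M₂ * (A * geo δ) * wt (β₂ * J) * e' J) := by gcongr
      _ = M₁ * M₂ * A * geo δ * (wt (α₁ * J) * wt (β₂ * J)) * (e J * e' J) := by ring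
      _ ≤ M₁ * M₂ * A * geo δ * (wt (12 * L) * wt ((α₁ + β₂) * k)) *
          ((A * wt 6 * e k) * (A * wt 6 * e' k)) := by gcongr
      _ = _ := by rw [w12]; ring
  · calc (∑' l : ℕ, pnorm η T q₃ r₃ (J - 1 - l) f) * pnorm η T q₄ r₄ J g
        ≤ (M₃ * (A * geo δ) * wt (β₃ * (J - 1 : ℤ)) * e (J - 1)) * (M₄ * wt (α₄ * J) * e' J) := by
          gcongr
      _ = M₃ * M₄ * A * geo δ * (wt (β₃ * (J - 1 : ℤ)) * wt (α₄ * J)) * (e (J - 1) * e' J) := by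
          ring
      _ ≤ M₃ * M₄ * A * geo δ * (wt (12 * L) * wt ((β₃ + α₄) * k)) *
          ((A * wt 6 * e k) * (A * wt 6 * e' k)) := by gcongr
      _ = _ := by rw [w12]; ring

omit hσ1 hσ1' in
lemma highHigh_le {q₅ r₅ q₆ r₆ : ℝ≥0∞} {M₅ M₆ : ℝ≥0∞} {γ₅ γ₆ : ℝ}
    (h5 : |γ₅| ≤ L) (h6 : |γ₆| ≤ L) (hδ : 0 ≤ δ) (hγ : γ₅ + γ₆ + σ + σ' ≤ -δ) {k : ℤ}
    (b5 : ∀ l ≥ k, pnorm η T q₅ r₅ l f ≤ M₅ * wt (γ₅ * l) * e l)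
    (b6 : ∀ l ≥ k, pnorm η T q₆ r₆ l g ≤ M₆ * wt (γ₆ * l) * e' l) (i : ℕ) :
    highHigh η T q₅ r₅ q₆ r₆ f g (k + 6 + i) ≤ 8 * (A * A * wt (4 * L) *
      (M₅ * M₆ * wt ((γ₅ + γ₆) * k)) * (e k * e' k)) * wt (-(δ * i)) := by
  have hL : 0 ≤ L := (abs_nonneg _).trans h5
  have key : ∀ a b : ℕ, a ≤ 6 + i → b ≤ 6 + i → 6 + i - a ≤ 4 → 6 + i - b ≤ 4 →
      (6 + i - a = 0 ∨ 6 + i - b = 0) →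
      pnorm η T q₅ r₅ (k + a) f * pnorm η T q₆ r₆ (k + b) g ≤ A * A * wt (4 * L) *
      (M₅ * M₆ * wt ((γ₅ + γ₆) * k)) * (e k * e' k) * wt (-(δ * i)) := by
    intro a b ha hb ha' hb' hab
    have ha2 : (a : ℝ) ≤ 6 + i := by exact_mod_cast ha
    have hb2 : (b : ℝ) ≤ 6 + i := by exact_mod_cast hb
    have e1 : e (k + a) ≤ A * wt (σ * (6 + i)) * e k := he.le hσ (by
      push_cast; rw [add_sub_cancel_left, abs_of_nonneg (by positivity)]; exact ha2)
    have e2 : e' (k + b) ≤ A * wt (σ' * (6 + i)) * e' k := he'.le hσ' (by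
      push_cast; rw [add_sub_cancel_left, abs_of_nonneg (by positivity)]; exact hb2)
    have hw : wt (γ₅ * (k + a : ℤ)) * wt (γ₆ * (k + b : ℤ)) * (wt (σ * (6 + i)) *
        wt (σ' * (6 + i))) ≤ wt (4 * L) * wt ((γ₅ + γ₆) * k) * wt (-(δ * i)) := by
      rw [← wt_add, ← wt_add, ← wt_add, ← wt_add, ← wt_add]
      refine wt_mono ?_
      have h7 : (γ₅ + γ₆ + σ + σ') * (6 + i : ℝ) ≤ -δ * (6 + i) := by gcongr
      have h8 : -γ₅ * (6 + i - a : ℝ) + -γ₆ * (6 + i - b : ℝ) ≤ L * 4 := by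
        have x5 : (6 + i - a : ℝ) ≤ 4 := by
          have : 6 + i ≤ a + 4 := by omega
          have : (6 + i : ℝ) ≤ a + 4 := by exact_mod_cast this
          linarith
        have x6 : (6 + i - b : ℝ) ≤ 4 := by
          have : 6 + i ≤ b + 4 := by omega
          have : (6 + i : ℝ) ≤ b + 4 := by exact_mod_cast this
          linarith
        have a5 := abs_mul_le_of (a := -γ₅) (L := L) (by rwa [abs_neg])
          (abs_le.2 ⟨by linarith, x5⟩ : |(6 + i - a : ℝ)| ≤ 4)
        have a6 := abs_mul_le_of (a := -γ₆) (L := L) (by rwa [abs_neg])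
          (abs_le.2 ⟨by linarith, x6⟩ : |(6 + i - b : ℝ)| ≤ 4)
        rcases hab with h | h
        · have : (6 + i : ℝ) = a := by
            have : 6 + i = a := by omega
            exact_mod_cast this
          rw [← this, sub_self, mul_zero, zero_add]
          exact a6
        · have : (6 + i : ℝ) = b := by
            have : 6 + i = b := by omega
            exact_mod_cast this
          rw [← this, sub_self, mul_zero, add_zero]
          exact a5
      push_cast
      nlinarith
    calc pnorm η T q₅ r₅ (k + a) f * pnorm η T q₆ r₆ (k + b) g
        ≤ (M₅ * wt (γ₅ * (k + a : ℤ)) * (A * wt (σ * (6 + i)) * e k)) *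
          (M₆ * wt (γ₆ * (k + b : ℤ)) * (A * wt (σ' * (6 + i)) * e' k)) := by
          refine mul_le_mul' ((b5 _ (by omega)).trans ?_) ((b6 _ (by omega)).trans ?_) <;> gcongr
      _ = M₅ * M₆ * A * A * (e k * e' k) * (wt (γ₅ * (k + a : ℤ)) * wt (γ₆ * (k + b : ℤ)) *
          (wt (σ * (6 + i)) * wt (σ' * (6 + i)))) := by ring
      _ ≤ M₅ * M₆ * A * A * (e k * e' k) *
          (wt (4 * L) * wt ((γ₅ + γ₆) * k) * wt (-(δ * i))) := by gcongr
      _ = _ := by ring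
  have hd : ∀ d ∈ Finset.range 4,
      pnorm η T q₅ r₅ (k + 6 + i) f * pnorm η T q₆ r₆ (k + 6 + i - d) g +
      pnorm η T q₅ r₅ (k + 6 + i - 1 - d) f * pnorm η T q₆ r₆ (k + 6 + i) g ≤
      2 * (A * A * wt (4 * L) * (M₅ * M₆ * wt ((γ₅ + γ₆) * k)) * (e k * e' k) *
        wt (-(δ * i))) := by
    intro d hd
    rw [Finset.mem_range] at hd
    rw [two_mul]
    have k1 := key (6 + i) (6 + i - d) le_rfl (by omega) (by omega) (by omega) (by omega)
    have k2 := key (6 + i - 1 - d) (6 + i) (by omega) le_rfl (by omega) (by omega) (by omega)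
    rw [show k + ((6 + i : ℕ) : ℤ) = k + 6 + i by push_cast; ring,
      show k + ((6 + i - d : ℕ) : ℤ) = k + 6 + i - d by omega] at k1
    rw [show k + ((6 + i : ℕ) : ℤ) = k + 6 + i by push_cast; ring,
      show k + ((6 + i - 1 - d : ℕ) : ℤ) = k + 6 + i - 1 - d by omega] at k2
    exact add_le_add k1 k2
  refine (sum_le_sum hd).trans_eq ?_
  rw [Finset.sum_const, Finset.card_range, nsmul_eq_mul]
  push_cast; ring

/-- The estimate of the frequency pieces of a product from estimates of those of the factors. -/
theorem pnorm_mul_le_of_bounds (hη : IsCutoff η) (hf : Tame η T f) (hg : Tame η T g) (hn : 1 ≤ n)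
    (hA : 1 ≤ A) (k : ℤ) {q r q₁ r₁ q₂ r₂ q₃ r₃ q₄ r₄ q₅ r₅ q₆ r₆ p : ℝ≥0∞}
    (hq : 1 ≤ q) (hr : 1 ≤ r)
    [ENNReal.HolderTriple r₁ r₂ r] [ENNReal.HolderTriple r₃ r₄ r] [ENNReal.HolderTriple r₅ r₆ p]
    (h12 : TimeHolder q₁ q₂ q) (h34 : TimeHolder q₃ q₄ q) (h56 : TimeHolder q₅ q₆ q)
    (hq2 : 1 ≤ q₂) (hr2 : 1 ≤ r₂) (hq3 : 1 ≤ q₃) (hr3 : 1 ≤ r₃) (hp : 1 ≤ p) (hpr : p ≤ r)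
    {M₁ M₂ M₃ M₄ M₅ M₆ : ℝ≥0∞} {α₁ β₂ β₃ α₄ γ₅ γ₆ : ℝ}
    (h1 : |α₁| ≤ L) (h2 : |β₂| ≤ L) (h3 : |β₃| ≤ L) (h4 : |α₄| ≤ L) (h5 : |γ₅| ≤ L)
    (h6 : |γ₆| ≤ L) (hδ : 0 ≤ δ) (hβ₂ : δ ≤ β₂ - σ') (hβ₃ : δ ≤ β₃ - σ)
    (hγ : γ₅ + γ₆ + σ + σ' ≤ -δ)
    (b1 : ∀ l ≤ k + 5, pnorm η T q₁ r₁ l f ≤ M₁ * wt (α₁ * l) * e l)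
    (b2 : ∀ l ≤ k + 5, pnorm η T q₂ r₂ l g ≤ M₂ * wt (β₂ * l) * e' l)
    (b3 : ∀ l ≤ k + 5, pnorm η T q₃ r₃ l f ≤ M₃ * wt (β₃ * l) * e l)
    (b4 : ∀ l ≤ k + 5, pnorm η T q₄ r₄ l g ≤ M₄ * wt (α₄ * l) * e' l)
    (b5 : ∀ l ≥ k, pnorm η T q₅ r₅ l f ≤ M₅ * wt (γ₅ * l) * e l)
    (b6 : ∀ l ≥ k, pnorm η T q₆ r₆ l g ≤ M₆ * wt (γ₆ * l) * e' l) :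
    pnorm η T q r k (fun t x => f t x * g t x) ≤ mulConst η A L δ *
      ((M₁ * M₂ * wt ((α₁ + β₂) * k) + M₃ * M₄ * wt ((β₃ + α₄) * k) +
        M₅ * M₆ * wt ((n * ((p⁻¹).toReal - (r⁻¹).toReal) + (γ₅ + γ₆)) * k)) * (e k * e' k)) := by
  have hL : 0 ≤ L := (abs_nonneg _).trans h5
  refine (pnorm_mul_le hη hf hg hn k (q₁ := q₁) (r₁ := r₁) (q₂ := q₂) (r₂ := r₂) (q₃ := q₃)
    (r₃ := r₃) (q₄ := q₄) (r₄ := r₄) (q₅ := q₅) (r₅ := r₅) (q₆ := q₆) (r₆ := r₆) (p := p)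
    hq hr h12 h34 h56 hq2 hr2 hq3 hr3 hp hpr).trans ?_
  rw [mulConst, mul_assoc (ofReal _)]
  refine mul_le_mul' le_rfl ?_
  rw [add_mul _ (M₅ * M₆ * _), mul_add]
  refine add_le_add ?_ ?_
  · have := sum_le_sum (s := Finset.range 10) fun i hi => by
      rw [Finset.mem_range] at hi
      exact lowHigh_le (T := T) (η := η) (f := f) (g := g) he he' hσ hσ1 hσ' hσ1' h1 h2 h3 h4 hβ₂
        hβ₃ (k := k) (J := k - 4 + (i : ℕ)) (by omega) (by omega) (b1 _ (by omega)) b2 b3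
        (b4 _ (by omega))
    refine this.trans_eq ?_
    rw [Finset.sum_const, Finset.card_range, nsmul_eq_mul]
    push_cast; ring
  · have := ENNReal.tsum_le_tsum fun i => highHigh_le (T := T) (η := η) (f := f) (g := g) he he'
      hσ hσ' h5 h6 hδ hγ b5 b6 i
    rw [ENNReal.tsum_mul_left] at this
    calc _ ≤ wt ((n : ℝ) * k * ((p⁻¹).toReal - (r⁻¹).toReal)) * (8 * (A * A * wt (4 * L) *
          (M₅ * M₆ * wt ((γ₅ + γ₆) * k)) * (e k * e' k)) * geo δ) := mul_le_mul' le_rfl this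
      _ = 8 * ((1 * A * A * geo δ * wt (4 * L)) * (M₅ * M₆ * wt ((n * ((p⁻¹).toReal -
          (r⁻¹).toReal) + (γ₅ + γ₆)) * k) * (e k * e' k))) := by
          rw [add_mul (_ * _) (_ + _), wt_add,
            show (n : ℝ) * k * ((p⁻¹).toReal - (r⁻¹).toReal) =
              n * ((p⁻¹).toReal - (r⁻¹).toReal) * k by ring]
          ring
      _ ≤ 10 * ((A * A * A * geo δ * wt (12 + 12 * L)) * (M₅ * M₆ * wt ((n * ((p⁻¹).toReal -
          (r⁻¹).toReal) + (γ₅ + γ₆)) * k) * (e k * e' k))) := by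
          have : wt (4 * L) ≤ wt (12 + 12 * L) := wt_mono (by linarith)
          gcongr
          norm_num
      _ = _ := by ring

end numeric

/-! ### Strichartz norms -/

/-- The part of the norm `S_k` without the time derivative. -/
def strich (T : ℝ) (k : ℤ) (u : STField n) : ℝ≥0∞ :=
  ⨆ (q : ℝ≥0∞) (r : ℝ≥0∞) (_ : Admissible n q r),
    wt ((k : ℝ) * ((q⁻¹).toReal + n * (r⁻¹).toReal - 1)) * mixedNorm T q r u

lemma wt_intCast (k : ℤ) : wt (k : ℝ) = ofReal ((2 : ℝ) ^ k) := by
  rw [wt, Real.rpow_intCast]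

lemma le_strich {q r : ℝ≥0∞} (h : Admissible n q r) (k : ℤ) (u : STField n) :
    wt ((k : ℝ) * ((q⁻¹).toReal + n * (r⁻¹).toReal - 1)) * mixedNorm T q r u ≤ strich T k u :=
  le_iSup₂_of_le q r (le_iSup_of_le h le_rfl)

lemma strich_le {k : ℤ} {u : STField n} {B : ℝ≥0∞} (h : ∀ q r, Admissible n q r →
    wt ((k : ℝ) * ((q⁻¹).toReal + n * (r⁻¹).toReal - 1)) * mixedNorm T q r u ≤ B) :
    strich T k u ≤ B := iSup₂_le fun q r => iSup_le fun hqr => h q r hqr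

lemma mixedNorm_le_strich {q r : ℝ≥0∞} (h : Admissible n q r) (k : ℤ) (u : STField n) :
    mixedNorm T q r u ≤
      wt (-((q⁻¹).toReal + n * (r⁻¹).toReal - 1) * k) * strich T k u := by
  calc mixedNorm T q r u = wt (-((q⁻¹).toReal + n * (r⁻¹).toReal - 1) * k) *
        (wt ((k : ℝ) * ((q⁻¹).toReal + n * (r⁻¹).toReal - 1)) * mixedNorm T q r u) := by
        rw [← mul_assoc, ← wt_add]
        ring_nf
        simp
    _ ≤ _ := mul_le_mul' le_rfl (le_strich h k u)

lemma Admissible.one_le_left {q r : ℝ≥0∞} (h : Admissible n q r) : 1 ≤ q := one_le_two.trans h.1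
lemma Admissible.one_le_right {q r : ℝ≥0∞} (h : Admissible n q r) : 1 ≤ r :=
  one_le_two.trans h.2.1

lemma toReal_inv_le_half {q : ℝ≥0∞} (h : 2 ≤ q) : (q⁻¹).toReal ≤ 1 / 2 := by
  have : (q⁻¹).toReal ≤ ((2 : ℝ≥0∞)⁻¹).toReal :=
    toReal_mono (by simp) (ENNReal.inv_le_inv.2 h)
  refine this.trans_eq ?_
  simp

lemma strich_congr {k : ℤ} {u v : STField n} (h : ∀ t ∈ Ioo 0 T, ∀ x, u t x = v t x) :
    strich T k u = strich T k v := by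
  simp only [strich]
  simp_rw [mixedNorm_congr h]

lemma strich_add_le (k : ℤ) {u v : STField n} (hu : Cont T u) (hv : Cont T v) :
    strich T k (fun t x => u t x + v t x) ≤ strich T k u + strich T k v := by
  refine strich_le fun q r h => ?_
  refine (mul_le_mul' le_rfl (mixedNorm_add_le h.one_le_left h.one_le_right hu hv)).trans ?_
  rw [mul_add]
  exact add_le_add (le_strich h k _) (le_strich h k _)

lemma strich_const_mul_le (k : ℤ) (c : ℝ) (u : STField n) :
    strich T k (fun t x => c * u t x) ≤ ofReal |c| * strich T k u := by
  refine strich_le fun q r h => ?_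
  refine (mul_le_mul' le_rfl (mixedNorm_const_mul c u)).trans ?_
  rw [mul_left_comm]
  exact mul_le_mul' le_rfl (le_strich h k _)

lemma strich_Op_le {a : Space n → ℂ} (ha : IsSymb a) (k l : ℤ) {u : STField n} (hu : Cont T u) :
    strich T k (fun t => Op (dil l a) (u t)) ≤ ofReal (kb a) * strich T k u := by
  refine strich_le fun q r h => ?_
  refine (mul_le_mul' le_rfl (mixedNorm_le_mul (kb a) fun t ht =>
    eLpNorm_Op_dil_le ha l h.one_le_right (hu.slice ht).aestronglyMeasurable)).trans ?_
  rw [mul_left_comm]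
  exact mul_le_mul' le_rfl (le_strich h k _)

lemma sNorm_le_strich (k : ℤ) (u : STField n) :
    sNorm T k u ≤ strich T k u + wt (-k) * strich T k (pd 0 u) := by
  refine iSup₂_le fun q r => iSup_le fun h => ?_
  rw [mul_add]
  refine add_le_add (le_strich h k u) ?_
  have e : ofReal ((2 : ℝ) ^ (-k)) = wt (-k) := by rw [← wt_intCast]; push_cast; rfl
  rw [e, mul_left_comm]
  exact mul_le_mul' le_rfl (le_strich h k _)

lemma strich_le_sNorm (k : ℤ) (u : STField n) : strich T k u ≤ sNorm T k u := by
  refine strich_le fun q r h => ?_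
  refine le_trans ?_ (le_iSup₂_of_le q r (le_iSup_of_le h le_rfl))
  exact mul_le_mul' le_rfl le_self_add

lemma strich_pd_le_sNorm (k : ℤ) (u : STField n) :
    strich T k (pd 0 u) ≤ wt k * sNorm T k u := by
  refine strich_le fun q r h => ?_
  have h1 : wt ((k : ℝ) * ((q⁻¹).toReal + n * (r⁻¹).toReal - 1)) *
      (wt (-k) * mixedNorm T q r (pd 0 u)) ≤ sNorm T k u := by
    refine le_trans ?_ (le_iSup₂_of_le q r (le_iSup_of_le h le_rfl))
    have e : ofReal ((2 : ℝ) ^ (-k)) = wt (-k) := by rw [← wt_intCast]; push_cast; rfl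
    rw [e]
    exact mul_le_mul' le_rfl le_add_self
  calc _ = wt k * (wt ((k : ℝ) * ((q⁻¹).toReal + n * (r⁻¹).toReal - 1)) *
      (wt (-k) * mixedNorm T q r (pd 0 u))) := by
        have := wt_neg_mul (k : ℝ)
        calc _ = (wt (-k) * wt k) * (wt ((k : ℝ) * ((q⁻¹).toReal + n * (r⁻¹).toReal - 1)) *
            mixedNorm T q r (pd 0 u)) := by rw [this, one_mul]
          _ = _ := by ring
    _ ≤ _ := mul_le_mul' le_rfl h1

/-! ### Admissible pairs -/

lemma toReal_inv_two : ((2 : ℝ≥0∞)⁻¹).toReal = 1 / 2 := by simp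
lemma toReal_inv_four : ((4 : ℝ≥0∞)⁻¹).toReal = 1 / 4 := by simp
lemma toReal_inv_top : ((⊤ : ℝ≥0∞)⁻¹).toReal = 0 := by simp

lemma two_le_four : (2 : ℝ≥0∞) ≤ 4 := by norm_num

lemma admissible_top_top (hn : 5 ≤ n) : Admissible n ⊤ ⊤ := by
  have : (5 : ℝ) ≤ n := by exact_mod_cast hn
  refine ⟨le_top, le_top, ?_⟩
  rw [toReal_inv_top]; linarith

lemma admissible_top_two : Admissible n ⊤ 2 := by
  refine ⟨le_top, le_rfl, ?_⟩
  rw [toReal_inv_top, toReal_inv_two]; linarith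

lemma admissible_top_four (hn : 5 ≤ n) : Admissible n ⊤ 4 := by
  have : (5 : ℝ) ≤ n := by exact_mod_cast hn
  refine ⟨le_top, two_le_four, ?_⟩
  rw [toReal_inv_top, toReal_inv_four]; linarith

lemma admissible_two_top (hn : 5 ≤ n) : Admissible n 2 ⊤ := by
  have : (5 : ℝ) ≤ n := by exact_mod_cast hn
  refine ⟨le_rfl, le_top, ?_⟩
  rw [toReal_inv_top, toReal_inv_two]; linarith

lemma admissible_two_four (hn : 5 ≤ n) : Admissible n 2 4 := by
  have : (5 : ℝ) ≤ n := by exact_mod_cast hn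
  refine ⟨le_rfl, two_le_four, ?_⟩
  rw [toReal_inv_two, toReal_inv_four]; linarith

/-! ### Fields of given size at each frequency -/

/-- The frequency pieces of `f` have the size `M 2^{sk} e_k`. -/
def XB (η : Space n → ℝ) (T s : ℝ) (M : ℝ≥0∞) (e : ℤ → ℝ≥0∞) (f : STField n) : Prop :=
  ∀ k : ℤ, strich T k (fun t => PP η k (f t)) ≤ M * wt (s * k) * e k

section X
variable {η : Space n → ℝ} {s : ℝ} {M : ℝ≥0∞} {e : ℤ → ℝ≥0∞} {f : STField n}

lemma XB.pnorm_le (h : XB η T s M e f) {q r : ℝ≥0∞} (hqr : Admissible n q r) (k : ℤ) :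
    pnorm η T q r k f ≤ M * wt ((s - ((q⁻¹).toReal + n * (r⁻¹).toReal - 1)) * k) * e k := by
  refine (mixedNorm_le_strich hqr k _).trans ?_
  calc _ ≤ wt (-((q⁻¹).toReal + n * (r⁻¹).toReal - 1) * k) * (M * wt (s * k) * e k) :=
        mul_le_mul' le_rfl (h k)
    _ = M * (wt (-((q⁻¹).toReal + n * (r⁻¹).toReal - 1) * k) * wt (s * k)) * e k := by ring
    _ = _ := by rw [← wt_add]; ring_nf

lemma XB.mono (h : XB η T s M e f) {M' : ℝ≥0∞} {e' : ℤ → ℝ≥0∞} (hM : M ≤ M')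
    (he : ∀ k, e k ≤ e' k) : XB η T s M' e' f := fun k =>
  (h k).trans (by gcongr; exact he k)

lemma XB.const (h : XB η T s M e f) {E : ℝ≥0∞} (hE : ∀ k, e k ≤ E) :
    XB η T s M (fun _ => E) f := h.mono le_rfl hE

lemma XB.tame (hn : 5 ≤ n) (hη : IsCutoff η) (hs : s ≤ 1) (h : XB η T s M e f) (hM : M ≠ ⊤)
    {E : ℝ≥0∞} (hEt : E ≠ ⊤) (hE : ∀ k, e k ≤ E) (hc : Cont T f) (hb : BddL T 2 f) :
    Tame η T f := by
  have hn' : (5 : ℝ) ≤ n := by exact_mod_cast hn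
  refine ⟨hc, hb, fun t ht J => ?_⟩
  have hcP : ∀ k, Cont T (fun t => PP η k (f t)) := fun k =>
    ((isSymb_p0 hη).dil k).cont_Op hc one_le_two hb
  set θ : ℝ := s + 1 - n / 2 with hθ
  have hθ0 : θ ≤ -(1 / 2) := by linarith
  have h1 : ∀ i : ℕ, eLpNorm (PP η (J + 1 + i) (f t)) 2 volume ≤
      M * wt (θ * (J + 1)) * E * wt (-((1 / 2) * i)) := by
    intro i
    refine ((hcP _).eLpNorm_le_mixedNorm 2 ht).trans ((h.pnorm_le admissible_top_two _).trans ?_)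
    calc _ ≤ M * wt (θ * (J + 1) + -((1 / 2) * i)) * E := by
          gcongr
          · refine wt_mono ?_
            rw [toReal_inv_top, toReal_inv_two]
            push_cast
            have : θ * i ≤ -(1 / 2) * i := by gcongr
            have e1 : (s - (0 + (n : ℝ) * (1 / 2) - 1)) = θ := by rw [hθ]; ring
            rw [e1]; linarith
          · exact hE _
      _ = _ := by rw [wt_add]; ring
  refine ne_top_of_le_ne_top ?_ (ENNReal.tsum_le_tsum h1)
  rw [ENNReal.tsum_mul_left]
  have h2 := geo_ne_top (δ := 1 / 2) (by norm_num)
  have h3 := wt_ne_top (θ * (J + 1))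
  change _ * geo (1 / 2) ≠ ⊤
  finiteness

end X

instance holderTriple_four_four_two : ENNReal.HolderTriple 4 4 2 := ⟨by
  rw [← ENNReal.toReal_eq_toReal_iff' (by simp) (by simp), ENNReal.toReal_add (by simp) (by simp)]
  simp; norm_num⟩

section products
variable {η : Space n → ℝ} {σ s₁ s₂ : ℝ} {A E M₁ M₂ : ℝ≥0∞} {e : ℤ → ℝ≥0∞} {f g : STField n}
  (hn : 5 ≤ n) (hη : IsCutoff η) (hσ : 0 ≤ σ) (hσ1 : σ < 1 / 2) (hA : 1 ≤ A) (he : Grow σ A e)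
  (hf : Tame η T f) (hg : Tame η T g)

include hn hη hσ hσ1 hA he hf hg

set_option maxHeartbeats 1000000 in
/-- Products of fields of given size. -/
theorem XB.mul (hσ2 : σ < ((n : ℝ) - 4) / 4) (h1 : 0 ≤ s₁) (h1' : s₁ ≤ 1) (h2 : 0 ≤ s₂)
    (h2' : s₂ ≤ 1) (hfX : XB η T s₁ M₁ e f) (hgX : XB η T s₂ M₂ (fun _ => E) g) :
    XB η T (s₁ + s₂ + 1) (3 * mulConst η A (n + 3) (min (1 / 2 : ℝ) (((n : ℝ) - 4) / 4) - σ) *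
      (M₁ * M₂ * E)) e (fun t x => f t x * g t x) := by
  intro k
  have hn' : (5 : ℝ) ≤ n := by exact_mod_cast hn
  set δ : ℝ := min (1 / 2 : ℝ) (((n : ℝ) - 4) / 4) - σ with hδ
  have hm1 : min (1 / 2 : ℝ) (((n : ℝ) - 4) / 4) ≤ 1 / 2 := min_le_left _ _
  have hm2 : min (1 / 2 : ℝ) (((n : ℝ) - 4) / 4) ≤ (n - 4) / 4 := min_le_right _ _
  have hδ0 : 0 ≤ δ := by
    have : σ ≤ min (1 / 2 : ℝ) (((n : ℝ) - 4) / 4) := le_min hσ1.le hσ2.le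
    linarith
  refine strich_le fun q r hqr => ?_
  set a := (q⁻¹).toReal with ha
  set b := (r⁻¹).toReal with hb
  have ha0 : 0 ≤ a := ENNReal.toReal_nonneg
  have hb0 : 0 ≤ b := ENNReal.toReal_nonneg
  have ha1 : a ≤ 1 / 2 := toReal_inv_le_half hqr.1
  have hb1 : b ≤ 1 / 2 := toReal_inv_le_half hqr.2.1
  have hab := hqr.2.2
  rw [← ha, ← hb] at hab
  set β : ℝ := 2 * a / (n - 1) with hβ
  have hβ' : β * (n - 1) = 2 * a := div_mul_cancel₀ _ (by linarith)
  have hβ0 : 0 ≤ β := div_nonneg (by linarith) (by linarith)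
  have hβ1 : β ≤ 1 / 4 := by rw [hβ, div_le_iff₀ (by linarith)]; linarith
  have hbβ : b ≤ 1 / 2 - β := by
    have : (n - 1 : ℝ) * b ≤ (n - 1) * (1 / 2 - β) := by nlinarith
    exact le_of_mul_le_mul_left this (by linarith)
  set r₅ : ℝ≥0∞ := (ofReal (1 / 2 - β))⁻¹ with hr₅
  set p : ℝ≥0∞ := (r₅⁻¹ + 2⁻¹)⁻¹ with hp
  have hr5' : (r₅⁻¹).toReal = 1 / 2 - β := by
    rw [hr₅, inv_inv, ENNReal.toReal_ofReal (by linarith)]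
  have hr5t : r₅⁻¹ ≠ ⊤ := by rw [hr₅, inv_inv]; exact ofReal_ne_top
  have hp' : (p⁻¹).toReal = 1 - β := by
    rw [hp, inv_inv, ENNReal.toReal_add hr5t (by simp), hr5', toReal_inv_two]; ring
  have hpt : p⁻¹ ≠ ⊤ := by rw [hp, inv_inv]; exact ENNReal.add_ne_top.2 ⟨hr5t, by simp⟩
  have hT : ENNReal.HolderTriple r₅ 2 p := ⟨(inv_inv _).symm⟩
  have hrt : r⁻¹ ≠ ⊤ := by
    simp only [ne_eq, ENNReal.inv_eq_top]
    exact (zero_lt_one.trans_le hqr.one_le_right).ne'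
  have hp1 : 1 ≤ p := by
    rw [← ENNReal.inv_le_one, ← ENNReal.toReal_le_toReal hpt (by simp), hp', ENNReal.toReal_one]
    linarith
  have hpr : p ≤ r := by
    rw [← ENNReal.inv_le_inv, ← ENNReal.toReal_le_toReal hrt hpt, hp', ← hb]
    linarith
  have hadm : Admissible n q r₅ := by
    refine ⟨hqr.1, ?_, ?_⟩
    · rw [← ENNReal.inv_le_inv, ← ENNReal.toReal_le_toReal hr5t (by simp), hr5', toReal_inv_two]
      linarith
    · rw [← ha, hr5']; nlinarith
  have hn1 : n * β ≤ n * (1 / 4) := by gcongr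
  have hnb : (n : ℝ) * b ≤ n * (1 / 2) := by gcongr
  have hnb0 : 0 ≤ (n : ℝ) * b := by positivity
  have hnβ0 : 0 ≤ (n : ℝ) * β := by positivity
  have key := pnorm_mul_le_of_bounds (T := T) (η := η) (f := f) (g := g) (σ := σ) (σ' := 0)
    (δ := δ) (L := n + 3) he (grow_const hA E) hσ (by linarith) le_rfl zero_le_one hη hf hg
    (by omega) hA k (q := q) (r := r) (q₁ := q) (r₁ := r) (q₂ := ⊤) (r₂ := ⊤) (q₃ := ⊤)
    (r₃ := ⊤) (q₄ := q) (r₄ := r) (q₅ := q) (r₅ := r₅) (q₆ := ⊤) (r₆ := 2) (p := p)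
    hqr.one_le_left hqr.one_le_right (timeHolder_top_right q hqr.one_le_left)
    (timeHolder_top_left q hqr.one_le_left) (timeHolder_top_right q hqr.one_le_left)
    le_top le_top le_top le_top hp1 hpr
    (M₁ := M₁) (M₂ := M₂) (M₃ := M₁) (M₄ := M₂) (M₅ := M₁) (M₆ := M₂)
    (α₁ := s₁ - (a + n * b - 1)) (β₂ := s₂ + 1) (β₃ := s₁ + 1) (α₄ := s₂ - (a + n * b - 1))
    (γ₅ := s₁ - (a + n * (1 / 2 - β) - 1)) (γ₆ := s₂ + 1 - n / 2)
    (abs_le.2 ⟨by linarith, by linarith⟩) (abs_le.2 ⟨by linarith, by linarith⟩)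
    (abs_le.2 ⟨by linarith, by linarith⟩) (abs_le.2 ⟨by linarith, by linarith⟩)
    (abs_le.2 ⟨by linarith, by linarith⟩) (abs_le.2 ⟨by linarith, by linarith⟩)
    hδ0 (by linarith) (by linarith) (by nlinarith)
    (fun l _ => hfX.pnorm_le hqr l)
    (fun l _ => (hgX.pnorm_le (admissible_top_top hn) l).trans_eq (by
      rw [toReal_inv_top]; ring_nf))
    (fun l _ => (hfX.pnorm_le (admissible_top_top hn) l).trans_eq (by
      rw [toReal_inv_top]; ring_nf))
    (fun l _ => hgX.pnorm_le hqr l)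
    (fun l _ => (hfX.pnorm_le hadm l).trans_eq (by rw [hr5']))
    (fun l _ => (hgX.pnorm_le admissible_top_two l).trans_eq (by
      rw [toReal_inv_top, toReal_inv_two]; ring_nf))
  rw [hp', ← hb] at key
  have e1 : (s₁ - (a + n * b - 1) + (s₂ + 1)) = s₁ + s₂ + 1 - (a + n * b - 1) := by ring
  have e2 : (s₁ + 1 + (s₂ - (a + n * b - 1))) = s₁ + s₂ + 1 - (a + n * b - 1) := by ring
  have e3 : (n * (1 - β - b) + (s₁ - (a + n * (1 / 2 - β) - 1) + (s₂ + 1 - n / 2))) =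
      s₁ + s₂ + 1 - (a + n * b - 1) := by ring
  rw [e1, e2, e3] at key
  calc _ ≤ wt ((k : ℝ) * (a + n * b - 1)) * _ := mul_le_mul' le_rfl key
    _ = 3 * mulConst η A (n + 3) δ * (M₁ * M₂ * E) * (wt ((k : ℝ) * (a + n * b - 1)) *
        wt ((s₁ + s₂ + 1 - (a + n * b - 1)) * k)) * e k := by ring
    _ = _ := by rw [← wt_add]; congr 3; ring

omit hA he hn hη hσ hσ1 hf hg in
lemma three_mul_const (C B W W₁ W₂ W₃ e₁ : ℝ≥0∞) (h1 : W₁ = W) (h2 : W₂ = W) (h3 : W₃ = W) :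
    C * ((B * W₁ + B * W₂ + B * W₃) * e₁) = 3 * C * B * W * e₁ := by
  rw [h1, h2, h3]; ring

/-- The `L¹L^∞` norm of a product. -/
theorem pnorm_one_top_mul_le {e' : ℤ → ℝ≥0∞} (he' : Grow σ A e') (hfX : XB η T 0 M₁ e f)
    (hgX : XB η T 0 M₂ e' g) (k : ℤ) :
    pnorm η T 1 ⊤ k (fun t x => f t x * g t x) ≤
      3 * mulConst η A (n + 3) (1 / 2 - σ) * (M₁ * M₂) * wt k * (e k * e' k) := by
  have hn' : (5 : ℝ) ≤ n := by exact_mod_cast hn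
  have bl : ∀ {M : ℝ≥0∞} {e : ℤ → ℝ≥0∞} {f : STField n}, XB η T 0 M e f → ∀ l : ℤ,
      pnorm η T 2 ⊤ l f ≤ M * wt (1 / 2 * l) * e l := fun h l =>
    (h.pnorm_le (admissible_two_top hn) l).trans_eq (by
      rw [toReal_inv_top, toReal_inv_two]; ring_nf)
  have bh : ∀ {M : ℝ≥0∞} {e : ℤ → ℝ≥0∞} {f : STField n}, XB η T 0 M e f → ∀ l : ℤ,
      pnorm η T 2 4 l f ≤ M * wt ((1 / 2 - n / 4) * l) * e l := fun h l =>
    (h.pnorm_le (admissible_two_four hn) l).trans_eq (by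
      rw [toReal_inv_four, toReal_inv_two]; ring_nf)
  have a1 : |(1 / 2 : ℝ)| ≤ n + 3 := by rw [abs_of_pos (by norm_num)]; linarith
  have a2 : |(1 / 2 - n / 4 : ℝ)| ≤ n + 3 := abs_le.2 ⟨by linarith, by linarith⟩
  refine (pnorm_mul_le_of_bounds (T := T) (η := η) (f := f) (g := g) (σ := σ) (σ' := σ)
    (δ := 1 / 2 - σ) (L := n + 3) he he' hσ (by linarith) hσ (by linarith) hη hf hg
    (by omega) hA k (q₁ := 2) (r₁ := ⊤) (q₂ := 2) (r₂ := ⊤) (q₃ := 2)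
    (r₃ := ⊤) (q₄ := 2) (r₄ := ⊤) (q₅ := 2) (r₅ := 4) (q₆ := 2) (r₆ := 4) (p := 2)
    le_rfl le_top timeHolder_two timeHolder_two timeHolder_two one_le_two le_top one_le_two le_top
    one_le_two le_top a1 a1 a1 a1 a2 a2 (by linarith) le_rfl le_rfl (by linarith)
    (fun l _ => bl hfX l) (fun l _ => bl hgX l) (fun l _ => bl hfX l) (fun l _ => bl hgX l)
    (fun l _ => bh hfX l) (fun l _ => bh hgX l)).trans_eq ?_
  refine three_mul_const _ _ _ _ _ _ _ (by congr 1; ring) (by congr 1; ring) ?_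
  rw [toReal_inv_two, toReal_inv_top]; congr 1; ring

/-- The `L^∞L^∞` norm of a product. -/
theorem pnorm_top_top_mul_le {e' : ℤ → ℝ≥0∞} (he' : Grow σ A e') (hfX : XB η T 0 M₁ e f)
    (hgX : XB η T 0 M₂ e' g) (k : ℤ) :
    pnorm η T ⊤ ⊤ k (fun t x => f t x * g t x) ≤
      3 * mulConst η A (n + 3) (1 / 2 - σ) * (M₁ * M₂) * wt (2 * k) * (e k * e' k) := by
  have hn' : (5 : ℝ) ≤ n := by exact_mod_cast hn
  have bl : ∀ {M : ℝ≥0∞} {e : ℤ → ℝ≥0∞} {f : STField n}, XB η T 0 M e f → ∀ l : ℤ,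
      pnorm η T ⊤ ⊤ l f ≤ M * wt (1 * l) * e l := fun h l =>
    (h.pnorm_le (admissible_top_top hn) l).trans_eq (by
      rw [toReal_inv_top]; ring_nf)
  have bh : ∀ {M : ℝ≥0∞} {e : ℤ → ℝ≥0∞} {f : STField n}, XB η T 0 M e f → ∀ l : ℤ,
      pnorm η T ⊤ 2 l f ≤ M * wt ((1 - n / 2) * l) * e l := fun h l =>
    (h.pnorm_le admissible_top_two l).trans_eq (by
      rw [toReal_inv_top, toReal_inv_two]; ring_nf)
  have a1 : |(1 : ℝ)| ≤ n + 3 := by rw [abs_of_pos (by norm_num)]; linarith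
  have a2 : |(1 - n / 2 : ℝ)| ≤ n + 3 := abs_le.2 ⟨by linarith, by linarith⟩
  refine (pnorm_mul_le_of_bounds (T := T) (η := η) (f := f) (g := g) (σ := σ) (σ' := σ)
    (δ := 1 / 2 - σ) (L := n + 3) he he' hσ (by linarith) hσ (by linarith) hη hf hg
    (by omega) hA k (q₁ := ⊤) (r₁ := ⊤) (q₂ := ⊤) (r₂ := ⊤) (q₃ := ⊤)
    (r₃ := ⊤) (q₄ := ⊤) (r₄ := ⊤) (q₅ := ⊤) (r₅ := 2) (q₆ := ⊤) (r₆ := 2) (p := 1)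
    le_top le_top (timeHolder_top_left _ le_top) (timeHolder_top_left _ le_top)
    (timeHolder_top_left _ le_top) le_top le_top le_top le_top
    le_rfl le_top a1 a1 a1 a1 a2 a2 (by linarith) (by linarith) (by linarith) (by linarith)
    (fun l _ => bl hfX l) (fun l _ => bl hgX l) (fun l _ => bl hfX l) (fun l _ => bl hgX l)
    (fun l _ => bh hfX l) (fun l _ => bh hgX l)).trans_eq ?_
  refine three_mul_const _ _ _ _ _ _ _ (by congr 1; ring) (by congr 1; ring) ?_
  rw [inv_one, ENNReal.toReal_one, toReal_inv_top]; congr 1; ring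

/-- The `L²L²` norm of a product. -/
theorem pnorm_two_two_mul_le (hfX : XB η T 0 M₁ e f) (hgX : XB η T 0 M₂ (fun _ => E) g) (k : ℤ) :
    pnorm η T 2 2 k (fun t x => f t x * g t x) ≤
      3 * mulConst η A (n + 3) (1 / 2 - σ) * (M₁ * M₂) * wt ((3 / 2 - n / 2) * k) * (e k * E) := by
  have hn' : (5 : ℝ) ≤ n := by exact_mod_cast hn
  have bl : ∀ {M : ℝ≥0∞} {e : ℤ → ℝ≥0∞} {f : STField n}, XB η T 0 M e f → ∀ l : ℤ,
      pnorm η T 2 ⊤ l f ≤ M * wt (1 / 2 * l) * e l := fun h l =>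
    (h.pnorm_le (admissible_two_top hn) l).trans_eq (by
      rw [toReal_inv_top, toReal_inv_two]; ring_nf)
  have bh : ∀ {M : ℝ≥0∞} {e : ℤ → ℝ≥0∞} {f : STField n}, XB η T 0 M e f → ∀ l : ℤ,
      pnorm η T ⊤ 2 l f ≤ M * wt ((1 - n / 2) * l) * e l := fun h l =>
    (h.pnorm_le admissible_top_two l).trans_eq (by
      rw [toReal_inv_top, toReal_inv_two]; ring_nf)
  have a1 : |(1 / 2 : ℝ)| ≤ n + 3 := by rw [abs_of_pos (by norm_num)]; linarith
  have a2 : |(1 - n / 2 : ℝ)| ≤ n + 3 := abs_le.2 ⟨by linarith, by linarith⟩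
  refine (pnorm_mul_le_of_bounds (T := T) (η := η) (f := f) (g := g) (σ := σ) (σ' := 0)
    (δ := 1 / 2 - σ) (L := n + 3) he (grow_const hA E) hσ (by linarith) le_rfl zero_le_one hη hf hg
    (by omega) hA k (q₁ := ⊤) (r₁ := 2) (q₂ := 2) (r₂ := ⊤) (q₃ := 2)
    (r₃ := ⊤) (q₄ := ⊤) (r₄ := 2) (q₅ := 2) (r₅ := 4) (q₆ := ⊤) (r₆ := 4) (p := 2)
    one_le_two one_le_two (timeHolder_top_left _ one_le_two) (timeHolder_top_right _ one_le_two)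
    (timeHolder_top_right _ one_le_two) one_le_two le_top one_le_two le_top
    one_le_two le_rfl a2 a1 a1 a2 (γ₅ := 1 / 2 - n / 4) (γ₆ := 1 - n / 4)
    (abs_le.2 ⟨by linarith, by linarith⟩) (abs_le.2 ⟨by linarith, by linarith⟩)
    (by linarith) (by linarith) (by linarith) (by linarith)
    (fun l _ => bh hfX l) (fun l _ => bl hgX l) (fun l _ => bl hfX l) (fun l _ => bh hgX l)
    (fun l _ => (hfX.pnorm_le (admissible_two_four hn) l).trans_eq (by
      rw [toReal_inv_four, toReal_inv_two]; ring_nf))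
    (fun l _ => (hgX.pnorm_le (admissible_top_four hn) l).trans_eq (by
      rw [toReal_inv_four, toReal_inv_top]; ring_nf))).trans_eq ?_
  refine three_mul_const _ _ _ _ _ _ _ (by congr 1; ring) (by congr 1; ring) ?_
  congr 1; ring

/-- The `L¹L²` norm of a product with three factors. -/
theorem pnorm_one_two_mul_mul_le {h : STField n} (hh : Tame η T h)
    (hw : Tame η T (fun t x => f t x * g t x))
    (hfX : XB η T 0 M₁ e f) (hgX : XB η T 0 M₁ (fun _ => E) g)
    (hhX : XB η T 0 M₁ (fun _ => E) h) (k : ℤ) :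
    pnorm η T 1 2 k (fun t x => (f t x * g t x) * h t x) ≤
      9 * mulConst η A (n + 3) (1 / 2 - σ) ^ 2 * (M₁ * M₁ * M₁ * (E * E)) *
        wt ((2 - n / 2) * k) * e k := by
  have hn' : (5 : ℝ) ≤ n := by exact_mod_cast hn
  have bl : ∀ {M : ℝ≥0∞} {e : ℤ → ℝ≥0∞} {f : STField n}, XB η T 0 M e f → ∀ l : ℤ,
      pnorm η T 2 ⊤ l f ≤ M * wt (1 / 2 * l) * e l := fun h l =>
    (h.pnorm_le (admissible_two_top hn) l).trans_eq (by
      rw [toReal_inv_top, toReal_inv_two]; ring_nf)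
  have hgr : Grow σ A fun _ : ℤ => E := fun k l => by
    have : 1 ≤ A * wt (σ * |((k - l : ℤ) : ℝ)|) := one_le_mul hA (one_le_wt (by positivity))
    exact le_mul_of_one_le_left' this
  have w1 := fun l => pnorm_one_top_mul_le hn hη hσ hσ1 hA he hf hg hgr hfX hgX l
  have w2 := fun l => pnorm_two_two_mul_le hn hη hσ hσ1 hA he hf hg hfX hgX l
  set K := mulConst η A (n + 3) (1 / 2 - σ) with hK
  refine (pnorm_mul_le_of_bounds (T := T) (η := η) (f := fun t x => f t x * g t x) (g := h)
    (σ := σ) (σ' := 0) (M₁ := 3 * K * (M₁ * M₁) * E) (M₂ := M₁) (M₃ := 3 * K * (M₁ * M₁) * E)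
    (M₄ := M₁) (M₅ := 3 * K * (M₁ * M₁) * E) (M₆ := M₁)
    (δ := 1 / 2 - σ) (L := n + 3) he (grow_const hA E) hσ (by linarith) le_rfl zero_le_one hη hw hh
    (by omega) hA k (q₁ := 2) (r₁ := 2) (q₂ := 2) (r₂ := ⊤) (q₃ := 1)
    (r₃ := ⊤) (q₄ := ⊤) (r₄ := 2) (q₅ := 2) (r₅ := 2) (q₆ := 2) (r₆ := ⊤) (p := 2)
    le_rfl one_le_two timeHolder_two (timeHolder_top_right _ le_rfl)
    timeHolder_two one_le_two le_top le_rfl le_top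
    one_le_two le_rfl (α₁ := 3 / 2 - n / 2) (β₂ := 1 / 2) (β₃ := 1) (α₄ := 1 - n / 2)
    (γ₅ := 3 / 2 - n / 2) (γ₆ := 1 / 2)
    (abs_le.2 ⟨by linarith, by linarith⟩) (abs_le.2 ⟨by linarith, by linarith⟩)
    (abs_le.2 ⟨by linarith, by linarith⟩) (abs_le.2 ⟨by linarith, by linarith⟩)
    (abs_le.2 ⟨by linarith, by linarith⟩) (abs_le.2 ⟨by linarith, by linarith⟩)
    (by linarith) (by linarith) (by linarith) (by linarith)
    (fun l _ => (w2 l).trans_eq (by ring)) (fun l _ => bl hhX l)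
    (fun l _ => (w1 l).trans_eq (by rw [one_mul]; ring))
    (fun l _ => (hhX.pnorm_le admissible_top_two l).trans_eq (by
      rw [toReal_inv_top, toReal_inv_two]; ring_nf))
    (fun l _ => (w2 l).trans_eq (by ring)) (fun l _ => bl hhX l)).trans_eq ?_
  rw [three_mul_const _ _ (wt ((2 - n / 2) * k)) _ _ _ _ (by congr 1; ring) (by congr 1; ring) (by
    congr 1; ring), ← hK]
  ring

end products

/-! ### Square integrability of derivatives -/

lemma eLpNorm_two_sq (f : Space n → ℝ) :
    eLpNorm f 2 volume ^ (2 : ℝ) = ∫⁻ x, ‖f x‖ₑ ^ (2 : ℝ) := by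
  have := eLpNorm_nnreal_pow_eq_lintegral (f := f) (p := 2) (μ := volume) (by norm_num)
  simpa using this

lemma eLpNorm_comp_add (f : Space n → ℝ) (p : ℝ≥0∞) (hf : AEStronglyMeasurable f volume)
    (v : Space n) : eLpNorm (fun x => f (x + v)) p volume = eLpNorm f p volume :=
  eLpNorm_comp_measurePreserving hf (measurePreserving_add_right volume v)

/-- Minkowski's inequality for the fundamental theorem of calculus. -/
lemma eLpNorm_sub_le_of_isPd {w g : STField n} {μ : Fin (n + 1)} (hg : Cont T g)
    (h : IsPd T μ w g) {B : ℝ≥0∞} (hB : ∀ t ∈ Ioo 0 T, eLpNorm (g t) 2 volume ≤ B) {t s : ℝ}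
    (hs : 0 < s) (hts : ∀ τ ∈ Icc 0 s, t + τ * dirT μ ∈ Ioo 0 T) :
    eLpNorm (fun x => w (t + s * dirT μ) (x + s • dirX μ) - w t x) 2 volume ≤
      ofReal s * B := by
  set G : ℝ → Space n → ℝ := fun τ x => g (t + τ * dirT μ) (x + τ • dirX μ) with hG
  have hGc : ContinuousOn (fun p : Space n × ℝ => G p.2 p.1) (univ ×ˢ Icc 0 s) := by
    have hm : Continuous fun p : Space n × ℝ =>
        ((t + p.2 * dirT μ, p.1 + p.2 • dirX μ) : ℝ × Space n) := by fun_prop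
    exact ContinuousOn.comp hg hm.continuousOn fun p hp => mem_slab (hts _ hp.2) _
  have hGx : ∀ x, ContinuousOn (fun τ => G τ x) (Icc 0 s) := fun x =>
    hGc.comp (f := fun τ => (x, τ)) (by fun_prop) fun τ hτ => ⟨mem_univ _, hτ⟩
  have hftc : ∀ x, w (t + s * dirT μ) (x + s • dirX μ) - w t x = ∫ τ in (0 : ℝ)..s, G τ x := by
    intro x
    rw [intervalIntegral.integral_eq_sub_of_hasDerivAt
      (f := fun τ => w (t + τ * dirT μ) (x + τ • dirX μ))]
    · simp
    · intro τ hτ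
      rw [uIcc_of_le hs.le] at hτ
      exact h.hasDerivAt (hts τ hτ) x
    · rw [intervalIntegrable_iff_integrableOn_Icc_of_le hs.le]
      exact (hGx x).integrableOn_Icc
  set ν := volume.restrict (Icc (0 : ℝ) s) with hν
  have hGm : ∀ x, AEStronglyMeasurable (fun τ => G τ x) ν := fun x =>
    (hGx x).aestronglyMeasurable measurableSet_Icc
  have hpt : ∀ x, ‖w (t + s * dirT μ) (x + s • dirX μ) - w t x‖ₑ ^ (2 : ℝ) ≤
      ofReal s * ∫⁻ τ, ‖G τ x‖ₑ ^ (2 : ℝ) ∂ν := by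
    intro x
    rw [hftc, intervalIntegral.integral_of_le hs.le, ← integral_Icc_eq_integral_Ioc]
    have h1 : ‖∫ τ, G τ x ∂ν‖ₑ ≤ eLpNorm (fun τ => G τ x) 2 ν * ofReal s ^ (1 / 2 : ℝ) := by
      refine (enorm_integral_le_lintegral_enorm _).trans ?_
      rw [← eLpNorm_one_eq_lintegral_enorm]
      refine (eLpNorm_le_eLpNorm_mul_rpow_measure_univ one_le_two (hGm x)).trans_eq ?_
      congr 2
      · simp [hν]
      · norm_num
    have h2 := eLpNorm_nnreal_pow_eq_lintegral (f := fun τ => G τ x) (p := 2) (μ := ν)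
      (by norm_num)
    simp only [NNReal.coe_ofNat, ENNReal.coe_ofNat] at h2
    rw [← h2]
    calc _ ≤ (eLpNorm (fun τ => G τ x) 2 ν * ofReal s ^ (1 / 2 : ℝ)) ^ (2 : ℝ) := by gcongr
      _ = _ := by
        rw [mul_rpow_of_nonneg _ _ (by norm_num), ← ENNReal.rpow_mul]
        norm_num [mul_comm]
  have hsq : eLpNorm (fun x => w (t + s * dirT μ) (x + s • dirX μ) - w t x) 2 volume ^ (2 : ℝ) ≤
      (ofReal s * B) ^ (2 : ℝ) := by
    rw [eLpNorm_two_sq]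
    refine (lintegral_mono hpt).trans ?_
    rw [lintegral_const_mul' _ _ ofReal_ne_top]
    have hm : AEMeasurable (Function.uncurry fun (x : Space n) (τ : ℝ) => ‖G τ x‖ₑ ^ (2 : ℝ))
        (volume.prod ν) := by
      have h1 : AEStronglyMeasurable (fun p : Space n × ℝ => G p.2 p.1) (volume.prod ν) := by
        have := hGc.aestronglyMeasurable (μ := (volume : Measure (Space n)).prod volume)
          (MeasurableSet.univ.prod measurableSet_Icc)
        rwa [← Measure.prod_restrict, Measure.restrict_univ] at this
      exact h1.enorm.pow_const _
    rw [lintegral_lintegral_swap hm]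
    have h3 : ∀ τ ∈ Icc (0 : ℝ) s, ∫⁻ x, ‖G τ x‖ₑ ^ (2 : ℝ) ≤ B ^ (2 : ℝ) := by
      intro τ hτ
      rw [← eLpNorm_two_sq, hG,
        eLpNorm_comp_add _ _ (hg.slice (hts τ hτ)).aestronglyMeasurable]
      gcongr
      exact hB _ (hts τ hτ)
    calc _ ≤ ofReal s * ∫⁻ _, B ^ (2 : ℝ) ∂ν := by
          refine mul_le_mul' le_rfl (lintegral_mono_ae ?_)
          exact (ae_restrict_iff' measurableSet_Icc).2 (Eventually.of_forall h3)
      _ = _ := by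
          rw [lintegral_const, hν, Measure.restrict_apply_univ, Real.volume_Icc, sub_zero,
            mul_rpow_of_nonneg _ _ (by norm_num)]
          rw [show (2 : ℝ) = ((2 : ℕ) : ℝ) by norm_num, ENNReal.rpow_natCast,
            ENNReal.rpow_natCast]
          ring
  exact (ENNReal.rpow_le_rpow_iff (by norm_num)).1 hsq

/-- Uniform bounds for the derivatives of pointwise approximations give a bound for the
derivative. -/
lemma bddL_of_approx {u : STField n} {μ : Fin (n + 1)} {g : STField n} (h : IsPd T μ u g)
    (hu : Cont T u) {w v : ℕ → STField n} (hw : ∀ m, Cont T (w m)) (hv : ∀ m, Cont T (v m))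
    (hwv : ∀ m, IsPd T μ (w m) (v m))
    (hlim : ∀ t ∈ Ioo 0 T, ∀ x, Tendsto (fun m => w m t x) atTop (𝓝 (u t x)))
    {B : ℝ≥0∞} (hBt : B ≠ ⊤) (hB : ∀ m, ∀ t ∈ Ioo 0 T, eLpNorm (v m t) 2 volume ≤ B) :
    BddL T 2 g := by
  refine ⟨B, hBt, fun t ht => ?_⟩
  obtain ⟨δ, hδ, hδs⟩ := Metric.eventually_nhds_iff_ball.1 (dir_mem μ ht)
  have hseg : ∀ s ∈ Ioo (0 : ℝ) δ, ∀ τ ∈ Icc 0 s, t + τ * dirT μ ∈ Ioo 0 T := by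
    intro s hs τ hτ
    refine hδs τ ?_
    rw [Metric.mem_ball, Real.dist_eq, sub_zero, abs_of_nonneg hτ.1]
    exact lt_of_le_of_lt hτ.2 hs.2
  -- difference quotients, cut off outside of the slab
  set D : ℝ → Space n → ℝ := fun s x =>
    if s ∈ Ioo (0 : ℝ) δ then s⁻¹ * (u (t + s * dirT μ) (x + s • dirX μ) - u t x) else 0 with hD
  have hcu : ∀ {w : STField n}, Cont T w → ∀ s ∈ Ioo (0 : ℝ) δ,
      Continuous fun x => w (t + s * dirT μ) (x + s • dirX μ) - w t x := fun hw s hs =>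
    ((hw.slice (hseg s hs s ⟨hs.1.le, le_rfl⟩)).comp (by fun_prop)).sub (hw.slice ht)
  have hDm : ∀ s, AEStronglyMeasurable (D s) volume := by
    intro s
    by_cases hs : s ∈ Ioo (0 : ℝ) δ
    · simp only [hD, if_pos hs]
      exact (continuous_const.mul (hcu hu s hs)).aestronglyMeasurable
    · simp only [hD, if_neg hs]; exact aestronglyMeasurable_const
  have hev : ∀ᶠ s in 𝓝[>] (0 : ℝ), s ∈ Ioo (0 : ℝ) δ := Ioo_mem_nhdsGT hδ
  refine Lp.eLpNorm_le_of_ae_tendsto (u := 𝓝[>] (0 : ℝ)) (f := D) ?_ hDm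
    (Eventually.of_forall fun x => ?_)
  · filter_upwards [hev] with s hs
    simp only [hD, if_pos hs]
    have h1 : eLpNorm (fun x => u (t + s * dirT μ) (x + s • dirX μ) - u t x) 2 volume ≤
        ofReal s * B := by
      refine Lp.eLpNorm_le_of_ae_tendsto (u := atTop)
        (f := fun m x => w m (t + s * dirT μ) (x + s • dirX μ) - w m t x)
        (Eventually.of_forall fun m => eLpNorm_sub_le_of_isPd (hv m) (hwv m) (hB m) hs.1
          (hseg s hs)) (fun m => (hcu (hw m) s hs).aestronglyMeasurable)
        (Eventually.of_forall fun x => ?_)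
      exact (hlim _ (hseg s hs s ⟨hs.1.le, le_rfl⟩) _).sub (hlim t ht x)
    have h2 := eLpNorm_const_smul_le (c := s⁻¹) (p := 2) (μ := volume)
      (f := fun x => u (t + s * dirT μ) (x + s • dirX μ) - u t x)
    refine h2.trans ((mul_le_mul' le_rfl h1).trans_eq ?_)
    rw [Real.enorm_eq_ofReal (inv_nonneg.2 hs.1.le), ← mul_assoc,
      ← ofReal_mul (inv_nonneg.2 hs.1.le), inv_mul_cancel₀ hs.1.ne', ENNReal.ofReal_one,
      one_mul]
  · have h1 := (h t ht x).tendsto_slope_zero_right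
    refine h1.congr' ?_
    filter_upwards [hev] with s hs
    simp only [hD, if_pos hs]
    simp

/-! ### The class of fields to which the estimates are applied -/

/-- Smooth fields `f`, bounded in `L²`, of size `M e_k` at frequency `2 ^ k`, together with their
time derivatives. -/
structure Fld (η : Space n → ℝ) (T : ℝ) (M : ℝ≥0∞) (e : ℤ → ℝ≥0∞) (f : STField n) : Prop where
  smooth : Smooth T f
  bdd : BddL T 2 f
  X : XB η T 0 M e f
  Xt : ∀ k : ℤ, strich T k (pd 0 fun t => PP η k (f t)) ≤ M * wt k * e k
  dt : ∃ (v : STField n) (w : Fin n → STField n), Smooth T v ∧ (∀ i, Smooth T (w i)) ∧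
    BddL T 1 v ∧ (∀ i, BddL T 2 (w i)) ∧
    ∀ t ∈ Ioo 0 T, ∀ x, pd 0 f t x = v t x + ∑ i, pd i.succ (w i) t x

lemma bddL_zero (p : ℝ≥0∞) : BddL T p (fun _ _ => 0 : STField n) :=
  ⟨0, by simp, fun t _ => by
    change eLpNorm (0 : Space n → ℝ) p volume ≤ 0
    simp⟩

section Fld
variable {η : Space n → ℝ} (hη : IsCutoff η) {M E : ℝ≥0∞} {e : ℤ → ℝ≥0∞} {f : STField n}

lemma Fld.dmu (hf : Fld η T M e f) (μ : Fin (n + 1)) :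
    ∃ (v : STField n) (w : Fin n → STField n), Smooth T v ∧ (∀ i, Smooth T (w i)) ∧
    BddL T 1 v ∧ (∀ i, BddL T 2 (w i)) ∧
    ∀ t ∈ Ioo 0 T, ∀ x, pd μ f t x = v t x + ∑ i, pd i.succ (w i) t x := by
  induction μ using Fin.cases with
  | zero => exact hf.dt
  | succ i =>
    refine ⟨fun _ _ => 0, fun j => if j = i then f else fun _ _ => 0, smooth_zero, fun j => ?_,
      bddL_zero 1, fun j => ?_, fun t ht x => ?_⟩
    · by_cases h : j = i
      · simpa [h] using hf.smooth
      · simpa [h] using smooth_zero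
    · by_cases h : j = i
      · simpa [h] using hf.bdd
      · simpa [h] using bddL_zero 2
    · rw [zero_add, Finset.sum_eq_single i]
      · simp
      · intro j _ hj
        simp only [if_neg hj]
        exact (isPd_zero (T := T) j.succ).pd_eq ht x
      · simp

include hη

/-- Spatial derivatives of frequency pieces. -/
lemma Op_dsymb_PP {p : ℝ≥0∞} (hp : 1 ≤ p) {g : Space n → ℝ} (hg : MemLp g p volume) (i : Fin n)
    (k : ℤ) (x : Space n) : Op (dsymb i (dil k (p0 η))) g x =
      (2 : ℝ) ^ k * Op (dil k (dsymb i (pt η))) (PP η k g) x := by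
  rw [PP, Op_comp (((isSymb_pt hη).dsymb i).dil k) ((isSymb_p0 hη).dil k) hp hg, ← dil_mul,
    ← dsymb_mul, mul_comm (pt η), p0_mul_pt hη, dsymb_dil,
    Op_smul (((isSymb_p0 hη).dsymb i).dil k)]

omit hη in
lemma isPd_Op_space {a : Space n → ℂ} (ha : IsSymb a) (hf : Smooth T f) {p : ℝ≥0∞} (hp : 1 ≤ p)
    (hb : BddL T p f) (i : Fin n) :
    IsPd T i.succ (fun t => Op a (f t)) (fun t x => Op (dsymb i a) (f t) x) := by
  refine (ha.isPd_Op (μ := i.succ) (p := p) (q := 1) (r := fun _ => p) hf smooth_zero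
    (w := fun j => if j = i then f else fun _ _ => 0) (fun j => ?_) hp le_rfl (fun _ => hp) hb
    (bddL_zero 1) (fun j => ?_) (fun t ht x => ?_)).congr (fun _ _ _ => rfl) (fun t ht x => ?_)
  · by_cases h : j = i
    · simpa [h] using hf
    · simpa [h] using smooth_zero
  · by_cases h : j = i
    · simpa [h] using hb
    · simpa [h] using bddL_zero p
  · rw [zero_add, Finset.sum_eq_single i]
    · simp
    · intro j _ hj
      simp only [if_neg hj]
      exact (isPd_zero (T := T) j.succ).pd_eq ht x
    · simp
  · have hz : ∀ a : Space n → ℂ, Op a (fun _ => 0) x = 0 := fun a => by simp [Op, cnv]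
    rw [hz, zero_add, Finset.sum_eq_single i]
    · simp
    · intro j _ hj
      simp only [if_neg hj]
      exact hz _
    · simp

omit hη in
/-- If the derivative of `f` is controlled in `L^p` then it commutes with multipliers. -/
lemma isPd_Op_of_bddL {a : Space n → ℂ} (ha : IsSymb a) (hf : Smooth T f) {p q : ℝ≥0∞}
    (hp : 1 ≤ p) (hq : 1 ≤ q) (hb : BddL T p f) {μ : Fin (n + 1)} (hd : BddL T q (pd μ f)) :
    IsPd T μ (fun t => Op a (f t)) (fun t x => Op a (pd μ f t) x) := by
  refine (ha.isPd_Op (μ := μ) (p := p) (q := q) (r := fun _ => 1) hf (hf.pd μ)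
    (w := fun j => fun _ _ => 0) (fun j => smooth_zero) hp hq (fun _ => le_rfl) hb
    hd (fun j => bddL_zero 1) (fun t ht x => ?_)).congr (fun _ _ _ => rfl) (fun t ht x => ?_)
  · rw [Finset.sum_eq_zero, add_zero]
    exact fun j _ => (isPd_zero (T := T) j.succ).pd_eq ht x
  · rw [Finset.sum_eq_zero, add_zero]
    exact fun j _ => by simp [Op, cnv]

omit hη in
lemma Fld.memLp (hf : Fld η T M e f) {t : ℝ} (ht : t ∈ Ioo 0 T) : MemLp (f t) 2 volume :=
  hf.bdd.memLp hf.smooth.cont ht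

lemma Fld.tame (hn : 5 ≤ n) (hf : Fld η T M e f) (hM : M ≠ ⊤) (hEt : E ≠ ⊤)
    (hE : ∀ k, e k ≤ E) : Tame η T f :=
  hf.X.tame hn hη zero_le_one hM hEt hE hf.smooth.cont hf.bdd

lemma Fld.cont_PP (hf : Fld η T M e f) (k : ℤ) : Cont T (fun t => PP η k (f t)) :=
  ((isSymb_p0 hη).dil k).cont_Op hf.smooth.cont one_le_two hf.bdd

/-- The derivatives of the frequency pieces. -/
lemma Fld.strich_pd_PP (hf : Fld η T M e f) (μ : Fin (n + 1)) (k : ℤ) :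
    strich T k (pd μ fun t => PP η k (f t)) ≤
      ofReal (1 + ∑ i, kb (dsymb i (pt η))) * M * wt k * e k := by
  have hk : ∀ i : Fin n, 1 ≤ kb (dsymb i (pt η)) := fun i => one_le_kb _
  have hs : 0 ≤ ∑ i, kb (dsymb i (pt η)) := Finset.sum_nonneg fun i _ => by linarith [hk i]
  induction μ using Fin.cases with
  | zero =>
    refine (hf.Xt k).trans ?_
    have : 1 ≤ ofReal (1 + ∑ i, kb (dsymb i (pt η))) := by
      rw [← ENNReal.ofReal_one]; exact ofReal_le_ofReal (by linarith)
    calc M * wt k * e k = 1 * (M * wt k * e k) := (one_mul _).symm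
      _ ≤ ofReal (1 + ∑ i, kb (dsymb i (pt η))) * (M * wt k * e k) :=
          mul_le_mul' this le_rfl
      _ = _ := by ring
  | succ i =>
    have h1 : ∀ t ∈ Ioo 0 T, ∀ x, pd i.succ (fun t => PP η k (f t)) t x =
        (2 : ℝ) ^ k * Op (dil k (dsymb i (pt η))) (PP η k (f t)) x := fun t ht x =>
      ((isPd_Op_space ((isSymb_p0 hη).dil k) hf.smooth one_le_two hf.bdd i).pd_eq ht x).trans
        (Op_dsymb_PP hη one_le_two (hf.memLp ht) i k x)
    rw [strich_congr h1]
    refine (strich_const_mul_le k _ _).trans ?_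
    rw [abs_of_pos (by positivity), ← wt_intCast]
    have h2 := strich_Op_le ((isSymb_pt hη).dsymb i) k k (hf.cont_PP hη k)
    have h3 := hf.X k
    rw [zero_mul, wt_zero, mul_one] at h3
    calc _ ≤ wt k * (ofReal (kb (dsymb i (pt η))) * (M * e k)) :=
          mul_le_mul' le_rfl (h2.trans (mul_le_mul' le_rfl h3))
      _ ≤ wt k * (ofReal (1 + ∑ i, kb (dsymb i (pt η))) * (M * e k)) := by
          gcongr
          have := single_le_sum (f := fun i => kb (dsymb i (pt η)))
            (fun i _ => by linarith [hk i]) (Finset.mem_univ i)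
          linarith
      _ = _ := by ring

omit hη in
lemma Fld.cont_pd_Op (hf : Fld η T M e f) {a : Space n → ℂ} (ha : IsSymb a) (μ : Fin (n + 1)) :
    Cont T (pd μ fun t => Op a (f t)) ∧ IsPd T μ (fun t => Op a (f t)) (pd μ fun t => Op a (f t))
      := by
  obtain ⟨v, w, hv, hw, hvb, hwb, heq⟩ := hf.dmu μ
  have h1 := ha.isPd_Op hf.smooth hv hw one_le_two le_rfl (r := fun _ => 2) (fun _ => one_le_two)
    hf.bdd hvb hwb heq
  refine ⟨?_, h1.congr (fun _ _ _ => rfl) fun t ht x => h1.pd_eq ht x⟩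
  refine Cont.congr ?_ fun t ht x => h1.pd_eq ht x
  exact (ha.cont_Op hv.cont le_rfl hvb).add
    (Cont.sum _ fun i _ => (ha.dsymb i).cont_Op (hw i).cont one_le_two (hwb i))

/-- The derivatives are bounded in `L²`. -/
theorem Fld.bdd_pd (hn : 5 ≤ n) (hf : Fld η T M e f) (hM : M ≠ ⊤) (hEt : E ≠ ⊤)
    (hE : ∀ k, e k ≤ E) (μ : Fin (n + 1)) : BddL T 2 (pd μ f) := by
  have hn' : (5 : ℝ) ≤ n := by exact_mod_cast hn
  obtain ⟨v, w, hv, hw, hvb, hwb, heq⟩ := hf.dmu μ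
  have ha := (isSymb_e0 hη).dil 0
  have h0 := ha.isPd_Op hf.smooth hv hw one_le_two le_rfl (r := fun _ => 2) (fun _ => one_le_two)
    hf.bdd hvb hwb heq
  obtain ⟨Bv, hBv, hbv⟩ := hvb
  choose Bw hBw hbw using hwb
  set B₀ := ofReal (kb (e0 η) * (2 : ℝ) ^ ((n : ℝ) * (0 : ℤ) *
    (((1 : ℝ≥0∞)⁻¹).toReal - ((2 : ℝ≥0∞)⁻¹).toReal))) * Bv +
    ∑ i, ofReal (kb (dsymb i (dil 0 (e0 η)))) * Bw i with hB₀
  have hB₀t : B₀ ≠ ⊤ := by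
    refine ENNReal.add_ne_top.2 ⟨mul_ne_top ofReal_ne_top hBv, ?_⟩
    exact ENNReal.sum_ne_top.2 fun i _ => mul_ne_top ofReal_ne_top (hBw i)
  have hlow : ∀ t ∈ Ioo 0 T, eLpNorm (pd μ (fun t => LL η 0 (f t)) t) 2 volume ≤ B₀ := by
    intro t ht
    have e1 : pd μ (fun t => LL η 0 (f t)) t = (Op (dil 0 (e0 η)) (v t)) +
        ∑ i, Op (dsymb i (dil 0 (e0 η))) (w i t) := by
      ext x
      simp only [Pi.add_apply, Finset.sum_apply]
      exact h0.pd_eq ht x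
    have hmv := (hv.cont.slice ht).aestronglyMeasurable (μ := volume)
    have hmw := fun i => ((hw i).cont.slice ht).aestronglyMeasurable (μ := volume)
    rw [e1]
    refine (eLpNorm_add_le (aestronglyMeasurable_cnv ha.continuous_kern hmv)
      (Finset.aestronglyMeasurable_sum _ fun i _ =>
        aestronglyMeasurable_cnv (ha.dsymb i).continuous_kern (hmw i)) one_le_two).trans ?_
    refine add_le_add ?_ ?_
    · refine (eLpNorm_Op_dil_le_bernstein (isSymb_e0 hη) 0 le_rfl one_le_two hmv).trans ?_
      gcongr
      exact hbv t ht
    · refine (eLpNorm_sum_le (fun i _ => aestronglyMeasurable_cnv (ha.dsymb i).continuous_kern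
        (hmw i)) one_le_two).trans (sum_le_sum fun i _ => ?_)
      refine (eLpNorm_cnv_le (ha.dsymb i).kb_spec.2 (hmw i) one_le_two).trans ?_
      gcongr
      exact hbw i t ht
  set K := ofReal (1 + ∑ i, kb (dsymb i (pt η))) with hK
  set B₁ := K * M * E * geo (1 / 2) with hB₁
  have hB₁t : B₁ ≠ ⊤ := by
    have := geo_ne_top (δ := 1 / 2) (by norm_num)
    rw [hB₁, hK]; finiteness
  have hhigh : ∀ i : ℕ, ∀ t ∈ Ioo 0 T,
      eLpNorm (pd μ (fun t => PP η (0 + 1 + i) (f t)) t) 2 volume ≤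
        K * M * E * wt (-(1 / 2 * i)) := by
    intro i t ht
    have h1 := (hf.cont_pd_Op ((isSymb_p0 hη).dil (0 + 1 + i)) μ).1.eLpNorm_le_mixedNorm 2 ht
    refine h1.trans ((mixedNorm_le_strich admissible_top_two (0 + 1 + i) _).trans ?_)
    refine (mul_le_mul' le_rfl (hf.strich_pd_PP hη μ _)).trans ?_
    rw [toReal_inv_top, toReal_inv_two]
    calc _ = K * M * e (0 + 1 + i) * (wt (-(0 + (n : ℝ) * (1 / 2) - 1) * (0 + 1 + i : ℤ)) *
          wt ((0 + 1 + i : ℤ) : ℝ)) := by ring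
      _ ≤ K * M * E * wt (-(1 / 2 * i)) := by
          rw [← wt_add]
          gcongr
          · exact hE _
          · refine wt_mono ?_
            push_cast
            have : (0 : ℝ) ≤ i := Nat.cast_nonneg i
            nlinarith
  refine bddL_of_approx (hf.smooth.isPd μ) hf.smooth.cont
    (w := fun m t => LL η (0 + m) (f t)) (v := fun m => pd μ (fun t => LL η (0 + m) (f t)))
    (fun m => ((isSymb_e0 hη).dil _).cont_Op hf.smooth.cont one_le_two hf.bdd)
    (fun m => (hf.cont_pd_Op ((isSymb_e0 hη).dil _) μ).1)
    (fun m => (hf.cont_pd_Op ((isSymb_e0 hη).dil _) μ).2)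
    (fun t ht x => tendsto_LL_atTop hη one_le_two (hf.memLp ht) (hf.smooth.cont.slice ht) 0 x)
    (B := B₀ + B₁) (ENNReal.add_ne_top.2 ⟨hB₀t, hB₁t⟩) fun m t ht => ?_
  have hsum : IsPd T μ (fun t => LL η (0 + m) (f t)) (fun t x => pd μ (fun t => LL η 0 (f t)) t x +
      ∑ i ∈ Finset.range m, pd μ (fun t => PP η (0 + 1 + i) (f t)) t x) :=
    (((hf.cont_pd_Op ha μ).2).add (IsPd.sum (Finset.range m) fun (i : ℕ) _ =>
      (hf.cont_pd_Op ((isSymb_p0 hη).dil (0 + 1 + i)) μ).2)).congr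
      (fun t ht x => LL_add_eq hη one_le_two (hf.memLp ht) 0 m x) fun _ _ _ => rfl
  have e2 : pd μ (fun t => LL η (0 + m) (f t)) t = pd μ (fun t => LL η 0 (f t)) t +
      ∑ i ∈ Finset.range m, pd μ (fun t => PP η (0 + 1 + i) (f t)) t := by
    ext x
    rw [hsum.pd_eq ht x]
    simp
  have hm2 : ∀ i ∈ Finset.range m, AEStronglyMeasurable
      (pd μ (fun t => PP η (0 + 1 + i) (f t)) t) volume := fun i _ =>
    ((hf.cont_pd_Op ((isSymb_p0 hη).dil (0 + 1 + i)) μ).1.slice ht).aestronglyMeasurable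
  rw [e2]
  refine (eLpNorm_add_le ((hf.cont_pd_Op ha μ).1.slice ht).aestronglyMeasurable
    (Finset.aestronglyMeasurable_sum _ hm2) one_le_two).trans (add_le_add (hlow t ht) ?_)
  refine (eLpNorm_sum_le hm2 one_le_two).trans ?_
  refine (sum_le_sum fun i _ => hhigh i t ht).trans ?_
  refine (ENNReal.sum_le_tsum _).trans ?_
  rw [ENNReal.tsum_mul_left, hB₁, geo]

/-- The frequency pieces of the derivatives. -/
theorem Fld.X_pd (hn : 5 ≤ n) (hf : Fld η T M e f) (hM : M ≠ ⊤) (hEt : E ≠ ⊤)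
    (hE : ∀ k, e k ≤ E) (μ : Fin (n + 1)) :
    XB η T 1 (ofReal (1 + ∑ i, kb (dsymb i (pt η))) * M) e (pd μ f) := by
  intro k
  have h1 := isPd_Op_of_bddL ((isSymb_p0 hη).dil k) hf.smooth one_le_two one_le_two hf.bdd
    (hf.bdd_pd hη hn hM hEt hE μ)
  refine (strich_congr fun t ht x => (h1.pd_eq ht x).symm).trans_le ?_
  refine (hf.strich_pd_PP hη μ k).trans_eq ?_
  rw [one_mul]

lemma Fld.tame_pd (hn : 5 ≤ n) (hf : Fld η T M e f) (hM : M ≠ ⊤) (hEt : E ≠ ⊤)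
    (hE : ∀ k, e k ≤ E) (μ : Fin (n + 1)) : Tame η T (pd μ f) :=
  (hf.X_pd hη hn hM hEt hE μ).tame hn hη le_rfl (mul_ne_top ofReal_ne_top hM) hEt
    hE (hf.smooth.pd μ).cont (hf.bdd_pd hη hn hM hEt hE μ)

theorem Fld.bdd_four (hn : 5 ≤ n) (hf : Fld η T M e f) (hM : M ≠ ⊤) (hEt : E ≠ ⊤)
    (hE : ∀ k, e k ≤ E) : BddL T 4 f := by
  have hn' : (5 : ℝ) ≤ n := by exact_mod_cast hn
  obtain ⟨B, hB, hb⟩ := hf.bdd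
  set C := ofReal (kb (e0 η) * (2 : ℝ) ^ ((n : ℝ) * (0 : ℤ) *
    (((2 : ℝ≥0∞)⁻¹).toReal - ((4 : ℝ≥0∞)⁻¹).toReal))) with hC
  refine ⟨C * B + M * E * geo (1 / 4), ?_, fun t ht => ?_⟩
  · have := geo_ne_top (δ := 1 / 4) (by norm_num)
    finiteness
  have hc := hf.smooth.cont.slice ht
  have hm := hf.memLp ht
  have e1 : f t = (LL η 0 (f t)) + fun x => f t x - LL η 0 (f t) x := by
    ext x; simp
  have hmL := aestronglyMeasurable_LL hη hm.1 0
  calc eLpNorm (f t) 4 volume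
      = eLpNorm (LL η 0 (f t) + fun x => f t x - LL η 0 (f t) x) 4 volume := by rw [← e1]
    _ ≤ eLpNorm (LL η 0 (f t)) 4 volume + eLpNorm (fun x => f t x - LL η 0 (f t) x) 4 volume :=
        eLpNorm_add_le hmL (hm.1.sub hmL) (one_le_two.trans two_le_four)
    _ ≤ _ := add_le_add ?_ ?_
  · refine (eLpNorm_Op_dil_le_bernstein (isSymb_e0 hη) 0 one_le_two two_le_four hm.1).trans ?_
    gcongr
    exact hb t ht
  · refine (eLpNorm_sub_LL_le_tsum hη one_le_two hm hc 0 (one_le_two.trans two_le_four)).trans ?_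
    have h1 : ∀ i : ℕ, eLpNorm (PP η (0 + 1 + i) (f t)) 4 volume ≤
        M * E * wt (-(1 / 4 * i)) := by
      intro i
      refine ((hf.cont_PP hη _).eLpNorm_le_mixedNorm 4 ht).trans
        ((hf.X.pnorm_le (admissible_top_four hn) _).trans ?_)
      rw [toReal_inv_top, toReal_inv_four]
      calc _ = M * e (0 + 1 + i) * wt ((0 - (0 + (n : ℝ) * (1 / 4) - 1)) * (0 + 1 + i : ℤ)) := by
            ring
        _ ≤ _ := by
            gcongr
            · exact hE _
            · refine wt_mono ?_
              push_cast
              have : (0 : ℝ) ≤ i := Nat.cast_nonneg i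
              nlinarith
    refine (ENNReal.tsum_le_tsum h1).trans_eq ?_
    rw [ENNReal.tsum_mul_left, geo]

end Fld

/-! ### Commutators with functions of low frequency -/

lemma lintegral_dil {φ : Space n → ℝ≥0∞} (hφ : Measurable φ) (k : ℤ) :
    ofReal ((2 : ℝ) ^ (n * k)) * ∫⁻ y, φ ((2 : ℝ) ^ k • y) = ∫⁻ y, φ y := by
  have h2 : (2 : ℝ) ^ k ≠ 0 := by positivity
  have : ∫⁻ y, φ ((2 : ℝ) ^ k • y) =
      ofReal |(((2 : ℝ) ^ k) ^ Module.finrank ℝ (Space n))⁻¹| * ∫⁻ y, φ y := by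
    rw [← smul_eq_mul, ← lintegral_smul_measure, ← Measure.map_addHaar_smul _ h2,
      lintegral_map hφ (measurable_const_smul _)]
  rw [this, ← mul_assoc, ← ofReal_mul (by positivity), finrank_euclideanSpace_fin,
    abs_of_pos (by positivity), ← zpow_natCast, ← zpow_mul, mul_comm (n : ℤ) k,
    mul_inv_cancel₀ (by positivity)]
  simp

/-- The `L¹` norm of the gradient of the kernel of a symbol. -/
def kg (a : Space n → ℂ) : ℝ≥0∞ := ∫⁻ y, ‖fderiv ℝ (kern a) y‖ₑ

lemma IsSymb.kg_ne_top {a : Space n → ℂ} (ha : IsSymb a) : kg a ≠ ⊤ := by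
  set S := 𝓕⁻ ha.sch with hS
  have hi := (SchwartzMap.fderivCLM ℝ (Space n) ℂ S).integrable (μ := volume)
  have e1 : kern a = fun x => Complex.reCLM (S x) := by
    ext x; simp [kern, hS, ha.fourierInv_sch]
  refine ne_top_of_le_ne_top hi.2.ne ?_
  refine lintegral_mono fun y => ?_
  have hd := ((𝓕⁻ ha.sch).differentiable y).hasFDerivAt
  have h2 : fderiv ℝ (kern a) y = Complex.reCLM.comp (fderiv ℝ S y) := by
    rw [e1]; exact (Complex.reCLM.hasFDerivAt.comp y hd).fderiv
  rw [← ofReal_norm, ← ofReal_norm]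
  refine ofReal_le_ofReal ?_
  rw [h2, SchwartzMap.fderivCLM_apply]
  refine (ContinuousLinearMap.opNorm_comp_le _ _).trans ?_
  rw [Complex.reCLM_norm, one_mul]

lemma IsSymb.lintegral_shift_le {a : Space n → ℂ} (ha : IsSymb a) (z : Space n) :
    ∫⁻ x, ‖kern a (x - z) - kern a x‖ₑ ≤ ‖z‖ₑ * kg a := by
  have hc := ha.contDiff_kern
  have hfc : Continuous (fderiv ℝ (kern a)) := hc.continuous_fderiv (by simp)
  set ν := volume.restrict (Ioc (0 : ℝ) 1) with hν
  have hpt : ∀ x, ‖kern a (x - z) - kern a x‖ₑ ≤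
      ∫⁻ τ, ‖z‖ₑ * ‖fderiv ℝ (kern a) (x + τ • (-z))‖ₑ ∂ν := by
    intro x
    have hl : ∀ τ : ℝ, HasDerivAt (fun τ : ℝ => kern a (x + τ • (-z)))
        (fderiv ℝ (kern a) (x + τ • (-z)) (-z)) τ := by
      intro τ
      have h1 := (hc.differentiable (by simp) (x + τ • (-z))).hasFDerivAt
      have h2 : HasDerivAt (fun τ : ℝ => x + τ • (-z)) (-z) τ := by
        simpa using ((hasDerivAt_id τ).smul_const (-z)).const_add x
      exact h1.comp_hasDerivAt τ h2
    have hcc : Continuous fun τ : ℝ => fderiv ℝ (kern a) (x + τ • (-z)) (-z) :=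
      (hfc.comp (by fun_prop)).clm_apply continuous_const
    have h3 := intervalIntegral.integral_eq_sub_of_hasDerivAt (a := 0) (b := 1)
      (fun τ _ => hl τ) (hcc.intervalIntegrable _ _)
    simp only [one_smul, zero_smul, add_zero, ← sub_eq_add_neg] at h3
    rw [← h3, intervalIntegral.integral_of_le zero_le_one]
    refine (enorm_integral_le_lintegral_enorm _).trans (lintegral_mono fun τ => ?_)
    have h4 := (fderiv ℝ (kern a) (x + τ • (-z))).le_opNorm (-z)
    rw [norm_neg, mul_comm] at h4
    have e : x + τ • (-z) = x + τ • (-z) := rfl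
    rw [← ofReal_norm, ← ofReal_norm, ← ofReal_norm, ← ofReal_mul (norm_nonneg _)]
    refine ofReal_le_ofReal ?_
    simpa [smul_neg, sub_eq_add_neg] using h4
  refine (lintegral_mono hpt).trans ?_
  have hm : Measurable (Function.uncurry fun (x : Space n) (τ : ℝ) =>
      ‖z‖ₑ * ‖fderiv ℝ (kern a) (x + τ • (-z))‖ₑ) := by
    refine Measurable.const_mul ?_ _
    have : Continuous fun p : Space n × ℝ => fderiv ℝ (kern a) (p.1 + p.2 • (-z)) :=
      hfc.comp (by fun_prop)
    exact this.enorm.measurable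
  rw [lintegral_lintegral_swap hm.aemeasurable]
  have h5 : ∀ τ : ℝ, ∫⁻ x, ‖z‖ₑ * ‖fderiv ℝ (kern a) (x + τ • (-z))‖ₑ = ‖z‖ₑ * kg a := by
    intro τ
    rw [lintegral_const_mul' _ _ enorm_ne_top, kg,
      lintegral_add_right_eq_self (fun x => ‖fderiv ℝ (kern a) x‖ₑ)]
  simp_rw [h5]
  rw [lintegral_const, hν, Measure.restrict_apply_univ, Real.volume_Ioc]
  simp

lemma IsSymb.lintegral_shift_dil_le {a : Space n → ℂ} (ha : IsSymb a) (k : ℤ) (z : Space n) :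
    ∫⁻ x, ‖kern (WaveMap.dil k a) (x - z) - kern (WaveMap.dil k a) x‖ₑ ≤
      wt k * ‖z‖ₑ * kg a := by
  have h1 := ha.lintegral_shift_le ((2 : ℝ) ^ k • z)
  have hm : Measurable fun x => ‖kern a (x - (2 : ℝ) ^ k • z) - kern a x‖ₑ :=
    ((ha.continuous_kern.comp (by fun_prop)).sub ha.continuous_kern).enorm.measurable
  rw [← lintegral_dil hm k, ← lintegral_const_mul' _ _ ofReal_ne_top] at h1
  rw [wt_intCast]
  refine le_trans (le_of_eq (lintegral_congr fun x => ?_)) (h1.trans_eq ?_)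
  · rw [kern_dil, kern_dil, ← mul_sub, enorm_mul, Real.enorm_eq_ofReal (by positivity), smul_sub]
  · rw [enorm_smul, Real.enorm_eq_ofReal (by positivity)]

section commutator
variable {η : Space n → ℝ} (hη : IsCutoff η) {f : Space n → ℝ}
include hη

/-- Translations of frequency pieces. -/
lemma eLpNorm_PP_shift_le {p : ℝ≥0∞} (hp : 1 ≤ p) (hf : MemLp f p volume) {s : ℝ≥0∞} (hs : 1 ≤ s)
    (k : ℤ) (z : Space n) :
    eLpNorm (fun x => PP η k f (x - z) - PP η k f x) s volume ≤
      wt k * ‖z‖ₑ * kg (pt η) * eLpNorm (PP η k f) s volume := by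
  have ht := (isSymb_pt hη).dil k
  set g := PP η k f with hg
  have hgm : MemLp g p volume := memLp_PP hη hp hf k
  have e0 : g = cnv (kern (dil k (pt η))) g := by
    have := Op_comp ht ((isSymb_p0 hη).dil k) hp hf
    rw [← dil_mul, mul_comm, p0_mul_pt hη] at this
    exact this.symm
  have e1 : (fun x => g (x - z) - g x) =
      cnv (fun y => kern (dil k (pt η)) (y - z) - kern (dil k (pt η)) y) g := by
    ext x
    conv_lhs => rw [e0]
    simp only [cnv, sub_mul]
    refine (integral_sub (ht.integrable_mul hp hgm (x - z))
      (ht.integrable_mul hp hgm x)).symm.trans (integral_congr_ae (Eventually.of_forall fun y => ?_))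
    simp only
    rw [show x - z - y = x - y - z by abel]
  have hK : KBound (fun y => kern (dil k (pt η)) (y - z) - kern (dil k (pt η)) y)
      (wt k * ‖z‖ₑ * kg (pt η)) (ofReal (kb (dil k (pt η))) +
        ofReal (kb (dil k (pt η)))) := by
    refine ⟨(ht.continuous_kern.comp (by fun_prop)).sub ht.continuous_kern,
      (isSymb_pt hη).lintegral_shift_dil_le k z, fun y => ?_⟩
    exact enorm_sub_le.trans (add_le_add (ht.kb_spec.2.sup _) (ht.kb_spec.2.sup _))
  rw [e1]
  exact eLpNorm_cnv_le hK hgm.1 hs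

/-- Translations of functions of low frequency. -/
lemma eLpNorm_LL_shift_le (hn : 1 ≤ n) {p : ℝ≥0∞} (hp : 1 ≤ p) (hpt : p ≠ ⊤)
    (hf : MemLp f p volume) {s : ℝ≥0∞} (hs : 1 ≤ s) (J : ℤ) (z : Space n) :
    eLpNorm (fun x => LL η J f (x - z) - LL η J f x) s volume ≤
      ‖z‖ₑ * (kg (pt η) * ∑' i : ℕ, wt (J - i : ℤ) * eLpNorm (PP η (J - i) f) s volume) := by
  refine (eLpNorm_le_tsum (F := fun i x => PP η (J - i) f (x - z) - PP η (J - i) f x)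
    (fun i => ?_) (fun x => ?_) hs).trans ?_
  · have h1 := (memLp_PP hη hp hf (J - i)).1
    exact (h1.comp_measurePreserving (measurePreserving_sub_right volume z)).sub h1
  · simp only [Finset.sum_sub_distrib]
    exact (tendsto_sum_PP_low hη hp hpt hn hf J (x - z)).sub
      (tendsto_sum_PP_low hη hp hpt hn hf J x)
  · rw [← mul_assoc, ← ENNReal.tsum_mul_left]
    refine ENNReal.tsum_le_tsum fun i => ?_
    refine (eLpNorm_PP_shift_le hη hp hf hs _ z).trans_eq ?_
    ring

end commutator

/-- A moment of the kernel of a symbol. -/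
def kmom (a : Space n → ℂ) : ℝ≥0∞ := ∫⁻ y, ‖kern a y‖ₑ * ‖y‖ₑ ^ (2 : ℝ)

lemma IsSymb.kmom_ne_top {a : Space n → ℂ} (ha : IsSymb a) : kmom a ≠ ⊤ := by
  have h1 := (𝓕⁻ ha.sch).integrable_pow_mul volume 2
  refine ne_top_of_le_ne_top h1.2.ne (lintegral_mono fun y => ?_)
  rw [Real.enorm_eq_ofReal (r := ‖y‖ ^ 2 * _) (by positivity), ofReal_mul (by positivity),
    mul_comm]
  refine mul_le_mul' (le_of_eq ?_) ?_
  · rw [show (2 : ℝ) = ((2 : ℕ) : ℝ) by norm_num, ENNReal.rpow_natCast, ← ofReal_norm,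
      ENNReal.ofReal_pow (norm_nonneg _)]
  · rw [Real.enorm_eq_ofReal_abs]
    refine ofReal_le_ofReal ?_
    rw [kern, ← ha.fourierInv_sch]
    exact Complex.abs_re_le_norm _

/-- The commutator estimate at a fixed time. -/
lemma eLpNorm_commutator_le {a : Space n → ℂ} (ha : IsSymb a) {F G : Space n → ℝ}
    (hF : Continuous F) (hG : Continuous G) {p q : ℝ≥0∞} (hp : 1 ≤ p) (hq : 1 ≤ q)
    (hGp : MemLp G p volume) (hFG : MemLp (fun y => F y * G y) q volume) {s r : ℝ≥0∞}
    [ENNReal.HolderTriple s r 2] {D : ℝ≥0∞}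
    (hD : ∀ z, eLpNorm (fun x => F (x - z) - F x) s volume ≤ ‖z‖ₑ * D) :
    eLpNorm (fun x => Op a (fun y => F y * G y) x - F x * Op a G x) 2 volume ≤
      (ofReal (kb a) * kmom a) ^ (1 / 2 : ℝ) * (D * eLpNorm G r volume) := by
  set H : Space n → ℝ := fun x => Op a (fun y => F y * G y) x - F x * Op a G x with hH
  set m : Space n → Space n → ℝ≥0∞ := fun x z => ‖(F (x - z) - F x) * G (x - z)‖ₑ with hm
  have hkc : Continuous fun z => ‖kern a z‖ₑ := ha.continuous_kern.enorm
  have hmc : Continuous (Function.uncurry m) := by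
    have : Continuous fun p : Space n × Space n => (F (p.1 - p.2) - F p.1) * G (p.1 - p.2) := by
      fun_prop
    exact this.enorm
  have hH1 : ∀ x, ‖H x‖ₑ ≤ ∫⁻ z, ‖kern a z‖ₑ * m x z := by
    intro x
    have e : H x = ∫ y, kern a (x - y) * ((F y - F x) * G y) := by
      simp only [hH, Op, cnv]
      rw [← integral_const_mul, ← integral_sub (ha.integrable_mul hq hFG x)
        ((ha.integrable_mul hp hGp x).const_mul _)]
      refine integral_congr_ae (Eventually.of_forall fun y => ?_)
      simp only
      ring
    rw [e]
    refine (enorm_integral_le_lintegral_enorm _).trans_eq ?_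
    rw [← lintegral_sub_left_eq_self _ x]
    refine lintegral_congr fun z => ?_
    rw [enorm_mul, sub_sub_cancel]
  have hH2 : ∀ x, ‖H x‖ₑ ^ (2 : ℝ) ≤
      ofReal (kb a) * ∫⁻ z, ‖kern a z‖ₑ * m x z ^ (2 : ℝ) := by
    intro x
    have hmx : Measurable (m x) := (hmc.comp (by fun_prop : Continuous fun z => (x, z))).measurable
    have h1 := ENNReal.lintegral_mul_le_Lp_mul_Lq volume Real.HolderConjugate.two_two
      (f := fun z => ‖kern a z‖ₑ ^ (1 / 2 : ℝ)) (g := fun z => ‖kern a z‖ₑ ^ (1 / 2 : ℝ) * m x z)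
      (hkc.measurable.pow_const _).aemeasurable
      ((hkc.measurable.pow_const _).mul hmx).aemeasurable
    have e1 : ∀ z, ‖kern a z‖ₑ ^ (1 / 2 : ℝ) * (‖kern a z‖ₑ ^ (1 / 2 : ℝ) * m x z) =
        ‖kern a z‖ₑ * m x z := by
      intro z
      rw [← mul_assoc, ← ENNReal.rpow_add_of_nonneg _ _ (by norm_num) (by norm_num)]
      norm_num
    have e2 : ∀ z, (‖kern a z‖ₑ ^ (1 / 2 : ℝ)) ^ (2 : ℝ) = ‖kern a z‖ₑ := by
      intro z
      rw [← ENNReal.rpow_mul]; norm_num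
    simp only [Pi.mul_apply, e1, mul_rpow_of_nonneg _ _ zero_le_two, e2] at h1
    calc ‖H x‖ₑ ^ (2 : ℝ) ≤ (∫⁻ z, ‖kern a z‖ₑ * m x z) ^ (2 : ℝ) := by gcongr; exact hH1 x
      _ ≤ ((∫⁻ z, ‖kern a z‖ₑ) ^ (1 / 2 : ℝ) *
          (∫⁻ z, ‖kern a z‖ₑ * m x z ^ (2 : ℝ)) ^ (1 / 2 : ℝ)) ^ (2 : ℝ) := by gcongr
      _ = (∫⁻ z, ‖kern a z‖ₑ) * ∫⁻ z, ‖kern a z‖ₑ * m x z ^ (2 : ℝ) := by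
          rw [mul_rpow_of_nonneg _ _ zero_le_two, ← ENNReal.rpow_mul, ← ENNReal.rpow_mul]
          norm_num
      _ ≤ _ := by gcongr; exact ha.kb_spec.2.l1
  have hsq : eLpNorm H 2 volume ^ (2 : ℝ) ≤
      ((ofReal (kb a) * kmom a) ^ (1 / 2 : ℝ) * (D * eLpNorm G r volume)) ^ (2 : ℝ) := by
    rw [eLpNorm_two_sq]
    refine (lintegral_mono hH2).trans ?_
    rw [lintegral_const_mul' _ _ ofReal_ne_top]
    have hmm : Measurable (Function.uncurry fun x z => ‖kern a z‖ₑ * m x z ^ (2 : ℝ)) :=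
      (hkc.measurable.comp measurable_snd).mul (hmc.measurable.pow_const _)
    rw [lintegral_lintegral_swap hmm.aemeasurable]
    have h2 : ∀ z, ∫⁻ x, ‖kern a z‖ₑ * m x z ^ (2 : ℝ) ≤
        ‖kern a z‖ₑ * ‖z‖ₑ ^ (2 : ℝ) * (D * eLpNorm G r volume) ^ (2 : ℝ) := by
      intro z
      rw [lintegral_const_mul' _ _ enorm_ne_top, mul_assoc, ← eLpNorm_two_sq,
        ← mul_rpow_of_nonneg _ _ zero_le_two]
      gcongr
      have c1 : Continuous fun x => F (x - z) - F x := by fun_prop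
      have c2 : Continuous fun x => G (x - z) := by fun_prop
      refine (eLpNorm_mul_le (r₁ := s) (r₂ := r) c1.aestronglyMeasurable
        c2.aestronglyMeasurable).trans ?_
      rw [← mul_assoc]
      refine mul_le_mul' (hD z) (le_of_eq ?_)
      exact eLpNorm_comp_measurePreserving hG.aestronglyMeasurable
        (measurePreserving_sub_right volume z)
    refine (mul_le_mul' le_rfl (lintegral_mono h2)).trans_eq ?_
    rw [lintegral_mul_const, mul_rpow_of_nonneg ((_ : ℝ≥0∞) ^ (1 / 2 : ℝ)) _ zero_le_two,
      ← ENNReal.rpow_mul, ← mul_assoc, kmom]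
    · norm_num
    · exact hkc.measurable.mul (continuous_enorm.measurable.pow_const _)
  exact (ENNReal.rpow_le_rpow_iff (by norm_num)).1 hsq

/-! ### The commutator estimate in `L¹L²` -/

lemma cont_sub {u v : STField n} (hu : Cont T u) (hv : Cont T v) :
    Cont T (fun t x => u t x - v t x) := ContinuousOn.sub hu hv

lemma BddL.sub {r : ℝ≥0∞} (hr : 1 ≤ r) {f g : STField n} (hf : Cont T f)
    (hg : Cont T g) (hfb : BddL T r f) (hgb : BddL T r g) :
    BddL T r (fun t x => f t x - g t x) := by
  obtain ⟨B, hB, hb⟩ := hfb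
  obtain ⟨B', hB', hb'⟩ := hgb
  refine ⟨B + B', ENNReal.add_ne_top.2 ⟨hB, hB'⟩, fun t ht => ?_⟩
  exact (eLpNorm_sub_le (hf.slice ht).aestronglyMeasurable
    (hg.slice ht).aestronglyMeasurable hr).trans (add_le_add (hb t ht) (hb' t ht))

section low
variable {η : Space n → ℝ} (hη : IsCutoff η)
include hη

lemma PP_Op_comm {a : Space n → ℂ} (ha : IsSymb a) {p : ℝ≥0∞} (hp : 1 ≤ p) {f : Space n → ℝ}
    (hf : MemLp f p volume) (k : ℤ) : PP η k (Op a f) = Op a (PP η k f) := by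
  rw [PP, Op_comp ((isSymb_p0 hη).dil k) ha hp hf, mul_comm, PP,
    Op_comp ha ((isSymb_p0 hη).dil k) hp hf]

lemma Tame.op {f : STField n} (hf : Tame η T f) {a : Space n → ℂ} (ha : IsSymb a) :
    Tame η T (fun t => Op a (f t)) := by
  refine ⟨ha.cont_Op hf.cont one_le_two hf.bdd, ha.bddL_Op one_le_two hf.cont hf.bdd,
    fun t ht J => ?_⟩
  have hm := (hf.at ht).memLp
  refine ne_top_of_le_ne_top (mul_ne_top (ofReal_ne_top (r := kb a))
    (hf.tail t ht J)) ?_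
  rw [← ENNReal.tsum_mul_left]
  refine ENNReal.tsum_le_tsum fun i => ?_
  rw [PP_Op_comm hη ha one_le_two hm]
  exact eLpNorm_cnv_le ha.kb_spec.2 (memLp_PP hη one_le_two hm _).1 one_le_two

lemma Tame.sub {f g : STField n} (hf : Tame η T f) (hg : Tame η T g) :
    Tame η T (fun t x => f t x - g t x) := by
  refine ⟨cont_sub hf.cont hg.cont, BddL.sub one_le_two hf.cont hg.cont hf.bdd hg.bdd,
    fun t ht J => ?_⟩
  have hm := (hf.at ht).memLp
  have hm' := (hg.at ht).memLp
  refine ne_top_of_le_ne_top (ENNReal.add_ne_top.2 ⟨hf.tail t ht J, hg.tail t ht J⟩) ?_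
  rw [← ENNReal.tsum_add]
  refine ENNReal.tsum_le_tsum fun i => ?_
  have e : PP η (J + 1 + i) (fun x => f t x - g t x) =
      PP η (J + 1 + i) (f t) - PP η (J + 1 + i) (g t) := by
    ext x
    exact Op_sub_fun ((isSymb_p0 hη).dil _) one_le_two one_le_two hm hm' x
  rw [e]
  exact eLpNorm_sub_le (memLp_PP hη one_le_two hm _).1 (memLp_PP hη one_le_two hm' _).1 one_le_two

/-- The high frequency part of a field. -/
lemma XB.sub_low {s : ℝ} {M : ℝ≥0∞} {e : ℤ → ℝ≥0∞} {f : STField n} (hf : Tame η T f)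
    (h : XB η T s M e f) (J : ℤ) :
    XB η T s (ofReal (1 + kb (e0 η)) * M) e (fun t x => f t x - LL η J (f t) x) := by
  intro k
  have h1 : ∀ t ∈ Ioo 0 T, ∀ x, PP η k (fun x => f t x - LL η J (f t) x) x =
      PP η k (f t) x + (-1) * Op (dil J (e0 η)) (PP η k (f t)) x := by
    intro t ht x
    have hm := (hf.at ht).memLp
    rw [← PP_Op_comm hη ((isSymb_e0 hη).dil J) one_le_two hm]
    refine (Op_sub_fun ((isSymb_p0 hη).dil _) one_le_two one_le_two hm
      (memLp_LL hη one_le_two hm J) x).trans ?_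
    simp only [PP, LL]; ring
  have hc := hf.cont_PP hη k
  have hcL : Cont T (fun t => Op (dil J (e0 η)) (PP η k (f t))) :=
    ((isSymb_e0 hη).dil J).cont_Op hc one_le_two (hf.bdd_PP hη k)
  rw [strich_congr h1]
  refine (strich_add_le k hc (hcL.const_mul _)).trans ?_
  have h2 := (strich_const_mul_le (T := T) k (-1) _).trans
    (mul_le_mul' le_rfl (strich_Op_le (isSymb_e0 hη) k J hc))
  rw [abs_neg, abs_one, ENNReal.ofReal_one, one_mul] at h2
  refine (add_le_add (h k) (h2.trans (mul_le_mul' le_rfl (h k)))).trans_eq ?_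
  rw [ENNReal.ofReal_add zero_le_one (by linarith [one_le_kb (e0 η)]), ENNReal.ofReal_one]
  ring

lemma PP_sub_low_eq_zero {f : Space n → ℝ} (hm : MemLp f 2 volume) {k J : ℤ} (hk : k + 1 ≤ J) :
    PP η k (fun x => f x - LL η J f x) = 0 := by
  ext x
  refine (Op_sub_fun ((isSymb_p0 hη).dil _) one_le_two one_le_two hm
    (memLp_LL hη one_le_two hm J) x).trans ?_
  have e : dil k (p0 η) * dil J (e0 η) = dil k (p0 η) := by
    ext v
    simp only [Pi.mul_apply]
    by_cases hv : 2 * Real.pi * ‖v‖ ≤ 2 ^ J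
    · rw [dil_e0_eq_one hη J v hv, mul_one]
    · rw [dil_p0_eq_zero_of_lt hη k v, zero_mul]
      exact (zpow_le_zpow_right₀ (by norm_num) hk).trans_lt (not_le.1 hv)
  have := Op_comp ((isSymb_p0 hη).dil k) ((isSymb_e0 hη).dil J) one_le_two hm
  rw [e] at this
  rw [LL, this, sub_self]; rfl

/-- When the first factor has low frequencies, only the frequencies of the second factor which are
close to the one of the output matter. -/
lemma PP_low_mul_eq {f g : Space n → ℝ} (hF : TameAt η (LL η (-10) f)) (hf : MemLp f 2 volume)
    (hg : TameAt η g) :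
    PP η 0 (fun y => LL η (-10) f y * g y) =
      PP η 0 (fun y => LL η (-10) f y * (LL η 5 g y - LL η (-3) g y)) := by
  ext x
  have hp := (isSymb_p0 hη).dil 0
  have hFm := hF.memLp
  have hG : ∀ J, MemLp (LL η J g) 2 volume := memLp_LL hη one_le_two hg.memLp
  have hG' : ∀ J, MemLp (PP η J g) 2 volume := memLp_PP hη one_le_two hg.memLp
  have hlow : PP η 0 (fun y => LL η (-10) f y * LL η (-3) g y) x = 0 := congrFun
    (Op_mul_eq_zero hp ((isSymb_e0 hη).dil (-10)) ((isSymb_e0 hη).dil (-3))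
      (low_low hη (by norm_num) (by norm_num)) one_le_two one_le_two hf hg.memLp) x
  have hhigh : ∀ J : ℤ, 6 ≤ J → PP η 0 (fun y => LL η (-10) f y * PP η J g y) x = 0 := by
    intro J hJ
    have := congrFun (Op_mul_eq_zero hp ((isSymb_p0 hη).dil J) ((isSymb_e0 hη).dil (-10))
      (high_low hη (by omega) (by omega)) one_le_two one_le_two hg.memLp hf) x
    refine Eq.trans ?_ this
    simp only [mul_comm]; rfl
  have hsum : ∀ m : ℕ, PP η 0 (fun y => LL η (-10) f y * LL η (5 + m) g y) x =
      PP η 0 (fun y => LL η (-10) f y * LL η 5 g y) x := by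
    intro m
    induction m with
    | zero => simp
    | succ m ih =>
      rw [← ih]
      have h1 := Op_add hp le_rfl le_rfl (memLp_mul_one hFm (hG (5 + m)))
        (memLp_mul_one hFm (hG' (6 + m))) x
      have h2 := hhigh (6 + m) (by omega)
      unfold PP at h2 ⊢
      unfold PP at h1
      rw [h2, add_zero] at h1
      rw [← h1]
      congr 1
      ext y
      have := PP_eq hη one_le_two hg.memLp (6 + m) y
      rw [PP] at this
      rw [this, show (6 + (m : ℤ) - 1) = 5 + m by ring,
        show (5 + ((m + 1 : ℕ) : ℤ)) = 6 + m by push_cast; ring]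
      ring
  have hlim := hF.tendsto_PP_mul hη hg 0 5 x
  have hLF : ∀ m : ℕ, LL η (5 + m) (LL η (-10) f) = LL η (-10) f := by
    intro m
    rw [LL, LL, Op_comp ((isSymb_e0 hη).dil _) ((isSymb_e0 hη).dil _) one_le_two hf]
    congr 1
    ext v
    simp only [Pi.mul_apply]
    by_cases hv : 2 * Real.pi * ‖v‖ ≤ 2 ^ (5 + (m : ℤ))
    · rw [dil_e0_eq_one hη _ v hv, one_mul]
    · rw [dil_e0_eq_zero hη (-10) v, mul_zero]
      exact (zpow_le_zpow_right₀ (by norm_num) (by omega)).trans_lt (not_le.1 hv)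
  simp_rw [hLF, hsum] at hlim
  have h3 := tendsto_nhds_unique hlim tendsto_const_nhds
  rw [h3]
  have h4 := Op_sub_fun hp le_rfl le_rfl (memLp_mul_one hFm (hG 5)) (memLp_mul_one hFm (hG (-3))) x
  unfold PP at hlow ⊢
  simp only [mul_sub]
  rw [h4, hlow, sub_zero]

lemma PP_zero_band {g : Space n → ℝ} (hg : MemLp g 2 volume) :
    PP η 0 (fun y => LL η 5 g y - LL η (-3) g y) = PP η 0 g := by
  ext x
  refine (Op_sub_fun ((isSymb_p0 hη).dil _) one_le_two one_le_two (memLp_LL hη one_le_two hg 5)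
    (memLp_LL hη one_le_two hg (-3)) x).trans ?_
  have e1 : dil 0 (p0 η) * dil 5 (e0 η) = dil 0 (p0 η) := by
    ext v
    simp only [Pi.mul_apply]
    by_cases hv : 2 * Real.pi * ‖v‖ ≤ 2 ^ (5 : ℤ)
    · rw [dil_e0_eq_one hη _ v hv, mul_one]
    · rw [dil_p0_eq_zero_of_lt hη 0 v, zero_mul]
      exact (zpow_le_zpow_right₀ (by norm_num) (by norm_num)).trans_lt (not_le.1 hv)
  have e2 : dil 0 (p0 η) * dil (-3) (e0 η) = 0 := by
    ext v
    simp only [Pi.mul_apply, Pi.zero_apply]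
    by_cases hv : 2 * Real.pi * ‖v‖ ≤ 2 ^ (0 - 1 : ℤ)
    · rw [dil_p0_eq_zero_of_le hη 0 v hv, zero_mul]
    · rw [dil_e0_eq_zero hη (-3) v, mul_zero]
      exact (zpow_le_zpow_right₀ (by norm_num) (by norm_num)).trans_lt (not_le.1 hv)
  have h1 := Op_comp ((isSymb_p0 hη).dil 0) ((isSymb_e0 hη).dil 5) one_le_two hg
  have h2 := Op_comp ((isSymb_p0 hη).dil 0) ((isSymb_e0 hη).dil (-3)) one_le_two hg
  rw [e1] at h1
  rw [e2] at h2
  rw [LL, LL, h1, h2, Op_zero_symb, sub_zero]; rfl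

end low

/-- The exponent with inverse `κ`. -/
def expo (κ : ℝ) : ℝ≥0∞ := (ofReal κ)⁻¹

lemma toReal_inv_expo {κ : ℝ} (h : 0 ≤ κ) : ((expo κ)⁻¹).toReal = κ := by
  rw [expo, inv_inv, ENNReal.toReal_ofReal h]

lemma admissible_two_expo {κ : ℝ} (h0 : 0 ≤ κ) (h1 : κ ≤ 1 / 2)
    (h : 1 / 2 + ((n : ℝ) - 1) / 2 * κ ≤ ((n : ℝ) - 1) / 4) : Admissible n 2 (expo κ) := by
  refine ⟨le_rfl, ?_, ?_⟩
  · rw [← ENNReal.inv_le_inv, expo, inv_inv]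
    refine (ofReal_le_ofReal h1).trans_eq ?_
    rw [← ENNReal.toReal_eq_toReal_iff' (by simp) (by simp), ENNReal.toReal_ofReal (by norm_num)]
    simp
  · rw [toReal_inv_two, toReal_inv_expo h0]; exact h

lemma holderTriple_expo {κ : ℝ} (h0 : 0 ≤ κ) (h1 : κ ≤ 1 / 2) :
    ENNReal.HolderTriple (expo κ) (expo (1 / 2 - κ)) 2 := ⟨by
  rw [expo, expo, inv_inv, inv_inv, ← ENNReal.ofReal_add h0 (by linarith),
    ← ENNReal.toReal_eq_toReal_iff' (by simp) (by simp), ENNReal.toReal_ofReal (by linarith)]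
  simp⟩

section commutator
variable {η : Space n → ℝ} {σ : ℝ} {A E M₁ M₂ : ℝ≥0∞} {e : ℤ → ℝ≥0∞} {f g : STField n}
  (hn : 5 ≤ n) (hη : IsCutoff η) (hσ : 0 ≤ σ) (hσ1 : σ < 1 / 2) (hA : 1 ≤ A) (he : Grow σ A e)
  (hf : Tame η T f) (hg : Tame η T g)

include hn hη hσ hσ1 hA he hf hg

/-- The high frequencies of the first factor. -/
lemma pnorm_high_mul_le (hfX : XB η T 0 M₁ e f) (hgX : XB η T 1 M₂ (fun _ => E) g) :
    pnorm η T 1 2 0 (fun t x => (f t x - LL η (-10) (f t) x) * g t x) ≤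
      mulConst η A (n + 3) ((1 / 2 - σ) / 2) * ofReal (1 + kb (e0 η)) * (2 + wt 22) *
        (M₁ * M₂ * E) * e 0 := by
  have hn' : (5 : ℝ) ≤ n := by exact_mod_cast hn
  set κ : ℝ := 1 / ((n : ℝ) - 1) with hκ
  have hκn : (n - 1) * κ = 1 := by rw [hκ]; field_simp [show (n : ℝ) - 1 ≠ 0 by linarith]
  have hκ0 : 0 ≤ κ := div_nonneg zero_le_one (by linarith)
  have hκ1 : κ ≤ 1 / 4 := by rw [hκ]; gcongr; linarith
  have hnκ : n * κ = 1 + κ := by linarith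
  have ad1 : Admissible n 2 (expo κ) := admissible_two_expo hκ0 (by linarith) (by linarith)
  have ad0 : Admissible n 2 (expo (1 / 2 - κ)) := admissible_two_expo (by linarith) (by linarith)
    (by linarith)
  have t1 : ((expo κ)⁻¹).toReal = κ := toReal_inv_expo hκ0
  have t0 : ((expo (1 / 2 - κ))⁻¹).toReal = 1 / 2 - κ := toReal_inv_expo (by linarith)
  have H1 := holderTriple_expo hκ0 (by linarith)
  have H0 : ENNReal.HolderTriple (expo (1 / 2 - κ)) (expo κ) 2 := H1.symm
  set h : STField n := fun t x => f t x - LL η (-10) (f t) x with hh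
  have htame : Tame η T h := hf.sub hη (hf.op hη ((isSymb_e0 hη).dil (-10)))
  have hX : XB η T 0 (ofReal (1 + kb (e0 η)) * M₁) e h := hfX.sub_low hη hf (-10)
  set M := ofReal (1 + kb (e0 η)) * M₁ with hM
  have hz : ∀ l : ℤ, l ≤ -11 → pnorm η T 2 (expo κ) l h = 0 := by
    intro l hl
    refine (mixedNorm_congr (v := fun _ _ => 0) fun t ht x =>
      congrFun (PP_sub_low_eq_zero hη (hf.at ht).memLp (by omega)) x).trans ?_
    have : ∀ t : ℝ, eLpNorm ((fun _ _ => 0 : STField n) t) (expo κ) volume = 0 := fun t => by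
      change eLpNorm (0 : Space n → ℝ) _ volume = 0
      simp
    rw [mixedNorm, show (fun t => eLpNorm ((fun _ _ => 0 : STField n) t) (expo κ) volume) =
      fun _ => 0 from funext this]
    change eLpNorm (0 : ℝ → ℝ≥0∞) _ _ = 0
    exact eLpNorm_zero
  refine (pnorm_mul_le_of_bounds (T := T) (η := η) (f := h) (g := g) (σ := σ) (σ' := 0)
    (δ := (1 / 2 - σ) / 2) (L := n + 3) he (grow_const hA E) hσ (by linarith) le_rfl zero_le_one hη
    htame hg (by omega) hA 0 (q₁ := 2) (r₁ := expo (1 / 2 - κ)) (q₂ := 2) (r₂ := expo κ)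
    (q₃ := 2) (r₃ := expo κ) (q₄ := 2) (r₄ := expo (1 / 2 - κ)) (q₅ := 2) (r₅ := 4) (q₆ := 2)
    (r₆ := 4) (p := 2) (q := 1) (r := 2) (M₁ := M) (M₂ := M₂) (M₃ := M * wt 22) (M₄ := M₂)
    (M₅ := M) (M₆ := M₂)
    le_rfl one_le_two timeHolder_two timeHolder_two timeHolder_two one_le_two ad1.one_le_right
    one_le_two ad1.one_le_right one_le_two le_rfl
    (α₁ := 0 - (1 / 2 + n * (1 / 2 - κ) - 1)) (β₂ := 1 - (1 / 2 + n * κ - 1)) (β₃ := 1)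
    (α₄ := 1 - (1 / 2 + n * (1 / 2 - κ) - 1)) (γ₅ := 0 - (1 / 2 + n * (1 / 4) - 1))
    (γ₆ := 1 - (1 / 2 + n * (1 / 4) - 1))
    (abs_le.2 ⟨by linarith, by linarith⟩) (abs_le.2 ⟨by linarith, by linarith⟩)
    (abs_le.2 ⟨by linarith, by linarith⟩) (abs_le.2 ⟨by linarith, by linarith⟩)
    (abs_le.2 ⟨by linarith, by linarith⟩) (abs_le.2 ⟨by linarith, by linarith⟩)
    (by linarith) (by linarith) (by linarith) (by linarith)
    (fun l _ => (hX.pnorm_le ad0 l).trans_eq (by rw [t0, toReal_inv_two]))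
    (fun l _ => (hgX.pnorm_le ad1 l).trans_eq (by rw [t1, toReal_inv_two]))
    (fun l hl => ?_)
    (fun l _ => (hgX.pnorm_le ad0 l).trans_eq (by rw [t0, toReal_inv_two]))
    (fun l _ => (hX.pnorm_le (admissible_two_four hn) l).trans_eq (by
      rw [toReal_inv_four, toReal_inv_two]))
    (fun l _ => (hgX.pnorm_le (admissible_two_four hn) l).trans_eq (by
      rw [toReal_inv_four, toReal_inv_two]))).trans_eq ?_
  · by_cases h11 : l ≤ -11
    · rw [hz l h11]; exact zero_le
    · refine (hX.pnorm_le ad1 l).trans ?_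
      rw [t1, toReal_inv_two, mul_assoc M (wt 22), ← wt_add]
      gcongr
      refine wt_mono ?_
      have l1 : (-10 : ℝ) ≤ l := by exact_mod_cast (by omega : (-10 : ℤ) ≤ l)
      have l2 : (l : ℝ) ≤ 5 := by exact_mod_cast (by omega : l ≤ (5 : ℤ))
      rw [hnκ]
      nlinarith
  · simp only [Int.cast_zero, mul_zero, wt_zero]
    rw [hM]; ring

/-- The constant in `mixedNorm_comm_le`. -/
def bandConst (η : Space n → ℝ) (A : ℝ≥0∞) : ℝ≥0∞ :=
  (ofReal (kb (dil 0 (p0 η))) * kmom (dil 0 (p0 η))) ^ (1 / 2 : ℝ) *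
    (kg (pt η) * geo (1 / 4)) * (8 * (A * wt (5 * n + 20)))

omit hA hσ in
/-- The commutator of `P_0` with a function of low frequency. -/
lemma mixedNorm_comm_le (hσ0 : 0 ≤ σ) (hE : ∀ k, e k ≤ E) (hfX : XB η T 0 M₁ e f)
    (hgX : XB η T 1 M₂ e g) :
    mixedNorm T 1 2 (fun t x => PP η 0 (fun y => LL η (-10) (f t) y * g t y) x -
      LL η (-10) (f t) x * PP η 0 (g t) x) ≤ bandConst η A * (M₁ * M₂ * E) * e 0 := by
  have hn' : (5 : ℝ) ≤ n := by exact_mod_cast hn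
  set κ : ℝ := 1 / ((n : ℝ) - 1) with hκ
  have hκn : (n - 1) * κ = 1 := by rw [hκ]; field_simp [show (n : ℝ) - 1 ≠ 0 by linarith]
  have hκ0 : 0 ≤ κ := div_nonneg zero_le_one (by linarith)
  have hκ1 : κ ≤ 1 / 4 := by rw [hκ]; gcongr; linarith
  have hnκ : n * κ = 1 + κ := by linarith
  have ad1 : Admissible n 2 (expo κ) := admissible_two_expo hκ0 (by linarith) (by linarith)
  have ad0 : Admissible n 2 (expo (1 / 2 - κ)) := admissible_two_expo (by linarith) (by linarith)
    (by linarith)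
  have t1 : ((expo κ)⁻¹).toReal = κ := toReal_inv_expo hκ0
  have t0 : ((expo (1 / 2 - κ))⁻¹).toReal = 1 / 2 - κ := toReal_inv_expo (by linarith)
  have H1 := holderTriple_expo hκ0 (by linarith)
  have hp := (isSymb_p0 hη).dil 0
  set D : ℝ → ℝ≥0∞ := fun t => ∑' i : ℕ, wt (-10 - i : ℤ) *
    eLpNorm (PP η (-10 - i) (f t)) (expo κ) volume with hD
  set G : ℝ → ℝ≥0∞ := fun t => ∑ i ∈ Finset.range 8,
    eLpNorm (PP η (-3 + 1 + i) (g t)) (expo (1 / 2 - κ)) volume with hG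
  set C₁ := (ofReal (kb (dil 0 (p0 η))) * kmom (dil 0 (p0 η))) ^ (1 / 2 : ℝ) with hC₁
  have hmD : ∀ i : ℕ, AEMeasurable (fun t => wt (-10 - i : ℤ) *
      eLpNorm (PP η (-10 - i) (f t)) (expo κ) volume) (volume.restrict (Ioo 0 T)) := fun i =>
    ((hf.cont_PP hη _).aemeasurable_eLpNorm _).const_mul _
  have hmG : ∀ i ∈ Finset.range 8, AEMeasurable (fun t =>
      eLpNorm (PP η (-3 + 1 + (i : ℕ)) (g t)) (expo (1 / 2 - κ)) volume)
      (volume.restrict (Ioo 0 T)) := fun i _ => (hg.cont_PP hη _).aemeasurable_eLpNorm _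
  have hpt : ∀ t ∈ Ioo 0 T, eLpNorm (fun x => PP η 0 (fun y => LL η (-10) (f t) y * g t y) x -
      LL η (-10) (f t) x * PP η 0 (g t) x) 2 volume ≤
      ofReal (C₁ * kg (pt η)).toReal * (D t * G t) := by
    intro t ht
    have hfm := (hf.at ht).memLp
    have hgm := (hg.at ht).memLp
    have hFt : TameAt η (LL η (-10) (f t)) :=
      (hf.op hη ((isSymb_e0 hη).dil (-10))).at ht
    have hGL := fun J : ℤ => hg.op hη ((isSymb_e0 hη).dil J)
    have hGt : TameAt η (fun y => LL η 5 (g t) y - LL η (-3) (g t) y) :=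
      ((hGL 5).sub hη (hGL (-3))).at ht
    have e1 : (fun x => PP η 0 (fun y => LL η (-10) (f t) y * g t y) x -
        LL η (-10) (f t) x * PP η 0 (g t) x) = fun x => Op (dil 0 (p0 η)) (fun y =>
          LL η (-10) (f t) y * (LL η 5 (g t) y - LL η (-3) (g t) y)) x -
        LL η (-10) (f t) x * Op (dil 0 (p0 η)) (fun y => LL η 5 (g t) y - LL η (-3) (g t) y) x := by
      ext x
      rw [PP_low_mul_eq hη hFt hfm (hg.at ht), ← PP_zero_band hη hgm]; rfl
    rw [e1]
    refine (eLpNorm_commutator_le (s := expo κ) (r := expo (1 / 2 - κ)) (D := kg (pt η) * D t)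
      hp hFt.cont hGt.cont one_le_two le_rfl hGt.memLp
      (memLp_mul_one hFt.memLp hGt.memLp) fun z =>
        eLpNorm_LL_shift_le hη (by omega) one_le_two (by norm_num) hfm ad1.one_le_right (-10)
          z).trans ?_
    rw [ofReal_toReal (mul_ne_top (ENNReal.rpow_ne_top_of_nonneg (by norm_num)
      (mul_ne_top ofReal_ne_top hp.kmom_ne_top)) (isSymb_pt hη).kg_ne_top)]
    have e2 : (fun y => LL η 5 (g t) y - LL η (-3) (g t) y) =
        ∑ i ∈ Finset.range 8, PP η (-3 + 1 + i) (g t) := by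
      ext y
      have := LL_add_eq hη one_le_two hgm (-3) 8 y
      rw [show (-3 + ((8 : ℕ) : ℤ)) = 5 by norm_num] at this
      rw [this, Finset.sum_apply]; ring
    have h3 : eLpNorm (fun y => LL η 5 (g t) y - LL η (-3) (g t) y) (expo (1 / 2 - κ)) volume ≤
        G t := by
      rw [e2]
      exact eLpNorm_sum_le (fun i _ => (memLp_PP hη one_le_two hgm _).1) ad0.one_le_right
    calc _ ≤ C₁ * (kg (pt η) * D t * G t) := by gcongr
      _ = _ := by ring
  have hDn : tnorm T 2 D ≤ M₁ * E * geo (1 / 4) := by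
    refine (tnorm_tsum_le one_le_two hmD).trans ?_
    rw [geo, ← ENNReal.tsum_mul_left]
    refine ENNReal.tsum_le_tsum fun i => ?_
    rw [wt]
    refine (tnorm_const_mul _ _).trans ?_
    rw [← wt]
    refine (mul_le_mul' le_rfl (hfX.pnorm_le ad1 (-10 - i))).trans ?_
    rw [t1, toReal_inv_two, hnκ]
    calc _ = M₁ * e (-10 - i) * (wt ((-10 - i : ℤ) : ℝ) *
          wt ((0 - (1 / 2 + (1 + κ) - 1)) * ((-10 - i : ℤ) : ℝ))) := by ring
      _ ≤ M₁ * E * wt (-(1 / 4 * i)) := by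
          rw [← wt_add]
          gcongr
          · exact hE _
          · refine wt_mono ?_
            push_cast
            have : (0 : ℝ) ≤ i := Nat.cast_nonneg i
            nlinarith
  have hGn : tnorm T 2 G ≤ 8 * (M₂ * (A * wt (5 * n + 20)) * e 0) := by
    refine (tnorm_sum_le _ one_le_two hmG).trans ?_
    have : ∀ i ∈ Finset.range 8, tnorm T 2 (fun t =>
        eLpNorm (PP η (-3 + 1 + (i : ℕ)) (g t)) (expo (1 / 2 - κ)) volume) ≤
        M₂ * (A * wt (5 * n + 20)) * e 0 := by
      intro i hi
      rw [Finset.mem_range] at hi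
      refine (hgX.pnorm_le ad0 (-3 + 1 + i)).trans ?_
      rw [t0, toReal_inv_two]
      set j : ℤ := -3 + 1 + i with hj
      have j1 : (-5 : ℝ) ≤ j := by exact_mod_cast (by omega : (-5 : ℤ) ≤ j)
      have j2 : (j : ℝ) ≤ 5 := by exact_mod_cast (by omega : j ≤ (5 : ℤ))
      have h5 : e j ≤ A * wt (σ * 5) * e 0 := he.le hσ0 (by
        rw [sub_zero]; exact abs_le.2 ⟨j1, j2⟩)
      calc _ ≤ M₂ * wt ((1 - (1 / 2 + n * (1 / 2 - κ) - 1)) * j) * (A * wt (σ * 5) * e 0) := by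
            gcongr
        _ = M₂ * (A * (wt ((1 - (1 / 2 + n * (1 / 2 - κ) - 1)) * j) * wt (σ * 5))) * e 0 := by ring
        _ ≤ _ := by
            rw [← wt_add]
            gcongr
            refine wt_mono ?_
            have := abs_mul_le_of (a := 1 - (1 / 2 + n * (1 / 2 - κ) - 1)) (L := n)
              (abs_le.2 ⟨by linarith, by linarith⟩) (abs_le.2 ⟨j1, j2⟩)
            linarith
    refine (sum_le_sum this).trans_eq ?_
    rw [Finset.sum_const, Finset.card_range, nsmul_eq_mul]
    norm_num
  refine (tnorm_mono hpt).trans ((tnorm_const_mul _ _).trans ?_)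
  rw [ofReal_toReal (mul_ne_top (ENNReal.rpow_ne_top_of_nonneg (by norm_num)
      (mul_ne_top ofReal_ne_top hp.kmom_ne_top)) (isSymb_pt hη).kg_ne_top)]
  have hmDs : AEMeasurable D (volume.restrict (Ioo 0 T)) := AEMeasurable.tsum hmD
  have hmGs : AEMeasurable G (volume.restrict (Ioo 0 T)) := Finset.aemeasurable_fun_sum _ hmG
  refine (mul_le_mul' le_rfl ((timeHolder_two T D G hmDs hmGs).trans
    (mul_le_mul' hDn hGn))).trans_eq ?_
  rw [bandConst]
  ring

/-- The constant in `mixedNorm_PP_mul_sub_le`. -/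
def commConst (η : Space n → ℝ) (A : ℝ≥0∞) (σ : ℝ) : ℝ≥0∞ :=
  mulConst η A (n + 3) ((1 / 2 - σ) / 2) * ofReal (1 + kb (e0 η)) * (2 + wt 22) +
    bandConst η A

/-- Only the interaction of the frequencies close to `1` of the second factor with the low
frequencies of the first one is not perturbative. -/
theorem mixedNorm_PP_mul_sub_le (hE : ∀ k, e k ≤ E) (hfX : XB η T 0 M₁ e f)
    (hgX : XB η T 1 M₂ e g) :
    mixedNorm T 1 2 (fun t x => PP η 0 (fun y => f t y * g t y) x -
      LL η (-10) (f t) x * PP η 0 (g t) x) ≤ commConst η A σ * (M₁ * M₂ * E) * e 0 := by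
  have h1 := pnorm_high_mul_le hn hη hσ hσ1 hA he hf hg hfX (hgX.const hE)
  have h2 := mixedNorm_comm_le hn hη hσ1 he hf hg hσ hE hfX hgX
  have hL := hf.op hη ((isSymb_e0 hη).dil (-10))
  have hh : Tame η T (fun t x => f t x - LL η (-10) (f t) x) := hf.sub hη hL
  have hp := (isSymb_p0 hη).dil 0
  have c1 : Cont T (fun t => PP η 0 fun x => (f t x - LL η (-10) (f t) x) * g t x) :=
    hp.cont_Op (hh.cont.mul hg.cont) le_rfl (BddL.mul (r₁ := 2) (r₂ := 2) hh.cont hg.cont hh.bdd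
      hg.bdd)
  have c2 : Cont T (fun t => PP η 0 fun x => LL η (-10) (f t) x * g t x) :=
    hp.cont_Op (hL.cont.mul hg.cont) le_rfl (BddL.mul (r₁ := 2) (r₂ := 2) hL.cont hg.cont hL.bdd
      hg.bdd)
  have c3 := cont_sub c2 (hL.cont.mul (hg.cont_PP hη 0))
  rw [commConst, add_mul, add_mul]
  refine le_trans (le_of_eq ?_) ((mixedNorm_add_le le_rfl one_le_two c1 c3).trans
    (add_le_add h1 h2))
  refine mixedNorm_congr fun t ht x => ?_
  have h3 := Op_add hp le_rfl le_rfl (memLp_mul_one (hh.at ht).memLp (hg.at ht).memLp)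
    (memLp_mul_one (hL.at ht).memLp (hg.at ht).memLp) x
  have e1 : PP η 0 (fun y => f t y * g t y) x =
      PP η 0 (fun y => (f t y - LL η (-10) (f t) y) * g t y) x +
        PP η 0 (fun y => LL η (-10) (f t) y * g t y) x := by
    refine Eq.trans ?_ h3
    rw [PP]
    congr 1
    ext y
    simp only [LL]; ring
  rw [e1]
  change _ = _ + (_ - LL η (-10) (f t) x * PP η 0 (g t) x)
  ring

end commutator

lemma commConst_ne_top {η : Space n → ℝ} (hη : IsCutoff η) {A : ℝ≥0∞} (hA : A ≠ ⊤) {σ : ℝ}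
    (hσ : σ < 1 / 2) : commConst η A σ ≠ ⊤ := by
  have h1 := mulConst_ne_top η hA (n + 3) (δ := (1 / 2 - σ) / 2) (by linarith)
  have h2 := wt_ne_top 22
  have h3 := wt_ne_top (5 * n + 20)
  have h4 := ((isSymb_p0 hη).dil 0).kmom_ne_top
  have h5 := (isSymb_pt hη).kg_ne_top
  have h6 := geo_ne_top (δ := 1 / 4) (by norm_num)
  have h7 : (ofReal (kb (dil 0 (p0 η))) * kmom (dil 0 (p0 η))) ^ (1 / 2 : ℝ) ≠ ⊤ :=
    ENNReal.rpow_ne_top_of_nonneg (by norm_num) (mul_ne_top ofReal_ne_top h4)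
  unfold commConst bandConst
  finiteness

/-! ### Fields whose time derivatives are controlled -/

lemma pd_add {μ : Fin (n + 1)} {u v : STField n} (hu : Smooth T u) (hv : Smooth T v) {t : ℝ}
    (ht : t ∈ Ioo 0 T) (x : Space n) :
    pd μ (fun t x => u t x + v t x) t x = pd μ u t x + pd μ v t x :=
  ((hu.isPd μ).add (hv.isPd μ)).pd_eq ht x

lemma pd_const_mul {μ : Fin (n + 1)} {u : STField n} (hu : Smooth T u) (c : ℝ) {t : ℝ}
    (ht : t ∈ Ioo 0 T) (x : Space n) : pd μ (fun t x => c * u t x) t x = c * pd μ u t x :=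
  ((hu.isPd μ).const_mul c).pd_eq ht x

lemma pd_zero_field (μ : Fin (n + 1)) {t : ℝ} (ht : t ∈ Ioo 0 T) (x : Space n) :
    pd μ (fun _ _ => 0) t x = 0 := (isPd_zero (T := T) μ).pd_eq ht x

lemma XB.add {η : Space n → ℝ} (hη : IsCutoff η) {s : ℝ} {M M' : ℝ≥0∞} {e : ℤ → ℝ≥0∞}
    {p : ℝ≥0∞} (hp : 1 ≤ p) {u v : STField n} (hu : Cont T u) (hv : Cont T v) (hub : BddL T p u)
    (hvb : BddL T p v) (h : XB η T s M e u) (h' : XB η T s M' e v) :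
    XB η T s (M + M') e (fun t x => u t x + v t x) := by
  intro k
  have hk := (isSymb_p0 hη).dil k
  refine (strich_congr fun t ht x => Op_add hk hp hp (hub.memLp hu ht) (hvb.memLp hv ht) x).trans_le
    ((strich_add_le k (hk.cont_Op hu hp hub) (hk.cont_Op hv hp hvb)).trans ?_)
  rw [add_mul, add_mul]
  exact add_le_add (h k) (h' k)

lemma XB.const_mul {η : Space n → ℝ} {s : ℝ} {M : ℝ≥0∞} {e : ℤ → ℝ≥0∞} {u : STField n}
    (h : XB η T s M e u) (c : ℝ) :
    XB η T s (ofReal |c| * M) e (fun t x => c * u t x) := by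
  intro k
  refine (strich_congr fun t ht x => Op_const_mul c x).trans_le ((strich_const_mul_le k c _).trans ?_)
  rw [mul_assoc, mul_assoc, ← mul_assoc M]
  exact mul_le_mul' le_rfl (h k)

lemma XB.zero {η : Space n → ℝ} {s : ℝ} {e : ℤ → ℝ≥0∞} : XB η T s 0 e (fun _ _ => 0) := by
  intro k
  have h1 : ∀ t ∈ Ioo 0 T, ∀ x, PP η k ((fun _ _ => 0 : STField n) t) x =
      0 * (fun _ _ => 0 : STField n) t x := fun t ht x => by simp [PP, Op, cnv]
  refine (strich_congr h1).trans_le ((strich_const_mul_le k 0 _).trans ?_)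
  simp

lemma BddL.const_mul {p : ℝ≥0∞} {u : STField n} (h : BddL T p u) (c : ℝ) :
    BddL T p (fun t x => c * u t x) := by
  obtain ⟨B, hB, hb⟩ := h
  refine ⟨ofReal |c| * B, mul_ne_top ofReal_ne_top hB, fun t ht => ?_⟩
  refine (eLpNorm_const_smul_le (c := c) (f := u t)).trans ?_
  rw [Real.enorm_eq_ofReal_abs]
  exact mul_le_mul' le_rfl (hb t ht)

/-- The Lebesgue exponent of the linear fields (`l = 0`) and of the products. -/
def pex (l : ℕ) : ℝ≥0∞ := if l = 0 then 2 else 1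

lemma one_le_pex (l : ℕ) : 1 ≤ pex l := by
  unfold pex; split_ifs
  exacts [one_le_two, le_rfl]

/-- Smooth integrable fields of size `M 2^{lk} e_k` at the frequency `2 ^ k`. -/
structure Sized (η : Space n → ℝ) (T : ℝ) (M : ℝ≥0∞) (e : ℤ → ℝ≥0∞) (l : ℕ) (u : STField n) :
    Prop where
  smooth : Smooth T u
  bdd : BddL T (pex l) u
  X : XB η T l M e u

/-- Fields of a given size, `m` time derivatives of which can be expressed through divergences of
fields of the same kind. -/
def Chain (η : Space n → ℝ) (T : ℝ) (M : ℝ≥0∞) (e : ℤ → ℝ≥0∞) : ℕ → ℕ → STField n → Prop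
  | 0, l, u => Sized η T M e l u
  | m + 1, l, u => Sized η T M e l u ∧ ∃ (v : STField n) (w : Fin n → STField n),
      Chain η T M e m (l + 1) v ∧ (∀ i, Chain η T M e m l (w i)) ∧
      ∀ t ∈ Ioo 0 T, ∀ x, pd 0 u t x = v t x + ∑ i, pd i.succ (w i) t x

section chain
variable {η : Space n → ℝ} {M M' : ℝ≥0∞} {e : ℤ → ℝ≥0∞} {m l : ℕ} {u v : STField n}

lemma Sized.mono (h : Sized η T M e l u) (hM : M ≤ M') : Sized η T M' e l u :=
  ⟨h.smooth, h.bdd, h.X.mono hM fun _ => le_rfl⟩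

lemma Sized.add (hη : IsCutoff η) (h : Sized η T M e l u) (h' : Sized η T M' e l v) :
    Sized η T (M + M') e l (fun t x => u t x + v t x) :=
  ⟨h.smooth.add h'.smooth, BddL.add (one_le_pex l) h.smooth.cont h'.smooth.cont h.bdd h'.bdd,
    XB.add hη (one_le_pex l) h.smooth.cont h'.smooth.cont h.bdd h'.bdd h.X h'.X⟩

lemma Sized.const_mul (h : Sized η T M e l u) (c : ℝ) :
    Sized η T (ofReal |c| * M) e l (fun t x => c * u t x) :=
  ⟨h.smooth.const_mul c, h.bdd.const_mul c, h.X.const_mul c⟩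

lemma sized_zero (M : ℝ≥0∞) : Sized η T M e l (fun _ _ => 0) :=
  ⟨smooth_zero, bddL_zero _, XB.zero.mono zero_le fun _ => le_rfl⟩

lemma Chain.sized (h : Chain η T M e m l u) : Sized η T M e l u := by
  cases m with
  | zero => exact h
  | succ m => exact h.1

lemma Chain.mono (h : Chain η T M e m l u) (hM : M ≤ M') : Chain η T M' e m l u := by
  induction m generalizing l u with
  | zero => exact Sized.mono h hM
  | succ m ih =>
    obtain ⟨h1, v, w, hv, hw, hvw⟩ := h
    exact ⟨h1.mono hM, v, w, ih hv, fun i => ih (hw i), hvw⟩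

lemma Chain.pred (h : Chain η T M e (m + 1) l u) : Chain η T M e m l u := by
  induction m generalizing l u with
  | zero => exact h.1
  | succ m ih =>
    obtain ⟨h1, v, w, hv, hw, hvw⟩ := h
    exact ⟨h1, v, w, ih hv, fun i => ih (hw i), hvw⟩

lemma Chain.add (hη : IsCutoff η) (h : Chain η T M e m l u) (h' : Chain η T M' e m l v) :
    Chain η T (M + M') e m l (fun t x => u t x + v t x) := by
  induction m generalizing l u v with
  | zero => exact Sized.add hη h h'
  | succ m ih =>
    obtain ⟨h1, p, q, hp, hq, hpq⟩ := h
    obtain ⟨h1', p', q', hp', hq', hpq'⟩ := h'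
    refine ⟨h1.add hη h1', _, fun i t x => q i t x + q' i t x, ih hp hp',
      fun i => ih (hq i) (hq' i), fun t ht x => ?_⟩
    rw [pd_add h1.smooth h1'.smooth ht, hpq t ht, hpq' t ht]
    simp_rw [fun i => pd_add (μ := Fin.succ i) (hq i).sized.smooth (hq' i).sized.smooth ht x]
    rw [sum_add_distrib]
    ring

lemma Chain.const_mul (h : Chain η T M e m l u) (c : ℝ) :
    Chain η T (ofReal |c| * M) e m l (fun t x => c * u t x) := by
  induction m generalizing l u with
  | zero => exact Sized.const_mul h c
  | succ m ih =>
    obtain ⟨h1, p, q, hp, hq, hpq⟩ := h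
    refine ⟨h1.const_mul c, _, fun i t x => c * q i t x, ih hp, fun i => ih (hq i),
      fun t ht x => ?_⟩
    rw [pd_const_mul h1.smooth c ht, hpq t ht]
    simp_rw [fun i => pd_const_mul (μ := Fin.succ i) (hq i).sized.smooth c ht x]
    rw [mul_add, mul_sum]

lemma chain_zero (M : ℝ≥0∞) : Chain η T M e m l (fun _ _ => 0) := by
  induction m generalizing l with
  | zero => exact sized_zero M
  | succ m ih =>
    refine ⟨sized_zero M, fun _ _ => 0, fun _ _ _ => 0, ih, fun _ => ih, fun t ht x => ?_⟩
    rw [pd_zero_field 0 ht, Finset.sum_eq_zero fun i _ => pd_zero_field i.succ ht x, add_zero]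

lemma Chain.sum (hη : IsCutoff η) {ι : Type*} (s : Finset ι) (c : ι → ℝ) {u : ι → STField n}
    (h : ∀ i ∈ s, Chain η T M e m l (u i)) :
    Chain η T ((∑ i ∈ s, ofReal |c i|) * M) e m l (fun t x => ∑ i ∈ s, c i * u i t x) := by
  classical
  induction s using Finset.induction_on with
  | empty => simpa using chain_zero 0
  | insert i s hi ih =>
    simp only [Finset.sum_insert hi, add_mul]
    exact ((h i (Finset.mem_insert_self i s)).const_mul (c i)).add hη
      (ih fun j hj => h j (Finset.mem_insert_of_mem hj))

end chain

/-- Fields with `m` derivatives in the space with norm `strich T k`, of size `B 2^{lk}` where `l`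
increases with each derivative. -/
def Reg (T : ℝ) (k : ℤ) (B : ℝ≥0∞) : ℕ → ℕ → STField n → Prop
  | 0, l, f => Cont T f ∧ strich T k f ≤ B * wt (l * k)
  | m + 1, l, f => (Cont T f ∧ strich T k f ≤ B * wt (l * k)) ∧
      ∀ μ, ∃ g, IsPd T μ f g ∧ Reg T k B m (l + 1) g

section reg
variable {k : ℤ} {B B' : ℝ≥0∞} {m l : ℕ} {f g : STField n}

lemma Reg.base (h : Reg T k B m l f) : Cont T f ∧ strich T k f ≤ B * wt (l * k) := by
  cases m with
  | zero => exact h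
  | succ m => exact h.1

lemma Reg.congr (h : Reg T k B m l f) (hg : ∀ t ∈ Ioo 0 T, ∀ x, g t x = f t x) :
    Reg T k B m l g := by
  have hb : Cont T g ∧ strich T k g ≤ B * wt (l * k) :=
    ⟨h.base.1.congr hg, (strich_congr hg).trans_le h.base.2⟩
  cases m with
  | zero => exact hb
  | succ m =>
    refine ⟨hb, fun μ => ?_⟩
    obtain ⟨p, hp, hp'⟩ := h.2 μ
    exact ⟨p, hp.congr hg fun _ _ _ => rfl, hp'⟩

lemma Reg.mono (h : Reg T k B m l f) (hB : B ≤ B') : Reg T k B' m l f := by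
  induction m generalizing l f with
  | zero => exact ⟨h.1, h.2.trans (mul_le_mul' hB le_rfl)⟩
  | succ m ih =>
    refine ⟨⟨h.1.1, h.1.2.trans (mul_le_mul' hB le_rfl)⟩, fun μ => ?_⟩
    obtain ⟨g, hg, hg'⟩ := h.2 μ
    exact ⟨g, hg, ih hg'⟩

lemma Reg.add (h : Reg T k B m l f) (h' : Reg T k B' m l g) :
    Reg T k (B + B') m l (fun t x => f t x + g t x) := by
  have hb : Cont T (fun t x => f t x + g t x) ∧
      strich T k (fun t x => f t x + g t x) ≤ (B + B') * wt (l * k) := by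
    refine ⟨h.base.1.add h'.base.1, (strich_add_le k h.base.1 h'.base.1).trans ?_⟩
    rw [add_mul]
    exact add_le_add h.base.2 h'.base.2
  induction m generalizing l f g with
  | zero => exact hb
  | succ m ih =>
    refine ⟨hb, fun μ => ?_⟩
    obtain ⟨p, hp, hp'⟩ := h.2 μ
    obtain ⟨q, hq, hq'⟩ := h'.2 μ
    refine ⟨_, hp.add hq, ih hp' hq' ⟨hp'.base.1.add hq'.base.1,
      (strich_add_le k hp'.base.1 hq'.base.1).trans ?_⟩⟩
    rw [add_mul]
    exact add_le_add hp'.base.2 hq'.base.2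

lemma Reg.const_mul (h : Reg T k B m l f) (c : ℝ) :
    Reg T k (ofReal |c| * B) m l (fun t x => c * f t x) := by
  have key : ∀ {l : ℕ} {f : STField n}, Cont T f ∧ strich T k f ≤ B * wt (l * k) →
      Cont T (fun t x => c * f t x) ∧ strich T k (fun t x => c * f t x) ≤
        ofReal |c| * B * wt (l * k) := fun h =>
    ⟨h.1.const_mul c, (strich_const_mul_le k c _).trans (by
      rw [mul_assoc]; exact mul_le_mul' le_rfl h.2)⟩
  induction m generalizing l f with
  | zero => exact key h
  | succ m ih =>
    refine ⟨key h.1, fun μ => ?_⟩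
    obtain ⟨p, hp, hp'⟩ := h.2 μ
    exact ⟨_, hp.const_mul c, ih hp'⟩

lemma Reg.scale (h : Reg T k B m l f) : Reg T k B m (l + 1) (fun t x => (2 : ℝ) ^ k * f t x) := by
  have key : ∀ {l : ℕ} {f : STField n}, Cont T f ∧ strich T k f ≤ B * wt (l * k) →
      Cont T (fun t x => (2 : ℝ) ^ k * f t x) ∧ strich T k (fun t x => (2 : ℝ) ^ k * f t x) ≤
        B * wt ((l + 1 : ℕ) * k) := by
    intro l f h
    refine ⟨h.1.const_mul _, (strich_const_mul_le k _ _).trans ?_⟩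
    rw [abs_of_pos (by positivity), ← wt_intCast]
    refine (mul_le_mul' le_rfl h.2).trans_eq ?_
    push_cast
    rw [add_mul, one_mul, wt_add]; ring
  induction m generalizing l f with
  | zero => exact key h
  | succ m ih =>
    refine ⟨key h.1, fun μ => ?_⟩
    obtain ⟨p, hp, hp'⟩ := h.2 μ
    exact ⟨_, hp.const_mul _, ih hp'⟩

lemma reg_zero (B : ℝ≥0∞) : Reg T k B m l (fun _ _ => 0 : STField n) := by
  have key : ∀ l : ℕ, Cont T (fun _ _ => 0 : STField n) ∧
      strich T k (fun _ _ => 0 : STField n) ≤ B * wt (l * k) := by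
    intro l
    refine ⟨continuousOn_const, ?_⟩
    have h1 : ∀ t ∈ Ioo 0 T, ∀ x, (fun _ _ => 0 : STField n) t x =
      0 * (fun _ _ => 0 : STField n) t x := fun t ht x => by simp
    refine (strich_congr h1).trans_le ((strich_const_mul_le k 0 _).trans ?_)
    simp
  induction m generalizing l with
  | zero => exact key l
  | succ m ih => exact ⟨key l, fun μ => ⟨_, isPd_zero μ, ih⟩⟩

lemma Reg.sum {ι : Type*} (s : Finset ι) {B : ι → ℝ≥0∞} {f : ι → STField n}
    (h : ∀ i ∈ s, Reg T k (B i) m l (f i)) :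
    Reg T k (∑ i ∈ s, B i) m l (fun t x => ∑ i ∈ s, f i t x) := by
  classical
  induction s using Finset.induction_on with
  | empty => simpa using reg_zero 0
  | insert i s hi ih =>
    simp only [Finset.sum_insert hi]
    exact (h i (Finset.mem_insert_self i s)).add
      (ih fun j hj => h j (Finset.mem_insert_of_mem hj))

end reg

/-- The constant in `Chain.reg`. -/
def symConst : ℕ → (Space n → ℂ) → ℝ≥0∞
  | 0, a => ofReal (kb a)
  | m + 1, a => symConst m a + ∑ i, symConst m (dsymb i a)

lemma symConst_ne_top (m : ℕ) (a : Space n → ℂ) : symConst m a ≠ ⊤ := by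
  induction m generalizing a with
  | zero => exact ofReal_ne_top
  | succ m ih => exact ENNReal.add_ne_top.2 ⟨ih a, ENNReal.sum_ne_top.2 fun i _ => ih _⟩

lemma kb_le_symConst (m : ℕ) (a : Space n → ℂ) : ofReal (kb a) ≤ symConst m a := by
  induction m with
  | zero => exact le_rfl
  | succ m ih => exact ih.trans le_self_add

/-- The frequency pieces of the fields in `Chain` are differentiable. -/
theorem Chain.reg {η : Space n → ℝ} (hη : IsCutoff η) {M : ℝ≥0∞} {e : ℤ → ℝ≥0∞} {m l : ℕ}
    {u : STField n} (h : Chain η T M e m l u) {a : Space n → ℂ} (ha : IsSymb a) (k : ℤ) :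
    Reg T k (symConst m a * (M * e k)) m l (fun t => Op (dil k (a * p0 η)) (u t)) := by
  have key : ∀ {l : ℕ} {u : STField n}, Sized η T M e l u → ∀ {a : Space n → ℂ}, IsSymb a →
      ∀ m, Cont T (fun t => Op (dil k (a * p0 η)) (u t)) ∧
      strich T k (fun t => Op (dil k (a * p0 η)) (u t)) ≤
        symConst m a * (M * e k) * wt (l * k) := by
    intro l u h a ha m
    have hc := h.smooth.cont
    have hp := one_le_pex l
    refine ⟨((ha.mul (isSymb_p0 hη)).dil k).cont_Op hc hp h.bdd, ?_⟩
    have h1 : ∀ t ∈ Ioo 0 T, ∀ x, Op (dil k (a * p0 η)) (u t) x =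
        Op (dil k a) (PP η k (u t)) x := fun t ht x => by
      rw [PP, Op_comp (ha.dil k) ((isSymb_p0 hη).dil k) hp (h.bdd.memLp hc ht), dil_mul]
    refine (strich_congr h1).trans_le ((strich_Op_le ha k k
      (((isSymb_p0 hη).dil k).cont_Op hc hp h.bdd)).trans ?_)
    refine (mul_le_mul' (kb_le_symConst m a) (h.X k)).trans_eq ?_
    ring
  have hd : ∀ (a : Space n → ℂ) (i : Fin n), IsSymb a → ∀ (f : Space n → ℝ) (x : Space n),
      Op (dsymb i (dil k (a * p0 η))) f x =
        (2 : ℝ) ^ k * Op (dil k (dsymb i a * p0 η)) f x := fun a i ha f x => by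
    rw [dsymb_dil, dsymb_mul, Op_smul (((ha.dsymb i).mul (isSymb_p0 hη)).dil k)]
  induction m generalizing l u a with
  | zero => exact key h ha 0
  | succ m ih =>
    have hs := h.sized
    refine ⟨key hs ha (m + 1), fun μ => ?_⟩
    have hS := (ha.mul (isSymb_p0 hη)).dil k
    have hle : ∀ i : Fin n, symConst m (dsymb i a) * (M * e k) ≤
        symConst (m + 1) a * (M * e k) := fun i => mul_le_mul' ((single_le_sum
          (f := fun i => symConst m (dsymb i a)) (fun _ _ => zero_le)
            (Finset.mem_univ i)).trans le_add_self) le_rfl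
    induction μ using Fin.cases with
    | succ i =>
      refine ⟨_, isPd_Op_space hS hs.smooth (one_le_pex l) hs.bdd i, ?_⟩
      exact ((ih h.pred (ha.dsymb i)).scale.mono (hle i)).congr fun t ht x => hd a i ha _ x
    | zero =>
      obtain ⟨-, v, w, hv, hw, hvw⟩ := h
      refine ⟨_, hS.isPd_Op hs.smooth hv.sized.smooth (fun i => (hw i).sized.smooth)
        (one_le_pex l) (one_le_pex (l + 1)) (fun _ => one_le_pex l) hs.bdd hv.sized.bdd
        (fun i => (hw i).sized.bdd) hvw, ?_⟩
      have h2 := (ih hv ha).add (Reg.sum Finset.univ fun i _ => (ih (hw i) (ha.dsymb i)).scale)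
      refine (h2.mono (le_of_eq ?_)).congr fun t ht x => ?_
      · rw [symConst, add_mul, sum_mul]
      · simp only [hd a _ ha]

/-! ### First order systems with quadratic nonlinearities -/

/-- Partial derivatives commute. -/
lemma pd_comm {u : STField n} (h : Smooth T u) (μ ν : Fin (n + 1)) {t : ℝ}
    (ht : t ∈ Ioo 0 T) (x : Space n) : pd μ (pd ν u) t x = pd ν (pd μ u) t x := by
  set f : ℝ × Space n → ℝ := fun p => u p.1 p.2 with hf
  have hd : DifferentiableOn ℝ (fderiv ℝ f) (slab n T) :=
    (h.fderiv_of_isOpen (m := ∞) isOpen_slab (by simp)).differentiableOn (by simp)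
  have key : ∀ μ ν : Fin (n + 1), pd μ (pd ν u) t x =
      fderiv ℝ (fderiv ℝ f) (t, x) (dirT μ, dirX μ) (dirT ν, dirX ν) := by
    intro μ ν
    have h1 : ∀ t ∈ Ioo 0 T, ∀ x, pd ν u t x = fderiv ℝ f (t, x) (dirT ν, dirX ν) :=
      fun t ht x => (isPd_of_differentiable (h.differentiableOn (by simp)) ν).pd_eq ht x
    have h2 : DifferentiableOn ℝ (fun p : ℝ × Space n =>
        (fun t x => fderiv ℝ f (t, x) (dirT ν, dirX ν) : STField n) p.1 p.2) (slab n T) :=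
      fun p hp => (hd p hp).clm_apply (differentiableWithinAt_const _)
    rw [pd_congr h1 ht, (isPd_of_differentiable h2 μ).pd_eq ht x]
    have h3 := (hd.differentiableAt (isOpen_slab.mem_nhds (mem_slab ht x)))
    rw [fderiv_clm_apply h3 (differentiableAt_const _)]
    simp
  rw [key, key]
  exact ((h.contDiffAt (isOpen_slab.mem_nhds (mem_slab ht x))).isSymmSndFDerivAt (n := ∞) (by
    simp only [minSmoothness_of_isRCLikeNormedField]; exact ENat.LEInfty.out)).eq _ _

/-- The constant in the product estimate `XB.mul`. -/
def prodConst (η : Space n → ℝ) (A : ℝ≥0∞) (σ : ℝ) : ℝ≥0∞ :=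
  3 * mulConst η A (n + 3) (min (1 / 2 : ℝ) (((n : ℝ) - 4) / 4) - σ)

/-- The constant in the estimate of derivatives. -/
def derConst (η : Space n → ℝ) : ℝ≥0∞ := ofReal (1 + ∑ i, kb (dsymb i (pt η)))

lemma one_le_derConst (η : Space n → ℝ) : 1 ≤ derConst η := by
  rw [derConst, ← ENNReal.ofReal_one]
  exact ofReal_le_ofReal (by
    have := Finset.sum_nonneg fun (i : Fin n) (_ : i ∈ Finset.univ) =>
      zero_le_one.trans (one_le_kb (dsymb i (pt η)))
    linarith)

/-- The constant in the estimates of products. -/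
def monoConst (η : Space n → ℝ) (A : ℝ≥0∞) (σ : ℝ) : ℝ≥0∞ :=
  (1 + prodConst η A σ) ^ 2 * derConst η ^ 2

lemma prodConst_ne_top (η : Space n → ℝ) {A : ℝ≥0∞} (hAt : A ≠ ⊤) {σ : ℝ} (hσ1 : σ < 1 / 2)
    (hσ2 : σ < ((n : ℝ) - 4) / 4) : prodConst η A σ ≠ ⊤ := by
  have := mulConst_ne_top η hAt (n + 3) (δ := min (1 / 2 : ℝ) (((n : ℝ) - 4) / 4) - σ)
    (sub_pos.2 (lt_min hσ1 hσ2))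
  unfold prodConst
  finiteness

lemma monoConst_ne_top (η : Space n → ℝ) {A : ℝ≥0∞} (hAt : A ≠ ⊤) {σ : ℝ} (hσ1 : σ < 1 / 2)
    (hσ2 : σ < ((n : ℝ) - 4) / 4) : monoConst η A σ ≠ ⊤ := by
  have := prodConst_ne_top η hAt hσ1 hσ2
  unfold monoConst derConst
  finiteness

section sized
variable {η : Space n → ℝ} {σ : ℝ} {A E M : ℝ≥0∞} {e : ℤ → ℝ≥0∞} {f g h : STField n}
  (hn : 5 ≤ n) (hη : IsCutoff η) (hσ : 0 ≤ σ) (hσ1 : σ < 1 / 2) (hσ2 : σ < ((n : ℝ) - 4) / 4)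
  (hA : 1 ≤ A) (he : Grow σ A e) (hM : M ≠ ⊤) (hEt : E ≠ ⊤) (hE : ∀ k, e k ≤ E) (hME : M * E ≤ 1)
  (hf : Fld η T M e f) (hg : Fld η T M e g) (hh : Fld η T M e h)

lemma le_monoConst_mul (η : Space n → ℝ) (A : ℝ≥0∞) (σ : ℝ) {a b : ℕ} (ha : a ≤ 2) (hb : b ≤ 2)
    (M : ℝ≥0∞) : prodConst η A σ ^ a * derConst η ^ b * M ≤ monoConst η A σ * M := by
  unfold monoConst
  gcongr ?_ * ?_ * _
  · refine (pow_le_pow_left' (le_add_self : _ ≤ 1 + prodConst η A σ) a).trans ?_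
    exact pow_le_pow_right₀ le_self_add ha
  · exact pow_le_pow_right₀ (one_le_derConst η) hb

lemma Fld.sized (hf : Fld η T M e f) : Sized η T (monoConst η A σ * M) e 0 f := by
  refine ⟨hf.smooth, hf.bdd, ?_⟩
  have h1 := hf.X.mono (M' := monoConst η A σ * M) (by
    simpa using le_monoConst_mul η A σ (a := 0) (b := 0) (by norm_num) (by norm_num) M)
    fun _ => le_rfl
  simpa using h1

include hn hη hσ hσ1 hσ2 hA he hM hEt hE hME hf hg

lemma Fld.X_mul : XB η T 1 (prodConst η A σ * M) e (fun t x => f t x * g t x) := by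
  have h1 := XB.mul hn hη hσ hσ1 hA he (hf.tame hη hn hM hEt hE) (hg.tame hη hn hM hEt hE) hσ2
    le_rfl zero_le_one le_rfl zero_le_one hf.X (hg.X.const hE)
  rw [show (0 + 0 + 1 : ℝ) = 1 by norm_num] at h1
  refine h1.mono ?_ fun _ => le_rfl
  calc _ = prodConst η A σ * M * (M * E) := by rw [prodConst]; ring
    _ ≤ prodConst η A σ * M * 1 := by gcongr
    _ = _ := mul_one _

omit hσ hσ1 hσ2 hA he hME in
lemma Fld.bdd_mul : BddL T 2 (fun t x => f t x * g t x) :=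
  BddL.mul (r₁ := 4) (r₂ := 4) hf.smooth.cont hg.smooth.cont (hf.bdd_four hη hn hM hEt hE)
    (hg.bdd_four hη hn hM hEt hE)

lemma Fld.tame_mul (hAt : A ≠ ⊤) : Tame η T (fun t x => f t x * g t x) :=
  (hf.X_mul hn hη hσ hσ1 hσ2 hA he hM hEt hE hME hg).tame hn hη le_rfl
    (mul_ne_top (prodConst_ne_top η hAt hσ1 hσ2) hM) hEt
    hE (hf.smooth.cont.mul hg.smooth.cont) (hf.bdd_mul hn hη hM hEt hE hg)

lemma Fld.sized_mul : Sized η T (monoConst η A σ * M) e 1 (fun t x => f t x * g t x) := by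
  refine ⟨hf.smooth.mul hg.smooth, BddL.mul (r₁ := 2) (r₂ := 2) (r := 1) hf.smooth.cont
    hg.smooth.cont hf.bdd hg.bdd, ?_⟩
  have h1 := (hf.X_mul hn hη hσ hσ1 hσ2 hA he hM hEt hE hME hg).mono
    (M' := monoConst η A σ * M) (by
    simpa using le_monoConst_mul η A σ (a := 1) (b := 0) (by norm_num) (by norm_num) M)
    fun _ => le_rfl
  simpa using h1

lemma Fld.sized_mul_pd (μ : Fin (n + 1)) :
    Sized η T (monoConst η A σ * M) e 2 (fun t x => f t x * pd μ g t x) := by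
  refine ⟨hf.smooth.mul (hg.smooth.pd μ), BddL.mul (r₁ := 2) (r₂ := 2) (r := 1) hf.smooth.cont
    (hg.smooth.pd μ).cont hf.bdd (hg.bdd_pd hη hn hM hEt hE μ), ?_⟩
  have h1 := XB.mul hn hη hσ hσ1 hA he (hf.tame hη hn hM hEt hE)
    (hg.tame_pd hη hn hM hEt hE μ) hσ2 le_rfl zero_le_one zero_le_one le_rfl hf.X
    ((hg.X_pd hη hn hM hEt hE μ).const hE)
  rw [show (0 + 1 + 1 : ℝ) = ((2 : ℕ) : ℝ) by norm_num] at h1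
  refine h1.mono ?_ fun _ => le_rfl
  calc _ = prodConst η A σ ^ 1 * derConst η ^ 1 * M * (M * E) := by
        rw [prodConst, derConst]; ring
    _ ≤ prodConst η A σ ^ 1 * derConst η ^ 1 * M * 1 := by gcongr
    _ ≤ _ := by rw [mul_one]; exact le_monoConst_mul η A σ (by norm_num) (by norm_num) M

lemma Fld.sized_pd_mul_pd (μ ν : Fin (n + 1)) :
    Sized η T (monoConst η A σ * M) e 3 (fun t x => pd μ f t x * pd ν g t x) := by
  refine ⟨(hf.smooth.pd μ).mul (hg.smooth.pd ν), BddL.mul (r₁ := 2) (r₂ := 2) (r := 1)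
    (hf.smooth.pd μ).cont (hg.smooth.pd ν).cont (hf.bdd_pd hη hn hM hEt hE μ)
    (hg.bdd_pd hη hn hM hEt hE ν), ?_⟩
  have h1 := XB.mul hn hη hσ hσ1 hA he (hf.tame_pd hη hn hM hEt hE μ)
    (hg.tame_pd hη hn hM hEt hE ν) hσ2 zero_le_one le_rfl zero_le_one le_rfl
    (hf.X_pd hη hn hM hEt hE μ) ((hg.X_pd hη hn hM hEt hE ν).const hE)
  rw [show (1 + 1 + 1 : ℝ) = ((3 : ℕ) : ℝ) by norm_num] at h1
  refine h1.mono ?_ fun _ => le_rfl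
  calc _ = prodConst η A σ ^ 1 * derConst η ^ 2 * M * (M * E) := by
        rw [prodConst, derConst]; ring
    _ ≤ prodConst η A σ ^ 1 * derConst η ^ 2 * M * 1 := by gcongr
    _ ≤ _ := by rw [mul_one]; exact le_monoConst_mul η A σ (by norm_num) (by norm_num) M

include hh in
lemma Fld.sized_mul_mul_pd (hAt : A ≠ ⊤) (μ : Fin (n + 1)) :
    Sized η T (monoConst η A σ * M) e 3 (fun t x => (f t x * g t x) * pd μ h t x) := by
  refine ⟨(hf.smooth.mul hg.smooth).mul (hh.smooth.pd μ), BddL.mul (r₁ := 2) (r₂ := 2) (r := 1)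
    (hf.smooth.mul hg.smooth).cont (hh.smooth.pd μ).cont (hf.bdd_mul hn hη hM hEt hE hg)
    (hh.bdd_pd hη hn hM hEt hE μ), ?_⟩
  have h1 := XB.mul hn hη hσ hσ1 hA he
    (hf.tame_mul hn hη hσ hσ1 hσ2 hA he hM hEt hE hME hg hAt)
    (hh.tame_pd hη hn hM hEt hE μ) hσ2 zero_le_one le_rfl zero_le_one le_rfl
    (hf.X_mul hn hη hσ hσ1 hσ2 hA he hM hEt hE hME hg) ((hh.X_pd hη hn hM hEt hE μ).const hE)
  rw [show (1 + 1 + 1 : ℝ) = ((3 : ℕ) : ℝ) by norm_num] at h1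
  refine h1.mono ?_ fun _ => le_rfl
  calc _ = prodConst η A σ ^ 2 * derConst η ^ 1 * M * (M * E) := by
        rw [prodConst, derConst]; ring
    _ ≤ prodConst η A σ ^ 2 * derConst η ^ 1 * M * 1 := by gcongr
    _ ≤ _ := by rw [mul_one]; exact le_monoConst_mul η A σ (by norm_num) (by norm_num) M

end sized

/-- Systems `∂_t φ_I = s_{IJK} φ_J φ_K + r_{IiJ} ∂_i φ_J`. -/
def IsSys {ι : Type*} [Fintype ι] (T : ℝ) (s : ι → ι × ι → ℝ) (r : ι → Fin n × ι → ℝ)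
    (φ : ι → STField n) : Prop :=
  ∀ I, ∀ t ∈ Ioo 0 T, ∀ x, pd 0 (φ I) t x = ∑ p, s I p * (φ p.1 t x * φ p.2 t x) +
    ∑ i, ∑ J, r I (i, J) * pd i.succ (φ J) t x

/-- The size of the coefficients of a system. -/
def sysConst {ι : Type*} [Fintype ι] (s : ι → ι × ι → ℝ) (r : ι → Fin n × ι → ℝ) : ℝ≥0∞ :=
  1 + ∑ I, ∑ p, ofReal |s I p| + ∑ I, ∑ q, ofReal |r I q|

section sys
variable {ι : Type*} [Fintype ι] {s : ι → ι × ι → ℝ} {r : ι → Fin n × ι → ℝ} {φ : ι → STField n}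

lemma one_le_sysConst : 1 ≤ sysConst s r := by
  unfold sysConst; rw [add_assoc]; exact le_self_add

lemma sysConst_ne_top : sysConst s r ≠ ⊤ := by
  unfold sysConst
  refine ENNReal.add_ne_top.2 ⟨ENNReal.add_ne_top.2 ⟨by simp, ?_⟩, ?_⟩ <;>
  exact ENNReal.sum_ne_top.2 fun _ _ => ENNReal.sum_ne_top.2 fun _ _ => ofReal_ne_top

lemma sum_s_le (I : ι) : ∑ p, ofReal |s I p| ≤ sysConst s r :=
  (single_le_sum (f := fun I => ∑ p, ofReal |s I p|) (fun _ _ => zero_le)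
    (Finset.mem_univ I)).trans (le_add_self.trans le_self_add)

lemma sum_r_le (I : ι) : ∑ q, ofReal |r I q| ≤ sysConst s r :=
  (single_le_sum (f := fun I => ∑ p, ofReal |r I p|) (fun _ _ => zero_le)
    (Finset.mem_univ I)).trans le_add_self

lemma sum_r_le' (I : ι) (i : Fin n) : ∑ J, ofReal |r I (i, J)| ≤ sysConst s r := by
  refine le_trans ?_ (sum_r_le (s := s) I)
  rw [Fintype.sum_prod_type]
  exact single_le_sum (f := fun i => ∑ J, ofReal |r I (i, J)|)
    (fun _ _ => zero_le) (Finset.mem_univ i)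

variable {η : Space n → ℝ} {σ : ℝ} {A E M : ℝ≥0∞} {e : ℤ → ℝ≥0∞}
  (hn : 5 ≤ n) (hη : IsCutoff η) (hσ : 0 ≤ σ) (hσ1 : σ < 1 / 2) (hσ2 : σ < ((n : ℝ) - 4) / 4)
  (hA : 1 ≤ A) (hAt : A ≠ ⊤) (he : Grow σ A e) (hM : M ≠ ⊤) (hEt : E ≠ ⊤) (hE : ∀ k, e k ≤ E)
  (hME : M * E ≤ 1) (hφ : ∀ I, Fld η T M e (φ I)) (hs : IsSys T s r φ)

include hφ hs in
/-- The second time derivatives of the solutions of a system. -/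
lemma IsSys.pd_pd (K : ι) {t : ℝ} (ht : t ∈ Ioo 0 T) (x : Space n) :
    pd 0 (pd 0 (φ K)) t x =
      ∑ p, s K p * (pd 0 (φ p.1) t x * φ p.2 t x + φ p.1 t x * pd 0 (φ p.2) t x) +
      ∑ i, ∑ L, r K (i, L) * pd i.succ (pd 0 (φ L)) t x := by
  have h1 : ∀ I, IsPd T 0 (φ I) (pd 0 (φ I)) := fun I => (hφ I).smooth.isPd 0
  have h2 := (IsPd.sum Finset.univ fun (p : ι × ι) _ =>
    ((h1 p.1).mul (h1 p.2)).const_mul (s K p)).add (IsPd.sum Finset.univ fun (i : Fin n) _ =>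
      IsPd.sum Finset.univ fun (L : ι) _ => (((hφ L).smooth.pd i.succ).isPd 0).const_mul (r K (i, L)))
  rw [pd_congr (hs K) ht, h2.pd_eq ht x]
  congr 1
  refine sum_congr rfl fun i _ => sum_congr rfl fun L _ => ?_
  rw [pd_comm (hφ L).smooth 0 i.succ ht]

include hn hη hσ hσ1 hσ2 hA hAt he hM hEt hE hME hφ hs

lemma IsSys.chain_mul_pd (J K : ι) : Chain η T (4 * sysConst s r * (monoConst η A σ * M)) e 1 2
    (fun t x => φ J t x * pd 0 (φ K) t x) := by
  set M' := monoConst η A σ * M with hM'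
  set Λ := sysConst s r with hΛ
  have hΛ1 : 1 ≤ Λ := one_le_sysConst
  have q2 := fun (J K : ι) => (hφ J).sized_mul_pd hn hη hσ hσ1 hσ2 hA he hM hEt hE hME (hφ K) 0
  have q3 := fun (J K : ι) (μ : Fin (n + 1)) =>
    (hφ J).sized_pd_mul_pd hn hη hσ hσ1 hσ2 hA he hM hEt hE hME (hφ K) μ 0
  have q4 := fun (J K L : ι) => (hφ J).sized_mul_mul_pd hn hη hσ hσ1 hσ2 hA he hM hEt hE hME
    (hφ K) (hφ L) hAt 0
  have c1 : Chain η T M' e 0 3 (fun t x => pd 0 (φ J) t x * pd 0 (φ K) t x) := q3 J K 0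
  have c2 := Chain.sum hη (m := 0) (l := 3) (M := M' + M') (e := e) Finset.univ (s K)
    (u := fun p t x => (φ J t x * φ p.2 t x) * pd 0 (φ p.1) t x +
      (φ J t x * φ p.1 t x) * pd 0 (φ p.2) t x) fun p _ =>
        Chain.add (m := 0) (l := 3) hη (q4 J p.2 p.1) (q4 J p.1 p.2)
  have c3 := Chain.sum hη (m := 0) (l := 3) (M := M') (e := e) Finset.univ
    (fun q : Fin n × ι => -r K q) (u := fun q t x => pd q.1.succ (φ J) t x * pd 0 (φ q.2) t x)
    fun q _ => q3 J q.2 q.1.succ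
  have c4 := fun i : Fin n => Chain.sum hη (m := 0) (l := 2) (M := M') (e := e) Finset.univ
    (fun L => r K (i, L)) (u := fun L t x => φ J t x * pd 0 (φ L) t x) fun L _ => q2 J L
  have le1 : M' ≤ 4 * Λ * M' := by
    calc M' = 1 * 1 * M' := by ring
      _ ≤ 4 * Λ * M' := by gcongr; norm_num
  refine ⟨(q2 J K).mono le1, _, _, ((c1.add hη c2).add hη c3).mono ?_, fun i => (c4 i).mono ?_,
    fun t ht x => ?_⟩
  · have e1 := sum_s_le (s := s) (r := r) K
    have e2 := sum_r_le (s := s) (r := r) K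
    simp only [abs_neg]
    calc _ ≤ Λ * M' + Λ * (M' + M') + Λ * M' := by
          gcongr
          calc M' = 1 * M' := (one_mul _).symm
            _ ≤ _ := by gcongr
      _ = _ := by ring
  · refine (mul_le_mul' (sum_r_le' (s := s) K i) le_rfl).trans ?_
    gcongr
    calc sysConst s r = 1 * Λ := (one_mul _).symm
      _ ≤ _ := by gcongr; norm_num
  · have hJ := (hφ J).smooth
    have h1 := ((hJ.isPd 0).mul (((hφ K).smooth.pd 0).isPd 0)).pd_eq ht x
    rw [h1, hs.pd_pd hφ K ht]
    have h2 : ∀ i : Fin n, pd i.succ (fun t x => ∑ L, r K (i, L) * (φ J t x * pd 0 (φ L) t x)) t x =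
        ∑ L, r K (i, L) * (pd i.succ (φ J) t x * pd 0 (φ L) t x +
          φ J t x * pd i.succ (pd 0 (φ L)) t x) := fun i =>
      (IsPd.sum Finset.univ fun L _ => ((hJ.isPd i.succ).mul
        (((hφ L).smooth.pd 0).isPd i.succ)).const_mul (r K (i, L))).pd_eq ht x
    simp_rw [h2, mul_add, sum_add_distrib, Fintype.sum_prod_type, neg_mul,
      Finset.sum_neg_distrib, mul_sum]
    have h3 : ∀ a b c d f g k y : ℝ, y * c = f → y * d = g →
        a + (y * (c + d) + b) = a + (f + g) + -k + (k + b) :=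
      fun a b c d f g k y h h' => by rw [mul_add, h, h']; ring
    have h5 : ∑ i : Fin n, ∑ L, φ J t x * (r K (i, L) * pd i.succ (pd 0 (φ L)) t x) =
        ∑ i : Fin n, ∑ L, r K (i, L) * (φ J t x * pd i.succ (pd 0 (φ L)) t x) :=
      sum_congr rfl fun i _ => sum_congr rfl fun L _ => by ring
    rw [h5]
    refine h3 _ _ _ _ _ _ _ _ ?_ ?_ <;>
    · simp_rw [mul_sum]
      exact sum_congr rfl fun i _ => sum_congr rfl fun L _ => by ring

lemma IsSys.chain_mul (J K : ι) : Chain η T (8 * sysConst s r * (monoConst η A σ * M)) e 2 1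
    (fun t x => φ J t x * φ K t x) := by
  have h1 := fun J K => hs.chain_mul_pd hn hη hσ hσ1 hσ2 hA hAt he hM hEt hE hME hφ J K
  set M' := monoConst η A σ * M with hM'
  set Λ := sysConst s r with hΛ
  have hΛ1 : 1 ≤ Λ := one_le_sysConst
  have le1 : M' ≤ 8 * Λ * M' := by
    calc M' = 1 * 1 * M' := by ring
      _ ≤ 8 * Λ * M' := by gcongr; norm_num
  refine ⟨((hφ J).sized_mul hn hη hσ hσ1 hσ2 hA he hM hEt hE hME (hφ K)).mono le1, _,
    fun _ _ _ => 0, ((h1 K J).add hη (h1 J K)).mono (le_of_eq (by ring)),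
    fun _ => chain_zero _, fun t ht x => ?_⟩
  rw [(((hφ J).smooth.isPd 0).mul ((hφ K).smooth.isPd 0)).pd_eq ht x,
    Finset.sum_eq_zero fun i _ => pd_zero_field i.succ ht x]
  ring

/-- The solutions of a system belong to the class `Chain`. -/
theorem IsSys.chain {m : ℕ} (hm : m ≤ 3) (I : ι) :
    Chain η T (8 * sysConst s r ^ (m + 2) * (monoConst η A σ * M)) e m 0 (φ I) := by
  have h1 := fun J K => hs.chain_mul hn hη hσ hσ1 hσ2 hA hAt he hM hEt hE hME hφ J K
  set M' := monoConst η A σ * M with hM'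
  set Λ := sysConst s r with hΛ
  have hΛ1 : 1 ≤ Λ := one_le_sysConst
  have hS : ∀ (m : ℕ) (I : ι), Sized η T (8 * Λ ^ (m + 2) * M') e 0 (φ I) := fun m I =>
    (hφ I).sized.mono (by
      calc M' = 1 * 1 * M' := by ring
        _ ≤ 8 * Λ ^ (m + 2) * M' := by
          gcongr
          · norm_num
          · exact one_le_pow₀ hΛ1)
  induction m generalizing I with
  | zero => exact hS 0 I
  | succ m ih =>
    have hv : ∀ J K, Chain η T (8 * Λ * M') e m 1 (fun t x => φ J t x * φ K t x) := by
      intro J K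
      have hm' : m = 0 ∨ m = 1 ∨ m = 2 := by omega
      rcases hm' with rfl | rfl | rfl
      exacts [(h1 J K).pred.pred, (h1 J K).pred, h1 J K]
    refine ⟨hS _ I, _, fun i t x => ∑ L, r I (i, L) * φ L t x,
      (Chain.sum hη Finset.univ (s I) fun p _ => hv p.1 p.2).mono ?_, fun i =>
      (Chain.sum hη Finset.univ (fun L => r I (i, L)) fun L _ => ih (by omega) L).mono ?_,
      fun t ht x => ?_⟩
    · calc _ ≤ Λ * (8 * Λ * M') := by gcongr; exact sum_s_le I
        _ = 8 * Λ ^ 2 * M' := by ring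
        _ ≤ _ := by
          gcongr 8 * ?_ * M'
          exact pow_le_pow_right₀ hΛ1 (by omega)
    · calc _ ≤ Λ * (8 * Λ ^ (m + 2) * M') := by gcongr; exact sum_r_le' I i
        _ = _ := by ring
    · rw [hs I t ht x]
      congr 1
      refine sum_congr rfl fun i _ => ?_
      exact ((IsPd.sum Finset.univ fun L _ =>
        ((hφ L).smooth.isPd i.succ).const_mul (r I (i, L))).pd_eq ht x).symm

end sys

/-! ### Fields with bounded derivatives -/

/-- The coordinates of space-time. -/
def coord (μ : Fin (n + 1)) : ℝ × Space n →L[ℝ] ℝ :=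
  Fin.cases (motive := fun _ => ℝ × Space n →L[ℝ] ℝ) (ContinuousLinearMap.fst ℝ ℝ (Space n))
    (fun i => (EuclideanSpace.proj i).comp (ContinuousLinearMap.snd ℝ ℝ (Space n))) μ

lemma abs_coord_le (μ : Fin (n + 1)) (h : ℝ × Space n) : |coord μ h| ≤ ‖h‖ := by
  induction μ using Fin.cases with
  | zero => exact norm_fst_le h
  | succ i => exact (PiLp.norm_apply_le h.2 i).trans (norm_snd_le h)

lemma norm_coord_le (μ : Fin (n + 1)) : ‖coord μ‖ ≤ 1 :=
  ContinuousLinearMap.opNorm_le_bound _ zero_le_one fun h => by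
    rw [one_mul]; exact abs_coord_le μ h

lemma norm_dir_le (μ : Fin (n + 1)) : ‖((dirT μ, dirX μ) : ℝ × Space n)‖ ≤ 1 := by
  induction μ using Fin.cases with
  | zero => simp [Prod.norm_def]
  | succ i => simp [Prod.norm_def]

lemma sum_coord_smul (h : ℝ × Space n) :
    ∑ μ, coord μ h • ((dirT μ, dirX μ) : ℝ × Space n) = h := by
  rw [Fin.sum_univ_succ]
  refine Prod.ext ?_ ?_
  · simp [coord, Prod.fst_sum]
  · ext j
    simp [coord, Prod.snd_sum, Pi.single_apply]

/-- A field with continuous partial derivatives is differentiable. -/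
theorem hasFDerivAt_of_isPd {f : STField n} {g : Fin (n + 1) → STField n}
    (hfg : ∀ μ, IsPd T μ f (g μ)) (hg : ∀ μ, Cont T (g μ)) {t : ℝ} (ht : t ∈ Ioo 0 T)
    (x : Space n) : HasFDerivAt (fun p : ℝ × Space n => f p.1 p.2)
      (∑ μ, (g μ t x) • coord μ) (t, x) := by
  set F : ℝ × Space n → ℝ := fun p => f p.1 p.2 with hF
  set p : ℝ × Space n := (t, x) with hp
  set dir : Fin (n + 1) → ℝ × Space n := fun μ => (dirT μ, dirX μ) with hdir
  have main : ∀ s : Finset (Fin (n + 1)), (fun h : ℝ × Space n =>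
      F (p + ∑ μ ∈ s, coord μ h • dir μ) - F p - ∑ μ ∈ s, g μ t x * coord μ h)
      =o[𝓝 0] fun h => h := by
    intro s
    induction s using Finset.induction_on with
    | empty => simp
    | insert ν s hν ih =>
      set P : ℝ × Space n → ℝ × Space n := fun h => ∑ μ ∈ s, coord μ h • dir μ with hP
      have hPn : ∀ h, ‖P h‖ ≤ s.card * ‖h‖ := by
        intro h
        refine (norm_sum_le _ _).trans ?_
        refine (Finset.sum_le_card_nsmul _ _ ‖h‖ fun μ _ => ?_).trans_eq (nsmul_eq_mul _ _)
        rw [norm_smul]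
        calc _ ≤ ‖h‖ * 1 := mul_le_mul (abs_coord_le μ h) (norm_dir_le μ) (norm_nonneg _)
              (norm_nonneg _)
          _ = _ := mul_one _
      have step : (fun h : ℝ × Space n => F (p + P h + coord ν h • dir ν) - F (p + P h) -
          g ν t x * coord ν h) =o[𝓝 0] fun h => h := by
        rw [Asymptotics.isLittleO_iff]
        intro c hc
        have hcont : ContinuousAt (fun q : ℝ × Space n => g ν q.1 q.2) p :=
          (hg ν).continuousAt (isOpen_slab.mem_nhds (mem_slab ht x))
        obtain ⟨δ, hδ, hball⟩ := Metric.eventually_nhds_iff_ball.1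
          ((Metric.continuousAt_iff'.1 hcont c hc).and (isOpen_slab.mem_nhds (mem_slab ht x)))
        have hN : (0 : ℝ) < s.card + 1 := by positivity
        filter_upwards [Metric.ball_mem_nhds (0 : ℝ × Space n) (div_pos hδ hN)] with h hh
        rw [mem_ball_zero_iff, lt_div_iff₀ hN] at hh
        have hq : ∀ τ ∈ Icc (0 : ℝ) 1, p + P h + (τ * coord ν h) • dir ν ∈ Metric.ball p δ := by
          intro τ hτ
          rw [mem_ball_iff_norm, add_assoc, add_sub_cancel_left]
          refine (norm_add_le _ _).trans_lt ?_
          have h1 : ‖(τ * coord ν h) • dir ν‖ ≤ ‖h‖ := by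
            rw [norm_smul, norm_mul, Real.norm_eq_abs, abs_of_nonneg hτ.1]
            calc _ ≤ 1 * ‖h‖ * 1 := mul_le_mul (mul_le_mul hτ.2 (abs_coord_le ν h)
                  (abs_nonneg _) zero_le_one) (norm_dir_le ν) (norm_nonneg _) (by positivity)
              _ = _ := by ring
          have := hPn h
          linarith
        have hder : ∀ τ ∈ Icc (0 : ℝ) 1, HasDerivWithinAt (fun τ : ℝ =>
            F (p + P h + (τ * coord ν h) • dir ν) - g ν t x * (τ * coord ν h))
            ((g ν (p + P h + (τ * coord ν h) • dir ν).1 (p + P h + (τ * coord ν h) • dir ν).2 -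
              g ν t x) * coord ν h) (Icc 0 1) τ := by
          intro τ hτ
          have h1 := (hball _ (hq τ hτ)).2
          have h2 : (p + P h).1 + (τ * coord ν h) * dirT ν ∈ Ioo 0 T := h1.1
          have h3 := ((hfg ν).hasDerivAt h2 (p + P h).2).comp τ (hasDerivAt_mul_const (coord ν h))
          have h4 := (hasDerivAt_mul_const (x := τ) (coord ν h)).const_mul (g ν t x)
          refine ((h3.sub h4).congr_deriv ?_).hasDerivWithinAt
          rw [sub_mul]; rfl
        have hbd := norm_image_sub_le_of_norm_deriv_le_segment_01' hder (C := c * ‖h‖)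
          fun τ hτ => by
            rw [norm_mul]
            refine mul_le_mul ?_ (abs_coord_le ν h) (norm_nonneg _) hc.le
            exact (hball _ (hq τ ⟨hτ.1, hτ.2.le⟩)).1.le
        simp only [one_mul, zero_mul, zero_smul, add_zero, mul_zero, sub_zero] at hbd
        refine le_trans (le_of_eq ?_) hbd
        congr 1; ring
      refine (ih.add step).congr_left fun h => ?_
      simp only [Finset.sum_insert hν]
      rw [add_comm (coord ν h • dir ν), ← add_assoc]
      ring
  rw [hasFDerivAt_iff_isLittleO_nhds_zero]
  refine (main Finset.univ).congr_left fun h => ?_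
  rw [sum_coord_smul]
  simp

/-- Fields whose derivatives of order up to `m` exist, are continuous and bounded by `b`. -/
def BddDer (T b : ℝ) : ℕ → STField n → Prop
  | 0, f => Cont T f ∧ ∀ t ∈ Ioo 0 T, ∀ x, |f t x| ≤ b
  | m + 1, f => (Cont T f ∧ ∀ t ∈ Ioo 0 T, ∀ x, |f t x| ≤ b) ∧
      ∀ μ, ∃ g, IsPd T μ f g ∧ BddDer T b m g

section bddDer
variable {b : ℝ} {m : ℕ} {f : STField n}

lemma BddDer.base (h : BddDer T b m f) : Cont T f ∧ ∀ t ∈ Ioo 0 T, ∀ x, |f t x| ≤ b := by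
  cases m with
  | zero => exact h
  | succ m => exact h.1

lemma BddDer.contDiffOn (h : BddDer T b m f) :
    ContDiffOn ℝ m (fun p : ℝ × Space n => f p.1 p.2) (slab n T) := by
  induction m generalizing f with
  | zero => exact contDiffOn_zero.2 h.1
  | succ m ih =>
    choose g hg hg' using h.2
    have hd : ∀ p ∈ slab n T, HasFDerivAt (fun p : ℝ × Space n => f p.1 p.2)
        (∑ μ, (g μ p.1 p.2) • coord μ) p := fun p hp =>
      hasFDerivAt_of_isPd hg (fun μ => (hg' μ).base.1) hp.1 p.2
    push_cast
    refine (contDiffOn_succ_iff_fderiv_of_isOpen isOpen_slab).2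
      ⟨fun p hp => (hd p hp).differentiableAt.differentiableWithinAt, by simp, ?_⟩
    refine ContDiffOn.congr (f := fun p => ∑ μ, (g μ p.1 p.2) • coord μ)
      (ContDiffOn.sum fun μ _ => (ih (hg' μ)).smul contDiffOn_const) fun p hp => (hd p hp).fderiv

lemma norm_iteratedFDeriv_sum_le {E F : Type*} [NormedAddCommGroup E] [NormedSpace ℝ E]
    [NormedAddCommGroup F] [NormedSpace ℝ F] {ι : Type*} (s : Finset ι) {G : ι → E → F} {x : E}
    {j : ℕ} (hG : ∀ i ∈ s, ContDiffAt ℝ j (G i) x) :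
    ‖iteratedFDeriv ℝ j (fun y => ∑ i ∈ s, G i y) x‖ ≤ ∑ i ∈ s, ‖iteratedFDeriv ℝ j (G i) x‖ := by
  classical
  induction s using Finset.induction_on with
  | empty =>
    simp only [Finset.sum_empty]
    rw [iteratedFDeriv_fun_zero]; simp
  | insert i s hi ih =>
    simp only [Finset.sum_insert hi]
    have h1 := fun j hj => hG j (Finset.mem_insert_of_mem hj)
    have h2 := iteratedFDeriv_add_apply (hG i (Finset.mem_insert_self i s)) (ContDiffAt.sum h1)
    change ‖iteratedFDeriv ℝ j (G i + fun y => ∑ i ∈ s, G i y) x‖ ≤ _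
    rw [h2]
    exact (norm_add_le _ _).trans (add_le_add le_rfl (ih h1))

lemma BddDer.norm_iteratedFDeriv_le (h : BddDer T b m f) {j : ℕ} (hj : j ≤ m) {p : ℝ × Space n}
    (hp : p ∈ slab n T) :
    ‖iteratedFDeriv ℝ j (fun p : ℝ × Space n => f p.1 p.2) p‖ ≤ (n + 1) ^ j * b := by
  induction j generalizing f m with
  | zero => simpa using h.base.2 p.1 hp.1 p.2
  | succ j ih =>
    obtain ⟨m, rfl⟩ : ∃ m', m = m' + 1 := ⟨m - 1, by omega⟩
    choose g hg hg' using h.2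
    have hd : ∀ p ∈ slab n T, fderiv ℝ (fun p : ℝ × Space n => f p.1 p.2) p =
        ∑ μ, (ContinuousLinearMap.toSpanSingleton ℝ (coord μ)) (g μ p.1 p.2) := fun p hp => by
      rw [(hasFDerivAt_of_isPd hg (fun μ => (hg' μ).base.1) hp.1 p.2).fderiv]
      simp
    rw [← norm_iteratedFDeriv_fderiv, (Filter.EventuallyEq.iteratedFDeriv ℝ
      (Filter.eventually_of_mem (isOpen_slab.mem_nhds hp) hd) j).eq_of_nhds]
    have hc : ∀ μ, ContDiffAt ℝ j (fun p : ℝ × Space n => g μ p.1 p.2) p := fun μ =>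
      ((hg' μ).contDiffOn.contDiffAt (isOpen_slab.mem_nhds hp)).of_le (by exact_mod_cast (by omega))
    refine (norm_iteratedFDeriv_sum_le Finset.univ fun μ _ =>
      (ContinuousLinearMap.contDiff _).contDiffAt.comp p (hc μ)).trans ?_
    calc _ ≤ ∑ μ : Fin (n + 1), ((n : ℝ) + 1) ^ j * b := sum_le_sum fun μ _ => by
          have h1 := (ContinuousLinearMap.toSpanSingleton ℝ
            (coord μ)).norm_iteratedFDeriv_comp_left (hc μ) le_rfl
          have h2 := ih (hg' μ) (by omega)
          refine h1.trans ((mul_le_mul_of_nonneg_right ?_ (norm_nonneg _)).trans_eq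
            (one_mul _) |>.trans h2)
          rw [ContinuousLinearMap.norm_toSpanSingleton]
          exact norm_coord_le μ
      _ = _ := by
          rw [Finset.sum_const, Finset.card_univ, Fintype.card_fin, nsmul_eq_mul]
          push_cast; ring

/-- Termwise differentiation. -/
lemma IsPd.tsum {f g : ℕ → STField n} {μ : Fin (n + 1)} (h : ∀ i, IsPd T μ (f i) (g i))
    {b : ℕ → ℝ} (hb : Summable b) (hg : ∀ i, ∀ t ∈ Ioo 0 T, ∀ x, |g i t x| ≤ b i)
    (hf : ∀ t ∈ Ioo 0 T, ∀ x, Summable fun i => f i t x) :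
    IsPd T μ (fun t x => ∑' i, f i t x) (fun t x => ∑' i, g i t x) := by
  intro t ht x
  have hopen : IsOpen {s : ℝ | t + s * dirT μ ∈ Ioo 0 T} :=
    isOpen_Ioo.preimage (by fun_prop)
  have hconv : Convex ℝ {s : ℝ | t + s * dirT μ ∈ Ioo 0 T} := by
    intro s hs r hr a c ha hc hac
    have h1 := (convex_Ioo (0 : ℝ) T) hs hr ha hc hac
    have e : a • (t + s * dirT μ) + c • (t + r * dirT μ) = t + (a • s + c • r) * dirT μ := by
      simp only [smul_eq_mul]
      linear_combination t * hac
    rw [e] at h1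
    exact h1
  have h0 : (0 : ℝ) ∈ {s : ℝ | t + s * dirT μ ∈ Ioo 0 T} := by simpa using ht
  have := hasDerivAt_tsum_of_isPreconnected (y₀ := 0) (y := 0) hb hopen hconv.isPreconnected
    (g := fun i s => f i (t + s * dirT μ) (x + s • dirX μ))
    (g' := fun i s => g i (t + s * dirT μ) (x + s • dirX μ))
    (fun i s hs => (h i).hasDerivAt hs x) (fun i s hs => hg i _ hs _) h0
    (by simpa using hf t ht x) h0
  simpa using this

lemma cont_tsum {f : ℕ → STField n} (h : ∀ i, Cont T (f i)) {b : ℕ → ℝ} (hb : Summable b)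
    (hf : ∀ i, ∀ t ∈ Ioo 0 T, ∀ x, |f i t x| ≤ b i) : Cont T (fun t x => ∑' i, f i t x) :=
  continuousOn_tsum h hb fun i p hp => hf i p.1 hp.1 p.2

lemma abs_tsum_le {f : ℕ → STField n} {b : ℕ → ℝ} (hb : Summable b)
    (hf : ∀ i, ∀ t ∈ Ioo 0 T, ∀ x, |f i t x| ≤ b i) {t : ℝ} (ht : t ∈ Ioo 0 T) (x : Space n) :
    |∑' i, f i t x| ≤ ∑' i, b i :=
  (Real.norm_eq_abs _).symm.trans_le
    (tsum_of_norm_bounded hb.hasSum fun i => (Real.norm_eq_abs _).trans_le (hf i t ht x))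

lemma bddDer_tsum {f : ℕ → STField n} {b : ℕ → ℝ} (hb : Summable b)
    (h : ∀ i, BddDer T (b i) m (f i)) : BddDer T (∑' i, b i) m (fun t x => ∑' i, f i t x) := by
  have key : ∀ {f : ℕ → STField n}, (∀ i, Cont T (f i) ∧ ∀ t ∈ Ioo 0 T, ∀ x, |f i t x| ≤ b i) →
      Cont T (fun t x => ∑' i, f i t x) ∧ ∀ t ∈ Ioo 0 T, ∀ x, |∑' i, f i t x| ≤ ∑' i, b i :=
    fun h => ⟨cont_tsum (fun i => (h i).1) hb fun i => (h i).2,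
      fun t ht x => abs_tsum_le hb (fun i => (h i).2) ht x⟩
  induction m generalizing f with
  | zero => exact key h
  | succ m ih =>
    refine ⟨key fun i => (h i).base, fun μ => ?_⟩
    choose g hg hg' using fun i => (h i).2 μ
    refine ⟨_, IsPd.tsum hg hb (fun i => (hg' i).base.2) fun t ht x => ?_, ih hg'⟩
    exact Summable.of_norm_bounded hb fun i => (h i).base.2 t ht x

end bddDer

/-! ### Sums of frequency pieces -/

section pieces
variable {η : Space n → ℝ}

lemma abs_le_of_eLpNorm_top_le {f : Space n → ℝ} (hf : Continuous f) {b : ℝ} (hb : 0 ≤ b)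
    (h : eLpNorm f ⊤ volume ≤ ofReal b) (x : Space n) : |f x| ≤ b := by
  have h1 : ∀ᵐ x, |f x| ≤ b := by
    filter_upwards [enorm_ae_le_eLpNormEssSup f volume] with x hx
    rw [← eLpNorm_exponent_top] at hx
    have h2 := hx.trans h
    rw [Real.enorm_eq_ofReal_abs] at h2
    exact (ENNReal.ofReal_le_ofReal_iff hb).1 h2
  have hd := Measure.dense_of_ae h1
  have hc : IsClosed {x | |f x| ≤ b} := isClosed_le hf.abs continuous_const
  have := hc.closure_eq ▸ hd x
  exact this

lemma Reg.bddDer (hn : 5 ≤ n) {k : ℤ} {B : ℝ≥0∞} {m l : ℕ} {f : STField n} (hk : k ≤ 0)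
    (h : Reg T k B m (l + 1) f) {b : ℝ} (hb0 : 0 ≤ b) (hb : B * wt (2 * k) ≤ ofReal b) :
    BddDer T b m f := by
  have key : ∀ {l : ℕ} {f : STField n}, Cont T f ∧ strich T k f ≤ B * wt ((l + 1 : ℕ) * k) →
      Cont T f ∧ ∀ t ∈ Ioo 0 T, ∀ x, |f t x| ≤ b := fun {l f} h => by
    refine ⟨h.1, fun t ht x => abs_le_of_eLpNorm_top_le (h.1.slice ht) hb0 ?_ x⟩
    refine (h.1.eLpNorm_le_mixedNorm ⊤ ht).trans
      ((mixedNorm_le_strich (admissible_top_top hn) k f).trans ?_)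
    refine ((mul_le_mul' le_rfl h.2).trans ?_).trans hb
    rw [mul_left_comm, ← wt_add]
    refine mul_le_mul' le_rfl (wt_mono ?_)
    have hk' : (k : ℝ) ≤ 0 := by exact_mod_cast hk
    rw [toReal_inv_top]
    push_cast
    nlinarith [Nat.cast_nonneg (α := ℝ) l]
  induction m generalizing l f with
  | zero => exact key h
  | succ m ih =>
    refine ⟨key h.1, fun μ => ?_⟩
    obtain ⟨g, hg, hg'⟩ := h.2 μ
    exact ⟨g, hg, ih hg'⟩

lemma exists_abs_Op_dil_le (hn : 5 ≤ n) {a : Space n → ℂ} (ha : IsSymb a) {p : ℝ≥0∞} (hp : 1 ≤ p)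
    (hp2 : p ≤ 2) {f : STField n} (hf : Cont T f) (hb : BddL T p f) :
    ∃ C : ℝ, 0 ≤ C ∧ ∀ l : ℤ, l ≤ 0 → ∀ t ∈ Ioo 0 T, ∀ x,
      |Op (dil l a) (f t) x| ≤ C * (2 : ℝ) ^ l * 2 ^ l := by
  obtain ⟨B, hB, hfB⟩ := hb
  have hk0 : 0 ≤ kb a := zero_le_one.trans (one_le_kb a)
  refine ⟨kb a * B.toReal, by positivity, fun l hl t ht x => ?_⟩
  have h1 := (enorm_Op_dil_le ha l hp (hf.slice ht).aestronglyMeasurable x).trans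
    (mul_le_mul' le_rfl (hfB t ht))
  rw [Real.enorm_eq_ofReal_abs, ← ofReal_toReal hB, ← ofReal_mul (by positivity),
    ENNReal.ofReal_le_ofReal_iff (by positivity)] at h1
  refine h1.trans ?_
  have h2 : 1 / 2 ≤ (p⁻¹).toReal := by
    rw [← toReal_inv_two]
    exact toReal_mono (by simp; rintro rfl; simp at hp) (ENNReal.inv_le_inv.2 hp2)
  have h3 : (2 : ℝ) ^ ((n : ℝ) * l * (p⁻¹).toReal) ≤ 2 ^ l * 2 ^ l := by
    rw [← zpow_add₀ two_ne_zero, ← Real.rpow_intCast]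
    refine Real.rpow_le_rpow_of_exponent_le one_le_two ?_
    have hl' : (l : ℝ) ≤ 0 := by exact_mod_cast hl
    have hn' : (5 : ℝ) ≤ n := by exact_mod_cast hn
    have h4 : 2 ≤ (n : ℝ) * (p⁻¹).toReal := by nlinarith
    push_cast
    nlinarith
  calc _ = kb a * B.toReal * (2 : ℝ) ^ ((n : ℝ) * l * (p⁻¹).toReal) := by ring
    _ ≤ kb a * B.toReal * (2 ^ l * 2 ^ l) := by gcongr
    _ = _ := by ring

lemma summable_zpow_down (C : ℝ) (J : ℤ) : Summable fun i : ℕ => C * (2 : ℝ) ^ (J - i : ℤ) := by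
  have : (fun i : ℕ => C * (2 : ℝ) ^ (J - i : ℤ)) = fun i : ℕ => C * 2 ^ J * (1 / 2 : ℝ) ^ i := by
    funext i
    rw [zpow_sub₀ two_ne_zero, zpow_natCast, one_div, inv_pow]
    ring
  rw [this]
  exact summable_geometric_two.mul_left _

lemma tsum_down_eq {g : ℤ → ℝ} {s : Finset ℤ} (J : ℤ) (h : ∀ l ∉ s, g l = 0) :
    ∑' i : ℕ, g (J - i) = ∑ l ∈ s, if l ≤ J then g l else 0 := by
  have hi : Function.Injective fun i : ℕ => J - (i : ℤ) := fun i j hij => by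
    simp only at hij; omega
  have h1 : ∑' l, (if l ≤ J then g l else 0) = ∑ l ∈ s, if l ≤ J then g l else 0 :=
    tsum_eq_sum fun l hl => by simp [h l hl]
  rw [← h1, ← hi.tsum_eq]
  · exact tsum_congr fun i => by simp
  · intro l hl
    have h1 : l ≤ J := by
      by_contra h1
      simp [h1] at hl
    exact ⟨(J - l).toNat, by simp only; omega⟩

lemma Op_tsum {a : Space n → ℂ} (ha : IsSymb a) {F : ℕ → Space n → ℝ} (hF : ∀ i, Continuous (F i))
    {b : ℕ → ℝ} (hb : Summable b) (hFb : ∀ i x, |F i x| ≤ b i) (x : Space n) :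
    Op a (fun y => ∑' i, F i y) x = ∑' i, Op a (F i) x := by
  have hk : Integrable (fun y => kern a (x - y)) volume := ha.integrable_kern.comp_sub_left x
  have hint : ∀ i, Integrable (fun y => kern a (x - y) * F i y) volume := fun i =>
    hk.mul_bdd (c := b i) (hF i).aestronglyMeasurable (ae_of_all _ (hFb i))
  refine (integral_congr_ae (ae_of_all _ fun y => ?_)).trans
    (hasSum_integral_of_summable_integral_norm hint ?_).tsum_eq.symm
  · exact (tsum_mul_left).symm
  · refine Summable.of_nonneg_of_le (fun i => integral_nonneg fun y => norm_nonneg _)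
      (fun i => ?_) (hb.mul_left (∫ y, ‖kern a (x - y)‖))
    rw [← integral_mul_const]
    refine integral_mono (hint i).norm (hk.norm.mul_const _) fun y => ?_
    rw [norm_mul]
    exact mul_le_mul_of_nonneg_left (hFb i y) (norm_nonneg _)

lemma integrable_mul_schwartz {f : Space n → ℝ} (hf : Continuous f) {b : ℝ}
    (hb : ∀ x, |f x| ≤ b) (h : 𝓢(Space n, ℂ)) :
    Integrable (fun x => (f x : ℂ) * (𝓕 h) x) volume :=
  (𝓕 h).integrable.bdd_mul (c := b) (Complex.continuous_ofReal.comp hf).aestronglyMeasurable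
    (ae_of_all _ fun x => by simpa using hb x)

lemma FourierSupportedIn.tsum {r : ℝ} {F : ℕ → Space n → ℝ} (hF : ∀ i, Continuous (F i))
    {b : ℕ → ℝ} (hb : Summable b) (hFb : ∀ i x, |F i x| ≤ b i)
    (hs : ∀ i, FourierSupportedIn r (F i)) : FourierSupportedIn r (fun x => ∑' i, F i x) := by
  intro h hh
  have hint := fun i => integrable_mul_schwartz (hF i) (hFb i) h
  have h1 := (hasSum_integral_of_summable_integral_norm hint (by
    refine Summable.of_nonneg_of_le (fun i => integral_nonneg fun y => norm_nonneg _)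
      (fun i => ?_) (hb.mul_right (∫ y, ‖(𝓕 h) y‖))
    rw [← integral_const_mul]
    refine integral_mono (hint i).norm ((𝓕 h).integrable.norm.const_mul _) fun y => ?_
    simp only [norm_mul, Complex.norm_real, Real.norm_eq_abs]
    exact mul_le_mul_of_nonneg_right (hFb i y) (norm_nonneg _))).tsum_eq
  rw [tsum_congr fun i => hs i h hh, tsum_zero] at h1
  rw [h1]
  refine integral_congr_ae (ae_of_all _ fun x => ?_)
  simp only
  rw [Complex.ofReal_tsum, tsum_mul_right]

lemma FourierSupportedIn.const_mul_sum {ι : Type*} [Fintype ι] {r : ℝ} {F : ι → Space n → ℝ}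
    (c : ℝ) (hF : ∀ i, Continuous (F i)) {b : ℝ} (hFb : ∀ i x, |F i x| ≤ b)
    (hs : ∀ i, FourierSupportedIn r (F i)) : FourierSupportedIn r (fun x => c * ∑ i, F i x) := by
  intro h hh
  push_cast
  simp_rw [mul_assoc, sum_mul]
  rw [integral_const_mul, integral_finsetSum _ fun i _ => integrable_mul_schwartz (hF i) (hFb i) h,
    Finset.sum_eq_zero fun i _ => hs i h hh, mul_zero]

end pieces

/-! ### The potential -/

/-- The symbol of `Δ⁻¹ ∂_j` on the frequencies of order one. -/
def nsym (η : Space n → ℝ) (j : Fin n) (v : Space n) : ℂ :=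
  pt η v * (-Complex.I * (v j / (2 * Real.pi * ‖v‖ ^ 2) : ℝ))

/-- The part at frequency `2 ^ l` of the potential of the vector field `f`. -/
def pot (η : Space n → ℝ) (f : Fin n → STField n) (l : ℤ) : STField n := fun t x =>
  (2 : ℝ) ^ (-l) * ∑ j, Op (dil l (nsym η j * p0 η)) (f j t) x

/-- The low frequency part of the potential of the vector field `f`. -/
def lowPot (η : Space n → ℝ) (f : Fin n → STField n) : STField n := fun t x =>
  ∑' i : ℕ, pot η f (-10 - i) t x

section potential
variable {η : Space n → ℝ}

lemma isSymb_nsym (hη : IsCutoff η) (j : Fin n) : IsSymb (nsym η j) := by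
  refine ⟨contDiff_iff_contDiffAt.2 fun v => ?_, (isSymb_pt hη).cpt.mul_right, fun v => ?_⟩
  · by_cases hv : v = 0
    · subst hv
      refine (contDiffAt_const (c := (0 : ℂ))).congr_of_eventuallyEq ?_
      have hr : (0 : ℝ) < 2 ^ (-2 : ℤ) / (2 * Real.pi) := by positivity
      filter_upwards [Metric.ball_mem_nhds (0 : Space n) hr] with v hv
      rw [mem_ball_zero_iff, lt_div_iff₀ (by positivity)] at hv
      have h1 : 2 * Real.pi * ‖v‖ ≤ 2 ^ (-2 : ℤ) := by linarith
      rw [nsym, pt, Pi.sub_apply, dil_e0_eq_one hη _ _ h1,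
        dil_e0_eq_one hη _ _ (h1.trans (zpow_le_zpow_right₀ one_le_two (by norm_num)))]
      simp
    · refine (isSymb_pt hη).smooth.contDiffAt.mul (contDiffAt_const.mul ?_)
      refine Complex.ofRealCLM.contDiff.contDiffAt.comp v ?_
      refine ContDiffAt.div ?_ (contDiffAt_const.mul (contDiff_norm_sq ℝ).contDiffAt) ?_
      · exact (EuclideanSpace.proj (𝕜 := ℝ) j).contDiff.contDiffAt
      · have := norm_pos_iff.2 hv
        positivity
  · rw [nsym, nsym, (isSymb_pt hη).herm, map_mul, map_mul, map_neg, Complex.conj_I,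
      Complex.conj_ofReal, norm_neg, PiLp.neg_apply, neg_div]
    push_cast
    ring

lemma isSymb_nsym_mul (hη : IsCutoff η) (j : Fin n) : IsSymb (nsym η j * p0 η) :=
  (isSymb_nsym hη j).mul (isSymb_p0 hη)

lemma sum_dsymb_nsym (hη : IsCutoff η) : ∑ j, dsymb j (nsym η j * p0 η) = p0 η := by
  funext v
  rw [Finset.sum_apply]
  by_cases hv : v = 0
  · have h0 : p0 η v = 0 := by
      have := dil_p0_eq_zero_of_le hη (k := 0) (v := v) (by simp [hv])
      simpa [dil] using this
    simp [dsymb, h0]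
  have hpt : pt η v * p0 η v = p0 η v := by
    rw [mul_comm]; exact congrFun (p0_mul_pt hη) v
  have hn : (‖v‖ : ℂ) ≠ 0 := by exact_mod_cast (norm_pos_iff.2 hv).ne'
  have hpi : (Real.pi : ℂ) ≠ 0 := by exact_mod_cast Real.pi_ne_zero
  have hsum : ∑ j, (v j : ℂ) ^ 2 = (‖v‖ : ℂ) ^ 2 := by
    rw [← Complex.ofReal_pow, EuclideanSpace.norm_sq_eq]
    push_cast
    exact sum_congr rfl fun j _ => by
      rw [← Complex.ofReal_pow, Real.norm_eq_abs, ← Complex.ofReal_pow, sq_abs]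
  have key : ∀ j, dsymb j (nsym η j * p0 η) v = (v j : ℂ) ^ 2 * (p0 η v / (‖v‖ : ℂ) ^ 2) := by
    intro j
    rw [dsymb_eq_mul, Pi.mul_apply, Pi.mul_apply, nsym]
    push_cast
    have : pt η v * (-Complex.I * ((v j : ℂ) / (2 * Real.pi * (‖v‖ : ℂ) ^ 2))) * p0 η v *
        (2 * Real.pi * Complex.I * (v j : ℂ)) = -(Complex.I * Complex.I) * (pt η v * p0 η v) *
          ((v j : ℂ) ^ 2 / (‖v‖ : ℂ) ^ 2) := by
      field_simp
    rw [this, hpt, Complex.I_mul_I]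
    ring
  rw [sum_congr rfl fun j _ => key j, ← sum_mul, hsum]
  field_simp

variable {p : ℝ≥0∞} {f : Fin n → STField n}

lemma cont_pot (hη : IsCutoff η) (hp : 1 ≤ p) (hf : ∀ j, Cont T (f j))
    (hb : ∀ j, BddL T p (f j)) (l : ℤ) : Cont T (pot η f l) :=
  (Cont.sum _ fun j _ => ((isSymb_nsym_mul hη j).dil l).cont_Op (hf j) hp (hb j)).const_mul _

lemma exists_abs_pot_le (hn : 5 ≤ n) (hη : IsCutoff η) (hp : 1 ≤ p) (hp2 : p ≤ 2)
    (hf : ∀ j, Cont T (f j)) (hb : ∀ j, BddL T p (f j)) :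
    ∃ C : ℝ, 0 ≤ C ∧ ∀ l : ℤ, l ≤ 0 → ∀ t ∈ Ioo 0 T, ∀ x, |pot η f l t x| ≤ C * (2 : ℝ) ^ l := by
  choose C hC0 hC using fun j => exists_abs_Op_dil_le hn (isSymb_nsym_mul hη j) hp hp2 (hf j) (hb j)
  refine ⟨∑ j, C j, Finset.sum_nonneg fun j _ => hC0 j, fun l hl t ht x => ?_⟩
  rw [pot, abs_mul, abs_of_pos (by positivity)]
  calc _ ≤ (2 : ℝ) ^ (-l) * ∑ j, C j * (2 : ℝ) ^ l * 2 ^ l := by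
        gcongr
        exact (Finset.abs_sum_le_sum_abs _ _).trans (sum_le_sum fun j _ => hC j l hl t ht x)
    _ = _ := by
        rw [← sum_mul, ← sum_mul, zpow_neg]
        field_simp

lemma PP_pot (hη : IsCutoff η) (hp : 1 ≤ p) (hf : ∀ j, Cont T (f j)) (hb : ∀ j, BddL T p (f j))
    (k l : ℤ) {t : ℝ} (ht : t ∈ Ioo 0 T) (x : Space n) : PP η k (pot η f l t) x =
      (2 : ℝ) ^ (-l) * ∑ j, Op (dil l (nsym η j * p0 η)) (PP η k (f j t)) x := by
  unfold PP pot
  rw [Op_const_mul, Op_sum ((isSymb_p0 hη).dil k) _ hp fun j _ =>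
    ((isSymb_nsym_mul hη j).dil l).memLp_Op hp ((hb j).memLp (hf j) ht)]
  congr 1
  refine sum_congr rfl fun j _ => ?_
  have := PP_Op_comm hη ((isSymb_nsym_mul hη j).dil l) hp ((hb j).memLp (hf j) ht) k
  exact congrFun this x

lemma PP_pot_eq (hη : IsCutoff η) (hp : 1 ≤ p) (hf : ∀ j, Cont T (f j))
    (hb : ∀ j, BddL T p (f j)) (k l : ℤ) {t : ℝ} (ht : t ∈ Ioo 0 T) (x : Space n) :
    PP η k (pot η f l t) x = (2 : ℝ) ^ (-l) *
      ∑ j, Op (dil k (dil (l - k) (nsym η j * p0 η) * p0 η)) (f j t) x := by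
  rw [PP_pot hη hp hf hb k l ht]
  congr 1
  refine sum_congr rfl fun j _ => ?_
  rw [PP, Op_comp ((isSymb_nsym_mul hη j).dil l) ((isSymb_p0 hη).dil k) hp ((hb j).memLp (hf j) ht),
    dil_mul k, dil_dil, add_sub_cancel]

lemma PP_pot_eq_zero (hη : IsCutoff η) (hp : 1 ≤ p) (hf : ∀ j, Cont T (f j))
    (hb : ∀ j, BddL T p (f j)) {k l : ℤ} (hl : l ∉ Finset.Icc (k - 1) (k + 1)) {t : ℝ}
    (ht : t ∈ Ioo 0 T) (x : Space n) : PP η k (pot η f l t) x = 0 := by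
  rw [PP_pot hη hp hf hb k l ht, Finset.sum_eq_zero, mul_zero]
  intro j _
  rw [PP, Op_comp ((isSymb_nsym_mul hη j).dil l) ((isSymb_p0 hη).dil k) hp
    ((hb j).memLp (hf j) ht)]
  have h0 : dil l (p0 η) * dil k (p0 η) = 0 := by
    rw [Finset.mem_Icc] at hl
    rcases le_or_gt (k + 2) l with h | h
    · exact dil_p0_mul_dil_p0 hη h
    · rw [mul_comm]; exact dil_p0_mul_dil_p0 hη (by omega)
  rw [dil_mul, mul_assoc, h0, mul_zero, Op_zero_symb]

/-- The frequency pieces of a sum of potentials. -/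
lemma PP_lowPot (hn : 5 ≤ n) (hη : IsCutoff η) (hp : 1 ≤ p) (hp2 : p ≤ 2)
    (hf : ∀ j, Cont T (f j)) (hb : ∀ j, BddL T p (f j)) (k : ℤ) {t : ℝ} (ht : t ∈ Ioo 0 T)
    (x : Space n) : PP η k (lowPot η f t) x =
      ∑ l ∈ Finset.Icc (k - 1) (k + 1), if l ≤ -10 then PP η k (pot η f l t) x else 0 := by
  obtain ⟨C, hC0, hC⟩ := exists_abs_pot_le hn hη hp hp2 hf hb
  rw [← tsum_down_eq (-10) fun l hl => PP_pot_eq_zero hη hp hf hb hl ht x]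
  exact Op_tsum ((isSymb_p0 hη).dil k) (fun i => (cont_pot hη hp hf hb _).slice ht)
    (summable_zpow_down C (-10)) (fun i x => hC _ (by omega) t ht x) x

lemma exists_abs_lowPot_le (hn : 5 ≤ n) (hη : IsCutoff η) (hp : 1 ≤ p) (hp2 : p ≤ 2)
    (hf : ∀ j, Cont T (f j)) (hb : ∀ j, BddL T p (f j)) :
    Cont T (lowPot η f) ∧ BddL T ⊤ (lowPot η f) := by
  obtain ⟨C, hC0, hC⟩ := exists_abs_pot_le hn hη hp hp2 hf hb
  have hs := summable_zpow_down C (-10)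
  have hl := fun i : ℕ => hC (-10 - i) (by omega)
  refine ⟨cont_tsum (fun i => cont_pot hη hp hf hb _) hs hl, _, ofReal_ne_top, fun t ht =>
    (eLpNorm_exponent_top).trans_le (eLpNormEssSup_le_of_ae_bound (ae_of_all _ fun x =>
      (Real.norm_eq_abs _).trans_le (abs_tsum_le hs hl ht x)))⟩

lemma fourierSupportedIn_lowPot (hn : 5 ≤ n) (hη : IsCutoff η) (hp : 1 ≤ p) (hp2 : p ≤ 2)
    (hf : ∀ j, Cont T (f j)) (hb : ∀ j, BddL T p (f j)) {t : ℝ} (ht : t ∈ Ioo 0 T) :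
    FourierSupportedIn ((2 : ℝ) ^ (-9 : ℤ)) (lowPot η f t) := by
  obtain ⟨C, hC0, hC⟩ := exists_abs_pot_le hn hη hp hp2 hf hb
  refine FourierSupportedIn.tsum (fun i => (cont_pot hη hp hf hb _).slice ht)
    (summable_zpow_down C (-10)) (fun i x => hC _ (by omega) t ht x) fun i => ?_
  have hS := fun j => (isSymb_nsym_mul hη j).dil (-10 - i)
  choose B hB0 hB using fun j =>
    exists_abs_Op_dil_le hn (isSymb_nsym_mul hη j) hp hp2 (hf j) (hb j)
  refine FourierSupportedIn.const_mul_sum _ (fun j => ((hS j).cont_Op (hf j) hp (hb j)).slice ht)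
    (b := ∑ j, B j * (2 : ℝ) ^ (-10 - i : ℤ) * 2 ^ (-10 - i : ℤ)) (fun j x =>
      (hB j _ (by omega) t ht x).trans (single_le_sum (fun j _ =>
        mul_nonneg (mul_nonneg (hB0 j) (by positivity)) (by positivity)) (Finset.mem_univ j)))
    fun j => fourierSupportedIn_Op (hS j) (fun v hv => ?_) hp ((hb j).memLp (hf j) ht)
  rw [norm_two_pi] at hv
  rw [dil_mul, Pi.mul_apply, dil_p0_eq_zero_of_lt hη, mul_zero]
  exact (zpow_le_zpow_right₀ one_le_two (by omega)).trans_lt hv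

end potential

section reg
variable {k : ℤ} {B : ℝ≥0∞} {m l : ℕ} {f : STField n}

lemma Reg.pd_field (h : Reg T k B (m + 1) l f) (μ : Fin (n + 1)) :
    Reg T k B m (l + 1) (pd μ f) := by
  obtain ⟨g, hg, hg'⟩ := h.2 μ
  exact hg'.congr fun t ht x => hg.pd_eq ht x

lemma Reg.box_field (h : Reg T k B (m + 2) l f) :
    Reg T k ((n + 1) * B) m (l + 2) (box f) := by
  refine (Reg.sum Finset.univ fun μ _ => ((h.pd_field μ).pd_field μ).const_mul (mink μ)).mono ?_
  have : ∀ μ : Fin (n + 1), ofReal |mink μ| * B = B := fun μ => by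
    unfold mink; split_ifs <;> simp
  simp [this]

lemma Reg.sNorm_le (h : Reg T k B (m + 1) l f) : sNorm T k f ≤ 2 * B * wt (l * k) := by
  refine (sNorm_le_strich k f).trans ((add_le_add h.base.2
    (mul_le_mul' le_rfl (h.pd_field 0).base.2)).trans_eq ?_)
  push_cast
  rw [add_mul, one_mul, add_comm ((l : ℝ) * k), wt_add]
  calc _ = B * wt (l * k) + wt (-k) * wt k * (B * wt (l * k)) := by ring
    _ = _ := by rw [wt_neg_mul]; ring

end reg

/-- The constant in the bounds on the potential. -/
def potConst (η : Space n → ℝ) : ℝ≥0∞ :=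
  ∑ d ∈ Finset.Icc (-1 : ℤ) 1, ∑ j, symConst 3 (dil d (nsym η j * p0 η))

lemma potConst_ne_top (η : Space n → ℝ) : potConst η ≠ ⊤ :=
  ENNReal.sum_ne_top.2 fun _ _ => ENNReal.sum_ne_top.2 fun _ _ => symConst_ne_top _ _

lemma wt_neg_le_of_mem {k l : ℤ} (hl : l ∈ Finset.Icc (k - 1) (k + 1)) :
    wt (-l) ≤ 2 * wt (-k) := by
  have h2 : wt 1 = 2 := by simp [wt]
  rw [← h2, ← wt_add]
  refine wt_mono ?_
  have : (k : ℝ) - 1 ≤ l := by exact_mod_cast (Finset.mem_Icc.1 hl).1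
  linarith

lemma ofReal_abs_zpow_neg (l : ℤ) : ofReal |(2 : ℝ) ^ (-l)| = wt (-l) := by
  rw [abs_of_pos (by positivity), ← wt_intCast]; push_cast; rfl

section potential
variable {η : Space n → ℝ} {f : Fin n → STField n}

section chain
variable {M : ℝ≥0∞} {e : ℤ → ℝ≥0∞}

/-- The frequency pieces of the potential. -/
theorem reg_proj_lowPot (hn : 5 ≤ n) (hη : IsCutoff η) (hf : ∀ j, Chain η T M e 3 0 (f j)) (k : ℤ) :
    Reg T k (2 * potConst η * wt (-k) * (M * e k)) 3 0 (proj η k (lowPot η f)) := by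
  have hc := fun j => (hf j).sized.smooth.cont
  have hb : ∀ j, BddL T 2 (f j) := fun j => (hf j).sized.bdd
  have hl := exists_abs_lowPot_le hn hη one_le_two le_rfl hc hb
  have key : ∀ l ∈ Finset.Icc (k - 1) (k + 1),
      Reg T k (2 * wt (-k) * (M * e k) * ∑ j, symConst 3 (dil (l - k) (nsym η j * p0 η))) 3 0
        (fun t x => if l ≤ -10 then PP η k (pot η f l t) x else 0) := by
    intro l hlk
    by_cases h10 : l ≤ -10
    swap
    · simp only [h10, if_false]; exact reg_zero _
    simp only [h10, if_true]
    have h1 := (Reg.sum Finset.univ fun j _ => (hf j).reg hη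
      ((isSymb_nsym_mul hη j).dil (l - k)) k).const_mul ((2 : ℝ) ^ (-l))
    refine (h1.mono ?_).congr fun t ht x => PP_pot_eq hη one_le_two hc hb k l ht x
    rw [ofReal_abs_zpow_neg, ← sum_mul]
    calc _ ≤ 2 * wt (-k) * ((∑ j, symConst 3 (dil (l - k) (nsym η j * p0 η))) * (M * e k)) :=
          mul_le_mul' (wt_neg_le_of_mem hlk) le_rfl
      _ = _ := by ring
  refine ((Reg.sum _ key).mono (le_of_eq ?_)).congr fun t ht x => ?_
  · rw [← mul_sum, potConst]
    have h1 : ∑ l ∈ Finset.Icc (k - 1) (k + 1), ∑ j, symConst 3 (dil (l - k) (nsym η j * p0 η)) =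
        ∑ d ∈ Finset.Icc (-1 : ℤ) 1, ∑ j, symConst 3 (dil d (nsym η j * p0 η)) :=
      Finset.sum_equiv (Equiv.subRight k) (fun l => by
        simp only [Finset.mem_Icc, Equiv.subRight_apply]; omega) fun l _ => rfl
    rw [h1]
    ring
  · rw [proj_eq hη le_top (hl.2.memLp hl.1 ht),
      PP_lowPot hn hη one_le_two le_rfl hc hb k ht]

theorem exists_bddDer_lowPot (hn : 5 ≤ n) (hη : IsCutoff η) (hM : M ≠ ⊤) {E : ℝ≥0∞} (hEt : E ≠ ⊤)
    (hE : ∀ k, e k ≤ E) (hf : ∀ j, Chain η T M e 3 0 (f j)) : ∃ b, BddDer T b 3 (lowPot η f) := by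
  have hc := fun j => (hf j).sized.smooth.cont
  have hb : ∀ j, BddL T 2 (f j) := fun j => (hf j).sized.bdd
  obtain ⟨C, hC0, hC⟩ := exists_abs_pot_le hn hη one_le_two le_rfl hc hb
  set K : ℝ≥0∞ := (∑ j, symConst 3 (nsym η j)) * (M * E) with hK
  have hKt : K ≠ ⊤ := mul_ne_top (ENNReal.sum_ne_top.2 fun _ _ => symConst_ne_top _ _)
    (mul_ne_top hM hEt)
  refine ⟨_, bddDer_tsum (summable_zpow_down (C + K.toReal) (-10)) fun i => ?_⟩
  have hl0 : (-10 - i : ℤ) ≤ 0 := by omega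
  set l : ℤ := -10 - i
  have h1 : Reg T l _ 3 0 (pot η f l) := (Reg.sum Finset.univ fun j _ =>
    (hf j).reg hη (isSymb_nsym hη j) l).const_mul ((2 : ℝ) ^ (-l))
  refine ⟨⟨h1.base.1, fun t ht x => (hC l hl0 t ht x).trans ?_⟩, fun μ => ?_⟩
  · gcongr
    exact le_add_of_nonneg_right ENNReal.toReal_nonneg
  · obtain ⟨g, hg, hg'⟩ := h1.2 μ
    refine ⟨g, hg, hg'.bddDer hn hl0 (by positivity) ?_⟩
    rw [ofReal_abs_zpow_neg, ← sum_mul]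
    calc _ ≤ wt (-l) * K * wt (2 * l) := by
          rw [hK]; gcongr; exact hE l
      _ = K * wt l := by
          rw [mul_comm (wt (-l)), mul_assoc, ← wt_add]; congr 2; ring
      _ ≤ _ := by
          rw [ofReal_mul (by positivity), ← wt_intCast]
          gcongr
          rw [ENNReal.ofReal_add hC0 ENNReal.toReal_nonneg, ofReal_toReal hKt]
          exact le_add_self

end chain

/-- The constant in the bounds on the potentials of products. -/
def remConst (η : Space n → ℝ) : ℝ≥0∞ :=
  ∑ j, (ofReal (kb (nsym η j * p0 η)) + ofReal (kb (nsym η j)))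

variable {q r p : ℝ≥0∞} {G : ℤ → ℝ≥0∞}

lemma pnorm_lowPot_le (hn : 5 ≤ n) (hη : IsCutoff η) (hp : 1 ≤ p) (hp2 : p ≤ 2) (hq : 1 ≤ q)
    (hr : 1 ≤ r) (hf : ∀ j, Cont T (f j)) (hb : ∀ j, BddL T p (f j)) (k : ℤ)
    (hG : ∀ j, pnorm η T q r k (f j) ≤ G k) :
    pnorm η T q r k (lowPot η f) ≤ 6 * remConst η * wt (-k) * G k := by
  have hPc : ∀ j, Cont T (fun t => PP η k (f j t)) := fun j =>
    ((isSymb_p0 hη).dil k).cont_Op (hf j) hp (hb j)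
  have hPb : ∀ j, BddL T p (fun t => PP η k (f j t)) := fun j =>
    ((isSymb_p0 hη).dil k).bddL_Op hp (hf j) (hb j)
  have hOc : ∀ l j, Cont T (fun t => Op (dil l (nsym η j * p0 η)) (PP η k (f j t))) := fun l j =>
    ((isSymb_nsym_mul hη j).dil l).cont_Op (hPc j) hp (hPb j)
  have key : ∀ l ∈ Finset.Icc (k - 1) (k + 1),
      Cont T (fun t x => if l ≤ -10 then PP η k (pot η f l t) x else 0) ∧ mixedNorm T q r
        (fun t x => if l ≤ -10 then PP η k (pot η f l t) x else 0) ≤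
          2 * remConst η * wt (-k) * G k := by
    intro l hl
    by_cases h10 : l ≤ -10
    swap
    · simp only [h10, if_false]
      refine ⟨continuousOn_const, ?_⟩
      have : mixedNorm T q r (fun _ _ => 0 : STField n) = 0 := by
        simp [mixedNorm]
      rw [this]; exact zero_le
    simp only [h10, if_true]
    have he : ∀ t ∈ Ioo 0 T, ∀ x, _ := fun t ht x => PP_pot hη hp hf hb k l ht x
    refine ⟨((Cont.sum _ fun j _ => hOc l j).const_mul _).congr he, ?_⟩
    refine (mixedNorm_congr he).trans_le ((mixedNorm_const_mul _ _).trans ?_)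
    rw [ofReal_abs_zpow_neg]
    calc _ ≤ 2 * wt (-k) * ∑ j, ofReal (kb (nsym η j * p0 η)) * G k := by
          refine mul_le_mul' (wt_neg_le_of_mem hl) ((mixedNorm_sum_le _ hq hr fun j _ =>
            hOc l j).trans (sum_le_sum fun j _ => ?_))
          refine (mixedNorm_le_mul _ fun t ht => eLpNorm_Op_dil_le (isSymb_nsym_mul hη j) l hr
            ((hPc j).slice ht).aestronglyMeasurable).trans (mul_le_mul' le_rfl (hG j))
      _ ≤ 2 * wt (-k) * (remConst η * G k) := by
          rw [← sum_mul, remConst]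
          gcongr
          exact le_self_add
      _ = _ := by ring
  have h1 : pnorm η T q r k (lowPot η f) = mixedNorm T q r fun t x =>
      ∑ l ∈ Finset.Icc (k - 1) (k + 1), if l ≤ -10 then PP η k (pot η f l t) x else 0 :=
    mixedNorm_congr fun t ht x => PP_lowPot hn hη hp hp2 hf hb k ht x
  rw [h1]
  refine (mixedNorm_sum_le _ hq hr fun l hl => (key l hl).1).trans
    ((Finset.sum_le_card_nsmul _ _ _ fun l hl => (key l hl).2).trans_eq ?_)
  rw [Int.card_Icc, show (k + 1 + 1 - (k - 1)).toNat = 3 by omega, nsmul_eq_mul]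
  push_cast
  ring

lemma mixedNorm_lowPot_le (hn : 5 ≤ n) (hη : IsCutoff η) (hp : 1 ≤ p) (hp2 : p ≤ 2) (hq : 1 ≤ q)
    (hr : 1 ≤ r) (hf : ∀ j, Cont T (f j)) (hb : ∀ j, BddL T p (f j))
    (hG : ∀ j k, pnorm η T q r k (f j) ≤ G k) :
    mixedNorm T q r (lowPot η f) ≤ remConst η * ∑' k : ℤ, wt (-k) * G k := by
  obtain ⟨C, hC0, hC⟩ := exists_abs_pot_le hn hη hp hp2 hf hb
  have hPc : ∀ k j, Cont T (fun t => PP η k (f j t)) := fun k j =>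
    ((isSymb_p0 hη).dil k).cont_Op (hf j) hp (hb j)
  have h1 : mixedNorm T q r (lowPot η f) ≤ ∑' i : ℕ, mixedNorm T q r (pot η f (-10 - i)) :=
    mixedNorm_le_tsum hq (fun i => cont_pot hη hp hf hb _) fun t ht => eLpNorm_le_tsum
      (fun i => ((cont_pot hη hp hf hb _).slice ht).aestronglyMeasurable) (fun x =>
        (Summable.of_norm_bounded (summable_zpow_down C (-10)) fun i =>
          hC _ (by omega) t ht x).hasSum.tendsto_sum_nat) hr
  refine h1.trans ?_
  rw [← ENNReal.tsum_mul_left]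
  have hi : Function.Injective fun i : ℕ => -10 - (i : ℤ) := fun i j hij => by
    simp only at hij; omega
  refine le_trans (ENNReal.tsum_le_tsum fun i => ?_)
    (ENNReal.tsum_comp_le_tsum_of_injective hi fun k : ℤ => remConst η * (wt (-k) * G k))
  set k : ℤ := -10 - i
  have he : ∀ t ∈ Ioo 0 T, ∀ x, pot η f k t x =
      (2 : ℝ) ^ (-k) * ∑ j, Op (dil k (nsym η j)) (PP η k (f j t)) x := fun t ht x => by
    rw [pot]
    congr 1
    refine sum_congr rfl fun j _ => ?_
    rw [PP, Op_comp ((isSymb_nsym hη j).dil k) ((isSymb_p0 hη).dil k) hp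
      ((hb j).memLp (hf j) ht), dil_mul]
  refine (mixedNorm_congr he).trans_le ((mixedNorm_const_mul _ _).trans ?_)
  rw [ofReal_abs_zpow_neg, mul_left_comm]
  refine mul_le_mul' le_rfl ((mixedNorm_sum_le _ hq hr fun j _ =>
    ((isSymb_nsym hη j).dil k).cont_Op (hPc k j) hp
      (((isSymb_p0 hη).dil k).bddL_Op hp (hf j) (hb j))).trans ?_)
  rw [remConst, sum_mul]
  refine sum_le_sum fun j _ => (mixedNorm_le_mul _ fun t ht => eLpNorm_Op_dil_le
    (isSymb_nsym hη j) k hr ((hPc k j).slice ht).aestronglyMeasurable).trans ?_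
  exact mul_le_mul' le_add_self (hG j k)

end potential

lemma Op_sum_symb {ι : Type*} (s : Finset ι) {a : ι → Space n → ℂ} (ha : ∀ i, IsSymb (a i))
    {p : ℝ≥0∞} (hp : 1 ≤ p) {f : Space n → ℝ} (hf : MemLp f p volume) (x : Space n) :
    Op (∑ i ∈ s, a i) f x = ∑ i ∈ s, Op (a i) f x := by
  classical
  suffices h : IsSymb (∑ i ∈ s, a i) ∧ Op (∑ i ∈ s, a i) f x = ∑ i ∈ s, Op (a i) f x from h.2
  induction s using Finset.induction_on with
  | empty => exact ⟨⟨contDiff_const, HasCompactSupport.zero, by simp⟩, by simp [Op_zero_symb]⟩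
  | insert i s hi ih =>
    rw [Finset.sum_insert hi, Finset.sum_insert hi, Op_add_symb (ha i) ih.1 hp hf, ih.2]
    exact ⟨(ha i).add ih.1, rfl⟩

/-- A vector field is the gradient of its potential, up to the potential of its curl. -/
theorem lowProj_sub_pd_lowPot {η : Space n → ℝ} (hn : 5 ≤ n) (hη : IsCutoff η)
    {R : Fin (n + 1) → STField n} {Q : Fin n → STField n} {μ : Fin (n + 1)}
    (hR : ∀ ν, Smooth T (R ν)) (hb : ∀ ν, BddL T 2 (R ν)) (hd : ∀ ν κ, BddL T 2 (pd κ (R ν)))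
    (hQ : ∀ j, Cont T (Q j)) (hQb : ∀ j, BddL T 1 (Q j))
    (heq : ∀ j, ∀ t ∈ Ioo 0 T, ∀ x, pd j.succ (R μ) t x = pd μ (R j.succ) t x + Q j t x) {t : ℝ}
    (ht : t ∈ Ioo 0 T) (x : Space n) :
    lowProj η (-10) (R μ) t x - pd μ (lowPot η fun j => R j.succ) t x = lowPot η Q t x := by
  have hdc := fun ν κ => (Smooth.pd (hR ν) κ).cont
  have hS := fun (l : ℤ) j => (isSymb_nsym_mul hη j).dil l
  obtain ⟨C, -, hC⟩ := exists_abs_pot_le (f := fun j => pd μ (R j.succ)) hn hη one_le_two le_rfl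
    (fun j => hdc _ _) fun j => hd _ _
  obtain ⟨C', -, hC'⟩ := exists_abs_pot_le hn hη le_rfl one_le_two hQ hQb
  obtain ⟨C₀, -, hC₀⟩ := exists_abs_pot_le (f := fun j => R j.succ) hn hη one_le_two le_rfl
    (fun j => (hR _).cont) fun j => hb _
  have hs : ∀ {C : ℝ} {F : ℕ → ℝ}, (∀ i : ℕ, |F i| ≤ C * (2 : ℝ) ^ (-10 - i : ℤ)) → Summable F :=
    fun h => Summable.of_norm_bounded (summable_zpow_down _ (-10)) h
  have hpd : pd μ (lowPot η fun j => R j.succ) t x = lowPot η (fun j => pd μ (R j.succ)) t x :=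
    (IsPd.tsum (fun i => (IsPd.sum Finset.univ fun j _ => isPd_Op_of_bddL (hS (-10 - i) j)
      (hR j.succ) one_le_two one_le_two (hb _) (hd _ μ)).const_mul _)
      (summable_zpow_down C (-10)) (fun i => hC _ (by omega))
      fun t ht x => hs fun i => hC₀ _ (by omega) t ht x).pd_eq ht x
  have hterm : ∀ l : ℤ, pot η (fun j => pd μ (R j.succ)) l t x + pot η Q l t x =
      PP η l (R μ t) x := by
    intro l
    rw [pot, pot, ← mul_add, ← sum_add_distrib]
    have h1 : ∀ j, Op (dil l (nsym η j * p0 η)) (pd μ (R j.succ) t) x +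
        Op (dil l (nsym η j * p0 η)) (Q j t) x =
          (2 : ℝ) ^ l * Op (dil l (dsymb j (nsym η j * p0 η))) (R μ t) x := fun j => by
      rw [← Op_smul (((isSymb_nsym_mul hη j).dsymb j).dil l), ← dsymb_dil,
        ← Op_add (hS l j) one_le_two le_rfl ((hd _ μ).memLp (hdc _ _) ht)
          ((hQb j).memLp (hQ j) ht)]
      have h2 := (isPd_Op_space (hS l j) (hR μ) one_le_two (hb μ) j).pd_eq ht x
      have h3 := (isPd_Op_of_bddL (hS l j) (hR μ) one_le_two one_le_two (hb μ)
        (hd μ j.succ)).pd_eq ht x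
      rw [← h2, h3]
      congr 1
      funext y
      exact (heq j t ht y).symm
    rw [sum_congr rfl fun j _ => h1 j, ← mul_sum, ← mul_assoc,
      ← zpow_add₀ two_ne_zero, neg_add_cancel, zpow_zero, one_mul,
      ← Op_sum_symb _ (fun j => ((isSymb_nsym_mul hη j).dsymb j).dil l) one_le_two
        ((hb μ).memLp (hR μ).cont ht)]
    have h4 : ∑ j, dil l (dsymb j (nsym η j * p0 η)) = dil l (p0 η) := by
      funext v
      rw [Finset.sum_apply]
      have h5 := congrFun (sum_dsymb_nsym hη) ((2 : ℝ) ^ (-l) • v)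
      rw [Finset.sum_apply] at h5
      exact h5
    rw [h4, PP]
  have h1 := (hs fun i => hC _ (by omega) t ht x).hasSum.add
    (hs fun i => hC' (-10 - i) (by omega) t ht x).hasSum
  simp only [hterm] at h1
  have h2 := tendsto_nhds_unique h1.tendsto_sum_nat (tendsto_sum_PP_low hη one_le_two
    ENNReal.ofNat_ne_top (by omega) ((hb μ).memLp (hR μ).cont ht) (-10) x)
  rw [hpd, lowProj_eq, ← h2]
  exact add_sub_cancel_left _ _

/-! ### The wave equation for the solutions of the divergence-curl system -/

lemma BddL.congr {p : ℝ≥0∞} {u v : STField n} (h : BddL T p u)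
    (hv : ∀ t ∈ Ioo 0 T, ∀ x, v t x = u t x) : BddL T p v := by
  obtain ⟨B, hB, hb⟩ := h
  exact ⟨B, hB, fun t ht => (congrArg (eLpNorm · p volume) (funext (hv t ht))).trans_le (hb t ht)⟩

lemma BddL.sum {ι : Type*} (s : Finset ι) {p : ℝ≥0∞} (hp : 1 ≤ p) {u : ι → STField n}
    (hc : ∀ i ∈ s, Cont T (u i)) (h : ∀ i ∈ s, BddL T p (u i)) :
    BddL T p (fun t x => ∑ i ∈ s, u i t x) := by
  classical
  induction s using Finset.induction_on with
  | empty => simpa using bddL_zero p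
  | insert i s hi ih =>
    have h1 := fun j hj => hc j (Finset.mem_insert_of_mem hj)
    simp only [Finset.sum_insert hi]
    exact BddL.add hp (hc i (Finset.mem_insert_self i s)) (Cont.sum s h1)
      (h i (Finset.mem_insert_self i s)) (ih h1 fun j hj => h j (Finset.mem_insert_of_mem hj))

lemma smooth_box {u : STField n} (hu : Smooth T u) : Smooth T (box u) :=
  Smooth.sum _ fun μ _ => ((hu.pd μ).pd μ).const_mul _

lemma box_PP {η : Space n → ℝ} (hη : IsCutoff η) {u : STField n} (hu : Smooth T u)
    (hb : BddL T 2 u) (hd : ∀ μ, BddL T 2 (pd μ u)) (hbox : BddL T 1 (box u)) (k : ℤ) {t : ℝ}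
    (ht : t ∈ Ioo 0 T) (x : Space n) :
    box (fun t => PP η k (u t)) t x = PP η k (box u t) x := by
  have hP := (isSymb_p0 hη).dil k
  have h1 : ∀ μ, ∀ t ∈ Ioo 0 T, ∀ x, pd μ (fun t => PP η k (u t)) t x = Op (dil k (p0 η)) (pd μ u t) x :=
    fun μ t ht x => (isPd_Op_of_bddL hP hu one_le_two one_le_two hb (hd μ)).pd_eq ht x
  have h2 : ∀ i : Fin n, pd i.succ (fun t => Op (dil k (p0 η)) (pd i.succ u t)) t x =
      Op (dsymb i (dil k (p0 η))) (pd i.succ u t) x := fun i =>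
    (isPd_Op_space hP (hu.pd i.succ) one_le_two (hd i.succ) i).pd_eq ht x
  have h3 := (hP.isPd_Op (μ := 0) (v := fun t x => (-1) * box u t x) (w := fun i => pd i.succ u)
    (r := fun _ => 2) (hu.pd 0) ((smooth_box hu).const_mul _) (fun i => hu.pd i.succ) one_le_two
    le_rfl (fun _ => one_le_two) (hd 0) (hbox.const_mul _) (fun i => hd i.succ) (fun t ht x => by
      simp [box, Fin.sum_univ_succ, mink])).pd_eq ht x
  have h4 : box (fun t => PP η k (u t)) t x = ∑ μ, mink μ *
      pd μ (fun t => Op (dil k (p0 η)) (pd μ u t)) t x :=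
    sum_congr rfl fun μ _ => by rw [pd_congr (h1 μ) ht]
  rw [h4, Fin.sum_univ_succ, h3, sum_congr rfl fun i _ => congrArg (mink i.succ * ·) (h2 i), Op_const_mul]
  simp [mink, PP]

section system
variable {N : ℕ} {S : Fin N → Fin N → Fin N → ℝ} {Φ : Fin N → Fin (n + 1) → STField n}

/-- The quadratic terms of the evolution equations. -/
def quadCoef (S : Fin N → Fin N → Fin N → ℝ) (I : Fin N × Fin (n + 1))
    (p : (Fin N × Fin (n + 1)) × (Fin N × Fin (n + 1))) : ℝ :=
  if I.2 = 0 then if p.1.2 = p.2.2 then conn S I.1 p.1.1 p.2.1 * mink p.1.2 else 0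
  else if p.1.2 = I.2 ∧ p.2.2 = 0 then S I.1 p.1.1 p.2.1 else 0

/-- The linear terms of the evolution equations. -/
def linCoef (I : Fin N × Fin (n + 1)) (q : Fin n × Fin N × Fin (n + 1)) : ℝ :=
  if q.2.1 = I.1 ∧ (I.2 = 0 ∧ q.2.2 = q.1.succ ∨ I.2 = q.1.succ ∧ q.2.2 = 0) then 1 else 0

lemma IsSolution.isSys (h : IsSolution S T Φ) :
    IsSys T (quadCoef S) linCoef (fun I : Fin N × Fin (n + 1) => Φ I.1 I.2) := by
  rintro ⟨a, α⟩ t ht x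
  obtain ⟨h1, h2⟩ := h t ht x a
  simp only [Fintype.sum_prod_type]
  induction α using Fin.cases with
  | zero =>
    have m1 : ∀ i : Fin n, mink i.succ = 1 := fun i => if_neg (Fin.succ_ne_zero i)
    rw [Fin.sum_univ_succ, show mink (0 : Fin (n + 1)) = -1 from if_pos rfl] at h2
    simp only [m1, one_mul] at h2
    have e1 : pd 0 (Φ a 0) t x = ∑ b, ∑ c, ∑ β, conn S a b c * mink β * Φ b β t x * Φ c β t x +
        ∑ i : Fin n, pd i.succ (Φ a i.succ) t x := by linarith
    rw [e1]
    congr 1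
    · refine sum_congr rfl fun b _ => ?_
      rw [sum_comm]
      simp [quadCoef, ite_mul, mul_assoc]
    · simp [linCoef, (Fin.succ_ne_zero _).symm, ite_and]
  | succ j =>
    rw [sub_eq_iff_eq_add.1 (h1 j.succ 0)]
    congr 1
    · simp [quadCoef, ite_and, mul_assoc, Fin.succ_ne_zero]
    · simp [linCoef, ite_and, Fin.succ_ne_zero]

lemma IsSolution.curl_conn (h : IsSolution S T Φ) (hΦ : ∀ a α, Smooth T (Φ a α)) (a b : Fin N)
    (α β : Fin (n + 1)) {t : ℝ} (ht : t ∈ Ioo 0 T) (x : Space n) :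
    pd β (connForm S Φ a b α) t x = pd α (connForm S Φ a b β) t x +
      ∑ p : Fin N × Fin N × Fin N, conn S a p.1 b * S p.1 p.2.1 p.2.2 *
        (Φ p.2.1 α t x * Φ p.2.2 β t x) := by
  have e : ∀ α β, pd β (connForm S Φ a b α) t x = ∑ c, conn S a c b * pd β (Φ c α) t x :=
    fun α β => (IsPd.sum _ fun c _ => ((hΦ c α).isPd β).const_mul _).pd_eq ht x
  rw [e, e, Fintype.sum_prod_type, ← sum_add_distrib]
  refine sum_congr rfl fun c _ => ?_
  rw [sub_eq_iff_eq_add'.1 ((h t ht x c).1 α β), Fintype.sum_prod_type, mul_add, mul_sum]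
  congr 1
  refine sum_congr rfl fun d _ => ?_
  rw [mul_sum]
  exact sum_congr rfl fun e _ => by ring

/-- The coefficients of the cubic terms of the wave equation. -/
def cubA (S : Fin N → Fin N → Fin N → ℝ) (a : Fin N)
    (p : Fin N × Fin N × Fin N × Fin N × Fin (n + 1)) : ℝ :=
  (conn S a p.1 p.2.1 + conn S a p.2.1 p.1) * S p.2.1 p.2.2.1 p.2.2.2.1 * mink p.2.2.2.2

/-- The coefficients of the cubic terms of the wave equation. -/
def cubB (S : Fin N → Fin N → Fin N → ℝ) (a : Fin N)
    (p : Fin N × Fin N × Fin N × Fin N × Fin (n + 1)) : ℝ :=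
  -(S a p.1 p.2.1 * conn S p.2.1 p.2.2.1 p.2.2.2.1 * mink p.2.2.2.2)

theorem IsSolution.box_eq (h : IsSolution S T Φ) (hS : ∀ a b c, S a b c = -S a c b)
    (hΦ : ∀ a α, Smooth T (Φ a α)) (a : Fin N) (α : Fin (n + 1)) {t : ℝ} (ht : t ∈ Ioo 0 T)
    (x : Space n) : box (Φ a α) t x =
      ∑ p : Fin N × Fin N × Fin (n + 1), -2 * conn S a p.1 p.2.1 * mink p.2.2 *
          (Φ p.1 p.2.2 t x * pd p.2.2 (Φ p.2.1 α) t x) +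
        ∑ p : Fin N × Fin N × Fin N × Fin N × Fin (n + 1),
          (cubA S a p * ((Φ p.1 p.2.2.2.2 t x * Φ p.2.2.1 α t x) * Φ p.2.2.2.1 p.2.2.2.2 t x) +
            cubB S a p * ((Φ p.1 α t x * Φ p.2.2.1 p.2.2.2.2 t x) *
              Φ p.2.2.2.1 p.2.2.2.2 t x)) := by
  have hP : ∀ a α μ, IsPd T μ (Φ a α) (pd μ (Φ a α)) := fun a α μ => (hΦ a α).isPd μ
  have h1 : ∀ a α μ, ∀ t ∈ Ioo 0 T, ∀ x, pd μ (Φ a α) t x = pd α (Φ a μ) t x +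
      ∑ b, ∑ c, S a b c * (Φ b α t x * Φ c μ t x) := fun a α μ t ht x => by
    rw [sub_eq_iff_eq_add'.1 ((h t ht x a).1 α μ)]
    simp only [mul_assoc]
  have h2 : ∀ a, ∀ t ∈ Ioo 0 T, ∀ x, ∑ μ, mink μ * pd μ (Φ a μ) t x =
      ∑ b, ∑ c, ∑ β, (-(conn S a b c * mink β)) * (Φ b β t x * Φ c β t x) := fun a t ht x => by
    rw [(h t ht x a).2]
    simp only [← Finset.sum_neg_distrib]
    refine sum_congr rfl fun b _ => sum_congr rfl fun c _ =>
      sum_congr rfl fun β _ => by ring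
  have e1 : ∀ μ, pd μ (pd μ (Φ a α)) t x = pd α (pd μ (Φ a μ)) t x + ∑ b, ∑ c, S a b c *
      (pd μ (Φ b α) t x * Φ c μ t x + Φ b α t x * pd μ (Φ c μ) t x) := fun μ => by
    rw [pd_congr (h1 a α μ) ht, ← pd_comm (hΦ a μ) μ α ht]
    exact ((((hΦ a μ).pd α).isPd μ).add (IsPd.sum _ fun b _ => IsPd.sum _ fun c _ =>
      ((hP b α μ).mul (hP c μ μ)).const_mul _)).pd_eq ht x
  have e2 : ∑ μ, mink μ * pd α (pd μ (Φ a μ)) t x = ∑ b, ∑ c, ∑ β, (-(conn S a b c * mink β)) *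
      (pd α (Φ b β) t x * Φ c β t x + Φ b β t x * pd α (Φ c β) t x) := by
    rw [← (IsPd.sum Finset.univ fun μ _ => (((hΦ a μ).pd μ).isPd α).const_mul (mink μ)).pd_eq ht x,
      pd_congr (h2 a) ht]
    exact (IsPd.sum _ fun b _ => IsPd.sum _ fun c _ => IsPd.sum _ fun β _ =>
      ((hP b β α).mul (hP c β α)).const_mul _).pd_eq ht x
  set X : Fin N → Fin N → ℝ := fun b c => ∑ β, mink β * (Φ b β t x * pd β (Φ c α) t x) with hX
  set Y : Fin N → Fin N → ℝ := fun b c => ∑ d, ∑ e, ∑ β, S c d e * mink β *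
    ((Φ b β t x * Φ d α t x) * Φ e β t x) with hY
  have e3 : ∀ b c, ∑ β, mink β * (Φ b β t x * pd α (Φ c β) t x) = X b c - Y b c := fun b c => by
    have : Y b c = ∑ β, ∑ d, ∑ e, S c d e * mink β * ((Φ b β t x * Φ d α t x) * Φ e β t x) := by
      rw [sum_comm]
      exact sum_congr rfl fun d _ => sum_comm
    rw [this, hX, ← Finset.sum_sub_distrib]
    refine sum_congr rfl fun β _ => ?_
    rw [h1 c α β t ht x, mul_add, mul_add, mul_sum, mul_sum, add_sub_assoc,
      left_eq_add, sub_eq_zero]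
    refine sum_congr rfl fun d _ => ?_
    rw [mul_sum, mul_sum]
    exact sum_congr rfl fun e _ => by ring
  have e4 : ∀ b c, ∑ β, (-(conn S a b c * mink β)) *
      (pd α (Φ b β) t x * Φ c β t x + Φ b β t x * pd α (Φ c β) t x) =
        -conn S a b c * (X c b - Y c b) - conn S a b c * (X b c - Y b c) := fun b c => by
    rw [← e3, ← e3, mul_sum, mul_sum, ← Finset.sum_sub_distrib]
    exact sum_congr rfl fun β _ => by ring
  have e5 : ∑ μ, mink μ * ∑ b, ∑ c, S a b c *
      (pd μ (Φ b α) t x * Φ c μ t x + Φ b α t x * pd μ (Φ c μ) t x) = ∑ b, ∑ c, (S a b c * X c b +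
        S a b c * (Φ b α t x * ∑ μ, mink μ * pd μ (Φ c μ) t x)) := by
    simp only [mul_sum]
    rw [sum_comm]
    refine sum_congr rfl fun b _ => ?_
    rw [sum_comm]
    refine sum_congr rfl fun c _ => ?_
    rw [hX, mul_sum, ← sum_add_distrib]
    exact sum_congr rfl fun μ _ => by ring
  have e6 : ∀ f Z : Fin N → Fin N → ℝ, ∑ b, ∑ c, f b c * Z c b = ∑ b, ∑ c, f c b * Z b c :=
    fun f Z => sum_comm
  have e7 : ∑ p : Fin N × Fin N × Fin (n + 1), -2 * conn S a p.1 p.2.1 * mink p.2.2 *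
      (Φ p.1 p.2.2 t x * pd p.2.2 (Φ p.2.1 α) t x) = ∑ b, ∑ c, -2 * conn S a b c * X b c := by
    simp only [Fintype.sum_prod_type, hX, mul_sum, mul_assoc]
  have e8 : ∑ p, cubA S a p * ((Φ p.1 p.2.2.2.2 t x * Φ p.2.2.1 α t x) *
      Φ p.2.2.2.1 p.2.2.2.2 t x) = ∑ b, ∑ c, (conn S a b c + conn S a c b) * Y b c := by
    simp only [Fintype.sum_prod_type, hY, mul_sum, mul_assoc, cubA]
  have e9 : ∑ p, cubB S a p * ((Φ p.1 α t x * Φ p.2.2.1 p.2.2.2.2 t x) *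
      Φ p.2.2.2.1 p.2.2.2.2 t x) = ∑ b, ∑ c, S a b c *
        (Φ b α t x * ∑ μ, mink μ * pd μ (Φ c μ) t x) := by
    simp only [h2 _ t ht x, Fintype.sum_prod_type, mul_sum, cubB]
    refine sum_congr rfl fun b _ => sum_congr rfl fun c _ =>
      sum_congr rfl fun d _ => sum_congr rfl fun e _ =>
        sum_congr rfl fun β _ => by ring
  have e10 : ∑ b, ∑ c, -conn S a b c * (X c b - Y c b) = ∑ b, ∑ c, -conn S a c b * (X b c - Y b c) :=
    e6 (fun b c => -conn S a b c) (fun b c => X b c - Y b c)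
  rw [sum_add_distrib, e7, e8, e9]
  calc box (Φ a α) t x = ∑ μ, mink μ * pd α (pd μ (Φ a μ)) t x + ∑ μ, mink μ * ∑ b, ∑ c, S a b c *
      (pd μ (Φ b α) t x * Φ c μ t x + Φ b α t x * pd μ (Φ c μ) t x) := by
        rw [← sum_add_distrib]
        exact sum_congr rfl fun μ _ => by rw [e1, mul_add]
    _ = _ := by
        rw [e2, e5]
        simp only [e4, Finset.sum_sub_distrib, sum_add_distrib, e10, e6 (S a) X]
        simp only [← Finset.sum_sub_distrib, ← sum_add_distrib]
        refine sum_congr rfl fun b _ => sum_congr rfl fun c _ => ?_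
        simp only [conn]
        rw [hS a c b, hS b a c, hS c a b]
        ring

end system

/-! ### The error terms -/

lemma mixedNorm_sum_const_mul_le {ι : Type*} [Fintype ι] {q r B : ℝ≥0∞} (hq : 1 ≤ q) (hr : 1 ≤ r)
    (c : ι → ℝ) {u : ι → STField n} (hu : ∀ i, Cont T (u i)) (hB : ∀ i, mixedNorm T q r (u i) ≤ B) :
    mixedNorm T q r (fun t x => ∑ i, c i * u i t x) ≤ (∑ i, ofReal |c i|) * B := by
  refine (mixedNorm_sum_le _ hq hr fun i _ => (hu i).const_mul (c i)).trans ?_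
  rw [sum_mul]
  exact sum_le_sum fun i _ => (mixedNorm_const_mul _ _).trans (mul_le_mul' le_rfl (hB i))

lemma pnorm_sum_const_mul_le {η : Space n → ℝ} (hη : IsCutoff η) {ι : Type*} [Fintype ι]
    {q r p B : ℝ≥0∞} (hq : 1 ≤ q) (hr : 1 ≤ r) (hp : 1 ≤ p) (c : ι → ℝ) {u : ι → STField n}
    (hu : ∀ i, Cont T (u i)) (hb : ∀ i, BddL T p (u i)) {k : ℤ}
    (hB : ∀ i, pnorm η T q r k (u i) ≤ B) :
    pnorm η T q r k (fun t x => ∑ i, c i * u i t x) ≤ (∑ i, ofReal |c i|) * B := by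
  have hP := (isSymb_p0 hη).dil k
  refine (mixedNorm_congr fun t ht x => ?_).trans_le (mixedNorm_sum_const_mul_le hq hr c
    (fun i => hP.cont_Op (hu i) hp (hb i)) hB)
  have h1 := Op_sum hP Finset.univ (F := fun i y => c i * u i t y) hp
    (fun i _ => ((hb i).memLp (hu i) ht).const_mul (c i)) x
  exact h1.trans (sum_congr rfl fun i _ => Op_const_mul (c i) x)

/-- Solutions of the system that are bounded by a frequency envelope. -/
structure Bounded {N : ℕ} (η : Space n → ℝ) (S : Fin N → Fin N → Fin N → ℝ) (σ : ℝ)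
    (A E M : ℝ≥0∞) (e : ℤ → ℝ≥0∞) (T : ℝ) (Φ : Fin N → Fin (n + 1) → STField n) : Prop where
  hn : 5 ≤ n
  hη : IsCutoff η
  hσ : 0 ≤ σ
  hσ1 : σ < 1 / 2
  hσ2 : σ < ((n : ℝ) - 4) / 4
  hA : 1 ≤ A
  hAt : A ≠ ⊤
  grow : Grow σ A e
  hM : M ≠ ⊤
  hEt : E ≠ ⊤
  hE : ∀ k, e k ≤ E
  hE2 : ∑' k, e k * e k ≤ E * E
  hME : M * E ≤ 1
  anti : ∀ a b c, S a b c = -S a c b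
  sol : IsSolution S T Φ
  fld : ∀ a α, Fld η T M e (Φ a α)

/-- The potential of the connection form. -/
def connPot {N : ℕ} (η : Space n → ℝ) (S : Fin N → Fin N → Fin N → ℝ)
    (Φ : Fin N → Fin (n + 1) → STField n) (a b : Fin N) : STField n :=
  lowPot η fun j => connForm S Φ a b j.succ

/-- The components of the curl of the connection form. -/
def connCurl {N : ℕ} (S : Fin N → Fin N → Fin N → ℝ) (Φ : Fin N → Fin (n + 1) → STField n)
    (a b : Fin N) (α β : Fin (n + 1)) : STField n := fun t x =>
  ∑ p : Fin N × Fin N × Fin N, conn S a p.1 b * S p.1 p.2.1 p.2.2 *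
    (Φ p.2.1 α t x * Φ p.2.2 β t x)

/-- The size of the coefficients of the curl of the connection form. -/
def curlConst {N : ℕ} (S : Fin N → Fin N → Fin N → ℝ) (a b : Fin N) : ℝ≥0∞ :=
  ∑ p : Fin N × Fin N × Fin N, ofReal |conn S a p.1 b * S p.1 p.2.1 p.2.2|

/-- The constant in the product estimates in `L¹L^∞` and `L^∞L^∞`. -/
def quadConst (η : Space n → ℝ) (A : ℝ≥0∞) (σ : ℝ) : ℝ≥0∞ := 3 * mulConst η A (n + 3) (1 / 2 - σ)

lemma quadConst_ne_top (η : Space n → ℝ) {A : ℝ≥0∞} (hA : A ≠ ⊤) {σ : ℝ} (hσ : σ < 1 / 2) :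
    quadConst η A σ ≠ ⊤ :=
  mul_ne_top (by norm_num) (mulConst_ne_top η hA _ (by linarith))

lemma curlConst_ne_top {N : ℕ} (S : Fin N → Fin N → Fin N → ℝ) (a b : Fin N) :
    curlConst S a b ≠ ⊤ := ENNReal.sum_ne_top.2 fun _ _ => ofReal_ne_top

lemma remConst_ne_top (η : Space n → ℝ) : remConst η ≠ ⊤ := ENNReal.sum_ne_top.2 fun _ _ =>
  ENNReal.add_ne_top.2 ⟨ofReal_ne_top, ofReal_ne_top⟩

/-- The constant in the bound on the error terms. -/
def errConst {N : ℕ} (η : Space n → ℝ) (S : Fin N → Fin N → Fin N → ℝ) (A : ℝ≥0∞) (σ : ℝ)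
    (a : Fin N) : ℝ≥0∞ :=
  (∑ p : Fin N × Fin N × Fin (n + 1), ofReal |-2 * conn S a p.1 p.2.1 * mink p.2.2|) *
      (commConst η A σ * derConst η) +
    ((∑ p : Fin N × Fin N × Fin N × Fin N × Fin (n + 1), ofReal |cubA S a p|) +
      ∑ p : Fin N × Fin N × Fin N × Fin N × Fin (n + 1), ofReal |cubB S a p|) *
      quadConst η A σ ^ 2 +
    (∑ p : Fin N × Fin (n + 1), ofReal |-2 * mink p.2|) *
      (remConst η * (∑ c, curlConst S a c) * quadConst η A σ * derConst η)

lemma errConst_ne_top {N : ℕ} {η : Space n → ℝ} (hη : IsCutoff η) (S : Fin N → Fin N → Fin N → ℝ)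
    {A : ℝ≥0∞} (hA : A ≠ ⊤) {σ : ℝ} (hσ : σ < 1 / 2) (a : Fin N) : errConst η S A σ a ≠ ⊤ := by
  have h1 := commConst_ne_top hη hA hσ
  have h2 := quadConst_ne_top η hA hσ
  have h3 : derConst η ≠ ⊤ := ofReal_ne_top
  have hs : ∀ {ι : Type} [Fintype ι] (c : ι → ℝ), ∑ i, ofReal |c i| ≠ ⊤ := fun c =>
    ENNReal.sum_ne_top.2 fun _ _ => ofReal_ne_top
  have h4 := remConst_ne_top η
  have h5 : ∑ c, curlConst S a c ≠ ⊤ := ENNReal.sum_ne_top.2 fun _ _ => curlConst_ne_top S _ _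
  exact ENNReal.add_ne_top.2 ⟨ENNReal.add_ne_top.2
    ⟨mul_ne_top (hs _) (mul_ne_top h1 h3),
      mul_ne_top (ENNReal.add_ne_top.2 ⟨hs _, hs _⟩) (ENNReal.pow_ne_top h2)⟩,
    mul_ne_top (hs _) (mul_ne_top (mul_ne_top
      (mul_ne_top h4 h5) h2) h3)⟩

section bounded
variable {N : ℕ} {η : Space n → ℝ} {S : Fin N → Fin N → Fin N → ℝ} {σ : ℝ} {A E M : ℝ≥0∞}
  {e : ℤ → ℝ≥0∞} {Φ : Fin N → Fin (n + 1) → STField n} (h : Bounded η S σ A E M e T Φ)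
include h

lemma Bounded.tame (a : Fin N) (α : Fin (n + 1)) : Tame η T (Φ a α) :=
  (h.fld a α).tame h.hη h.hn h.hM h.hEt h.hE

lemma Bounded.cont (a : Fin N) (α : Fin (n + 1)) : Cont T (Φ a α) := (h.fld a α).smooth.cont

lemma Bounded.tame_pd (a : Fin N) (α μ : Fin (n + 1)) : Tame η T (pd μ (Φ a α)) :=
  (h.fld a α).tame_pd h.hη h.hn h.hM h.hEt h.hE μ

lemma Bounded.X_pd (a : Fin N) (α μ : Fin (n + 1)) :
    XB η T 1 (derConst η * M) e (pd μ (Φ a α)) :=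
  (h.fld a α).X_pd h.hη h.hn h.hM h.hEt h.hE μ

lemma Bounded.smooth_conn (a b : Fin N) (μ : Fin (n + 1)) : Smooth T (connForm S Φ a b μ) :=
  Smooth.sum _ fun c _ => (h.fld c μ).smooth.const_mul _

lemma Bounded.bdd_conn (a b : Fin N) (μ : Fin (n + 1)) : BddL T 2 (connForm S Φ a b μ) :=
  BddL.sum _ one_le_two (fun c _ => (h.cont c μ).const_mul _) fun c _ =>
    (h.fld c μ).bdd.const_mul _

lemma Bounded.bdd_pd_conn (a b : Fin N) (μ ν : Fin (n + 1)) :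
    BddL T 2 (pd ν (connForm S Φ a b μ)) :=
  (BddL.sum Finset.univ one_le_two (fun c _ => (h.tame_pd c μ ν).cont.const_mul (conn S a c b))
    fun c _ => (h.tame_pd c μ ν).bdd.const_mul _).congr fun _ ht x =>
      (IsPd.sum _ fun c _ => ((h.fld c μ).smooth.isPd ν).const_mul _).pd_eq ht x

lemma Bounded.bdd_mul (a b : Fin N) (α β : Fin (n + 1)) :
    BddL T 1 (fun t x => Φ a α t x * Φ b β t x) :=
  BddL.mul (r₁ := 2) (r₂ := 2) (h.cont a α) (h.cont b β) (h.fld a α).bdd (h.fld b β).bdd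

lemma Bounded.cont_curl (a b : Fin N) (α β : Fin (n + 1)) : Cont T (connCurl S Φ a b α β) :=
  Cont.sum _ fun _ _ => ((h.cont _ _).mul (h.cont _ _)).const_mul _

lemma Bounded.bdd_curl (a b : Fin N) (α β : Fin (n + 1)) : BddL T 1 (connCurl S Φ a b α β) :=
  BddL.sum _ le_rfl (fun _ _ => ((h.cont _ _).mul (h.cont _ _)).const_mul _)
    fun _ _ => (h.bdd_mul _ _ _ _).const_mul _

lemma Bounded.pnorm_curl_le (a b : Fin N) (α β : Fin (n + 1)) (k : ℤ) :
    pnorm η T 1 ⊤ k (connCurl S Φ a b α β) ≤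
      curlConst S a b * (quadConst η A σ * (M * M) * wt k * (e k * e k)) ∧
    pnorm η T ⊤ ⊤ k (connCurl S Φ a b α β) ≤
      curlConst S a b * (quadConst η A σ * (M * M) * wt (2 * k) * (e k * e k)) :=
  ⟨pnorm_sum_const_mul_le h.hη le_rfl le_top le_rfl _ (fun _ => (h.cont _ _).mul (h.cont _ _))
    (fun _ => h.bdd_mul _ _ _ _) fun _ => pnorm_one_top_mul_le h.hn h.hη h.hσ h.hσ1 h.hA h.grow
      (h.tame _ _) (h.tame _ _) h.grow (h.fld _ _).X (h.fld _ _).X k,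
  pnorm_sum_const_mul_le h.hη le_top le_top le_rfl _ (fun _ => (h.cont _ _).mul (h.cont _ _))
    (fun _ => h.bdd_mul _ _ _ _) fun _ => pnorm_top_top_mul_le h.hn h.hη h.hσ h.hσ1 h.hA h.grow
      (h.tame _ _) (h.tame _ _) h.grow (h.fld _ _).X (h.fld _ _).X k⟩

/-- The remainder in the approximation of the connection form by a gradient. -/
theorem Bounded.remainder_eq (a b : Fin N) (μ : Fin (n + 1)) {t : ℝ} (ht : t ∈ Ioo 0 T)
    (x : Space n) : lowProj η (-10) (connForm S Φ a b μ) t x - pd μ (connPot η S Φ a b) t x =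
      lowPot η (fun j => connCurl S Φ a b μ j.succ) t x :=
  lowProj_sub_pd_lowPot h.hn h.hη (h.smooth_conn a b) (h.bdd_conn a b) (h.bdd_pd_conn a b)
    (fun _ => h.cont_curl a b _ _) (fun _ => h.bdd_curl a b _ _)
    (fun j _ ht x => h.sol.curl_conn (fun a α => (h.fld a α).smooth) a b μ j.succ ht x) ht x

theorem Bounded.pnorm_remainder_le (a b : Fin N) (μ : Fin (n + 1)) (k : ℤ) :
    pnorm η T 1 ⊤ k (lowPot η fun j => connCurl S Φ a b μ j.succ) ≤
      6 * remConst η * curlConst S a b * quadConst η A σ * (M * M) * (e k * e k) ∧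
    pnorm η T ⊤ ⊤ k (lowPot η fun j => connCurl S Φ a b μ j.succ) ≤
      6 * remConst η * curlConst S a b * quadConst η A σ * (M * M) * wt k * (e k * e k) := by
  constructor
  · refine (pnorm_lowPot_le (G := fun k => curlConst S a b *
      (quadConst η A σ * (M * M) * wt k * (e k * e k))) h.hn h.hη le_rfl one_le_two le_rfl
      le_top (fun _ => h.cont_curl a b _ _) (fun _ => h.bdd_curl a b _ _) k
      fun j => (h.pnorm_curl_le a b _ _ k).1).trans_eq ?_
    calc _ = 6 * remConst η * curlConst S a b * quadConst η A σ * (M * M) * (e k * e k) *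
          (wt (-k) * wt k) := by ring
      _ = _ := by rw [wt_neg_mul, mul_one]
  · refine (pnorm_lowPot_le (G := fun k => curlConst S a b *
      (quadConst η A σ * (M * M) * wt (2 * k) * (e k * e k))) h.hn h.hη le_rfl one_le_two le_top
      le_top (fun _ => h.cont_curl a b _ _) (fun _ => h.bdd_curl a b _ _) k
      fun j => (h.pnorm_curl_le a b _ _ k).2).trans_eq ?_
    calc _ = 6 * remConst η * curlConst S a b * quadConst η A σ * (M * M) * (e k * e k) *
          (wt (-k) * wt (2 * k)) := by ring
      _ = _ := by
        rw [← wt_add, show -(k : ℝ) + 2 * k = k by ring]; ring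

lemma Bounded.mixedNorm_remainder_le (a b : Fin N) (μ : Fin (n + 1)) :
    mixedNorm T 1 ⊤ (lowPot η fun j => connCurl S Φ a b μ j.succ) ≤
      remConst η * (∑ c, curlConst S a c) * quadConst η A σ * (M * M) * (E * E) := by
  refine (mixedNorm_lowPot_le (G := fun k => curlConst S a b *
      (quadConst η A σ * (M * M) * wt k * (e k * e k))) h.hn h.hη le_rfl one_le_two le_rfl le_top
      (fun _ => h.cont_curl a b _ _) (fun _ => h.bdd_curl a b _ _)
      fun j k => (h.pnorm_curl_le a b _ _ k).1).trans ?_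
  have h1 : ∀ k : ℤ, wt (-k) * (curlConst S a b * (quadConst η A σ * (M * M) * wt k *
      (e k * e k))) = curlConst S a b * (quadConst η A σ * (M * M)) * (e k * e k) := fun k => by
    calc _ = curlConst S a b * (quadConst η A σ * (M * M)) * (e k * e k) * (wt (-k) * wt k) := by
          ring
      _ = _ := by rw [wt_neg_mul, mul_one]
  simp only [h1]
  rw [ENNReal.tsum_mul_left]
  calc _ ≤ remConst η * ((∑ c, curlConst S a c) * (quadConst η A σ * (M * M)) * (E * E)) := by
        gcongr
        · exact single_le_sum (f := curlConst S a) (fun _ _ => zero_le) (Finset.mem_univ b)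
        · exact h.hE2
    _ = _ := by ring

lemma Bounded.proj_eq (a : Fin N) (α : Fin (n + 1)) (k : ℤ) {t : ℝ} (ht : t ∈ Ioo 0 T)
    (x : Space n) : proj η k (Φ a α) t x = PP η k (Φ a α t) x :=
  WaveMap.proj_eq h.hη one_le_two ((h.fld a α).memLp ht) k x

lemma Bounded.pd_proj (a : Fin N) (α μ : Fin (n + 1)) (k : ℤ) {t : ℝ} (ht : t ∈ Ioo 0 T)
    (x : Space n) : pd μ (proj η k (Φ a α)) t x = PP η k (pd μ (Φ a α) t) x :=
  (pd_congr (fun _ ht x => h.proj_eq a α k ht x) ht x).trans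
    ((isPd_Op_of_bddL ((isSymb_p0 h.hη).dil k) (h.fld a α).smooth one_le_two one_le_two
      (h.fld a α).bdd (h.tame_pd a α μ).bdd).pd_eq ht x)

lemma Bounded.bdd_mul_mul (a b c : Fin N) (α β γ : Fin (n + 1)) :
    BddL T 1 (fun t x => (Φ a α t x * Φ b β t x) * Φ c γ t x) :=
  BddL.mul (r₁ := 2) (r₂ := 2) ((h.cont a α).mul (h.cont b β)) (h.cont c γ)
    ((h.fld a α).bdd_mul h.hn h.hη h.hM h.hEt h.hE (h.fld b β)) (h.fld c γ).bdd

lemma Bounded.bdd_mul_pd (a b : Fin N) (α β μ : Fin (n + 1)) :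
    BddL T 1 (fun t x => Φ a α t x * pd μ (Φ b β) t x) :=
  BddL.mul (r₁ := 2) (r₂ := 2) (h.cont a α) (h.tame_pd b β μ).cont (h.fld a α).bdd
    (h.tame_pd b β μ).bdd

end bounded

/-- The error in the wave equation for a frequency piece. -/
def waveErr {N : ℕ} (η : Space n → ℝ) (S : Fin N → Fin N → Fin N → ℝ)
    (Φ : Fin N → Fin (n + 1) → STField n) (a : Fin N) (α : Fin (n + 1)) : STField n := fun t x =>
  box (proj η 0 (Φ a α)) t x + 2 * ∑ b, ∑ μ, mink μ * pd μ (connPot η S Φ a b) t x *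
    pd μ (proj η 0 (Φ b α)) t x

section bounded
variable {N : ℕ} {η : Space n → ℝ} {S : Fin N → Fin N → Fin N → ℝ} {σ : ℝ} {A E M : ℝ≥0∞}
  {e : ℤ → ℝ≥0∞} {Φ : Fin N → Fin (n + 1) → STField n} (h : Bounded η S σ A E M e T Φ)
include h

lemma Bounded.box_proj (a : Fin N) (α : Fin (n + 1)) {t : ℝ} (ht : t ∈ Ioo 0 T) (x : Space n) :
    box (proj η 0 (Φ a α)) t x =
      ∑ p : Fin N × Fin N × Fin (n + 1), -2 * conn S a p.1 p.2.1 * mink p.2.2 *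
          PP η 0 (fun y => Φ p.1 p.2.2 t y * pd p.2.2 (Φ p.2.1 α) t y) x +
        (∑ p, cubA S a p * PP η 0 (fun y => (Φ p.1 p.2.2.2.2 t y * Φ p.2.2.1 α t y) *
            Φ p.2.2.2.1 p.2.2.2.2 t y) x +
          ∑ p, cubB S a p * PP η 0 (fun y => (Φ p.1 α t y * Φ p.2.2.1 p.2.2.2.2 t y) *
              Φ p.2.2.2.1 p.2.2.2.2 t y) x) := by
  have hsm := fun a α => (h.fld a α).smooth
  have hP := (isSymb_p0 h.hη).dil 0
  set q : Fin N × Fin N × Fin (n + 1) → STField n := fun p t x =>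
    Φ p.1 p.2.2 t x * pd p.2.2 (Φ p.2.1 α) t x with hq
  set u : Fin N × Fin N × Fin N × Fin N × Fin (n + 1) → STField n := fun p t x =>
    (Φ p.1 p.2.2.2.2 t x * Φ p.2.2.1 α t x) * Φ p.2.2.2.1 p.2.2.2.2 t x with hu
  set v : Fin N × Fin N × Fin N × Fin N × Fin (n + 1) → STField n := fun p t x =>
    (Φ p.1 α t x * Φ p.2.2.1 p.2.2.2.2 t x) * Φ p.2.2.2.1 p.2.2.2.2 t x with hv
  have qc : ∀ p, Cont T (q p) := fun p => (h.cont _ _).mul (h.tame_pd _ _ _).cont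
  have uc : ∀ p, Cont T (u p) := fun p => ((h.cont _ _).mul (h.cont _ _)).mul (h.cont _ _)
  have vc : ∀ p, Cont T (v p) := fun p => ((h.cont _ _).mul (h.cont _ _)).mul (h.cont _ _)
  have qb : ∀ p, BddL T 1 (q p) := fun p => h.bdd_mul_pd _ _ _ _ _
  have ub : ∀ p, BddL T 1 (u p) := fun p => h.bdd_mul_mul _ _ _ _ _ _
  have vb : ∀ p, BddL T 1 (v p) := fun p => h.bdd_mul_mul _ _ _ _ _ _
  set cq : Fin N × Fin N × Fin (n + 1) → ℝ := fun p => -2 * conn S a p.1 p.2.1 * mink p.2.2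
  have hbox : ∀ t ∈ Ioo 0 T, ∀ x, box (Φ a α) t x = ∑ p, cq p * q p t x +
      (∑ p, cubA S a p * u p t x + ∑ p, cubB S a p * v p t x) := fun t ht x => by
    rw [h.sol.box_eq h.anti hsm a α ht x, sum_add_distrib]
  have lc : ∀ {ι : Type} [Fintype ι] (c : ι → ℝ) {w : ι → STField n}, (∀ i, Cont T (w i)) →
      (∀ i, BddL T 1 (w i)) → Cont T (fun t x => ∑ i, c i * w i t x) ∧
        BddL T 1 (fun t x => ∑ i, c i * w i t x) := fun c w hc hb =>
    ⟨Cont.sum _ fun i _ => (hc i).const_mul _, BddL.sum _ le_rfl (fun i _ => (hc i).const_mul _)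
      fun i _ => (hb i).const_mul _⟩
  have lP : ∀ {ι : Type} [Fintype ι] (c : ι → ℝ) {w : ι → STField n}, (∀ i, Cont T (w i)) →
      (∀ i, BddL T 1 (w i)) → Op (dil 0 (p0 η)) (fun y => ∑ i, c i * w i t y) x =
        ∑ i, c i * PP η 0 (w i t) x := fun c w hc hb =>
    (Op_sum hP Finset.univ (F := fun i y => c i * w i t y) le_rfl (fun i _ =>
      ((hb i).memLp (hc i) ht).const_mul (c i)) x).trans
        (sum_congr rfl fun i _ => Op_const_mul (c i) x)
  have hbb := ((lc cq qc qb).2.add le_rfl (lc cq qc qb).1 ((lc _ uc ub).1.add (lc _ vc vb).1)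
    ((lc (cubA S a) uc ub).2.add le_rfl (lc _ uc ub).1 (lc _ vc vb).1
      (lc (cubB S a) vc vb).2)).congr hbox
  rw [box_congr (fun t ht x => h.proj_eq a α 0 ht x) ht, box_PP h.hη (hsm a α) (h.fld a α).bdd
    (fun μ => (h.tame_pd a α μ).bdd) hbb 0 ht, PP, funext (hbox t ht),
    Op_add hP le_rfl le_rfl ((lc cq qc qb).2.memLp (lc cq qc qb).1 ht)
      (memLp_add_fun ((lc _ uc ub).2.memLp (lc _ uc ub).1 ht)
        ((lc _ vc vb).2.memLp (lc _ vc vb).1 ht)),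
    Op_add hP le_rfl le_rfl ((lc _ uc ub).2.memLp (lc _ uc ub).1 ht)
      ((lc _ vc vb).2.memLp (lc _ vc vb).1 ht), lP cq qc qb, lP _ uc ub, lP _ vc vb]

lemma Bounded.lowProj_conn (a b : Fin N) (μ : Fin (n + 1)) {t : ℝ} (ht : t ∈ Ioo 0 T)
    (x : Space n) : lowProj η (-10) (connForm S Φ a b μ) t x =
      ∑ c, conn S a c b * LL η (-10) (Φ c μ t) x := by
  rw [lowProj_eq]
  exact (Op_sum ((isSymb_e0 h.hη).dil (-10)) Finset.univ (F := fun c y => conn S a c b * Φ c μ t y)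
    one_le_two (fun c _ => ((h.fld c μ).memLp ht).const_mul _) x).trans
      (sum_congr rfl fun c _ => Op_const_mul _ x)

lemma Bounded.waveErr_eq (a : Fin N) (α : Fin (n + 1)) {t : ℝ} (ht : t ∈ Ioo 0 T) (x : Space n) :
    waveErr η S Φ a α t x =
      ∑ p : Fin N × Fin N × Fin (n + 1), -2 * conn S a p.1 p.2.1 * mink p.2.2 *
          (PP η 0 (fun y => Φ p.1 p.2.2 t y * pd p.2.2 (Φ p.2.1 α) t y) x -
            LL η (-10) (Φ p.1 p.2.2 t) x * PP η 0 (pd p.2.2 (Φ p.2.1 α) t) x) +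
        (∑ p, cubA S a p * PP η 0 (fun y => (Φ p.1 p.2.2.2.2 t y * Φ p.2.2.1 α t y) *
            Φ p.2.2.2.1 p.2.2.2.2 t y) x +
          ∑ p, cubB S a p * PP η 0 (fun y => (Φ p.1 α t y * Φ p.2.2.1 p.2.2.2.2 t y) *
              Φ p.2.2.2.1 p.2.2.2.2 t y) x) +
        ∑ p : Fin N × Fin (n + 1), -2 * mink p.2 *
          (lowPot η (fun j => connCurl S Φ a p.1 p.2 j.succ) t x *
            PP η 0 (pd p.2 (Φ p.1 α) t) x) := by
  rw [waveErr, h.box_proj a α ht]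
  simp only [mul_sub, Finset.sum_sub_distrib, ← h.remainder_eq a _ _ ht, sub_mul, h.pd_proj _ _ _ _ ht,
    h.lowProj_conn a _ _ ht]
  have h1 : ∑ p : Fin N × Fin N × Fin (n + 1), -2 * conn S a p.1 p.2.1 * mink p.2.2 *
      (LL η (-10) (Φ p.1 p.2.2 t) x * PP η 0 (pd p.2.2 (Φ p.2.1 α) t) x) =
      ∑ p : Fin N × Fin (n + 1), -2 * mink p.2 * ((∑ c, conn S a c p.1 *
        LL η (-10) (Φ c p.2 t) x) * PP η 0 (pd p.2 (Φ p.1 α) t) x) := by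
    simp only [Fintype.sum_prod_type, sum_mul, mul_sum]
    rw [sum_comm]
    refine sum_congr rfl fun b _ => ?_
    rw [sum_comm]
    exact sum_congr rfl fun μ _ => sum_congr rfl fun c _ => by ring
  have h2 : 2 * ∑ b, ∑ μ, mink μ * pd μ (connPot η S Φ a b) t x * PP η 0 (pd μ (Φ b α) t) x =
      -∑ p : Fin N × Fin (n + 1), -2 * mink p.2 * (pd p.2 (connPot η S Φ a p.1) t x *
        PP η 0 (pd p.2 (Φ p.1 α) t) x) := by
    simp only [Fintype.sum_prod_type, mul_sum, ← Finset.sum_neg_distrib]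
    exact sum_congr rfl fun b _ => sum_congr rfl fun μ _ => by ring
  rw [h1, h2]
  ring

theorem Bounded.mixedNorm_waveErr_le (a : Fin N) (α : Fin (n + 1)) :
    mixedNorm T 1 2 (waveErr η S Φ a α) ≤ errConst η S A σ a * (M * M * E * e 0) := by
  have hP := (isSymb_p0 h.hη).dil 0
  have qc : ∀ p : Fin N × Fin N × Fin (n + 1), Cont T (fun t x =>
      PP η 0 (fun y => Φ p.1 p.2.2 t y * pd p.2.2 (Φ p.2.1 α) t y) x -
        LL η (-10) (Φ p.1 p.2.2 t) x * PP η 0 (pd p.2.2 (Φ p.2.1 α) t) x) := fun p =>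
    cont_sub (hP.cont_Op ((h.cont _ _).mul (h.tame_pd _ _ _).cont) le_rfl (h.bdd_mul_pd _ _ _ _ _))
      (((h.tame _ _).cont_LL h.hη _).mul ((h.tame_pd _ _ _).cont_PP h.hη _))
  have tc : ∀ (a b c : Fin N) (α β γ : Fin (n + 1)), Cont T (fun t x =>
      PP η 0 (fun y => (Φ a α t y * Φ b β t y) * Φ c γ t y) x) := fun a b c α β γ =>
    hP.cont_Op (((h.cont _ _).mul (h.cont _ _)).mul (h.cont _ _)) le_rfl
      (h.bdd_mul_mul a b c α β γ)
  have hlc := fun (b : Fin N) (μ : Fin (n + 1)) => (exists_abs_lowPot_le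
    (f := fun j => connCurl S Φ a b μ j.succ) h.hn h.hη le_rfl one_le_two
    (fun _ => h.cont_curl a b _ _) fun _ => h.bdd_curl a b _ _).1
  have rc : ∀ p : Fin N × Fin (n + 1), Cont T (fun t x => lowPot η (fun j =>
      connCurl S Φ a p.1 p.2 j.succ) t x * PP η 0 (pd p.2 (Φ p.1 α) t) x) := fun p =>
    (hlc p.1 p.2).mul ((h.tame_pd _ _ _).cont_PP h.hη _)
  have hme : M * M * M * (E * E) * e 0 ≤ M * M * E * e 0 := by
    calc _ = M * M * E * (M * E) * e 0 := by ring
      _ ≤ M * M * E * 1 * e 0 := by gcongr; exact h.hME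
      _ = _ := by ring
  have qB := mixedNorm_sum_const_mul_le (T := T) (q := 1) (r := 2)
    (B := commConst η A σ * derConst η * (M * M * E * e 0)) le_rfl one_le_two
    (fun p : Fin N × Fin N × Fin (n + 1) => -2 * conn S a p.1 p.2.1 * mink p.2.2) qc fun p =>
      (mixedNorm_PP_mul_sub_le h.hn h.hη h.hσ h.hσ1 h.hA h.grow (h.tame _ _) (h.tame_pd _ _ _)
        h.hE (h.fld _ _).X (h.X_pd _ _ _)).trans_eq (by ring)
  have tB : ∀ (a b c : Fin N) (α β γ : Fin (n + 1)), mixedNorm T 1 2 (fun t x =>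
      PP η 0 (fun y => (Φ a α t y * Φ b β t y) * Φ c γ t y) x) ≤
        quadConst η A σ ^ 2 * (M * M * E * e 0) := fun a b c α β γ => by
    refine (pnorm_one_two_mul_mul_le h.hn h.hη h.hσ h.hσ1 h.hA h.grow (h.tame a α) (h.tame b β)
      (h.tame c γ) ((h.fld a α).tame_mul h.hn h.hη h.hσ h.hσ1 h.hσ2 h.hA h.grow h.hM h.hEt h.hE
        h.hME (h.fld b β) h.hAt) (h.fld a α).X ((h.fld b β).X.const h.hE)
        ((h.fld c γ).X.const h.hE) 0).trans ?_
    refine le_trans (le_of_eq ?_) (mul_le_mul' le_rfl hme)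
    rw [quadConst, Int.cast_zero, mul_zero, wt_zero]
    ring
  have rB := mixedNorm_sum_const_mul_le (T := T) (q := 1) (r := 2)
    (B := remConst η * (∑ c, curlConst S a c) * quadConst η A σ * derConst η * (M * M * E * e 0))
    le_rfl one_le_two (fun p : Fin N × Fin (n + 1) => -2 * mink p.2) rc fun p => by
      refine (mixedNorm_mul_le (timeHolder_top_right 1 le_rfl) (r₁ := ⊤) (r₂ := 2) (hlc p.1 p.2)
        ((h.tame_pd _ _ _).cont_PP h.hη 0)).trans ?_
      refine (mul_le_mul' (h.mixedNorm_remainder_le a p.1 p.2)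
        ((h.X_pd p.1 α p.2).pnorm_le admissible_top_two 0)).trans ?_
      refine le_trans (le_of_eq ?_) (mul_le_mul' le_rfl hme)
      rw [Int.cast_zero, mul_zero, wt_zero]
      ring
  have cA := fun p : Fin N × Fin N × Fin N × Fin N × Fin (n + 1) =>
    tc p.1 p.2.2.1 p.2.2.2.1 p.2.2.2.2 α p.2.2.2.2
  have cB := fun p : Fin N × Fin N × Fin N × Fin N × Fin (n + 1) =>
    tc p.1 p.2.2.1 p.2.2.2.1 α p.2.2.2.2 p.2.2.2.2
  have uB := mixedNorm_sum_const_mul_le le_rfl one_le_two (cubA S a) cA fun _ => tB _ _ _ _ _ _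
  have vB := mixedNorm_sum_const_mul_le le_rfl one_le_two (cubB S a) cB fun _ => tB _ _ _ _ _ _
  have hc : ∀ {ι : Type} [Fintype ι] (c : ι → ℝ) {w : ι → STField n}, (∀ i, Cont T (w i)) →
      Cont T (fun t x => ∑ i, c i * w i t x) := fun c w hc => Cont.sum _ fun i _ =>
    (hc i).const_mul _
  refine (mixedNorm_congr fun t ht x => h.waveErr_eq a α ht x).trans_le ?_
  refine (mixedNorm_add_le le_rfl one_le_two ((hc _ qc).add ((hc _ cA).add (hc _ cB)))
    (hc _ rc)).trans ((add_le_add ((mixedNorm_add_le le_rfl one_le_two (hc _ qc)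
      ((hc _ cA).add (hc _ cB))).trans (add_le_add qB ((mixedNorm_add_le le_rfl one_le_two
        (hc _ cA) (hc _ cB)).trans (add_le_add uB vB)))) rB).trans_eq ?_)
  rw [errConst]
  ring

end bounded

/-- The size of the connection potential. -/
def connPotConst {N : ℕ} (η : Space n → ℝ) (S : Fin N → Fin N → Fin N → ℝ) (A : ℝ≥0∞) (σ : ℝ)
    (a b : Fin N) : ℝ≥0∞ :=
  2 * potConst η * ((∑ c, ofReal |conn S a c b|) *
    (8 * sysConst (n := n) (quadCoef S) linCoef ^ 5 * monoConst η A σ))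

lemma connPotConst_ne_top {N : ℕ} (η : Space n → ℝ) (S : Fin N → Fin N → Fin N → ℝ) {A : ℝ≥0∞}
    (hA : A ≠ ⊤) {σ : ℝ} (hσ1 : σ < 1 / 2) (hσ2 : σ < ((n : ℝ) - 4) / 4) (a b : Fin N) :
    connPotConst η S A σ a b ≠ ⊤ := by
  have h1 := monoConst_ne_top η hA hσ1 hσ2
  have h2 := potConst_ne_top η
  have h3 : ∑ c, ofReal |conn S a c b| ≠ ⊤ :=
    ENNReal.sum_ne_top.2 fun _ _ => ofReal_ne_top
  have h4 : sysConst (n := n) (quadCoef S) linCoef ≠ ⊤ := sysConst_ne_top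
  unfold connPotConst
  finiteness

section bounded
variable {N : ℕ} {η : Space n → ℝ} {S : Fin N → Fin N → Fin N → ℝ} {σ : ℝ} {A E M : ℝ≥0∞}
  {e : ℤ → ℝ≥0∞} {Φ : Fin N → Fin (n + 1) → STField n}

lemma connPot_anti (hS : ∀ a b c, S a b c = -S a c b) (a b : Fin N) (t : ℝ) (x : Space n) :
    connPot η S Φ b a t x = -connPot η S Φ a b t x := by
  have h1 : ∀ j : Fin n, connForm S Φ b a j.succ t = fun y => -1 * connForm S Φ a b j.succ t y :=
    fun j => funext fun y => by
      rw [connForm, connForm, mul_sum]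
      refine sum_congr rfl fun c _ => ?_
      simp only [conn]
      rw [hS b c a, hS c b a, hS a b c]
      ring
  rw [connPot, connPot, lowPot, lowPot, ← tsum_neg]
  refine tsum_congr fun i => ?_
  simp only [pot, h1, Op_const_mul, ← mul_sum]
  ring

variable (h : Bounded η S σ A E M e T Φ)
include h

lemma Bounded.chain_conn (a b : Fin N) (μ : Fin (n + 1)) :
    Chain η T ((∑ c, ofReal |conn S a c b|) * (8 * sysConst (n := n) (quadCoef S) linCoef ^ 5 *
      (monoConst η A σ * M))) e 3 0 (connForm S Φ a b μ) :=
  Chain.sum h.hη Finset.univ (fun c => conn S a c b) fun c _ =>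
    IsSys.chain (φ := fun I : Fin N × Fin (n + 1) => Φ I.1 I.2) h.hn h.hη h.hσ h.hσ1 h.hσ2 h.hA
      h.hAt h.grow h.hM h.hEt h.hE h.hME (fun I => h.fld I.1 I.2) h.sol.isSys le_rfl (c, μ)

lemma Bounded.reg_connPot (a b : Fin N) (k : ℤ) :
    Reg T k (connPotConst η S A σ a b * (M * wt (-k) * e k)) 3 0
      (proj η k (connPot η S Φ a b)) := by
  refine (reg_proj_lowPot h.hn h.hη (fun j => h.chain_conn a b j.succ) k).mono (le_of_eq ?_)
  rw [connPotConst]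
  ring

lemma Bounded.sNorm_connPot_le (a b : Fin N) (k : ℤ) :
    sNorm T k (proj η k (connPot η S Φ a b)) ≤
      2 * connPotConst η S A σ a b * (M * wt (-k) * e k) ∧
    (∀ μ, sNorm T k (pd μ (proj η k (connPot η S Φ a b))) ≤
      2 * connPotConst η S A σ a b * (M * e k)) ∧
    sNorm T k (box (proj η k (connPot η S Φ a b))) ≤
      (n + 1) * (2 * connPotConst η S A σ a b) * (M * wt k * e k) := by
  have h1 := h.reg_connPot a b k
  set P := connPotConst η S A σ a b
  refine ⟨h1.sNorm_le.trans_eq ?_, fun μ => (h1.pd_field μ).sNorm_le.trans_eq ?_,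
    h1.box_field.sNorm_le.trans_eq ?_⟩
  · rw [Nat.cast_zero, zero_mul, wt_zero]; ring
  · rw [zero_add, Nat.cast_one, one_mul]
    calc _ = 2 * P * (M * e k) * (wt (-k) * wt k) := by ring
      _ = _ := by rw [wt_neg_mul, mul_one]
  · have h3 : wt ((0 + 2 : ℕ) * (k : ℝ)) = wt k * wt k := by
      rw [← wt_add]; push_cast; congr 1; ring
    rw [h3]
    calc _ = (n + 1) * (2 * P) * (M * wt k * e k) * (wt (-k) * wt k) := by ring
      _ = _ := by rw [wt_neg_mul, mul_one]

lemma Bounded.exists_bddDer (a b : Fin N) : ∃ B, BddDer T B 3 (connPot η S Φ a b) :=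
  exists_bddDer_lowPot h.hn h.hη (mul_ne_top (ENNReal.sum_ne_top.2 fun _ _ =>
    ofReal_ne_top) (mul_ne_top (mul_ne_top (by norm_num)
      (ENNReal.pow_ne_top sysConst_ne_top)) (mul_ne_top
        (monoConst_ne_top η h.hAt h.hσ1 h.hσ2) h.hM))) h.hEt h.hE
    fun j => h.chain_conn a b j.succ

lemma Bounded.fourierSupportedIn (a b : Fin N) {t : ℝ} (ht : t ∈ Ioo 0 T) :
    FourierSupportedIn ((2 : ℝ) ^ (-9 : ℤ)) (connPot η S Φ a b t) :=
  fourierSupportedIn_lowPot h.hn h.hη one_le_two le_rfl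
    (fun j => (h.smooth_conn a b j.succ).cont) (fun j => h.bdd_conn a b j.succ) ht

lemma Bounded.mixedNorm_proj_le (a b : Fin N) (μ : Fin (n + 1)) (k : ℤ) :
    mixedNorm T 1 ⊤ (proj η k (fun t x => lowProj η (-10) (connForm S Φ a b μ) t x -
      pd μ (connPot η S Φ a b) t x)) ≤
      6 * remConst η * curlConst S a b * quadConst η A σ * (M * M * (e k * e k)) ∧
    mixedNorm T ⊤ ⊤ (proj η k (fun t x => lowProj η (-10) (connForm S Φ a b μ) t x -
      pd μ (connPot η S Φ a b) t x)) ≤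
      6 * remConst η * curlConst S a b * quadConst η A σ * (M * M * wt k * (e k * e k)) := by
  have hl := exists_abs_lowPot_le (f := fun j => connCurl S Φ a b μ j.succ) h.hn h.hη le_rfl
    one_le_two (fun _ => h.cont_curl a b _ _) fun _ => h.bdd_curl a b _ _
  have h1 : ∀ t ∈ Ioo 0 T, ∀ x, proj η k (fun t x => lowProj η (-10) (connForm S Φ a b μ) t x -
      pd μ (connPot η S Φ a b) t x) t x =
      PP η k (lowPot η (fun j => connCurl S Φ a b μ j.succ) t) x := fun t ht x => by
    rw [← WaveMap.proj_eq h.hη le_top (hl.2.memLp hl.1 ht)]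
    simp only [proj]
    rw [lowProj_eq, lowProj_eq η (k - 1), lowProj_eq, lowProj_eq, lowProj_eq η (k - 1),
      ← funext (h.remainder_eq a b μ ht), lowProj_eq]
  rw [mixedNorm_congr h1, mixedNorm_congr h1]
  obtain ⟨h2, h3⟩ := h.pnorm_remainder_le a b μ k
  exact ⟨h2.trans_eq (by ring), h3.trans_eq (by ring)⟩

end bounded

/-- The time derivatives of the solutions of a system are divergences up to products. -/
lemma IsSys.divergence {ι : Type*} [Fintype ι] {s : ι → ι × ι → ℝ} {r : ι → Fin n × ι → ℝ}
    {φ : ι → STField n} (h : IsSys T s r φ) (hφ : ∀ I, Smooth T (φ I)) (hb : ∀ I, BddL T 2 (φ I))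
    (I : ι) : ∃ (v : STField n) (w : Fin n → STField n), Smooth T v ∧ (∀ i, Smooth T (w i)) ∧
    BddL T 1 v ∧ (∀ i, BddL T 2 (w i)) ∧
    ∀ t ∈ Ioo 0 T, ∀ x, pd 0 (φ I) t x = v t x + ∑ i, pd i.succ (w i) t x := by
  have hc := fun I => (hφ I).cont
  refine ⟨_, fun i t x => ∑ J, r I (i, J) * φ J t x,
    Smooth.sum Finset.univ fun p _ => ((hφ p.1).mul (hφ p.2)).const_mul (s I p),
    fun i => Smooth.sum _ fun J _ => (hφ J).const_mul _,
    BddL.sum _ le_rfl (fun p _ => ((hc p.1).mul (hc p.2)).const_mul _) fun p _ =>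
      (BddL.mul (r₁ := 2) (r₂ := 2) (hc p.1) (hc p.2) (hb p.1) (hb p.2)).const_mul _,
    fun i => BddL.sum _ one_le_two (fun J _ => (hc J).const_mul _) fun J _ => (hb J).const_mul _,
    fun t ht x => ?_⟩
  rw [h I t ht x]
  congr 1
  refine sum_congr rfl fun i _ => ?_
  exact ((IsPd.sum Finset.univ fun J _ => ((hφ J).isPd i.succ).const_mul (r I (i, J))).pd_eq ht
    x).symm

/-- The solutions bounded by a real frequency envelope. -/
theorem bounded_of_envelope {N : ℕ} (hn : 5 ≤ n) {η : Space n → ℝ} (hη : IsCutoff η)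
    {S : Fin N → Fin N → Fin N → ℝ} (hS : ∀ a b c, S a b c = -S a c b) {σ A : ℝ} (hσ₀ : 0 < σ)
    (hσ₁ : σ < 1 / 2) (hσ₂ : σ < ((n : ℝ) - 4) / 4) {C ε : ℝ} (hC : 0 ≤ C) (hε : 0 ≤ ε)
    (hCε : 2 * C * ε ≤ 1) {c : ℤ → ℝ} (hc : IsEnvelope σ A c)
    (hcε : Real.sqrt (∑' k, c k ^ 2) ≤ ε) {Φ : Fin N → Fin (n + 1) → STField n}
    (hΦ : ∀ a α, Smooth T (Φ a α))
    (hb : ∃ B : ℝ, ∀ t ∈ Ioo 0 T, ∀ a α, eLpNorm (Φ a α t) 2 volume ≤ ofReal B)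
    (hsol : IsSolution S T Φ)
    (hX : ∀ k : ℤ, ∑ a, ∑ α, sNorm T k (proj η k (Φ a α)) ≤ ofReal (2 * C * c k)) :
    Bounded η S σ (ofReal (max A 1)) (ofReal ε) (ofReal (2 * C))
      (fun k => ofReal (c k)) T Φ := by
  have hsq : ∑' k, c k ^ 2 ≤ ε ^ 2 := (Real.sqrt_le_left hε).1 hcε
  have hbd : ∀ a α, BddL T 2 (Φ a α) := fun a α =>
    ⟨_, ofReal_ne_top, fun t ht => hb.choose_spec t ht a α⟩
  have hpr : ∀ a α k, ∀ t ∈ Ioo 0 T, ∀ x, PP η k (Φ a α t) x = proj η k (Φ a α) t x :=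
    fun a α k t ht x => (proj_eq hη one_le_two ((hbd a α).memLp (hΦ a α).cont ht) k x).symm
  have hs : ∀ a α k, sNorm T k (proj η k (Φ a α)) ≤ ofReal (2 * C) * ofReal (c k) :=
    fun a α k => by
      rw [← ofReal_mul (by positivity)]
      exact ((single_le_sum (f := fun α => sNorm T k (proj η k (Φ a α)))
        (fun _ _ => zero_le) (Finset.mem_univ α)).trans (single_le_sum
          (f := fun a => ∑ α, sNorm T k (proj η k (Φ a α))) (fun _ _ => zero_le)
          (Finset.mem_univ a))).trans (hX k)
  refine ⟨hn, hη, hσ₀.le, hσ₁, hσ₂, ?_, ofReal_ne_top, fun k l => ?_,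
    ofReal_ne_top, ofReal_ne_top, fun k => ofReal_le_ofReal ?_, ?_, ?_, hS,
    hsol, fun a α => ⟨hΦ a α, hbd a α, fun k => ?_, fun k => ?_,
      IsSys.divergence (φ := fun I : Fin N × Fin (n + 1) => Φ I.1 I.2) hsol.isSys
        (fun I => hΦ I.1 I.2) (fun I => hbd I.1 I.2) (a, α)⟩⟩
  · rw [← ENNReal.ofReal_one]; exact ofReal_le_ofReal (le_max_right _ _)
  · rw [wt, ← ofReal_mul (by positivity), ← ofReal_mul (by positivity)]
    refine ofReal_le_ofReal ((hc.growth k l).trans ?_)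
    have := hc.nonneg l
    gcongr
    exact le_max_left _ _
  · exact abs_le_of_sq_le_sq' ((hc.summable_sq.le_tsum k fun _ _ => sq_nonneg _).trans hsq) hε |>.2
  · have : ∀ k, ofReal (c k) * ofReal (c k) = ofReal (c k ^ 2) := fun k => by
      rw [← ofReal_mul (hc.nonneg k), sq]
    simp only [this]
    rw [← ENNReal.ofReal_tsum_of_nonneg (fun _ => sq_nonneg _) hc.summable_sq,
      ← ofReal_mul hε, ← sq]
    exact ofReal_le_ofReal hsq
  · rw [← ofReal_mul (by positivity), ← ENNReal.ofReal_one]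
    exact ofReal_le_ofReal hCε
  · rw [zero_mul, wt_zero, mul_one]
    exact (strich_congr (hpr a α k)).trans_le ((strich_le_sNorm k _).trans (hs a α k))
  · rw [mul_comm _ (wt k), mul_assoc]
    exact (strich_congr fun t ht x => pd_congr (hpr a α k) ht x).trans_le
      ((strich_pd_le_sNorm k _).trans (mul_le_mul' le_rfl (hs a α k)))

lemma sum_sum_le_ofReal {ι κ : Type*} [Fintype ι] [Fintype κ] {f : ι → κ → ℝ≥0∞}
    {g : ι → κ → ℝ≥0∞} {x : ℝ≥0∞} {y z : ℝ} (hf : ∀ i j, f i j ≤ g i j * x)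
    (hx : x ≤ ofReal y) (hg : ∑ i, ∑ j, g i j ≠ ⊤)
    (hz : (∑ i, ∑ j, g i j).toReal * y ≤ z) : ∑ i, ∑ j, f i j ≤ ofReal z := by
  calc _ ≤ ∑ i, ∑ j, g i j * ofReal y := sum_le_sum fun i _ =>
        sum_le_sum fun j _ => (hf i j).trans (mul_le_mul' le_rfl hx)
    _ = ofReal (∑ i, ∑ j, g i j).toReal * ofReal y := by
        simp only [← sum_mul]; rw [ofReal_toReal hg]
    _ = ofReal ((∑ i, ∑ j, g i j).toReal * y) :=
        (ofReal_mul ENNReal.toReal_nonneg).symm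
    _ ≤ _ := ofReal_le_ofReal hz

end WaveMap

end

open WaveMap in
theorem mainTheorem3 (n N : ℕ) (hn : 5 ≤ n)
    (η : Space n → ℝ) (hη : IsCutoff η)
    (S : Fin N → Fin N → Fin N → ℝ) (hS : ∀ a b c, S a b c = -S a c b)
    (σ A : ℝ) (hσ₀ : 0 < σ) (hσ₁ : σ < 1 / 2) (hσ₂ : σ < ((n : ℝ) - 4) / 4) :
    ∃ K C₀ : ℝ, 0 < K ∧ 1 ≤ C₀ ∧ ∀ C : ℝ, C₀ ≤ C → ∃ ε₀ : ℝ, 0 < ε₀ ∧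
      ∀ ε : ℝ, 0 < ε → ε ≤ ε₀ → ∀ T : ℝ, 0 < T →
      ∀ c : ℤ → ℝ, IsEnvelope σ A c → Real.sqrt (∑' k, c k ^ 2) ≤ ε →
      ∀ Φ : Fin N → Fin (n + 1) → STField n,
        (∀ a α, ContDiffOn ℝ ∞ (fun p : ℝ × Space n => Φ a α p.1 p.2) (slab n T)) →
        (∃ B : ℝ, ∀ t ∈ Ioo 0 T, ∀ a α,
          eLpNorm (Φ a α t) 2 volume ≤ ENNReal.ofReal B) →
        IsSolution S T Φ →
        (∀ k : ℤ, ∑ a, ∑ α, sNorm T k (proj η k (Φ a α)) ≤ ENNReal.ofReal (2 * C * c k)) →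
        ∃ (Δ : Fin N → Fin N → STField n) (F : Fin N → Fin (n + 1) → STField n),
          -- regularity of the potential
          (∀ a b, ContDiffOn ℝ 3 (fun p : ℝ × Space n => Δ a b p.1 p.2) (slab n T)) ∧
          (∃ B : ℝ, ∀ a b, ∀ m : ℕ, m ≤ 3 → ∀ p ∈ slab n T,
            ‖iteratedFDeriv ℝ m (fun p : ℝ × Space n => Δ a b p.1 p.2) p‖ ≤ B) ∧
          -- the equation, with an acceptable error
          (∀ t ∈ Ioo 0 T, ∀ x a α, box (proj η 0 (Φ a α)) t x
            = -2 * (∑ b, ∑ μ, mink μ * pd μ (Δ a b) t x * pd μ (proj η 0 (Φ b α)) t x)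
              + F a α t x) ∧
          (∑ a, ∑ α, mixedNorm T 1 2 (F a α) ≤ ENNReal.ofReal (C ^ 3 * ε * c 0)) ∧
          -- antisymmetry and Fourier support
          (∀ t ∈ Ioo 0 T, ∀ x a b, Δ b a t x = -Δ a b t x) ∧
          (∀ t ∈ Ioo 0 T, ∀ a b, FourierSupportedIn ((2 : ℝ) ^ (-9 : ℤ)) (Δ a b t)) ∧
          -- bounds on the potential
          (∀ k : ℤ, ∑ a, ∑ b, sNorm T k (proj η k (Δ a b))
            ≤ ENNReal.ofReal (K * (2 : ℝ) ^ (-k) * C * c k)) ∧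
          (∀ k : ℤ, ∑ a, ∑ b, ∑ μ, sNorm T k (pd μ (proj η k (Δ a b)))
            ≤ ENNReal.ofReal (K * C * c k)) ∧
          (∀ k : ℤ, ∑ a, ∑ b, sNorm T k (box (proj η k (Δ a b)))
            ≤ ENNReal.ofReal (K * (2 : ℝ) ^ k * C * c k)) ∧
          -- bounds on the remainder
          (∀ k : ℤ, ∑ a, ∑ b, ∑ μ, mixedNorm T 1 ∞ (proj η k (fun t x =>
              lowProj η (-10) (connForm S Φ a b μ) t x - pd μ (Δ a b) t x))
            ≤ ENNReal.ofReal (K * C ^ 2 * c k ^ 2)) ∧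
          (∀ k : ℤ, ∑ a, ∑ b, ∑ μ, mixedNorm T ∞ ∞ (proj η k (fun t x =>
              lowProj η (-10) (connForm S Φ a b μ) t x - pd μ (Δ a b) t x))
            ≤ ENNReal.ofReal (K * (2 : ℝ) ^ k * C ^ 2 * c k ^ 2)) := by
  set P : ℝ≥0∞ := ∑ a, ∑ b, (n + 1) * (2 * connPotConst η S (ENNReal.ofReal (max A 1)) σ a b)
  set R : ℝ≥0∞ := ∑ a, ∑ b, (n + 1) * (6 * remConst η * curlConst S a b *
    quadConst η (ENNReal.ofReal (max A 1)) σ)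
  set Q : ℝ≥0∞ := ∑ a, ∑ _α : Fin (n + 1), errConst η S (ENNReal.ofReal (max A 1)) σ a
  have hPt : P ≠ ⊤ := ENNReal.sum_ne_top.2 fun a _ => ENNReal.sum_ne_top.2 fun b _ => by
    have := connPotConst_ne_top η S (ENNReal.ofReal_ne_top (r := max A 1)) hσ₁ hσ₂ a b
    finiteness
  have hRt : R ≠ ⊤ := ENNReal.sum_ne_top.2 fun a _ => ENNReal.sum_ne_top.2 fun b _ => by
    have h1 := quadConst_ne_top η (ENNReal.ofReal_ne_top (r := max A 1)) hσ₁
    have h2 := remConst_ne_top η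
    have h3 := curlConst_ne_top S a b
    finiteness
  have hQt : Q ≠ ⊤ := ENNReal.sum_ne_top.2 fun a _ => ENNReal.sum_ne_top.2 fun _ _ =>
    errConst_ne_top hη S ENNReal.ofReal_ne_top hσ₁ a
  have hP0 : 0 ≤ P.toReal := ENNReal.toReal_nonneg
  have hR0 : 0 ≤ R.toReal := ENNReal.toReal_nonneg
  have hQ0 : 0 ≤ Q.toReal := ENNReal.toReal_nonneg
  refine ⟨4 * (P.toReal + R.toReal) + 1, 4 * Q.toReal + 1, by positivity, by linarith,
    fun C hC => ?_⟩
  have hC0 : 0 < C := by linarith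
  refine ⟨1 / (2 * C), by positivity, fun ε hε hεC T hT c hc hcε Φ hΦ hb hsol hX => ?_⟩
  have h : Bounded η S σ _ _ _ _ T Φ := bounded_of_envelope hn hη hS hσ₀ hσ₁ hσ₂ hC0.le hε.le
    (by rwa [le_div_iff₀ (by positivity), mul_comm] at hεC) hc hcε hΦ hb hsol hX
  have hw : ∀ k : ℤ, wt (k : ℝ) = ENNReal.ofReal ((2 : ℝ) ^ k) := wt_intCast
  have hw' : ∀ k : ℤ, wt (-(k : ℝ)) = ENNReal.ofReal ((2 : ℝ) ^ (-k)) := fun k => by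
    rw [← hw]; push_cast; rfl
  have hsum : ∀ {f : Fin (n + 1) → ℝ≥0∞} {B : ℝ≥0∞}, (∀ μ, f μ ≤ B) → ∑ μ, f μ ≤ (n + 1) * B :=
    fun hf => (Finset.sum_le_card_nsmul _ _ _ fun μ _ => hf μ).trans_eq (by simp)
  have hn1 : (1 : ℝ≥0∞) ≤ n + 1 := le_add_self
  have hle : ∀ {p w : ℝ}, p ≤ P.toReal + R.toReal → 0 ≤ w →
      p * (4 * w) ≤ (4 * (P.toReal + R.toReal) + 1) * w := fun hp hw => by
    have := mul_le_mul_of_nonneg_right hp hw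
    linarith
  have hPR : P.toReal ≤ P.toReal + R.toReal := by linarith
  have hRP : R.toReal ≤ P.toReal + R.toReal := by linarith
  have hM4 : ENNReal.ofReal (2 * C) ≤ ENNReal.ofReal (4 * C) :=
    ENNReal.ofReal_le_ofReal (by linarith)
  have hMM : ENNReal.ofReal (2 * C) * ENNReal.ofReal (2 * C) = ENNReal.ofReal (4 * C ^ 2) := by
    rw [← ENNReal.ofReal_mul (by positivity)]; congr 1; ring
  have hcc : ∀ k, ENNReal.ofReal (c k) * ENNReal.ofReal (c k) = ENNReal.ofReal (c k ^ 2) :=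
    fun k => by rw [← ENNReal.ofReal_mul (hc.nonneg k), sq]
  choose B hB using h.exists_bddDer
  refine ⟨connPot η S Φ, waveErr η S Φ, fun a b => by exact_mod_cast (hB a b).contDiffOn,
    ⟨((n : ℝ) + 1) ^ 3 * ∑ a, ∑ b, |B a b|, fun a b m hm p hp => ?_⟩, fun t _ x a α => ?_, ?_,
    fun t _ x a b => connPot_anti hS a b t x, fun t ht a b => h.fourierSupportedIn a b ht,
    fun k => ?_, fun k => ?_, fun k => ?_, fun k => ?_, fun k => ?_⟩
  · refine ((hB a b).norm_iteratedFDeriv_le hm hp).trans ?_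
    have h1 : B a b ≤ ∑ a, ∑ b, |B a b| := (le_abs_self _).trans
      ((Finset.single_le_sum (f := fun b => |B a b|) (fun _ _ => abs_nonneg _)
        (Finset.mem_univ b)).trans (Finset.single_le_sum (f := fun a => ∑ b, |B a b|)
          (fun _ _ => Finset.sum_nonneg fun _ _ => abs_nonneg _) (Finset.mem_univ a)))
    have h2 : ((n : ℝ) + 1) ^ m ≤ ((n : ℝ) + 1) ^ 3 :=
      pow_le_pow_right₀ (by linarith [Nat.cast_nonneg (α := ℝ) n]) hm
    calc _ ≤ ((n : ℝ) + 1) ^ m * ∑ a, ∑ b, |B a b| := by gcongr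
      _ ≤ _ := mul_le_mul_of_nonneg_right h2
        (Finset.sum_nonneg fun _ _ => Finset.sum_nonneg fun _ _ => abs_nonneg _)
  · rw [waveErr]; ring
  · refine sum_sum_le_ofReal (y := 4 * C ^ 2 * ε * c 0) (fun a α => h.mixedNorm_waveErr_le a α)
      (le_of_eq ?_) hQt ?_
    · rw [hMM, ← ENNReal.ofReal_mul (by positivity), ← ENNReal.ofReal_mul (by positivity)]
    · have hw : 0 ≤ C ^ 2 * ε * c 0 := mul_nonneg (by positivity) (hc.nonneg 0)
      have := mul_le_mul_of_nonneg_right (show 4 * Q.toReal ≤ C by linarith) hw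
      calc _ = 4 * Q.toReal * (C ^ 2 * ε * c 0) := by ring
        _ ≤ C * (C ^ 2 * ε * c 0) := this
        _ = _ := by ring
  · refine sum_sum_le_ofReal (y := 4 * ((2 : ℝ) ^ (-k) * C * c k)) (fun a b =>
      (h.sNorm_connPot_le a b k).1.trans (mul_le_mul' (le_mul_of_one_le_left' hn1) le_rfl)) ?_ hPt ?_
    · refine (mul_le_mul' (mul_le_mul' hM4 (hw' k).le) le_rfl).trans_eq ?_
      rw [← ENNReal.ofReal_mul (by positivity), ← ENNReal.ofReal_mul (by positivity)]
      congr 1; ring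
    · exact (hle hPR (mul_nonneg (by positivity) (hc.nonneg k))).trans_eq (by ring)
  · refine sum_sum_le_ofReal (y := 4 * (C * c k)) (fun a b =>
      (hsum fun μ => (h.sNorm_connPot_le a b k).2.1 μ).trans_eq (mul_assoc _ _ _).symm) ?_ hPt ?_
    · refine (mul_le_mul' hM4 le_rfl).trans_eq ?_
      rw [← ENNReal.ofReal_mul (by positivity)]
      congr 1; ring
    · exact (hle hPR (mul_nonneg hC0.le (hc.nonneg k))).trans_eq (by ring)
  · refine sum_sum_le_ofReal (y := 4 * ((2 : ℝ) ^ k * C * c k)) (fun a b =>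
      (h.sNorm_connPot_le a b k).2.2) ?_ hPt ?_
    · refine (mul_le_mul' (mul_le_mul' hM4 (hw k).le) le_rfl).trans_eq ?_
      rw [← ENNReal.ofReal_mul (by positivity), ← ENNReal.ofReal_mul (by positivity)]
      congr 1; ring
    · exact (hle hPR (mul_nonneg (by positivity) (hc.nonneg k))).trans_eq (by ring)
  · refine sum_sum_le_ofReal (y := 4 * (C ^ 2 * c k ^ 2)) (fun a b =>
      (hsum fun μ => (h.mixedNorm_proj_le a b μ k).1).trans_eq (mul_assoc _ _ _).symm)
      (le_of_eq ?_) hRt ?_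
    · rw [hMM, hcc, ← ENNReal.ofReal_mul (by positivity)]
      congr 1; ring
    · exact (hle hRP (by positivity)).trans_eq (by ring)
  · refine sum_sum_le_ofReal (y := 4 * ((2 : ℝ) ^ k * C ^ 2 * c k ^ 2)) (fun a b =>
      (hsum fun μ => (h.mixedNorm_proj_le a b μ k).2).trans_eq (mul_assoc _ _ _).symm)
      (le_of_eq ?_) hRt ?_
    · rw [hMM, hw, hcc, ← ENNReal.ofReal_mul (by positivity), ← ENNReal.ofReal_mul (by positivity)]
      congr 1; ring
    · exact (hle hRP (by positivity)).trans_eq (by ring)
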